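/- Let $M\subset\mathbb R^3$ be an embedded $C^2$ surface and let $S\subset M$ be a bounded Lipschitz domain in $M$ with $\overline S\subset M$: $S$ is nonempty, connected, relatively open in $M$ and bounded, and near each point of its boundary $\partial S=\overline S\setminus S$ it is, in a suitable $C^2$ chart of $M$, the region above the graph of a Lipschitz function. Let $S$ be oriented by a unit normal field $n$, continuous on $\overline S$. For $h>0$ put $$S_h=\{x+t\,n(x) : x\in S,\ |t|<h\},\qquad (\partial S)_h=\{x+t\,n(x) : x\in\partial S,\ |t|<h\},$$ and let $H^1_0(S_h,\mathbb R^3)$ be the space of all $u\in W^{1,2}(S_h,\mathbb R^3)$ with $u=0$ on $(\partial S)_h$ in the sense of traces. For $\mu>0$ consider the following two properties of $S$. (1.1) There are $C>0$ and $h_0>0$ such that for every $0<h<h_0$ and every $u\in W^{1,2}(S_h,\mathbb R^3)$ there is a rotation $R\in SO(3)$ with $$\|\nabla u-R\|^2_{L^2(S_h)}\le \frac{C}{h^\mu}\,\|\operatorname{dist}(\nabla u,SO(3))\|^2_{L^2(S_h)}.$$ (1.2) There are $C>0$ and $h_0>0$ such that for every $0<h<h_0$ and every $u\in H^1_0(S_h,\mathbb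 R^3)$ $$\|\nabla u\|^2_{L^2(S_h)}\le \frac{C}{h^\mu}\,\|\operatorname{dist}(\nabla u+I,SO(3))\|^2_{L^2(S_h)}.$$ A map $w\in W^{2,2}(S,\mathbb R^3)$ is called an isometry if $\langle\nabla_a w,\nabla_b w\rangle=\langle a,b\rangle$ for all $a,b\in T_xM$, for almost every $x\in S$. Then the following hold. (i) If (1.1) holds for some $0<\mu<2$, then for every isometry $w\in W^{2,2}(S,\mathbb R^3)$ there are $R\in SO(3)$ and $a\in\mathbb R^3$ with $w(x)=Rx+a$ on $S$. (ii) If (1.2) holds for some $0<\mu<2$, then every isometry $w\in W^{2,2}(S,\mathbb R^3)$ that satisfies, in the sense of traces, $$w(x)=x,\qquad \nabla_\tau w(x)=\tau\qquad\text{for a.e. } x\in\partial S,$$ where $\tau$ is the outer unit normal along $\partial S$ tangent to $M$, is the identity, $w(x)=x$ on $S$. (In both conclusions the equality holds almost everywhere on $S$, and everywhere on $S$ for the continuous representative of $w$.) -/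

import Mathlib

open MeasureTheory Filter Topology
open scoped NNReal ENNReal

/-- The parameter plane `ℝ²` with its Euclidean norm. -/
abbrev E2 : Type := EuclideanSpace ℝ (Fin 2)

/-- The ambient space `ℝ³` with its Euclidean norm. -/
abbrev E3 : Type := EuclideanSpace ℝ (Fin 3)

/-! ### Rotations -/

/-- The rotation group `SO(3)`, as a set of linear maps: linear isometries of determinant one. -/
def SO3 : Set (E3 →L[ℝ] E3) :=
  {R | (∀ x, ‖R x‖ = ‖x‖) ∧ R.det = 1}

/-! ### Surfaces -/

/-- `X : V → M` is a `C²` local parametrization of `M ⊆ ℝ³`: an immersion of class `C²` on the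
open set `V ⊆ ℝ²` that is a homeomorphism onto a relatively open subset of `M`. -/
structure IsC2Chart (M : Set E3) (V : Set E2) (X : E2 → E3) : Prop where
  isOpen_source : IsOpen V
  contDiffOn : ContDiffOn ℝ 2 X V
  immersion : ∀ y ∈ V, Function.Injective (fderiv ℝ X y)
  isEmbedding : IsEmbedding (V.domRestrict X)
  isOpen_image : ∃ U : Set E3, IsOpen U ∧ X '' V = M ∩ U

/-- `M` is a (not necessarily closed) embedded surface of class `C²` in `ℝ³`. -/
def IsC2Surface (M : Set E3) : Prop :=
  ∀ p ∈ M, ∃ (V : Set E2) (X : E2 → E3), IsC2Chart M V X ∧ p ∈ X '' V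

/-- The boundary `∂S` of a relatively open piece `S` of a surface `M` with `closure S ⊆ M`. -/
def surfBoundary (S : Set E3) : Set E3 := closure S \ S

/-- `S` is a bounded Lipschitz domain in the `C²` surface `M`: a nonempty connected relatively open
bounded subset with `closure S ⊆ M` (so `S` is of class `C²` up to its boundary), which near each
of its boundary points is, in a suitable chart, the region above the graph of a Lipschitz
function. -/
structure IsC2LipschitzDomain (M S : Set E3) : Prop where
  surface : IsC2Surface M
  relOpen : ∃ U : Set E3, IsOpen U ∧ S = M ∩ U
  connected : IsConnected S
  bounded : Bornology.IsBounded S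
  closure_subset : closure S ⊆ M
  lipschitz : ∀ p ∈ surfBoundary S, ∃ (V : Set E2) (X : E2 → E3), IsC2Chart M V X ∧ p ∈ X '' V ∧
    ∃ (K : ℝ≥0) (γ : ℝ → ℝ), LipschitzWith K γ ∧ ∀ z ∈ V, (X z ∈ S ↔ γ (z 0) < z 1)

/-- `n` is a continuous unit normal field of `S` (continued to `∂S` by continuity), that is, an
orientation of `S`. -/
structure IsUnitNormal (M S : Set E3) (n : E3 → E3) : Prop where
  continuousOn : ContinuousOn n (closure S)
  norm_eq_one : ∀ p ∈ closure S, ‖n p‖ = 1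
  orthogonal : ∀ (V : Set E2) (X : E2 → E3), IsC2Chart M V X →
    ∀ y ∈ V, X y ∈ closure S → ∀ ξ : E2, inner ℝ (fderiv ℝ X y ξ) (n (X y)) = 0

/-- `A_h = { x + t n(x) | x ∈ A, |t| < h }`. With `A = S` this is the shell `S_h` with middle
surface `S`; with `A = ∂S` it is its lateral boundary `(∂S)_h`. -/
def shell (A : Set E3) (n : E3 → E3) (h : ℝ) : Set E3 :=
  {z | ∃ x ∈ A, ∃ t : ℝ, |t| < h ∧ z = x + t • n x}

/-- `τ` is the outer unit normal to `∂S` at `p`, tangent to the surface: the part of `M` near `p`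
strictly on the side of `τ` is outside `S`, and the part strictly on the other side is in `S`, up
to cones of arbitrarily small aperture. On a Lipschitz boundary there is exactly one
such `τ` at almost every boundary point `p`. -/
structure IsOuterConormal (M S : Set E3) (n : E3 → E3) (p τ : E3) : Prop where
  norm_eq_one : ‖τ‖ = 1
  tangent : inner ℝ τ (n p) = 0
  outer : ∀ ε > 0, ∃ r > 0, ∀ q ∈ M, dist q p < r →
    (ε * ‖q - p‖ < inner ℝ (q - p) τ → q ∉ S) ∧
    (inner ℝ (q - p) τ < -(ε * ‖q - p‖) → q ∈ S)

/-! ### Weak derivatives, Sobolev functions and traces -/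

/-- `G` is the weak gradient (weak total derivative) of `f` on `Ω`. -/
structure HasWeakFDerivOn {d : ℕ} {F : Type*} [NormedAddCommGroup F] [NormedSpace ℝ F]
    (Ω : Set (EuclideanSpace ℝ (Fin d))) (f : EuclideanSpace ℝ (Fin d) → F)
    (G : EuclideanSpace ℝ (Fin d) → EuclideanSpace ℝ (Fin d) →L[ℝ] F) : Prop where
  locallyIntegrableOn : LocallyIntegrableOn f Ω
  locallyIntegrableOn_grad : LocallyIntegrableOn G Ω
  integral_eq : ∀ φ : EuclideanSpace ℝ (Fin d) → ℝ, ContDiff ℝ (⊤ : ℕ∞) φ →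
    HasCompactSupport φ → tsupport φ ⊆ Ω → ∀ v : EuclideanSpace ℝ (Fin d),
      ∫ x in Ω, φ x • G x v = -∫ x in Ω, (fderiv ℝ φ x v) • f x

/-- `u ∈ W^{1,2}(Ω, ℝ³)` with weak gradient `G`. -/
structure IsW12 (Ω : Set E3) (u : E3 → E3) (G : E3 → E3 →L[ℝ] E3) : Prop where
  hasWeakFDerivOn : HasWeakFDerivOn Ω u G
  memLp : MemLp u 2 (volume.restrict Ω)
  memLp_grad : MemLp G 2 (volume.restrict Ω)

/-- The function `f` on `Ω` has trace `v` at the boundary point `x`, in the sense of Lebesgue means: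
`⨍_{Ω ∩ B(x,r)} ‖f - v‖ → 0` as `r → 0`. For a Sobolev function on a Lipschitz domain the trace
exists in this sense, and is the usual one, at almost all boundary points. -/
def HasTraceAt {d : ℕ} {F : Type*} [NormedAddCommGroup F]
    (Ω : Set (EuclideanSpace ℝ (Fin d))) (f : EuclideanSpace ℝ (Fin d) → F)
    (x : EuclideanSpace ℝ (Fin d)) (v : F) : Prop :=
  Tendsto (fun r : ℝ => ⨍⁻ z in Ω ∩ Metric.ball x r, ‖f z - v‖ₑ ∂volume) (𝓝[>] 0) (𝓝 0)

/-- `u ∈ H₀¹(S_h, ℝ³)` with weak gradient `G`: `u ∈ W^{1,2}(S_h, ℝ³)` and `u = 0` on `(∂S)_h`, in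
the sense of traces. -/
structure IsH01 (S : Set E3) (n : E3 → E3) (h : ℝ) (u : E3 → E3) (G : E3 → E3 →L[ℝ] E3) :
    Prop where
  isW12 : IsW12 (shell S n h) u G
  trace_zero : ∀ᵐ z ∂(Measure.hausdorffMeasure 2 : Measure E3),
    z ∈ shell (surfBoundary S) n h → HasTraceAt (shell S n h) u z 0

/-- `w ∈ W^{2,2}(S, ℝ³)`: in every chart `X : V → M`, the map `w ∘ X` has weak derivatives of the
first and second order on the part of `V` parametrizing `S`, and all of these are square integrable
over the part of any compact `K ⊆ V` parametrizing `S` (so, up to the boundary of `S`). -/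
def IsW22 (M S : Set E3) (w : E3 → E3) : Prop :=
  ∀ (V : Set E2) (X : E2 → E3), IsC2Chart M V X →
    ∃ (G : E2 → E2 →L[ℝ] E3) (H : E2 → E2 →L[ℝ] E2 →L[ℝ] E3),
      HasWeakFDerivOn (V ∩ X ⁻¹' S) (w ∘ X) G ∧ HasWeakFDerivOn (V ∩ X ⁻¹' S) G H ∧
      ∀ K ⊆ V, IsCompact K →
        MemLp (w ∘ X) 2 (volume.restrict (K ∩ X ⁻¹' S)) ∧
        MemLp G 2 (volume.restrict (K ∩ X ⁻¹' S)) ∧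
        MemLp H 2 (volume.restrict (K ∩ X ⁻¹' S))

/-- `w ∈ W^{2,2}(S, ℝ³)` is an isometry (isometric immersion): its weak differential preserves the
inner product of tangent vectors, `⟨∇_a w, ∇_b w⟩ = ⟨a, b⟩`, almost everywhere on `S`. -/
structure IsW22Isometry (M S : Set E3) (w : E3 → E3) : Prop where
  isW22 : IsW22 M S w
  isometric : ∀ (V : Set E2) (X : E2 → E3), IsC2Chart M V X →
    ∀ G : E2 → E2 →L[ℝ] E3, HasWeakFDerivOn (V ∩ X ⁻¹' S) (w ∘ X) G →
      ∀ᵐ y ∂(volume : Measure E2), y ∈ V ∩ X ⁻¹' S → ∀ ξ η : E2,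
        inner ℝ (G y ξ) (G y η) = inner ℝ (fderiv ℝ X y ξ) (fderiv ℝ X y η)

/-- `w(x) = x` on `∂S`, in the sense of traces. -/
def FixesBoundary (M S : Set E3) (w : E3 → E3) : Prop :=
  ∀ᵐ p ∂(Measure.hausdorffMeasure 1 : Measure E3), p ∈ surfBoundary S →
    ∀ (V : Set E2) (X : E2 → E3), IsC2Chart M V X → ∀ y ∈ V, X y = p →
      HasTraceAt (V ∩ X ⁻¹' S) (w ∘ X) y p

/-- `∇_τ w = τ` on `∂S`, in the sense of traces, with `τ` the outer normal along `∂S`. In a chart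
`X` with `X y = p`, the derivative of `w` in the direction `τ = DX(y) ξ` is `D(w ∘ X) ξ`. -/
def FixesConormal (M S : Set E3) (n w : E3 → E3) : Prop :=
  ∀ᵐ p ∂(Measure.hausdorffMeasure 1 : Measure E3), p ∈ surfBoundary S →
    ∀ τ : E3, IsOuterConormal M S n p τ →
      ∀ (V : Set E2) (X : E2 → E3), IsC2Chart M V X → ∀ y ∈ V, X y = p →
        ∀ ξ : E2, fderiv ℝ X y ξ = τ →
          ∀ G : E2 → E2 →L[ℝ] E3, HasWeakFDerivOn (V ∩ X ⁻¹' S) (w ∘ X) G →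
            HasTraceAt (V ∩ X ⁻¹' S) (fun z => G z ξ) y τ

/-- `w = g` as Sobolev maps on `S`, for continuous `g`: equality holds almost everywhere on `S` with
respect to the area, and everywhere on `S` if `w` is the continuous representative of its class. -/
def EqOnSurface (S : Set E3) (w g : E3 → E3) : Prop :=
  (∀ᵐ x ∂(Measure.hausdorffMeasure 2 : Measure E3), x ∈ S → w x = g x) ∧
    (ContinuousOn w S → ∀ x ∈ S, w x = g x)

/-! ### The rigidity inequalities

Norms and distances of `3 × 3` matrices are taken in the operator norm, which differs from the
Euclidean (Frobenius) one by a factor in `[1, √3]`; the constant `C` absorbs this factor. -/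

/-- The rigidity inequality with exponent `μ`, for all thin shells with middle surface `S`. -/
def RigidityIneq (S : Set E3) (n : E3 → E3) (μ : ℝ) : Prop :=
  ∃ C > 0, ∃ h₀ > 0, ∀ h : ℝ, 0 < h → h < h₀ →
    ∀ (u : E3 → E3) (G : E3 → E3 →L[ℝ] E3), IsW12 (shell S n h) u G →
      ∃ R ∈ SO3, ∫ z in shell S n h, ‖G z - R‖ ^ 2 ≤
        C / h ^ μ * ∫ z in shell S n h, Metric.infDist (G z) SO3 ^ 2

/-- The rigidity inequality with exponent `μ` for displacements that vanish on the lateral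
boundary, for all thin shells with middle surface `S`. -/
def ZeroBoundaryRigidityIneq (S : Set E3) (n : E3 → E3) (μ : ℝ) : Prop :=
  ∃ C > 0, ∃ h₀ > 0, ∀ h : ℝ, 0 < h → h < h₀ →
    ∀ (u : E3 → E3) (G : E3 → E3 →L[ℝ] E3), IsH01 S n h u G →
      ∫ z in shell S n h, ‖G z‖ ^ 2 ≤
        C / h ^ μ * ∫ z in shell S n h,
          Metric.infDist (G z + ContinuousLinearMap.id ℝ E3) SO3 ^ 2

/-! Let `w` be an isometry of class W^{2,2} with image normal `ν`. Extend it to the shell along the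
normals by u(x + t n(x)) = w(x) + t ν(x). On the middle surface the gradient of `u` is a rotation
R(x): it acts as ∇w on the tangent plane and sends n to ν. At height t the gradient differs from
R(x) by at most C |t| (1 + |∇ν|), by the computation in `TubeIsometry.Good.norm_Γ_sub_le`. An
isometry has bounded gradient, so ∇ν is linear in the second derivatives of `w` with bounded
coefficients, up to a bounded term. Hence ∇ν is square integrable and the squared distance of ∇u to
SO(3) has integral at most C h³ over the shell (`TubeAtlas.exists_shell_map`).

The rigidity inequality then gives a rotation Q_h with ∫ |∇u - Q_h|² ≤ C h^(3-μ). Since R does not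
depend on t, division by the thickness h bounds the integral of |R - Q_h|² over S by C (h² +
h^(2-μ)), which tends to zero because μ < 2. Along a subsequence Q_h converges, so R is almost
everywhere equal to one rotation Q (`TubeAtlas.exists_R_ae_eq`). Then w - Q has vanishing gradient,
and connectedness of S makes it a single constant (`TubeAtlas.exists_ae_eq`). This is (i).

For (ii) the inequality is applied to u - id, so that Q_h is the identity. The work lies in showing
that u - id has zero trace on the lateral boundary, that is, that both w - x and ν - n have zero
trace on ∂S. The normal depends on the whole gradient of `w`, of which only the conormal part is
prescribed; the tangential part must be recovered from w = x on ∂S. Integration by parts gives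
smallness only of weighted averages of ∇_e (w - x), with e tangent to ∂S
(`HasWeakFDerivOn.exists_weight`). The isometry upgrades this to convergence in mean square: as |∇_e
w| is known, |∇_e w - e|² is affine in ∇_e w, and an average of it controls its integral
(`HasWeakFDerivOn.meanZero_tangential`, `TubeIsometry.meanZero_tangent`). Finally, the inequality in
(ii) forces ∂S to be nonempty, and the boundary condition then excludes a translation.

All of this takes place in tubular coordinates (y, s) ↦ X(y) + s N(y). They are C¹ and bi-Lipschitz,
and volumes are compared through the Lipschitz constants instead of Jacobians. -/

section WeakDerivative

variable {d : ℕ} {F : Type*} [NormedAddCommGroup F] [NormedSpace ℝ F]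
  {Ω Ω' : Set (EuclideanSpace ℝ (Fin d))} {f f' : EuclideanSpace ℝ (Fin d) → F}
  {G G' : EuclideanSpace ℝ (Fin d) → EuclideanSpace ℝ (Fin d) →L[ℝ] F}

/-! ### Weak derivatives and mollification. -/

theorem setIntegral_eq_of_tsupport_subset {α W : Type*} [TopologicalSpace α] [MeasurableSpace α]
    {μ : Measure α} [NormedAddCommGroup W]
    [NormedSpace ℝ W] {A : Set α} {φ : α → ℝ} {g : α → W} (h : tsupport φ ⊆ A)
    (hg : ∀ x, x ∉ tsupport φ → g x = 0) : ∫ x in A, g x ∂μ = ∫ x, g x ∂μ := by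
  apply setIntegral_eq_integral_of_forall_compl_eq_zero
  intro x hx
  exact hg x fun h' => hx (h h')

theorem fderiv_eq_zero_of_notMem_tsupport {E W : Type*} [NormedAddCommGroup E] [NormedSpace ℝ E]
    [NormedAddCommGroup W] [NormedSpace ℝ W] {φ : E → W} {x : E} (h : x ∉ tsupport φ) :
    fderiv ℝ φ x = 0 := by
  by_contra h'
  exact h (support_fderiv_subset ℝ h')

theorem MeasureTheory.LocallyIntegrableOn.integrable_smul_of_hasCompactSupport {α : Type*} [TopologicalSpace α]
    [T2Space α] [MeasurableSpace α] [OpensMeasurableSpace α] {μ : Measure α} {Ω : Set α} {g : α → F}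
    (hg : LocallyIntegrableOn g Ω μ) {φ : α → ℝ} (hφ : Continuous φ) (hc : HasCompactSupport φ)
    (hs : tsupport φ ⊆ Ω) : Integrable (fun x => φ x • g x) μ := by
  have h1 : IntegrableOn g (tsupport φ) μ := hg.integrableOn_compact_subset hs hc
  have h2 : IntegrableOn (fun x => φ x • g x) (tsupport φ) μ :=
    h1.continuousOn_smul hφ.continuousOn hc
  rw [integrableOn_iff_integrable_of_support_subset] at h2
  · exact h2
  · intro x hx
    by_contra h
    exact hx (by simp [image_eq_zero_of_notMem_tsupport h])

namespace HasWeakFDerivOn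

/-- Integrals against a test function do not see the domain beyond its support, so all of them can
be compared as integrals over the whole space; no measurability of the domains is needed. -/
theorem mono (h : HasWeakFDerivOn Ω f G) (hsub : Ω' ⊆ Ω) : HasWeakFDerivOn Ω' f G where
  locallyIntegrableOn := h.locallyIntegrableOn.mono_set hsub
  locallyIntegrableOn_grad := h.locallyIntegrableOn_grad.mono_set hsub
  integral_eq φ h1 h2 h3 v := by
    have key := h.integral_eq φ h1 h2 (h3.trans hsub) v
    rw [setIntegral_eq_of_tsupport_subset (h3.trans hsub),
      setIntegral_eq_of_tsupport_subset (h3.trans hsub)] at key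
    · rw [setIntegral_eq_of_tsupport_subset h3, setIntegral_eq_of_tsupport_subset h3, key]
      · intro x hx; simp [fderiv_eq_zero_of_notMem_tsupport hx]
      · intro x hx; simp [image_eq_zero_of_notMem_tsupport hx]
    · intro x hx; simp [fderiv_eq_zero_of_notMem_tsupport hx]
    · intro x hx; simp [image_eq_zero_of_notMem_tsupport hx]

theorem congr_ae (h : HasWeakFDerivOn Ω f G) (hf : f =ᵐ[volume.restrict Ω] f')
    (hG : G =ᵐ[volume.restrict Ω] G') : HasWeakFDerivOn Ω f' G' where
  locallyIntegrableOn := h.locallyIntegrableOn.congr hf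
  locallyIntegrableOn_grad := h.locallyIntegrableOn_grad.congr hG
  integral_eq φ h1 h2 h3 v := by
    have key := h.integral_eq φ h1 h2 h3 v
    convert key using 1
    · apply integral_congr_ae
      filter_upwards [hG] with x hx
      rw [hx]
    · congr 1
      apply integral_congr_ae
      filter_upwards [hf] with x hx
      rw [hx]

theorem locallyIntegrableOn_apply (h : HasWeakFDerivOn Ω f G) (v : EuclideanSpace ℝ (Fin d)) :
    LocallyIntegrableOn (fun x => G x v) Ω := fun x hx => by
  obtain ⟨s, hs, h⟩ := h.locallyIntegrableOn_grad x hx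
  exact ⟨s, hs, (ContinuousLinearMap.apply ℝ F v).integrable_comp h⟩

variable [CompleteSpace F]

/-- The fundamental lemma of the calculus of variations, applied to each basis direction. -/
theorem ae_eq (h : HasWeakFDerivOn Ω f G) (h' : HasWeakFDerivOn Ω f G') (hΩ : IsOpen Ω) :
    G =ᵐ[volume.restrict Ω] G' := by
  let b := (EuclideanSpace.basisFun (Fin d) ℝ)
  have : ∀ i, ∀ᵐ x, x ∈ Ω → (G x - G' x) (b i) = 0 := by
    intro i
    apply hΩ.ae_eq_zero_of_integral_contDiff_smul_eq_zero
    · exact (h.locallyIntegrableOn_apply (b i)).sub (h'.locallyIntegrableOn_apply (b i))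
    · intro φ h1 h2 h3
      have e1 := h.integral_eq φ h1 h2 h3 (b i)
      have e2 := h'.integral_eq φ h1 h2 h3 (b i)
      rw [← e2, setIntegral_eq_of_tsupport_subset h3, setIntegral_eq_of_tsupport_subset h3] at e1
      · simp only [sub_apply, smul_sub]
        rw [integral_sub, e1, sub_self]
        · exact (h.locallyIntegrableOn_apply (b i)).integrable_smul_of_hasCompactSupport
            h1.continuous h2 h3
        · exact (h'.locallyIntegrableOn_apply (b i)).integrable_smul_of_hasCompactSupport
            h1.continuous h2 h3
      · intro x hx; simp [image_eq_zero_of_notMem_tsupport hx]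
      · intro x hx; simp [image_eq_zero_of_notMem_tsupport hx]
  rw [Filter.EventuallyEq, ae_restrict_iff' hΩ.measurableSet]
  filter_upwards [ae_all_iff.2 this] with x hx hxΩ
  have : (G x).toLinearMap = (G' x).toLinearMap := by
    apply b.toBasis.ext
    intro i
    have := hx i hxΩ
    simpa [sub_eq_zero] using this
  exact ContinuousLinearMap.coe_injective this

end HasWeakFDerivOn

/-- A sequence of bump functions shrinking to a point. -/
noncomputable def shrinkingBump (d k : ℕ) : ContDiffBump (0 : EuclideanSpace ℝ (Fin d)) where
  rIn := 1 / (k + 1)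
  rOut := 2 / (k + 1)
  rIn_pos := by positivity
  rIn_lt_rOut := by gcongr; norm_num

theorem tendsto_shrinkingBump_rOut (d : ℕ) :
    Tendsto (fun k => (shrinkingBump d k).rOut) atTop (𝓝 0) := by
  have := (tendsto_one_div_add_atTop_nhds_zero_nat (𝕜 := ℝ)).const_mul 2
  simpa [shrinkingBump, div_eq_mul_inv] using this

open scoped Convolution in
/-- Mollification of a function at scale `2 / (k + 1)`. -/
noncomputable def mollify (k : ℕ) (f : EuclideanSpace ℝ (Fin d) → F) :
    EuclideanSpace ℝ (Fin d) → F :=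
  ((shrinkingBump d k).normed volume) ⋆[ContinuousLinearMap.lsmul ℝ ℝ, volume] f

theorem mollify_apply (k : ℕ) (f : EuclideanSpace ℝ (Fin d) → F) (x : EuclideanSpace ℝ (Fin d)) :
    mollify k f x = ∫ y, (shrinkingBump d k).normed volume (x - y) • f y := by
  simp [mollify, convolution_eq_swap]

theorem contDiff_mollify (k : ℕ) (hf : LocallyIntegrable f) : ContDiff ℝ (⊤ : ℕ∞) (mollify k f) :=
  (shrinkingBump d k).hasCompactSupport_normed.contDiff_convolution_left _
    (shrinkingBump d k).contDiff_normed hf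

theorem integral_shrinkingBump_sub (k : ℕ) (x : EuclideanSpace ℝ (Fin d)) :
    ∫ y, (shrinkingBump d k).normed volume (x - y) = 1 := by
  rw [integral_sub_left_eq_self (fun y => (shrinkingBump d k).normed volume y) volume x]
  exact (shrinkingBump d k).integral_normed

theorem mollify_ae_tendsto [CompleteSpace F] (hf : LocallyIntegrable f) :
    ∀ᵐ x, Tendsto (fun k => mollify k f x) atTop (𝓝 (f x)) :=
  ContDiffBump.ae_convolution_tendsto_right_of_locallyIntegrable (K := 2)
    (tendsto_shrinkingBump_rOut d) (Eventually.of_forall fun k => by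
      simp [shrinkingBump, div_eq_mul_inv]) hf

/-- A mollification is an average over a small ball, so a bound on that ball alone suffices. The
local form serves for supports (`L = 0`), for sup bounds and for gradient bounds. -/
theorem norm_mollify_le (k : ℕ) {L : ℝ} (x : EuclideanSpace ℝ (Fin d))
    (h : ∀ᵐ y, y ∈ Metric.ball x (shrinkingBump d k).rOut → ‖f y‖ ≤ L) :
    ‖mollify k f x‖ ≤ L := by
  rw [mollify_apply]
  have hint : Integrable (fun y => (shrinkingBump d k).normed volume (x - y)) :=
    (shrinkingBump d k).integrable_normed.comp_sub_left x
  calc _ ≤ ∫ y, (shrinkingBump d k).normed volume (x - y) * L := by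
        apply norm_integral_le_of_norm_le (hint.mul_const L)
        filter_upwards [h] with y hy
        rw [norm_smul, Real.norm_of_nonneg ((shrinkingBump d k).nonneg_normed _)]
        by_cases hyx : y ∈ Metric.ball x (shrinkingBump d k).rOut
        · exact mul_le_mul_of_nonneg_left (hy hyx) ((shrinkingBump d k).nonneg_normed _)
        · have : (shrinkingBump d k).normed volume (x - y) = 0 := by
            rw [← Function.notMem_support, (shrinkingBump d k).support_normed_eq]
            simpa [dist_eq_norm, norm_sub_rev] using hyx
          simp [this]
    _ = L := by rw [integral_mul_const, integral_shrinkingBump_sub, one_mul]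

/-- Tonelli and translation invariance: the kernel is nonnegative of mass one. -/
theorem lintegral_enorm_mollify_le (k : ℕ) (hf : Integrable f) :
    ∫⁻ x, ‖mollify k f x‖ₑ ≤ ∫⁻ x, ‖f x‖ₑ := by
  set φ := (shrinkingBump d k).normed volume
  calc ∫⁻ x, ‖mollify k f x‖ₑ ≤ ∫⁻ x, ∫⁻ y, ‖φ y‖ₑ * ‖f (x - y)‖ₑ := by
        apply lintegral_mono
        intro x
        simp only [mollify, convolution]
        refine (enorm_integral_le_lintegral_enorm _).trans (le_of_eq ?_)
        simp [enorm_smul, φ]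
    _ = ∫⁻ y, ∫⁻ x, ‖φ y‖ₑ * ‖f (x - y)‖ₑ := by
        apply lintegral_lintegral_swap
        have m1 : AEMeasurable (fun p : EuclideanSpace ℝ (Fin d) × EuclideanSpace ℝ (Fin d) =>
            ‖φ p.2‖ₑ) (volume.prod volume) :=
          ((shrinkingBump d k).continuous_normed.enorm.measurable.comp measurable_snd).aemeasurable
        have m2 : AEMeasurable (fun p : EuclideanSpace ℝ (Fin d) × EuclideanSpace ℝ (Fin d) =>
            ‖f (p.1 - p.2)‖ₑ) (volume.prod volume) :=
          (hf.aestronglyMeasurable.enorm).comp_quasiMeasurePreserving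
            (quasiMeasurePreserving_sub_of_right_invariant volume volume)
        exact m1.mul m2
    _ = ∫⁻ y, ‖φ y‖ₑ * ∫⁻ x, ‖f x‖ₑ := by
        congr with y
        rw [lintegral_const_mul']
        · congr 1
          exact lintegral_sub_right_eq_self (fun x => ‖f x‖ₑ) y
        · simp
    _ = ∫⁻ x, ‖f x‖ₑ := by
        rw [lintegral_mul_const' _ _ hf.hasFiniteIntegral.ne]
        have : ∫⁻ y, ‖φ y‖ₑ = 1 := by
          have h1 := ofReal_integral_norm_eq_lintegral_enorm (shrinkingBump d k).integrable_normed (μ := volume)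
          rw [← h1]
          have : ∫ y, ‖φ y‖ = 1 := by
            rw [← (shrinkingBump d k).integral_normed (μ := volume)]
            congr with y
            exact Real.norm_of_nonneg ((shrinkingBump d k).nonneg_normed _)
          rw [this]; simp
        rw [this, one_mul]

theorem integrable_mollify (k : ℕ) (hf : Integrable f) : Integrable (mollify k f) :=
  (shrinkingBump d k).integrable_normed.integrable_convolution _ hf

theorem mollify_sub (k : ℕ) {g : EuclideanSpace ℝ (Fin d) → F} (hf : LocallyIntegrable f)
    (hg : LocallyIntegrable g) (x : EuclideanSpace ℝ (Fin d)) :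
    mollify k (f - g) x = mollify k f x - mollify k g x := by
  simp only [mollify, convolution]
  rw [← integral_sub]
  · simp [smul_sub]
  · exact (shrinkingBump d k).hasCompactSupport_normed.convolutionExists_left _
      (shrinkingBump d k).continuous_normed hf x
  · exact (shrinkingBump d k).hasCompactSupport_normed.convolutionExists_left _
      (shrinkingBump d k).continuous_normed hg x

theorem tendsto_lintegral_mollify_sub_of_continuous [CompleteSpace F] (hf : Continuous f)
    (hc : HasCompactSupport f) :
    Tendsto (fun k => ∫⁻ x, ‖mollify k f x - f x‖ₑ) atTop (𝓝 0) := by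
  have hloc := hf.locallyIntegrable (μ := (volume : Measure (EuclideanSpace ℝ (Fin d))))
  obtain ⟨C, hC⟩ := hc.exists_bound_of_continuous hf
  have hC0 : 0 ≤ C := (norm_nonneg _).trans (hC 0)
  -- Every radius `2 / (k + 1)` is at most 2, so all mollifications vanish outside this compact set,
  -- which carries the dominating function.
  let K := Metric.cthickening 2 (tsupport f)
  have hK : IsCompact K := hc.isCompact.cthickening
  have key := tendsto_lintegral_of_dominated_convergence' (μ := volume)
    (F := fun k x => ‖mollify k f x - f x‖ₑ) (f := fun _ => 0)
    (K.indicator fun _ => ENNReal.ofReal (2 * C)) ?_ ?_ ?_ ?_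
  · simpa using key
  · intro k
    exact ((contDiff_mollify k hloc).continuous.sub hf).enorm.measurable.aemeasurable
  · intro k
    refine Eventually.of_forall fun x => ?_
    by_cases hx : x ∈ K
    · rw [Set.indicator_of_mem hx]
      dsimp only
      rw [← ofReal_norm]
      apply ENNReal.ofReal_le_ofReal
      have := norm_mollify_le k x (f := f) (L := C) (Eventually.of_forall fun y _ => hC y)
      linarith [norm_sub_le (mollify k f x) (f x), hC x]
    · have h1 : ∀ y ∈ Metric.ball x (shrinkingBump d k).rOut, f y = 0 := by
        intro y hy
        by_contra h
        apply hx
        refine Metric.mem_cthickening_of_dist_le x y 2 _ (subset_tsupport _ h) ?_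
        have h2 : (shrinkingBump d k).rOut ≤ 2 := by
          simp only [shrinkingBump]
          rw [div_le_iff₀ (by positivity)]
          have : (0:ℝ) ≤ k := by positivity
          linarith
        rw [dist_comm]
        exact (Metric.mem_ball.1 hy).le.trans h2
      have h2 := norm_mollify_le k x (f := f) (L := 0)
        (Eventually.of_forall fun y hy => by rw [h1 y hy, norm_zero])
      have h3 := h1 x (Metric.mem_ball_self (shrinkingBump d k).rOut_pos)
      rw [norm_le_zero_iff] at h2
      simp [h2, h3]
  · rw [lintegral_indicator hK.measurableSet, lintegral_const]
    exact ENNReal.mul_ne_top ENNReal.ofReal_ne_top (by simpa using hK.measure_lt_top.ne)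
  · refine Eventually.of_forall fun x => ?_
    have := ContDiffBump.convolution_tendsto_right_of_continuous (μ := volume)
      (tendsto_shrinkingBump_rOut d) hf x
    have h2 := (this.sub_const (f x)).enorm
    simpa [mollify] using h2

/-- Density of compactly supported continuous functions; since mollification contracts L¹, the
approximation error is uniform in `k`. -/
theorem tendsto_lintegral_mollify_sub [CompleteSpace F] (hf : Integrable f) :
    Tendsto (fun k => ∫⁻ x, ‖mollify k f x - f x‖ₑ) atTop (𝓝 0) := by
  rw [ENNReal.tendsto_nhds_zero]
  intro ε hε
  obtain ⟨g, hgc, hfg, hg, hgi⟩ := hf.exists_hasCompactSupport_lintegral_sub_le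
    (ε := ε / 3) (ENNReal.div_pos hε.ne' (by simp)).ne'
  have h1 := tendsto_lintegral_mollify_sub_of_continuous hg hgc
  rw [ENNReal.tendsto_nhds_zero] at h1
  filter_upwards [h1 (ε / 3) (ENNReal.div_pos hε.ne' (by simp))] with k hk
  have hm : ∀ {u : EuclideanSpace ℝ (Fin d) → F}, Integrable u →
      AEMeasurable (fun x => ‖u x‖ₑ) := fun hu => hu.aestronglyMeasurable.enorm
  calc ∫⁻ x, ‖mollify k f x - f x‖ₑ
      ≤ ∫⁻ x, (‖mollify k (f - g) x‖ₑ + (‖mollify k g x - g x‖ₑ + ‖f x - g x‖ₑ)) := by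
        apply lintegral_mono
        intro x
        dsimp only
        rw [mollify_sub k hf.locallyIntegrable hgi.locallyIntegrable]
        have : mollify k f x - f x = (mollify k f x - mollify k g x) +
          ((mollify k g x - g x) - (f x - g x)) := by abel
        rw [this]
        exact (enorm_add_le _ _).trans (add_le_add le_rfl enorm_sub_le)
    _ = (∫⁻ x, ‖mollify k (f - g) x‖ₑ) +
          ((∫⁻ x, ‖mollify k g x - g x‖ₑ) + ∫⁻ x, ‖f x - g x‖ₑ) := by
        rw [lintegral_add_left' (hm (integrable_mollify k (hf.sub hgi))),
          lintegral_add_left' (by exact hm ((integrable_mollify k hgi).sub hgi))]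
    _ ≤ ε / 3 + (ε / 3 + ε / 3) := by
        gcongr
        exact (lintegral_enorm_mollify_le k (hf.sub hgi)).trans hfg
    _ = ε := by rw [← add_assoc]; exact ENNReal.add_thirds ε

namespace HasWeakFDerivOn

theorem fderiv_mollify [CompleteSpace F] (h : HasWeakFDerivOn Ω f G) (hΩ : MeasurableSet Ω)
    (hf : IntegrableOn f Ω)
    (hG : IntegrableOn G Ω) (k : ℕ) {x : EuclideanSpace ℝ (Fin d)}
    (hx : Metric.closedBall x (shrinkingBump d k).rOut ⊆ Ω) :
    HasFDerivAt (mollify k (Ω.indicator f)) (mollify k (Ω.indicator G) x) x := by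
  set φ := (shrinkingBump d k).normed (volume : Measure (EuclideanSpace ℝ (Fin d))) with hφ
  have hφs : ContDiff ℝ (⊤ : ℕ∞) φ := (shrinkingBump d k).contDiff_normed
  have hφc : HasCompactSupport φ := (shrinkingBump d k).hasCompactSupport_normed
  have hf' : Integrable (Ω.indicator f) := hf.integrable_indicator hΩ
  have hG' : Integrable (Ω.indicator G) := by
    have := (integrable_indicator_iff (f := G) (μ := volume) hΩ).2 hG
    exact this
  have h1 := hφc.hasFDerivAt_convolution_left (ContinuousLinearMap.lsmul ℝ ℝ)
    (hφs.of_le (by simp)) (hf'.locallyIntegrable (μ := volume)) x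
  suffices key : mollify k (Ω.indicator G) x = _ by
    rw [key]; exact h1
  refine ContinuousLinearMap.ext fun v => ?_
  -- The reflected and translated kernel is the test function. Reflection changes the sign of its
  -- derivative, which cancels the sign in the definition of the weak derivative.
  let ψ : EuclideanSpace ℝ (Fin d) → ℝ := fun y => φ (x - y)
  have hψs : ContDiff ℝ (⊤ : ℕ∞) ψ := hφs.comp (contDiff_const.sub contDiff_id)
  have hψd : ∀ y, fderiv ℝ ψ y v = - fderiv ℝ φ (x - y) v := by
    intro y
    have h2 : HasFDerivAt ψ ((fderiv ℝ φ (x - y)).comp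
        (-(ContinuousLinearMap.id ℝ (EuclideanSpace ℝ (Fin d))))) y := by
      apply HasFDerivAt.comp y (g := φ)
      · exact (hφs.differentiable (by simp) _).hasFDerivAt
      · exact (hasFDerivAt_id y).const_sub x
    rw [h2.fderiv]; simp
  have hψsupp : tsupport ψ ⊆ Metric.closedBall x (shrinkingBump d k).rOut := by
    apply closure_minimal _ Metric.isClosed_closedBall
    intro y hy
    have : x - y ∈ Function.support φ := hy
    rw [hφ, (shrinkingBump d k).support_normed_eq] at this
    have h3 : ‖x - y‖ < (shrinkingBump d k).rOut := by simpa using this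
    rw [Metric.mem_closedBall, dist_comm, dist_eq_norm]
    exact h3.le
  have hψc : HasCompactSupport ψ :=
    HasCompactSupport.of_support_subset_isCompact (isCompact_closedBall x _)
      ((subset_tsupport _).trans hψsupp)
  have e := h.integral_eq ψ hψs hψc (hψsupp.trans hx) v
  have lhs : (mollify k (Ω.indicator G) x) v = ∫ y in Ω, ψ y • G y v := by
    rw [mollify_apply, ContinuousLinearMap.integral_apply, ← integral_indicator hΩ]
    · congr with y
      by_cases hy : y ∈ Ω <;> simp [hy, ψ, hφ]
    · exact (hG'.locallyIntegrable.locallyIntegrableOn Set.univ).integrable_smul_of_hasCompactSupport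
        hψs.continuous hψc (Set.subset_univ _)
  rw [lhs, e, convolution_eq_swap, ContinuousLinearMap.integral_apply, ← integral_indicator hΩ,
    ← integral_neg]
  · congr with y
    by_cases hy : y ∈ Ω <;> simp [hy, hψd, ContinuousLinearMap.precompL_apply]
  · have := (hφc.fderiv (𝕜 := ℝ)).convolutionExists_left
      ((ContinuousLinearMap.lsmul ℝ ℝ).precompL (EuclideanSpace ℝ (Fin d)))
      (hφs.continuous_fderiv (by simp)) (hf'.locallyIntegrable (μ := volume)) x
    rw [← convolutionExistsAt_iff_integrable_swap]
    exact this

end HasWeakFDerivOn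

end WeakDerivative

/-! ### Local approximation by smooth functions; chain and product rules. -/

section SmoothApproximation

variable {d m : ℕ} {F F' W : Type*} [NormedAddCommGroup F] [NormedSpace ℝ F]
  [NormedAddCommGroup F'] [NormedSpace ℝ F'] [NormedAddCommGroup W] [NormedSpace ℝ W]
  {Ω U : Set (EuclideanSpace ℝ (Fin d))} {f : EuclideanSpace ℝ (Fin d) → F}
  {G : EuclideanSpace ℝ (Fin d) → EuclideanSpace ℝ (Fin d) →L[ℝ] F}

theorem enorm_add_le_add {E : Type*} [NormedAddCommGroup E] {a b : E} {x y : ℝ≥0∞}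
    (ha : ‖a‖ₑ ≤ x) (hb : ‖b‖ₑ ≤ y) : ‖a + b‖ₑ ≤ x + y :=
  (enorm_add_le _ _).trans (add_le_add ha hb)

/-- Changes of variables enter through an inequality between measures, which a Lipschitz inverse
provides without computing a Jacobian. -/
theorem lintegral_comp_le_of_map_le {α β : Type*} [MeasurableSpace α] [MeasurableSpace β]
    {μ : Measure α} {ν : Measure β} {T : α → β} (hT : AEMeasurable T μ) {C : ℝ≥0}
    (h : μ.map T ≤ C • ν) {g : β → ℝ≥0∞} (hg : AEMeasurable g ν) :
    ∫⁻ x, g (T x) ∂μ ≤ C * ∫⁻ y, g y ∂ν := by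
  have hac : μ.map T ≪ ν := (Measure.absolutelyContinuous_of_le h).trans
    (Measure.AbsolutelyContinuous.rfl.smul_left C)
  rw [← lintegral_map' (hg.mono_ac hac) hT]
  calc _ ≤ ∫⁻ y, g y ∂(C • ν) := lintegral_mono' h le_rfl
    _ = _ := by rw [lintegral_smul_measure]; rfl

theorem map_restrict_le_smul_restrict {α β : Type*} [MeasurableSpace α] [MeasurableSpace β]
    {μ : Measure α} {ν : Measure β} {T : α → β} {A A' : Set α} {B : Set β}
    (hT : AEMeasurable T (μ.restrict A')) {C : ℝ≥0} (h : (μ.restrict A').map T ≤ C • ν)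
    (hA : A ⊆ A') (hAm : MeasurableSet A) (hB : MeasurableSet B) (hmaps : Set.MapsTo T A B) :
    (μ.restrict A).map T ≤ C • ν.restrict B := by
  have hle : μ.restrict A ≤ μ.restrict A' := Measure.restrict_mono hA le_rfl
  rw [Measure.le_iff]
  intro s hs
  rw [Measure.map_apply_of_aemeasurable (hT.mono_measure hle) hs]
  calc (μ.restrict A) (T ⁻¹' s) ≤ (μ.restrict A) (T ⁻¹' (s ∩ B)) := by
        apply measure_mono_ae
        filter_upwards [ae_restrict_mem hAm] with x hx hxs
        exact ⟨hxs, hmaps hx⟩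
    _ ≤ (μ.restrict A') (T ⁻¹' (s ∩ B)) := hle _
    _ = (μ.restrict A').map T (s ∩ B) := by
        rw [Measure.map_apply_of_aemeasurable hT (hs.inter hB)]
    _ ≤ (C • ν) (s ∩ B) := h _
    _ = (C • ν.restrict B) s := by simp [Measure.restrict_apply hs]

/-- `φ k` is a sequence of `C¹` functions on `U` converging to `f` in `W^{1,1}(U)`, where the
gradient of `f` is `G`. -/
structure IsC1Approx (U : Set (EuclideanSpace ℝ (Fin d))) (f : EuclideanSpace ℝ (Fin d) → F)
    (G : EuclideanSpace ℝ (Fin d) → EuclideanSpace ℝ (Fin d) →L[ℝ] F)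
    (φ : ℕ → EuclideanSpace ℝ (Fin d) → F) : Prop where
  integrableOn : IntegrableOn f U
  integrableOn_grad : IntegrableOn G U
  contDiffOn : ∀ k, ContDiffOn ℝ 1 (φ k) U
  tendsto : Tendsto (fun k => ∫⁻ x in U, ‖φ k x - f x‖ₑ) atTop (𝓝 0)
  tendsto_fderiv : Tendsto (fun k => ∫⁻ x in U, ‖fderiv ℝ (φ k) x - G x‖ₑ) atTop (𝓝 0)

/-- The approximants are mollifications. Beyond convergence in W^{1,1}, the product rule needs their
convergence almost everywhere and the preservation of sup bounds. -/
theorem HasWeakFDerivOn.exists_approx [CompleteSpace F] (h : HasWeakFDerivOn Ω f G)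
    (hΩ : IsOpen Ω) {x : EuclideanSpace ℝ (Fin d)} (hx : x ∈ Ω) :
    ∃ r > 0, Metric.ball x r ⊆ Ω ∧ ∃ φ : ℕ → EuclideanSpace ℝ (Fin d) → F,
      (∀ k, ContDiff ℝ (⊤ : ℕ∞) (φ k)) ∧ IsC1Approx (Metric.ball x r) f G φ ∧
      (∀ᵐ y ∂(volume.restrict (Metric.ball x r)), Tendsto (fun k => φ k y) atTop (𝓝 (f y))) ∧
      (∀ L, (∀ᵐ y ∂(volume.restrict Ω), ‖f y‖ ≤ L) → ∀ k, ∀ y ∈ Metric.ball x r, ‖φ k y‖ ≤ L) := by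
  obtain ⟨r, hr, hrΩ⟩ := Metric.nhds_basis_closedBall.mem_iff.1 (hΩ.mem_nhds hx)
  have hi : IntegrableOn f (Metric.ball x r) :=
    (h.locallyIntegrableOn.integrableOn_compact_subset hrΩ (isCompact_closedBall x r)).mono_set
      Metric.ball_subset_closedBall
  have hiG : IntegrableOn G (Metric.ball x r) :=
    (h.locallyIntegrableOn_grad.integrableOn_compact_subset hrΩ (isCompact_closedBall x r)).mono_set
      Metric.ball_subset_closedBall
  have hb : Metric.ball x r ⊆ Ω := Metric.ball_subset_closedBall.trans hrΩ
  have hsub : Metric.ball x (r / 2) ⊆ Metric.ball x r := Metric.ball_subset_ball (by linarith)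
  have hmeas : MeasurableSet (Metric.ball x r) := Metric.isOpen_ball.measurableSet
  -- Dropping the first `k₀` terms makes the mollification radius less than `r / 2`, so that points
  -- of the half ball only see `f` on the full ball.
  obtain ⟨k₀, hk₀⟩ := eventually_atTop.1
    ((tendsto_shrinkingBump_rOut d).eventually_lt_const (half_pos hr))
  set f₁ := (Metric.ball x r).indicator f with hf₁
  set G₁ := (Metric.ball x r).indicator G with hG₁
  have hf₁i : Integrable f₁ := hi.integrable_indicator hmeas
  have hG₁i : Integrable G₁ := by
    have := (integrable_indicator_iff (f := G) (μ := volume) hmeas).2 hiG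
    exact this
  have hball : ∀ k, k₀ ≤ k → ∀ y ∈ Metric.ball x (r / 2),
      Metric.closedBall y (shrinkingBump d k).rOut ⊆ Metric.ball x r := by
    intro k hk y hy z hz
    have h1 := hk₀ k hk
    rw [Metric.mem_ball] at hy ⊢
    rw [Metric.mem_closedBall] at hz
    linarith [dist_triangle z y x]
  refine ⟨r / 2, half_pos hr, hsub.trans hb, fun k => mollify (k + k₀) f₁,
    fun k => contDiff_mollify _ hf₁i.locallyIntegrable, ?_, ?_, ?_⟩
  · refine ⟨hi.mono_set hsub, hiG.mono_set hsub,
      fun k => ((contDiff_mollify _ hf₁i.locallyIntegrable).of_le (by simp)).contDiffOn, ?_, ?_⟩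
    · have := (tendsto_lintegral_mollify_sub hf₁i).comp (tendsto_add_atTop_nat k₀)
      refine tendsto_of_tendsto_of_tendsto_of_le_of_le tendsto_const_nhds this
        (fun _ => zero_le) fun k => ?_
      refine le_trans (le_of_eq ?_) (setLIntegral_le_lintegral (Metric.ball x (r / 2)) _)
      apply setLIntegral_congr_fun Metric.isOpen_ball.measurableSet
      intro y hy
      simp only [hf₁, Set.indicator_of_mem (hsub hy)]
    · have := (tendsto_lintegral_mollify_sub hG₁i).comp (tendsto_add_atTop_nat k₀)
      refine tendsto_of_tendsto_of_tendsto_of_le_of_le tendsto_const_nhds this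
        (fun _ => zero_le) fun k => ?_
      refine le_trans (le_of_eq ?_) (setLIntegral_le_lintegral (Metric.ball x (r / 2)) _)
      apply setLIntegral_congr_fun Metric.isOpen_ball.measurableSet
      intro y hy
      have := (h.mono hb).fderiv_mollify hmeas hi hiG (k + k₀) (hball _ (by omega) y hy)
      simp only
      rw [this.fderiv, hG₁, Set.indicator_of_mem (hsub hy)]
  · have := mollify_ae_tendsto hf₁i.locallyIntegrable
    rw [ae_restrict_iff' Metric.isOpen_ball.measurableSet]
    filter_upwards [this] with y hy hyb
    have h2 := hy.comp (tendsto_add_atTop_nat k₀)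
    rwa [hf₁, Set.indicator_of_mem (hsub hyb)] at h2
  · intro L hL k y hy
    apply norm_mollify_le
    rw [ae_restrict_iff' hΩ.measurableSet] at hL
    filter_upwards [hL] with z hz hzb
    have := hball (k + k₀) (by omega) y hy (Metric.ball_subset_closedBall hzb)
    rw [hf₁, Set.indicator_of_mem this]
    exact hz (hb this)

theorem ContDiffOn.integrable_smul_fderiv {φ : EuclideanSpace ℝ (Fin d) → F} (hφ : ContDiffOn ℝ 1 φ U)
    (hU : IsOpen U) {ψ : EuclideanSpace ℝ (Fin d) → ℝ} (h1 : Continuous ψ)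
    (h2 : HasCompactSupport ψ) (h3 : tsupport ψ ⊆ U) (v : EuclideanSpace ℝ (Fin d)) :
    Integrable fun x => ψ x • fderiv ℝ φ x v :=
  (((hφ.continuousOn_fderiv_of_isOpen hU le_rfl).clm_apply
    continuousOn_const).locallyIntegrableOn hU.measurableSet).integrable_smul_of_hasCompactSupport
    h1 h2 h3

/-- Classical integration by parts holds for each `φ k`, and both sides pass to the limit because
the test function and its derivative are bounded. -/
theorem IsC1Approx.hasWeakFDerivOn {φ : ℕ → EuclideanSpace ℝ (Fin d) → F}
    (h : IsC1Approx U f G φ) (hU : IsOpen U) : HasWeakFDerivOn U f G where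
  locallyIntegrableOn := h.integrableOn.locallyIntegrableOn
  locallyIntegrableOn_grad := h.integrableOn_grad.locallyIntegrableOn
  integral_eq ψ h1 h2 h3 v := by
    have h2' : HasCompactSupport fun x => fderiv ℝ ψ x v := h2.fderiv_apply ℝ v
    have h3' : tsupport (fun x => fderiv ℝ ψ x v) ⊆ U := (tsupport_fderiv_apply_subset ℝ v).trans h3
    have hc' : Continuous fun x => fderiv ℝ ψ x v :=
      (h1.continuous_fderiv (by simp)).clm_apply continuous_const
    have hloc : ∀ k, LocallyIntegrableOn (φ k) U := fun k =>
      (h.contDiffOn k).continuousOn.locallyIntegrableOn hU.measurableSet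
    have key : ∀ k, ∫ x in U, ψ x • fderiv ℝ (φ k) x v = - ∫ x in U, fderiv ℝ ψ x v • φ k x := by
      intro k
      rw [setIntegral_eq_of_tsupport_subset h3, setIntegral_eq_of_tsupport_subset h3,
        integral_smul_fderiv_eq_neg_fderiv_smul_of_integrable]
      · exact (hloc k).integrable_smul_of_hasCompactSupport hc' h2' h3'
      · exact (h.contDiffOn k).integrable_smul_fderiv hU h1.continuous h2 h3 v
      · exact (hloc k).integrable_smul_of_hasCompactSupport h1.continuous h2 h3
      · exact fun x _ => h1.differentiable (by simp) x
      · exact fun x hx => ((h.contDiffOn k).differentiableOn (by simp)).differentiableAt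
          (hU.mem_nhds (h3 hx))
      · intro x hx; simp [fderiv_eq_zero_of_notMem_tsupport hx]
      · intro x hx; simp [image_eq_zero_of_notMem_tsupport hx]
    obtain ⟨C, hC⟩ := h2.exists_bound_of_continuous h1.continuous
    obtain ⟨C', hC'⟩ := h2'.exists_bound_of_continuous hc'
    have lim1 : Tendsto (fun k => ∫ x in U, ψ x • fderiv ℝ (φ k) x v) atTop
        (𝓝 (∫ x in U, ψ x • G x v)) := by
      apply tendsto_integral_of_L1
      · have : LocallyIntegrableOn (fun x => G x v) U := by
          have := (ContinuousLinearMap.apply ℝ F v).integrable_comp h.integrableOn_grad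
          exact IntegrableOn.locallyIntegrableOn this
        exact (this.integrable_smul_of_hasCompactSupport h1.continuous h2 h3).integrableOn.aestronglyMeasurable
      · exact Eventually.of_forall fun k =>
          ((h.contDiffOn k).integrable_smul_fderiv hU h1.continuous h2 h3 v).integrableOn
      · have := ENNReal.Tendsto.const_mul (a := ENNReal.ofReal C * ‖v‖ₑ) h.tendsto_fderiv (Or.inr (by finiteness))
        rw [mul_zero] at this
        refine tendsto_of_tendsto_of_tendsto_of_le_of_le tendsto_const_nhds this
          (fun _ => zero_le) fun k => ?_
        dsimp only
        rw [← lintegral_const_mul' _ _ (by finiteness)]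
        apply lintegral_mono
        intro x
        dsimp only
        rw [← smul_sub, enorm_smul, ← sub_apply, mul_assoc]
        gcongr
        · rw [← ofReal_norm]
          exact ENNReal.ofReal_le_ofReal (hC x)
        · rw [mul_comm]
          exact ContinuousLinearMap.le_opENorm _ _
    have lim2 : Tendsto (fun k => ∫ x in U, fderiv ℝ ψ x v • φ k x) atTop
        (𝓝 (∫ x in U, fderiv ℝ ψ x v • f x)) := by
      apply tendsto_integral_of_L1
      · exact (h.integrableOn.locallyIntegrableOn.integrable_smul_of_hasCompactSupport
          hc' h2' h3').integrableOn.aestronglyMeasurable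
      · exact Eventually.of_forall fun k =>
          ((hloc k).integrable_smul_of_hasCompactSupport hc' h2' h3').integrableOn
      · have := ENNReal.Tendsto.const_mul (a := ENNReal.ofReal C') h.tendsto (Or.inr (by finiteness))
        rw [mul_zero] at this
        refine tendsto_of_tendsto_of_tendsto_of_le_of_le tendsto_const_nhds this
          (fun _ => zero_le) fun k => ?_
        dsimp only
        rw [← lintegral_const_mul' _ _ (by finiteness)]
        apply lintegral_mono
        intro x
        dsimp only
        rw [← smul_sub, enorm_smul]
        gcongr
        rw [← ofReal_norm]
        exact ENNReal.ofReal_le_ofReal (hC' x)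
    exact tendsto_nhds_unique lim1 (by simpa only [key] using lim2.neg)


/-- Being a weak derivative is a local property. -/
theorem hasWeakFDerivOn_of_locally
    (h : ∀ x ∈ Ω, ∃ U, IsOpen U ∧ x ∈ U ∧ U ⊆ Ω ∧ HasWeakFDerivOn U f G) :
    HasWeakFDerivOn Ω f G := by
  choose! U hUo hxU hUΩ hU using h
  have hloc : LocallyIntegrableOn f Ω := fun x hx => by
    have := (hU x hx).locallyIntegrableOn x (hxU x hx)
    rw [(hUo x hx).nhdsWithin_eq (hxU x hx)] at this
    exact this.filter_mono nhdsWithin_le_nhds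
  have hlocG : LocallyIntegrableOn G Ω := fun x hx => by
    have := (hU x hx).locallyIntegrableOn_grad x (hxU x hx)
    rw [(hUo x hx).nhdsWithin_eq (hxU x hx)] at this
    exact this.filter_mono nhdsWithin_le_nhds
  refine ⟨hloc, hlocG, fun ψ h1 h2 h3 v => ?_⟩
  obtain ⟨t, ht, htΩ⟩ := h2.isCompact.elim_nhds_subcover U
    fun x hx => (hUo x (h3 hx)).mem_nhds (hxU x (h3 hx))
  have hsub : tsupport ψ ⊆ ⋃ i : t, U i := by
    intro y hy
    obtain ⟨i, hi, hyi⟩ := Set.mem_iUnion₂.1 (htΩ hy)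
    exact Set.mem_iUnion.2 ⟨⟨i, hi⟩, hyi⟩
  -- A partition of unity splits the test function into pieces, each supported where the weak
  -- derivative is already known.
  obtain ⟨ρ, hρ⟩ := SmoothPartitionOfUnity.exists_isSubordinate
    (modelWithCornersSelf ℝ (EuclideanSpace ℝ (Fin d))) (isClosed_tsupport ψ)
    (fun i : t => U i) (fun i => hUo _ (h3 (ht _ i.2))) hsub
  let θ : t → EuclideanSpace ℝ (Fin d) → ℝ := fun i x => ρ i x * ψ x
  have hθs : ∀ i, ContDiff ℝ (⊤ : ℕ∞) (θ i) := fun i => (ρ i).contMDiff.contDiff.mul h1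
  have hθc : ∀ i, HasCompactSupport (θ i) := fun i => h2.mul_left
  have hθU : ∀ i : t, tsupport (θ i) ⊆ U i := fun i => (tsupport_mul_subset_left).trans (hρ i)
  have hθsum : ∀ x, ψ x = ∑ i, θ i x := by
    intro x
    simp only [θ, ← Finset.sum_mul]
    by_cases hx : x ∈ tsupport ψ
    · rw [← finsum_eq_sum_of_fintype, ρ.sum_eq_one hx, one_mul]
    · rw [image_eq_zero_of_notMem_tsupport hx, mul_zero]
  have hθd : ∀ x, fderiv ℝ ψ x v = ∑ i, fderiv ℝ (θ i) x v := by
    intro x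
    have : ψ = fun x => ∑ i, θ i x := funext hθsum
    rw [this, fderiv_fun_sum fun i _ => (hθs i).differentiable (by simp) x]
    simp
  have hθΩ : ∀ i : t, tsupport (θ i) ⊆ Ω := fun i => (hθU i).trans (hUΩ _ (h3 (ht _ i.2)))
  have hlocGv : LocallyIntegrableOn (fun x => G x v) Ω := fun x hx => by
    obtain ⟨s, hs, h⟩ := hlocG x hx
    exact ⟨s, hs, (ContinuousLinearMap.apply ℝ F v).integrable_comp h⟩
  have e1 : ∀ x, ψ x • G x v = ∑ i, θ i x • G x v := fun x => by rw [hθsum, Finset.sum_smul]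
  have e2 : ∀ x, fderiv ℝ ψ x v • f x = ∑ i, fderiv ℝ (θ i) x v • f x := fun x => by
    rw [hθd, Finset.sum_smul]
  simp only [e1, e2]
  rw [integral_finsetSum, integral_finsetSum, ← Finset.sum_neg_distrib]
  · refine Finset.sum_congr rfl fun i _ => ?_
    have := (hU i (h3 (ht _ i.2))).integral_eq (θ i) (hθs i) (hθc i) (hθU i) v
    rw [setIntegral_eq_of_tsupport_subset (hθU i), setIntegral_eq_of_tsupport_subset (hθU i)] at this
    · rw [setIntegral_eq_of_tsupport_subset (hθΩ i), setIntegral_eq_of_tsupport_subset (hθΩ i), this]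
      · intro x hx; simp [fderiv_eq_zero_of_notMem_tsupport hx]
      · intro x hx; simp [image_eq_zero_of_notMem_tsupport hx]
    · intro x hx; simp [fderiv_eq_zero_of_notMem_tsupport hx]
    · intro x hx; simp [image_eq_zero_of_notMem_tsupport hx]
  · intro i _
    exact (hloc.integrable_smul_of_hasCompactSupport
      (((hθs i).continuous_fderiv (by simp)).clm_apply continuous_const) ((hθc i).fderiv_apply ℝ v)
      ((tsupport_fderiv_apply_subset ℝ v).trans (hθΩ i))).integrableOn
  · intro i _
    exact (hlocGv.integrable_smul_of_hasCompactSupport (hθs i).continuous (hθc i) (hθΩ i)).integrableOn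

/-- A function that is locally a limit of `C¹` functions in `W^{1,1}` is weakly differentiable. -/
theorem hasWeakFDerivOn_of_approx
    (h : ∀ x ∈ Ω, ∃ U φ, IsOpen U ∧ x ∈ U ∧ U ⊆ Ω ∧ IsC1Approx U f G φ) :
    HasWeakFDerivOn Ω f G := by
  apply hasWeakFDerivOn_of_locally
  intro x hx
  obtain ⟨U, φ, hU, hxU, hUΩ, hφ⟩ := h x hx
  exact ⟨U, hU, hxU, hUΩ, hφ.hasWeakFDerivOn hU⟩

namespace HasWeakFDerivOn

variable [CompleteSpace F]

/-- Chain rule for the composition of a weakly differentiable function with a `C¹` map. -/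
theorem comp (h : HasWeakFDerivOn Ω f G) (hΩ : IsOpen Ω) {Ω' : Set (EuclideanSpace ℝ (Fin m))}
    (hΩ' : IsOpen Ω') {P : EuclideanSpace ℝ (Fin m) → EuclideanSpace ℝ (Fin d)}
    (hP : ContDiffOn ℝ 1 P Ω') (hmaps : Set.MapsTo P Ω' Ω) {C : ℝ≥0}
    (hC : (volume.restrict Ω').map P ≤ C • volume) :
    HasWeakFDerivOn Ω' (fun z => f (P z)) (fun z => (G (P z)).comp (fderiv ℝ P z)) := by
  apply hasWeakFDerivOn_of_approx
  intro z hz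
  obtain ⟨r, hr, hrΩ, φ, hφs, hφ, -, -⟩ := h.exists_approx hΩ (hmaps hz)
  have hPc : ContinuousOn P Ω' := hP.continuousOn
  have hDc : ContinuousOn (fderiv ℝ P) Ω' := hP.continuousOn_fderiv_of_isOpen hΩ' le_rfl
  -- By continuity `M` bounds the derivative of `P` near `z`; this turns L¹ bounds for gradients
  -- into L¹ bounds for their compositions with `fderiv ℝ P`.
  set M := ‖fderiv ℝ P z‖ + 1
  set B := Metric.ball (P z) r
  have hev : ∀ᶠ y in 𝓝 z, y ∈ Ω' ∧ P y ∈ B ∧ ‖fderiv ℝ P y‖ < M := by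
    refine Filter.Eventually.and (hΩ'.mem_nhds hz)
      (((hPc.continuousAt (hΩ'.mem_nhds hz)).eventually
      (Metric.isOpen_ball.mem_nhds (Metric.mem_ball_self hr))).and ?_)
    exact ((hDc.continuousAt (hΩ'.mem_nhds hz)).norm).eventually_lt_const (lt_add_one _)
  obtain ⟨ρ, hρ, hρU⟩ := Metric.eventually_nhds_iff_ball.1 hev
  set U := Metric.ball z ρ
  have hUm : MeasurableSet U := Metric.isOpen_ball.measurableSet
  have hUΩ : U ⊆ Ω' := fun y hy => (hρU y hy).1
  have hPU : AEMeasurable P (volume.restrict U) := (hPc.mono hUΩ).aemeasurable hUm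
  have hle : (volume.restrict U).map P ≤ C • (volume.restrict B) :=
    map_restrict_le_smul_restrict (hPc.aemeasurable hΩ'.measurableSet) hC hUΩ hUm
      Metric.isOpen_ball.measurableSet fun y hy => (hρU y hy).2.1
  have hac : (volume.restrict U).map P ≪ volume.restrict B :=
    (Measure.absolutelyContinuous_of_le hle).trans (Measure.AbsolutelyContinuous.rfl.smul_left C)
  have hmf := (hφ.integrableOn.aestronglyMeasurable.mono_ac hac).comp_aemeasurable hPU
  have hmG := (hφ.integrableOn_grad.aestronglyMeasurable.mono_ac hac).comp_aemeasurable hPU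
  have hmD : AEStronglyMeasurable (fderiv ℝ P) (volume.restrict U) :=
    (hDc.mono hUΩ).aestronglyMeasurable hUm
  have hM : 0 ≤ M := by positivity
  have hMb : ∀ y ∈ U, ∀ A : EuclideanSpace ℝ (Fin d) →L[ℝ] F,
      ‖A.comp (fderiv ℝ P y)‖ₑ ≤ ENNReal.ofReal M * ‖A‖ₑ := by
    intro y hy A
    rw [← ofReal_norm, ← ofReal_norm, ← ENNReal.ofReal_mul hM, mul_comm]
    apply ENNReal.ofReal_le_ofReal
    exact (A.opNorm_comp_le _).trans (by gcongr; exact (hρU y hy).2.2.le)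
  refine ⟨U, fun k z => φ k (P z), Metric.isOpen_ball, Metric.mem_ball_self hρ, hUΩ,
    ⟨hmf, ?_⟩, ⟨?_, ?_⟩, ?_, ?_, ?_⟩
  · refine (lintegral_comp_le_of_map_le hPU hle
      hφ.integrableOn.aestronglyMeasurable.enorm).trans_lt ?_
    exact ENNReal.mul_lt_top ENNReal.coe_lt_top hφ.integrableOn.hasFiniteIntegral
  · exact (ContinuousLinearMap.compL ℝ _ _ _).aestronglyMeasurable_comp₂ hmG hmD
  · calc ∫⁻ y in U, ‖(G (P y)).comp (fderiv ℝ P y)‖ₑ ≤ ∫⁻ y in U, ENNReal.ofReal M * ‖G (P y)‖ₑ :=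
          setLIntegral_mono' hUm fun y hy => hMb y hy _
      _ = ENNReal.ofReal M * ∫⁻ y in U, ‖G (P y)‖ₑ := lintegral_const_mul' _ _ (by finiteness)
      _ < ∞ := by
          refine ENNReal.mul_lt_top (by finiteness) ((lintegral_comp_le_of_map_le hPU hle
            hφ.integrableOn_grad.aestronglyMeasurable.enorm).trans_lt ?_)
          exact ENNReal.mul_lt_top ENNReal.coe_lt_top hφ.integrableOn_grad.hasFiniteIntegral
  · exact fun k => ((hφs k).of_le (by simp)).comp_contDiffOn (hP.mono hUΩ)
  · have := ENNReal.Tendsto.const_mul (a := (C : ℝ≥0∞)) hφ.tendsto (Or.inr (by finiteness))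
    rw [mul_zero] at this
    refine tendsto_of_tendsto_of_tendsto_of_le_of_le tendsto_const_nhds this
      (fun _ => zero_le) fun k => ?_
    exact lintegral_comp_le_of_map_le hPU hle (g := fun y => ‖φ k y - f y‖ₑ)
      (((hφs k).continuous.aestronglyMeasurable.sub hφ.integrableOn.aestronglyMeasurable).enorm)
  · have := ENNReal.Tendsto.const_mul (a := ENNReal.ofReal M * (C : ℝ≥0∞)) hφ.tendsto_fderiv
      (Or.inr (by finiteness))
    rw [mul_zero] at this
    refine tendsto_of_tendsto_of_tendsto_of_le_of_le tendsto_const_nhds this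
      (fun _ => zero_le) fun k => ?_
    have hd : ∀ y ∈ U, fderiv ℝ (fun z => φ k (P z)) y - (G (P y)).comp (fderiv ℝ P y) =
        (fderiv ℝ (φ k) (P y) - G (P y)).comp (fderiv ℝ P y) := by
      intro y hy
      have h1 := ((hφs k).differentiable (by simp) (P y)).hasFDerivAt
      have h2 := ((hP.differentiableOn (by simp)).differentiableAt
        (hΩ'.mem_nhds (hUΩ hy))).hasFDerivAt
      rw [show (fun z => φ k (P z)) = φ k ∘ P from rfl, (h1.comp y h2).fderiv,
        ContinuousLinearMap.sub_comp]
    calc _ ≤ ∫⁻ y in U, ENNReal.ofReal M * ‖fderiv ℝ (φ k) (P y) - G (P y)‖ₑ := by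
          refine setLIntegral_mono' hUm fun y hy => ?_
          rw [hd y hy]
          exact hMb y hy _
      _ = ENNReal.ofReal M * ∫⁻ y in U, ‖fderiv ℝ (φ k) (P y) - G (P y)‖ₑ :=
          lintegral_const_mul' _ _ (by finiteness)
      _ ≤ ENNReal.ofReal M * (C * ∫⁻ y in B, ‖fderiv ℝ (φ k) y - G y‖ₑ) := by
          gcongr
          exact lintegral_comp_le_of_map_le hPU hle (g := fun y => ‖fderiv ℝ (φ k) y - G y‖ₑ)
            ((((hφs k).continuous_fderiv (by simp)).aestronglyMeasurable.sub
              hφ.integrableOn_grad.aestronglyMeasurable).enorm)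
      _ = _ := by rw [mul_assoc]

/-- Continuous linear maps act on weakly differentiable functions. -/
theorem clm_comp [CompleteSpace W] (h : HasWeakFDerivOn Ω f G) (L : F →L[ℝ] W) :
    HasWeakFDerivOn Ω (fun x => L (f x)) (fun x => L.comp (G x)) where
  locallyIntegrableOn := fun x hx => by
    obtain ⟨s, hs, h⟩ := h.locallyIntegrableOn x hx
    exact ⟨s, hs, L.integrable_comp h⟩
  locallyIntegrableOn_grad := fun x hx => by
    obtain ⟨s, hs, h⟩ := h.locallyIntegrableOn_grad x hx
    have := (ContinuousLinearMap.compL ℝ (EuclideanSpace ℝ (Fin d)) F W L).integrable_comp h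
    exact ⟨s, hs, this⟩
  integral_eq ψ h1 h2 h3 v := by
    have key := h.integral_eq ψ h1 h2 h3 v
    have := congrArg L key
    rw [map_neg, ← L.integral_comp_comm, ← L.integral_comp_comm] at this
    · simpa using this
    · exact (h.locallyIntegrableOn.integrable_smul_of_hasCompactSupport
        ((h1.continuous_fderiv (by simp)).clm_apply continuous_const) (h2.fderiv_apply ℝ v)
        ((tsupport_fderiv_apply_subset ℝ v).trans h3)).integrableOn
    · exact ((h.locallyIntegrableOn_apply v).integrable_smul_of_hasCompactSupport
        h1.continuous h2 h3).integrableOn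

omit [CompleteSpace F] in
theorem add {f' : EuclideanSpace ℝ (Fin d) → F}
    {G' : EuclideanSpace ℝ (Fin d) → EuclideanSpace ℝ (Fin d) →L[ℝ] F}
    (h : HasWeakFDerivOn Ω f G) (h' : HasWeakFDerivOn Ω f' G') :
    HasWeakFDerivOn Ω (fun x => f x + f' x) (fun x => G x + G' x) where
  locallyIntegrableOn := h.locallyIntegrableOn.add h'.locallyIntegrableOn
  locallyIntegrableOn_grad := by
    have := LocallyIntegrableOn.add (f := G) (g := G') h.locallyIntegrableOn_grad
      h'.locallyIntegrableOn_grad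
    exact this
  integral_eq ψ h1 h2 h3 v := by
    have hc : Continuous fun x => fderiv ℝ ψ x v :=
      (h1.continuous_fderiv (by simp)).clm_apply continuous_const
    have hs := (tsupport_fderiv_apply_subset ℝ v).trans h3
    simp only [add_apply, smul_add]
    rw [integral_add, integral_add, h.integral_eq ψ h1 h2 h3 v, h'.integral_eq ψ h1 h2 h3 v, neg_add]
    · exact (h.locallyIntegrableOn.integrable_smul_of_hasCompactSupport
        hc (h2.fderiv_apply ℝ v) hs).integrableOn
    · exact (h'.locallyIntegrableOn.integrable_smul_of_hasCompactSupport
        hc (h2.fderiv_apply ℝ v) hs).integrableOn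
    · exact ((h.locallyIntegrableOn_apply v).integrable_smul_of_hasCompactSupport
        h1.continuous h2 h3).integrableOn
    · exact ((h'.locallyIntegrableOn_apply v).integrable_smul_of_hasCompactSupport
        h1.continuous h2 h3).integrableOn

omit [CompleteSpace F] in
theorem neg (h : HasWeakFDerivOn Ω f G) :
    HasWeakFDerivOn Ω (fun x => -f x) (fun x => -G x) where
  locallyIntegrableOn := h.locallyIntegrableOn.neg
  locallyIntegrableOn_grad := h.locallyIntegrableOn_grad.neg
  integral_eq ψ h1 h2 h3 v := by
    simp [integral_neg, h.integral_eq ψ h1 h2 h3 v]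

omit [CompleteSpace F] in
theorem sub {f' : EuclideanSpace ℝ (Fin d) → F}
    {G' : EuclideanSpace ℝ (Fin d) → EuclideanSpace ℝ (Fin d) →L[ℝ] F}
    (h : HasWeakFDerivOn Ω f G) (h' : HasWeakFDerivOn Ω f' G') :
    HasWeakFDerivOn Ω (fun x => f x - f' x) (fun x => G x - G' x) := by
  simpa only [sub_eq_add_neg] using h.add h'.neg

omit [CompleteSpace F] in
/-- A `C¹` function is weakly differentiable. -/
theorem of_contDiffOn (hf : ContDiffOn ℝ 1 f Ω) (hΩ : IsOpen Ω) :
    HasWeakFDerivOn Ω f (fderiv ℝ f) := by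
  have hD := hf.continuousOn_fderiv_of_isOpen hΩ le_rfl
  apply hasWeakFDerivOn_of_approx
  intro x hx
  obtain ⟨r, hr, hrΩ⟩ := Metric.nhds_basis_closedBall.mem_iff.1 (hΩ.mem_nhds hx)
  have hb : Metric.ball x r ⊆ Ω := Metric.ball_subset_closedBall.trans hrΩ
  refine ⟨Metric.ball x r, fun _ => f, Metric.isOpen_ball, Metric.mem_ball_self hr, hb, ?_, ?_,
    fun _ => hf.mono hb, by simp, by simp [← ofReal_norm]⟩
  · exact ((hf.continuousOn.mono hrΩ).integrableOn_compact (isCompact_closedBall x r)).mono_set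
      Metric.ball_subset_closedBall
  · exact ((hD.mono hrΩ).integrableOn_compact (isCompact_closedBall x r)).mono_set
      Metric.ball_subset_closedBall

end HasWeakFDerivOn

theorem IsC1Approx.mono {U' : Set (EuclideanSpace ℝ (Fin d))}
    {φ : ℕ → EuclideanSpace ℝ (Fin d) → F} (h : IsC1Approx U f G φ) (hU : U' ⊆ U) :
    IsC1Approx U' f G φ where
  integrableOn := h.integrableOn.mono_set hU
  integrableOn_grad := h.integrableOn_grad.mono_set hU
  contDiffOn k := (h.contDiffOn k).mono hU
  tendsto := tendsto_of_tendsto_of_tendsto_of_le_of_le tendsto_const_nhds h.tendsto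
    (fun _ => zero_le) fun _ => lintegral_mono_set hU
  tendsto_fderiv := tendsto_of_tendsto_of_tendsto_of_le_of_le tendsto_const_nhds h.tendsto_fderiv
    (fun _ => zero_le) fun _ => lintegral_mono_set hU

/-- Dominated convergence with majorant `2 L ‖g‖`. In the product rule `g` is a gradient that is
merely integrable, so convergence of `φ k` in L¹ would not be enough. -/
theorem tendsto_lintegral_enorm_sub_mul {F F' : Type*} [NormedAddCommGroup F]
    [NormedAddCommGroup F'] {α : Type*} [MeasurableSpace α] {μ : Measure α}
    {φ : ℕ → α → F} {f : α → F} {g : α → F'} (hφ : ∀ k, AEStronglyMeasurable (φ k) μ)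
    (hf : AEStronglyMeasurable f μ) (hg : Integrable g μ) {L : ℝ≥0}
    (hφL : ∀ k, ∀ᵐ x ∂μ, ‖φ k x‖ ≤ L) (hfL : ∀ᵐ x ∂μ, ‖f x‖ ≤ L)
    (hlim : ∀ᵐ x ∂μ, Tendsto (fun k => φ k x) atTop (𝓝 (f x))) :
    Tendsto (fun k => ∫⁻ x, ‖φ k x - f x‖ₑ * ‖g x‖ₑ ∂μ) atTop (𝓝 0) := by
  have key := tendsto_lintegral_of_dominated_convergence' (μ := μ)
    (F := fun k x => ‖φ k x - f x‖ₑ * ‖g x‖ₑ) (f := fun _ => 0)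
    (fun x => (L + L) * ‖g x‖ₑ) ?_ ?_ ?_ ?_
  · simpa using key
  · exact fun k => ((hφ k).sub hf).enorm.mul hg.aestronglyMeasurable.enorm
  · intro k
    filter_upwards [hφL k, hfL] with x h1 h2
    gcongr
    refine enorm_sub_le.trans (add_le_add ?_ ?_)
    · rw [enorm_le_coe]; exact h1
    · rw [enorm_le_coe]; exact h2
  · rw [lintegral_const_mul' _ _ (by finiteness)]
    exact ENNReal.mul_ne_top (by finiteness) hg.hasFiniteIntegral.ne
  · filter_upwards [hlim] with x hx
    have h2 := ENNReal.Tendsto.mul_const (b := ‖g x‖ₑ) (hx.sub_const (f x)).enorm (Or.inr (by simp))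
    simpa using h2

namespace HasWeakFDerivOn

/-- Product rule for bounded weakly differentiable functions. -/
theorem bilinear [CompleteSpace F] [CompleteSpace F'] (h : HasWeakFDerivOn Ω f G)
    {f' : EuclideanSpace ℝ (Fin d) → F'}
    {G' : EuclideanSpace ℝ (Fin d) → EuclideanSpace ℝ (Fin d) →L[ℝ] F'}
    (h' : HasWeakFDerivOn Ω f' G') (hΩ : IsOpen Ω) (B : F →L[ℝ] F' →L[ℝ] W) {L : ℝ≥0}
    (hf : ∀ᵐ y ∂volume.restrict Ω, ‖f y‖ ≤ L) (hf' : ∀ᵐ y ∂volume.restrict Ω, ‖f' y‖ ≤ L) :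
    HasWeakFDerivOn Ω (fun x => B (f x) (f' x))
      (fun x => (B (f x)).comp (G' x) + (B.flip (f' x)).comp (G x)) := by
  apply hasWeakFDerivOn_of_approx
  intro x hx
  obtain ⟨r, hr, hrΩ, φ, hφs, hφ, hφt, hφL⟩ := h.exists_approx hΩ hx
  obtain ⟨r', hr', hrΩ', φ', hφs', hφ', hφt', hφL'⟩ := h'.exists_approx hΩ hx
  set U := Metric.ball x (min r r') with hUdef
  have hUo : IsOpen U := Metric.isOpen_ball
  have hU : U ⊆ Metric.ball x r := Metric.ball_subset_ball (min_le_left _ _)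
  have hU' : U ⊆ Metric.ball x r' := Metric.ball_subset_ball (min_le_right _ _)
  replace hφ := hφ.mono hU
  replace hφ' := hφ'.mono hU'
  replace hφt := ae_restrict_of_ae_restrict_of_subset hU hφt
  replace hφt' := ae_restrict_of_ae_restrict_of_subset hU' hφt'
  have hfU := ae_restrict_of_ae_restrict_of_subset (hU.trans hrΩ) hf
  have hfU' := ae_restrict_of_ae_restrict_of_subset (hU.trans hrΩ) hf'
  have bφ : ∀ k, ∀ᵐ y ∂volume.restrict U, ‖φ k y‖ ≤ L := fun k => by
    filter_upwards [ae_restrict_mem hUo.measurableSet] with y hy using hφL L hf k y (hU hy)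
  have bφ' : ∀ k, ∀ᵐ y ∂volume.restrict U, ‖φ' k y‖ ≤ L := fun k => by
    filter_upwards [ae_restrict_mem hUo.measurableSet] with y hy using hφL' L hf' k y (hU' hy)
  have mf := hφ.integrableOn.aestronglyMeasurable
  have mf' := hφ'.integrableOn.aestronglyMeasurable
  have mG := hφ.integrableOn_grad.aestronglyMeasurable
  have mG' := hφ'.integrableOn_grad.aestronglyMeasurable
  have mφ : ∀ k, AEStronglyMeasurable (φ k) (volume.restrict U) := fun k =>
    (hφs k).continuous.aestronglyMeasurable
  have mφ' : ∀ k, AEStronglyMeasurable (φ' k) (volume.restrict U) := fun k =>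
    (hφs' k).continuous.aestronglyMeasurable
  have mDφ : ∀ k, AEStronglyMeasurable (fderiv ℝ (φ k)) (volume.restrict U) := fun k =>
    ((hφs k).continuous_fderiv (by simp)).aestronglyMeasurable
  have mDφ' : ∀ k, AEStronglyMeasurable (fderiv ℝ (φ' k)) (volume.restrict U) := fun k =>
    ((hφs' k).continuous_fderiv (by simp)).aestronglyMeasurable
  have bB : ∀ {a : F} {b : F'}, ‖B a b‖ₑ ≤ ‖B‖ₑ * ‖a‖ₑ * ‖b‖ₑ := fun {a b} => by
    refine (ContinuousLinearMap.le_opENorm _ _).trans ?_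
    gcongr
    exact ContinuousLinearMap.le_opENorm _ _
  have bBT : ∀ {a : F} {T : EuclideanSpace ℝ (Fin d) →L[ℝ] F'},
      ‖(B a).comp T‖ₑ ≤ ‖B‖ₑ * (‖a‖ₑ * ‖T‖ₑ) := fun {a T} => by
    rw [← ofReal_norm, ← ofReal_norm, ← ofReal_norm, ← ofReal_norm, ← ENNReal.ofReal_mul (by simp),
      ← ENNReal.ofReal_mul (by simp)]
    apply ENNReal.ofReal_le_ofReal
    refine (ContinuousLinearMap.opNorm_comp_le _ _).trans ?_
    rw [← mul_assoc]
    gcongr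
    exact B.le_opNorm a
  have bBT' : ∀ {b : F'} {T : EuclideanSpace ℝ (Fin d) →L[ℝ] F},
      ‖(B.flip b).comp T‖ₑ ≤ ‖B‖ₑ * (‖b‖ₑ * ‖T‖ₑ) := fun {b T} => by
    rw [← ofReal_norm, ← ofReal_norm, ← ofReal_norm, ← ofReal_norm, ← ENNReal.ofReal_mul (by simp),
      ← ENNReal.ofReal_mul (by simp)]
    apply ENNReal.ofReal_le_ofReal
    refine (ContinuousLinearMap.opNorm_comp_le _ _).trans ?_
    rw [← mul_assoc]
    gcongr
    have := B.flip.le_opNorm b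
    rwa [ContinuousLinearMap.opNorm_flip] at this
  have hdφ : ∀ k y, fderiv ℝ (fun y => B (φ k y) (φ' k y)) y =
      (B (φ k y)).comp (fderiv ℝ (φ' k) y) + (B.flip (φ' k y)).comp (fderiv ℝ (φ k) y) := by
    intro k y
    rw [(B.hasFDerivAt_of_bilinear ((hφs k).differentiable (by simp) y).hasFDerivAt
      ((hφs' k).differentiable (by simp) y).hasFDerivAt).fderiv]
    refine ContinuousLinearMap.ext fun v => ?_
    simp
  refine ⟨U, fun k y => B (φ k y) (φ' k y), hUo, Metric.mem_ball_self (lt_min hr hr'),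
    hU.trans hrΩ, ⟨B.aestronglyMeasurable_comp₂ mf mf', ?_⟩,
    ⟨?_, ?_⟩, ?_, ?_, ?_⟩
  · calc ∫⁻ y in U, ‖B (f y) (f' y)‖ₑ ≤ ∫⁻ y in U, ‖B‖ₑ * L * ‖f' y‖ₑ := by
          apply lintegral_mono_ae
          filter_upwards [hfU] with y hy
          refine bB.trans ?_
          gcongr
          exact enorm_le_coe.2 hy
      _ = ‖B‖ₑ * L * ∫⁻ y in U, ‖f' y‖ₑ := lintegral_const_mul' _ _ (by finiteness)
      _ < ∞ := ENNReal.mul_lt_top (by finiteness) hφ'.integrableOn.hasFiniteIntegral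
  · have m1 := (ContinuousLinearMap.compL ℝ (EuclideanSpace ℝ (Fin d)) F' W).aestronglyMeasurable_comp₂
      (B.continuous.comp_aestronglyMeasurable mf) mG'
    have m2 := (ContinuousLinearMap.compL ℝ (EuclideanSpace ℝ (Fin d)) F W).aestronglyMeasurable_comp₂
      (B.flip.continuous.comp_aestronglyMeasurable mf') mG
    exact m1.add m2
  · calc ∫⁻ y in U, ‖(B (f y)).comp (G' y) + (B.flip (f' y)).comp (G y)‖ₑ
        ≤ ∫⁻ y in U, (‖B‖ₑ * (L * ‖G' y‖ₑ) + ‖B‖ₑ * (L * ‖G y‖ₑ)) := by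
          apply lintegral_mono_ae
          filter_upwards [hfU, hfU'] with y hy hy'
          refine enorm_add_le_add (bBT.trans ?_) (bBT'.trans ?_)
          · gcongr; exact enorm_le_coe.2 hy
          · gcongr; exact enorm_le_coe.2 hy'
      _ < ∞ := by
          rw [lintegral_add_left' ((mG'.enorm.const_mul _).const_mul _),
            lintegral_const_mul' _ _ (by finiteness), lintegral_const_mul' _ _ (by finiteness),
            lintegral_const_mul' _ _ (by finiteness), lintegral_const_mul' _ _ (by finiteness)]
          have a1 := hφ'.integrableOn_grad.hasFiniteIntegral
          have a2 := hφ.integrableOn_grad.hasFiniteIntegral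
          rw [hasFiniteIntegral_iff_enorm] at a1 a2
          have b1 := a1.ne
          have b2 := a2.ne
          finiteness
  · intro k
    exact (B.isBoundedBilinearMap.contDiff.comp
      (((hφs k).of_le (by simp)).prodMk ((hφs' k).of_le (by simp)))).contDiffOn
  · have := (ENNReal.Tendsto.const_mul (a := ‖B‖ₑ * L) hφ.tendsto (Or.inr (by finiteness))).add
      (ENNReal.Tendsto.const_mul (a := ‖B‖ₑ * L) hφ'.tendsto (Or.inr (by finiteness)))
    rw [mul_zero, add_zero] at this
    refine tendsto_of_tendsto_of_tendsto_of_le_of_le tendsto_const_nhds this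
      (fun _ => zero_le) fun k => ?_
    dsimp only
    rw [← lintegral_const_mul' _ _ (by finiteness), ← lintegral_const_mul' _ _ (by finiteness),
      ← lintegral_add_left' (by exact ((mφ k).sub mf).enorm.const_mul _)]
    apply lintegral_mono_ae
    filter_upwards [hfU, bφ' k] with y hy hy'
    have e : B (φ k y) (φ' k y) - B (f y) (f' y) =
      B (φ k y - f y) (φ' k y) + B (f y) (φ' k y - f' y) := by simp
    rw [e]
    refine (enorm_add_le _ _).trans (add_le_add (bB.trans ?_) (bB.trans ?_))
    · rw [mul_right_comm]; gcongr; exact enorm_le_coe.2 hy'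
    · gcongr; exact enorm_le_coe.2 hy
  · have t1 := tendsto_lintegral_enorm_sub_mul mφ mf hφ'.integrableOn_grad bφ hfU hφt
    have t2 := tendsto_lintegral_enorm_sub_mul mφ' mf' hφ.integrableOn_grad bφ' hfU' hφt'
    have := ((ENNReal.Tendsto.const_mul (a := ‖B‖ₑ * L) hφ'.tendsto_fderiv
      (Or.inr (by finiteness))).add (ENNReal.Tendsto.const_mul (a := ‖B‖ₑ) t1
      (Or.inr (by finiteness)))).add ((ENNReal.Tendsto.const_mul (a := ‖B‖ₑ * L) hφ.tendsto_fderiv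
      (Or.inr (by finiteness))).add (ENNReal.Tendsto.const_mul (a := ‖B‖ₑ) t2
      (Or.inr (by finiteness))))
    simp only [mul_zero, add_zero] at this
    refine tendsto_of_tendsto_of_tendsto_of_le_of_le tendsto_const_nhds this
      (fun _ => zero_le) fun k => ?_
    have n1 := (((mDφ' k).sub mG').enorm.const_mul (‖B‖ₑ * L))
    have n2 := ((((mφ k).sub mf).enorm.mul mG'.enorm).const_mul ‖B‖ₑ)
    have n3 := (((mDφ k).sub mG).enorm.const_mul (‖B‖ₑ * L))
    dsimp only
    rw [← lintegral_const_mul' _ _ (by finiteness), ← lintegral_const_mul' _ _ (by finiteness),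
      ← lintegral_const_mul' _ _ (by finiteness), ← lintegral_const_mul' _ _ (by finiteness),
      ← lintegral_add_left' (by exact n1), ← lintegral_add_left' (by exact n3),
      ← lintegral_add_left' (by exact n1.add n2)]
    apply lintegral_mono_ae
    filter_upwards [bφ k, bφ' k] with y hy hy'
    rw [hdφ]
    -- Each term of this telescoping sum pairs either a bounded sequence with a gradient error
    -- tending to zero in L¹, or a vanishing function error with a fixed integrable gradient.
    have e : (B (φ k y)).comp (fderiv ℝ (φ' k) y) + (B.flip (φ' k y)).comp (fderiv ℝ (φ k) y) -
        ((B (f y)).comp (G' y) + (B.flip (f' y)).comp (G y)) =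
        ((B (φ k y)).comp (fderiv ℝ (φ' k) y - G' y) + (B (φ k y - f y)).comp (G' y)) +
        ((B.flip (φ' k y)).comp (fderiv ℝ (φ k) y - G y) +
          (B.flip (φ' k y - f' y)).comp (G y)) := by
      refine ContinuousLinearMap.ext fun v => ?_
      simp
      abel
    rw [e]
    refine enorm_add_le_add (enorm_add_le_add (bBT.trans ?_) bBT)
      (enorm_add_le_add (bBT'.trans ?_) bBT')
    · rw [mul_assoc]; gcongr; exact enorm_le_coe.2 hy
    · rw [mul_assoc]; gcongr; exact enorm_le_coe.2 hy'

end HasWeakFDerivOn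

end SmoothApproximation

/-! ### Lipschitz bounds from bounded weak gradients. -/

section AELipschitz

variable {d : ℕ} {F : Type*} [NormedAddCommGroup F] [NormedSpace ℝ F] [CompleteSpace F]
  {Q : Set (EuclideanSpace ℝ (Fin d))} {f : EuclideanSpace ℝ (Fin d) → F}
  {G : EuclideanSpace ℝ (Fin d) → EuclideanSpace ℝ (Fin d) →L[ℝ] F}

/-- On a convex open set, a function with bounded weak gradient is Lipschitz outside a null set. -/
theorem HasWeakFDerivOn.exists_ae_lipschitz (h : HasWeakFDerivOn Q f G) (hQ : IsOpen Q)
    (hconv : Convex ℝ Q) (hf : IntegrableOn f Q) (hG : IntegrableOn G Q) {L : ℝ}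
    (hL : ∀ᵐ y ∂volume.restrict Q, ‖G y‖ ≤ L) :
    ∃ Z ⊆ Q, volume (Q \ Z) = 0 ∧ ∀ y ∈ Z, ∀ z ∈ Z, ‖f y - f z‖ ≤ L * ‖y - z‖ := by
  set f₁ := Q.indicator f with hf₁
  have hf₁i : Integrable f₁ := hf.integrable_indicator hQ.measurableSet
  set G₁ := Q.indicator G with hG₁
  -- The good set consists of the points where mollifications converge. On a segment in `Q` the
  -- mollified gradients are bounded by `L` once the radius is smaller than the distance of the
  -- segment to the complement, so the mean value inequality holds before the limit and hence in the
  -- limit.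
  refine ⟨{y | y ∈ Q ∧ Tendsto (fun k => mollify k f₁ y) atTop (𝓝 (f y))}, fun y hy => hy.1, ?_, ?_⟩
  · have := mollify_ae_tendsto hf₁i.locallyIntegrable
    rw [ae_iff] at this
    refine measure_mono_null ?_ this
    rintro y ⟨hy, hyZ⟩ hyt
    rw [hf₁, Set.indicator_of_mem hy] at hyt
    exact hyZ ⟨hy, hyt⟩
  · rintro y ⟨hy, hyt⟩ z ⟨hz, hzt⟩
    have hseg : IsCompact (segment ℝ z y) := by
      rw [segment_eq_image_lineMap]
      exact isCompact_Icc.image (AffineMap.lineMap_continuous)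
    obtain ⟨ε, hε, hεQ⟩ := hseg.exists_cthickening_subset_open hQ (hconv.segment_subset hz hy)
    refine le_of_tendsto (hyt.sub hzt).norm ?_
    filter_upwards [(tendsto_shrinkingBump_rOut d).eventually_lt_const hε] with k hk
    have hball : ∀ x ∈ segment ℝ z y, Metric.closedBall x (shrinkingBump d k).rOut ⊆ Q := by
      intro x hx w hw
      exact hεQ (Metric.mem_cthickening_of_dist_le w x ε _ hx ((Metric.mem_closedBall.1 hw).trans hk.le))
    refine (convex_segment z y).norm_image_sub_le_of_norm_hasFDerivWithin_le (𝕜 := ℝ)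
      (f' := fun x => mollify k G₁ x) (fun x hx =>
      (h.fderiv_mollify hQ.measurableSet hf hG k (hball x hx)).hasFDerivWithinAt) (fun x hx => ?_)
      (left_mem_segment ℝ z y) (right_mem_segment ℝ z y)
    apply norm_mollify_le
    rw [ae_restrict_iff' hQ.measurableSet] at hL
    filter_upwards [hL] with w hw hwb
    have := hball x hx (Metric.ball_subset_closedBall hwb)
    rw [hG₁, Set.indicator_of_mem this]
    exact hw this

/-- A function with vanishing weak gradient on a ball is almost everywhere constant. -/
theorem HasWeakFDerivOn.exists_ae_eq_const (h : HasWeakFDerivOn Q f G) (hQ : IsOpen Q)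
    (hG : G =ᵐ[volume.restrict Q] 0) {x : EuclideanSpace ℝ (Fin d)} (hx : x ∈ Q) :
    ∃ r > 0, Metric.ball x r ⊆ Q ∧ ∃ a, ∀ᵐ y ∂volume.restrict (Metric.ball x r), f y = a := by
  obtain ⟨r, hr, hrΩ⟩ := Metric.nhds_basis_closedBall.mem_iff.1 (hQ.mem_nhds hx)
  have hb : Metric.ball x r ⊆ Q := Metric.ball_subset_closedBall.trans hrΩ
  have hi : IntegrableOn f (Metric.ball x r) :=
    (h.locallyIntegrableOn.integrableOn_compact_subset hrΩ (isCompact_closedBall x r)).mono_set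
      Metric.ball_subset_closedBall
  have hiG : IntegrableOn G (Metric.ball x r) :=
    (h.locallyIntegrableOn_grad.integrableOn_compact_subset hrΩ (isCompact_closedBall x r)).mono_set
      Metric.ball_subset_closedBall
  obtain ⟨Z, hZ, hZ0, hZL⟩ := (h.mono hb).exists_ae_lipschitz Metric.isOpen_ball (convex_ball x r)
    hi hiG (L := 0) (by
      filter_upwards [ae_restrict_of_ae_restrict_of_subset hb hG] with y hy
      rw [hy]; simp)
  refine ⟨r, hr, hb, ?_⟩
  have hne : Z.Nonempty := by
    by_contra hne
    rw [Set.not_nonempty_iff_eq_empty] at hne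
    rw [hne, Set.sdiff_empty] at hZ0
    exact (Metric.measure_ball_pos volume x hr).ne' hZ0
  obtain ⟨z, hz⟩ := hne
  refine ⟨f z, ?_⟩
  rw [ae_restrict_iff' Metric.isOpen_ball.measurableSet, ae_iff]
  refine measure_mono_null ?_ hZ0
  intro y hy
  rw [Set.mem_ofPred_eq, Classical.not_imp] at hy
  refine ⟨hy.1, fun hyZ => hy.2 ?_⟩
  have := hZL y hyZ z hz
  rw [zero_mul, norm_le_zero_iff, sub_eq_zero] at this
  exact this

end AELipschitz

/-! ### Volumes under Lipschitz maps. -/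

section Volume

/-- In both spaces Lebesgue measure is a multiple of the Hausdorff measure of the common dimension,
which a `K`-Lipschitz map increases by a factor of at most `K ^ dim`. The two spaces may carry
different norms, as `E2 × ℝ` and `E3` do. -/
theorem exists_volume_image_le (E F : Type*) [NormedAddCommGroup E] [NormedSpace ℝ E]
    [FiniteDimensional ℝ E] [MeasureSpace E] [BorelSpace E] [(volume : Measure E).IsAddHaarMeasure]
    [NormedAddCommGroup F] [NormedSpace ℝ F]
    [FiniteDimensional ℝ F] [MeasureSpace F] [BorelSpace F] [(volume : Measure F).IsAddHaarMeasure]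
    (hEF : Module.finrank ℝ E = Module.finrank ℝ F) (K : ℝ≥0) :
    ∃ C : ℝ≥0, ∀ (f : E → F) (s : Set E), LipschitzOnWith K f s →
      volume (f '' s) ≤ C * volume s := by
  let μE : Measure E := Measure.hausdorffMeasure (Module.finrank ℝ E)
  let μF : Measure F := Measure.hausdorffMeasure (Module.finrank ℝ F)
  refine ⟨Measure.addHaarScalarFactor (volume : Measure F) μF * K ^ (Module.finrank ℝ E) *
    Measure.addHaarScalarFactor μE (volume : Measure E), fun f s hf => ?_⟩
  have e1 : (volume : Measure F) = Measure.addHaarScalarFactor (volume : Measure F) μF • μF :=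
    Measure.isAddLeftInvariant_eq_smul _ _
  have e2 : μE = Measure.addHaarScalarFactor μE (volume : Measure E) • (volume : Measure E) :=
    Measure.isAddLeftInvariant_eq_smul _ _
  have h1 : μF (f '' s) ≤ (K : ℝ≥0∞) ^ (Module.finrank ℝ E : ℝ) * μE s := by
    have := hf.hausdorffMeasure_image_le (d := Module.finrank ℝ E) (by positivity)
    simpa [μF, μE, hEF] using this
  calc volume (f '' s) = Measure.addHaarScalarFactor (volume : Measure F) μF * μF (f '' s) := by
        conv_lhs => rw [e1]
        rfl
    _ ≤ Measure.addHaarScalarFactor (volume : Measure F) μF *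
        ((K : ℝ≥0∞) ^ (Module.finrank ℝ E : ℝ) * μE s) := by gcongr
    _ = _ := by
        conv_lhs => rw [e2]
        simp only [Measure.smul_apply, ENNReal.rpow_natCast, ENNReal.coe_mul, ENNReal.coe_pow]
        rw [ENNReal.smul_def, smul_eq_mul]
        ring

theorem finrank_E2_prod_real : Module.finrank ℝ (E2 × ℝ) = Module.finrank ℝ E3 := by
  simp

end Volume

/-! ### Cross products and rotations of three-space. -/

section Rotations

/-- The cross product on Euclidean space. -/
noncomputable def crossL : E3 →L[ℝ] E3 →L[ℝ] E3 :=
  LinearMap.toContinuousLinearMap ((LinearMap.toContinuousLinearMap :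
    (E3 →ₗ[ℝ] E3) ≃ₗ[ℝ] (E3 →L[ℝ] E3)).toLinearMap ∘ₗ
    LinearMap.mk₂ ℝ (fun a b : E3 => (!₂[a 1 * b 2 - a 2 * b 1, a 2 * b 0 - a 0 * b 2,
      a 0 * b 1 - a 1 * b 0] : E3))
      (fun a b c => by ext i; fin_cases i <;> simp <;> ring)
      (fun t a b => by ext i; fin_cases i <;> simp <;> ring)
      (fun a b c => by ext i; fin_cases i <;> simp <;> ring)
      (fun t a b => by ext i; fin_cases i <;> simp <;> ring))

@[simp] theorem crossL_zero (a b : E3) : crossL a b 0 = a 1 * b 2 - a 2 * b 1 := rfl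
@[simp] theorem crossL_one (a b : E3) : crossL a b 1 = a 2 * b 0 - a 0 * b 2 := rfl
@[simp] theorem crossL_two (a b : E3) : crossL a b 2 = a 0 * b 1 - a 1 * b 0 := rfl

theorem inner_E3 (a b : E3) : inner ℝ a b = a 0 * b 0 + a 1 * b 1 + a 2 * b 2 := by
  rw [PiLp.inner_apply, Fin.sum_univ_three]
  simp [mul_comm]

theorem inner_crossL_left (a b : E3) : inner ℝ a (crossL a b) = 0 := by
  simp [inner_E3]; ring

theorem inner_crossL_right (a b : E3) : inner ℝ b (crossL a b) = 0 := by
  simp [inner_E3]; ring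

theorem inner_crossL_crossL (a b c d : E3) : inner ℝ (crossL a b) (crossL c d) =
    inner ℝ a c * inner ℝ b d - inner ℝ a d * inner ℝ b c := by
  simp [inner_E3]; ring

theorem norm_crossL_sq (a b : E3) : ‖crossL a b‖ ^ 2 = ‖a‖ ^ 2 * ‖b‖ ^ 2 - inner ℝ a b ^ 2 := by
  rw [← real_inner_self_eq_norm_sq, ← real_inner_self_eq_norm_sq, ← real_inner_self_eq_norm_sq,
    inner_crossL_crossL, real_inner_comm a b]
  ring

theorem norm_crossL_le (a b : E3) : ‖crossL a b‖ ≤ ‖a‖ * ‖b‖ := by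
  refine abs_le_of_sq_le_sq' ?_ (by positivity) |>.2
  rw [norm_crossL_sq, mul_pow]
  linarith [sq_nonneg (inner ℝ a b : ℝ)]

/-- Expansion of a vector in the frame `a, b, a × b`. -/
theorem normSq_crossL_smul (a b v : E3) : ‖crossL a b‖ ^ 2 • v =
    (inner ℝ a v * ‖b‖ ^ 2 - inner ℝ b v * inner ℝ a b) • a +
    (inner ℝ b v * ‖a‖ ^ 2 - inner ℝ a v * inner ℝ a b) • b +
    inner ℝ (crossL a b) v • crossL a b := by
  rw [← real_inner_self_eq_norm_sq, ← real_inner_self_eq_norm_sq, ← real_inner_self_eq_norm_sq]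
  have h : ∀ i : Fin 3, (inner ℝ (crossL a b) (crossL a b) : ℝ) * v i =
      (inner ℝ a v * inner ℝ b b - inner ℝ b v * inner ℝ a b) * a i +
      (inner ℝ b v * inner ℝ a a - inner ℝ a v * inner ℝ a b) * b i +
      inner ℝ (crossL a b) v * crossL a b i := by
    intro i
    simp only [inner_E3, crossL_zero, crossL_one, crossL_two]
    fin_cases i <;> simp <;> ring
  ext i
  simpa only [PiLp.add_apply, PiLp.smul_apply, smul_eq_mul] using h i

theorem inner_crossL_map (R : E3 →L[ℝ] E3) (a b c : E3) :
    inner ℝ (crossL (R a) (R b)) (R c) = R.det * inner ℝ (crossL a b) c := by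
  have hv : ∀ (a : E3) (i : Fin 3), R a i = R (EuclideanSpace.single 0 1) i * a 0 +
      R (EuclideanSpace.single 1 1) i * a 1 + R (EuclideanSpace.single 2 1) i * a 2 := by
    intro a i
    have : a = a 0 • EuclideanSpace.single 0 (1 : ℝ) + a 1 • EuclideanSpace.single 1 (1 : ℝ) +
        a 2 • EuclideanSpace.single 2 (1 : ℝ) := by
      ext j; fin_cases j <;> simp
    conv_lhs => rw [this]
    simp only [map_add, map_smul, PiLp.add_apply, PiLp.smul_apply, smul_eq_mul]
    ring
  have hdet : R.det = (LinearMap.toMatrix (EuclideanSpace.basisFun (Fin 3) ℝ).toBasis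
      (EuclideanSpace.basisFun (Fin 3) ℝ).toBasis R.toLinearMap).det :=
    (LinearMap.det_toMatrix _ _).symm
  rw [hdet, Matrix.det_fin_three]
  simp only [LinearMap.toMatrix_apply, inner_E3, crossL_zero, crossL_one, crossL_two, hv a, hv b,
    hv c, OrthonormalBasis.coe_toBasis, EuclideanSpace.basisFun_apply,
    OrthonormalBasis.coe_toBasis_repr_apply, EuclideanSpace.basisFun_repr,
    ContinuousLinearMap.coe_coe]
  ring

theorem inner_map_map_of_norm {R : E3 →L[ℝ] E3} (h : ∀ x, ‖R x‖ = ‖x‖) (a b : E3) :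
    inner ℝ (R a) (R b) = inner ℝ a b :=
  (LinearMap.norm_map_iff_inner_map_map R).1 h a b

/-- Both sides have the same inner product with every `R c`, by the triple product formula and `det
R = 1`; these vectors fill the space. -/
theorem crossL_map_of_mem_SO3 {R : E3 →L[ℝ] E3} (hR : R ∈ SO3) (a b : E3) :
    crossL (R a) (R b) = R (crossL a b) := by
  have hinj : Function.Injective R.toLinearMap := by
    rw [injective_iff_map_eq_zero]
    intro x hx
    have := hR.1 x
    rw [show R x = 0 from hx, norm_zero] at this
    exact norm_eq_zero.1 this.symm
  have hsurj := LinearMap.surjective_of_injective hinj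
  refine ext_inner_right ℝ fun v => ?_
  obtain ⟨c, rfl⟩ := hsurj v
  change inner ℝ _ (R c) = inner ℝ _ (R c)
  rw [inner_crossL_map, hR.2, one_mul, inner_map_map_of_norm hR.1]

/-- A rotation is determined on two independent vectors, since it also transports their cross
product. -/
theorem eq_of_mem_SO3 {R R' : E3 →L[ℝ] E3} (hR : R ∈ SO3) (hR' : R' ∈ SO3) {a b : E3}
    (hab : crossL a b ≠ 0) (ha : R a = R' a) (hb : R b = R' b) : R = R' := by
  refine ContinuousLinearMap.ext fun v => ?_
  have hc : R (crossL a b) = R' (crossL a b) := by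
    rw [← crossL_map_of_mem_SO3 hR, ← crossL_map_of_mem_SO3 hR', ha, hb]
  have hn : ‖crossL a b‖ ^ 2 ≠ 0 := by positivity
  have : ‖crossL a b‖ ^ 2 • R v = ‖crossL a b‖ ^ 2 • R' v := by
    rw [← map_smul, ← map_smul, normSq_crossL_smul]
    simp only [map_add, map_smul, ha, hb, hc]
  exact smul_right_injective _ hn this

theorem norm_le_one_of_mem_SO3 {R : E3 →L[ℝ] E3} (hR : R ∈ SO3) : ‖R‖ ≤ 1 :=
  R.opNorm_le_bound zero_le_one fun x => by rw [hR.1 x, one_mul]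

theorem isCompact_SO3 : IsCompact SO3 := by
  rw [Metric.isCompact_iff_isClosed_bounded]
  constructor
  · apply IsClosed.inter
    · have : {R : E3 →L[ℝ] E3 | ∀ x, ‖R x‖ = ‖x‖} = ⋂ x, {R | ‖R x‖ = ‖x‖} := by
        ext; simp
      change IsClosed {R : E3 →L[ℝ] E3 | ∀ x, ‖R x‖ = ‖x‖}
      rw [this]
      refine isClosed_iInter fun x => isClosed_eq ?_ continuous_const
      exact (ContinuousLinearMap.apply ℝ E3 x).continuous.norm
    · exact isClosed_eq ContinuousLinearMap.continuous_det continuous_const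
  · exact (Metric.isBounded_closedBall (x := (0 : E3 →L[ℝ] E3)) (r := 1)).subset fun R hR => by
      simpa using norm_le_one_of_mem_SO3 hR

/-- The standard basis vectors of the parameter plane. -/
noncomputable abbrev e₁ : E2 := EuclideanSpace.single 0 1
noncomputable abbrev e₂ : E2 := EuclideanSpace.single 1 1

theorem map_E2 {W : Type*} [NormedAddCommGroup W] [NormedSpace ℝ W] (A : E2 →L[ℝ] W) (ξ : E2) :
    A ξ = ξ 0 • A e₁ + ξ 1 • A e₂ := by
  have : ξ = ξ 0 • e₁ + ξ 1 • e₂ := by ext j; fin_cases j <;> simp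
  conv_lhs => rw [this]
  simp only [map_add, map_smul]

theorem inner_map_crossL (A : E2 →L[ℝ] E3) (ξ : E2) :
    inner ℝ (A ξ) (crossL (A e₁) (A e₂)) = 0 := by
  rw [map_E2 A ξ, inner_add_left, inner_smul_left, inner_smul_left, inner_crossL_left,
    inner_crossL_right]
  simp

/-- If the cross product of a = A e₁ and b = A e₂ vanished, equality would hold in Cauchy–Schwarz
and ‖a‖² e₂ - ⟨a, b⟩ e₁ would lie in the kernel of `A`. -/
theorem crossL_ne_zero_of_injective {A : E2 →L[ℝ] E3} (hA : Function.Injective A) :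
    crossL (A e₁) (A e₂) ≠ 0 := by
  intro h
  have h1 := norm_crossL_sq (A e₁) (A e₂)
  rw [h, norm_zero] at h1
  have h2 : A (‖A e₁‖ ^ 2 • e₂ - inner ℝ (A e₁) (A e₂) • e₁) = 0 := by
    rw [← norm_eq_zero, ← sq_eq_zero_iff, map_sub, map_smul, map_smul, norm_sub_sq_real, norm_smul,
      norm_smul, inner_smul_left, inner_smul_right]
    simp only [Real.norm_eq_abs, mul_pow, sq_abs, RCLike.conj_to_real]
    have hcomm : inner ℝ (A e₂) (A e₁) = (inner ℝ (A e₁) (A e₂) : ℝ) := real_inner_comm _ _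
    rw [hcomm]
    linear_combination -‖A e₁‖ ^ 2 * h1
  have h3 := hA (h2.trans (map_zero A).symm)
  have h4 : ‖A e₁‖ ^ 2 = 0 := by simpa using congrArg (fun v : E2 => v 1) h3
  have h5 : A e₁ = 0 := by simpa using h4
  have h6 := hA (h5.trans (map_zero A).symm)
  simpa using congrArg (fun v : E2 => v 0) h6

/-- A unit vector orthogonal to a plane is one of the two unit normals. -/
theorem eq_or_eq_neg_of_orthogonal {A : E2 →L[ℝ] E3} {N v : E3} {c : ℝ}
    (hN : N = c • crossL (A e₁) (A e₂)) (hN1 : ‖N‖ = 1) (hv1 : ‖v‖ = 1)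
    (hv : ∀ ξ, inner ℝ (A ξ) v = 0) : v = N ∨ v = -N := by
  have hc : crossL (A e₁) (A e₂) ≠ 0 := by
    rintro h; rw [h, smul_zero] at hN; simp [hN] at hN1
  have hn : ‖crossL (A e₁) (A e₂)‖ ^ 2 ≠ 0 := by positivity
  have key := normSq_crossL_smul (A e₁) (A e₂) v
  rw [hv, hv] at key
  simp only [zero_mul, sub_zero, zero_smul, zero_add] at key
  have hc0 : c ≠ 0 := by rintro rfl; rw [zero_smul] at hN; simp [hN] at hN1
  obtain ⟨t, rfl⟩ : ∃ t : ℝ, v = t • N := by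
    refine ⟨(‖crossL (A e₁) (A e₂)‖ ^ 2)⁻¹ * inner ℝ (crossL (A e₁) (A e₂)) v * c⁻¹, ?_⟩
    rw [hN, smul_smul, mul_assoc, inv_mul_cancel₀ hc0, mul_one, mul_smul, ← key, smul_smul,
      inv_mul_cancel₀ hn, one_smul]
  rw [norm_smul, hN1, mul_one, Real.norm_eq_abs] at hv1
  rcases eq_or_eq_neg_of_abs_eq hv1 with h | h
  · left; rw [h, one_smul]
  · right; rw [h, neg_one_smul]

/-- The rotation that carries the frame of one immersion to that of an isometric one. -/
theorem rotation_mem_SO3 {A G : E2 →L[ℝ] E3} {N : E3} {c : ℝ} {L : E3 →L[ℝ] E2} {s : E3 →L[ℝ] ℝ}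
    (hG : ∀ ξ η, inner ℝ (G ξ) (G η) = inner ℝ (A ξ) (A η))
    (hN : N = c • crossL (A e₁) (A e₂)) (hN1 : ‖N‖ = 1) (hL : ∀ ξ, L (A ξ) = ξ)
    (hid : ∀ v, A (L v) + s v • N = v) :
    let R := G.comp L + s.smulRight (c • crossL (G e₁) (G e₂))
    R ∈ SO3 ∧ (∀ ξ, R (A ξ) = G ξ) ∧ R N = c • crossL (G e₁) (G e₂) := by
  intro R
  set ν := c • crossL (G e₁) (G e₂) with hν
  have hAN : ∀ ξ, inner ℝ (A ξ) N = 0 := fun ξ => by rw [hN, inner_smul_right, inner_map_crossL, mul_zero]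
  have hGν : ∀ ξ, inner ℝ (G ξ) ν = 0 := fun ξ => by rw [hν, inner_smul_right, inner_map_crossL, mul_zero]
  have hnn : ‖crossL (G e₁) (G e₂)‖ ^ 2 = ‖crossL (A e₁) (A e₂)‖ ^ 2 := by
    rw [norm_crossL_sq, norm_crossL_sq, hG, ← real_inner_self_eq_norm_sq,
      ← real_inner_self_eq_norm_sq, hG, hG, real_inner_self_eq_norm_sq, real_inner_self_eq_norm_sq]
  have hν2 : ‖ν‖ ^ 2 = 1 := by
    rw [hν, norm_smul, mul_pow, hnn, ← mul_pow, ← norm_smul, ← hN, hN1, one_pow]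
  -- The decomposition `hid` is orthogonal, so its last coordinate is the component along the unit
  -- vector `N`.
  have hs : ∀ v, s v = inner ℝ v N := by
    intro v
    conv_rhs => rw [← hid v]
    rw [inner_add_left, hAN, inner_smul_left, real_inner_self_eq_norm_sq, hN1]
    simp
  have hRA : ∀ ξ, R (A ξ) = G ξ := by
    intro ξ
    simp [R, hL, hs, hAN]
  have hNN : inner ℝ N N = (1 : ℝ) := by rw [real_inner_self_eq_norm_sq, hN1, one_pow]
  have hLN : L N = 0 := by
    have h1 := hid N
    rw [hs, hNN, one_smul, add_eq_right] at h1
    have := hL (L N)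
    rw [h1, map_zero] at this
    exact this.symm
  have hRN : R N = ν := by
    simp [R, hLN, hs, hN1, hν]
  have hnorm : ∀ v, ‖R v‖ = ‖v‖ := by
    intro v
    have hRv : R v = G (L v) + s v • ν := rfl
    rw [← sq_eq_sq₀ (norm_nonneg _) (norm_nonneg _), hRv]
    conv_rhs => rw [← hid v]
    rw [norm_add_sq_real, norm_add_sq_real, inner_smul_right (G (L v)) ν (s v), inner_smul_right (A (L v)) N (s v), hGν, hAN,
      norm_smul (s v) ν, norm_smul (s v) N, mul_pow, mul_pow, hν2, hN1, ← real_inner_self_eq_norm_sq, hG,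
      real_inner_self_eq_norm_sq]
    ring
  refine ⟨⟨hnorm, ?_⟩, hRA, hRN⟩
  -- The determinant is read off from the triple product of the frame. Using the same factor `c` for
  -- `N` and for the image normal makes both frames equally oriented, whence determinant 1 and not
  -- -1.
  have hdet := inner_crossL_map R (A e₁) (A e₂) N
  rw [hRA, hRA, hRN, hν, hN, inner_smul_right, inner_smul_right, real_inner_self_eq_norm_sq,
    real_inner_self_eq_norm_sq, hnn] at hdet
  have hc0 : c * ‖crossL (A e₁) (A e₂)‖ ^ 2 ≠ 0 := by
    intro h0
    rcases mul_eq_zero.1 h0 with h0 | h0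
    · rw [hN, h0, zero_smul] at hN1; simp at hN1
    · rw [sq_eq_zero_iff, norm_eq_zero] at h0
      rw [hN, h0, smul_zero] at hN1; simp at hN1
  have := mul_right_cancel₀ hc0 ((one_mul _).trans hdet)
  exact this.symm

end Rotations

/-! ### Construction of tubular coordinates. -/

section Tubes

variable {M S : Set E3} {n : E3 → E3} {V : Set E2} {X : E2 → E3}

/-- The cross product of the coordinate tangent vectors of a parametrization. -/
noncomputable def chartCross (X : E2 → E3) (y : E2) : E3 :=
  crossL (fderiv ℝ X y e₁) (fderiv ℝ X y e₂)

namespace IsC2Chart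

theorem contDiffOn_fderiv (h : IsC2Chart M V X) : ContDiffOn ℝ 1 (fderiv ℝ X) V :=
  h.contDiffOn.fderiv_of_isOpen h.isOpen_source (by norm_num)

theorem contDiffOn_chartCross (h : IsC2Chart M V X) : ContDiffOn ℝ 1 (chartCross X) V := by
  have h1 : ContDiffOn ℝ 1 (fun y => fderiv ℝ X y e₁) V := h.contDiffOn_fderiv.clm_apply contDiffOn_const
  have h2 : ContDiffOn ℝ 1 (fun y => fderiv ℝ X y e₂) V := h.contDiffOn_fderiv.clm_apply contDiffOn_const
  exact (crossL.contDiff.comp_contDiffOn h1).clm_apply h2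

theorem chartCross_ne_zero (h : IsC2Chart M V X) {y : E2} (hy : y ∈ V) : chartCross X y ≠ 0 :=
  crossL_ne_zero_of_injective (h.immersion y hy)

theorem injOn (h : IsC2Chart M V X) : Set.InjOn X V :=
  Set.injOn_iff_injective.2 h.isEmbedding.injective

theorem mapsTo (h : IsC2Chart M V X) : Set.MapsTo X V M := by
  obtain ⟨U, -, hU⟩ := h.isOpen_image
  intro y hy
  exact (hU.subset ⟨y, hy, rfl⟩).1

/-- Charts are open maps onto the surface: points of `M` near a chart point come from nearby
parameters. -/
theorem image_eq_inter (h : IsC2Chart M V X) {B : Set E2} (hB : IsOpen B) (hBV : B ⊆ V) :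
    ∃ U : Set E3, IsOpen U ∧ X '' B = M ∩ U := by
  obtain ⟨U₀, hU₀, hV⟩ := h.isOpen_image
  have hB' : IsOpen ((↑) ⁻¹' B : Set V) := hB.preimage continuous_subtype_val
  rw [h.isEmbedding.isInducing.isOpen_iff] at hB'
  obtain ⟨U₁, hU₁, hB₁⟩ := hB'
  have key : ∀ y ∈ V, X y ∈ U₁ ↔ y ∈ B := by
    intro y hy
    have := Set.ext_iff.1 hB₁ ⟨y, hy⟩
    simpa using this
  refine ⟨U₀ ∩ U₁, hU₀.inter hU₁, ?_⟩
  ext p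
  constructor
  · rintro ⟨y, hy, rfl⟩
    have := hV.subset ⟨y, hBV hy, rfl⟩
    exact ⟨this.1, this.2, (key y (hBV hy)).2 hy⟩
  · rintro ⟨hpM, hp0, hp1⟩
    obtain ⟨y, hy, rfl⟩ := hV.superset ⟨hpM, hp0⟩
    exact ⟨y, (key y hy).1 hp1, rfl⟩

end IsC2Chart

/-- Tubular coordinates `(y, s) ↦ X y + s N(y)` of `ℝ³` around a point of the surface, with
`N = n ∘ X` on the part of the coordinate ball that parametrizes the closure of `S`. -/
structure Tube (M S : Set E3) (n : E3 → E3) where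
  V : Set E2
  X : E2 → E3
  y₀ : E2
  δ : ℝ
  c : E2 → ℝ
  P : E3 → E2
  t : E3 → ℝ
  K : ℝ≥0
  chart : IsC2Chart M V X
  δ_pos : 0 < δ
  closedBall_subset : Metric.closedBall y₀ δ ⊆ V
  contDiffOn_c : ContDiffOn ℝ 1 c (Metric.ball y₀ δ)
  norm_N : ∀ y ∈ Metric.ball y₀ δ, ‖c y • chartCross X y‖ = 1
  n_eq : ∀ y ∈ Metric.ball y₀ δ, X y ∈ closure S → n (X y) = c y • chartCross X y
  isOpen_image : ∀ O ⊆ Metric.ball y₀ δ ×ˢ Metric.ball (0 : ℝ) δ, IsOpen O →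
    IsOpen ((fun q : E2 × ℝ => X q.1 + q.2 • c q.1 • chartCross X q.1) '' O)
  contDiffOn_P : ContDiffOn ℝ 1 P ((fun q : E2 × ℝ => X q.1 + q.2 • c q.1 • chartCross X q.1) ''
    (Metric.ball y₀ δ ×ˢ Metric.ball (0 : ℝ) δ))
  contDiffOn_t : ContDiffOn ℝ 1 t ((fun q : E2 × ℝ => X q.1 + q.2 • c q.1 • chartCross X q.1) ''
    (Metric.ball y₀ δ ×ˢ Metric.ball (0 : ℝ) δ))
  left_inv : ∀ y ∈ Metric.ball y₀ δ, ∀ s ∈ Metric.ball (0 : ℝ) δ,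
    P (X y + s • c y • chartCross X y) = y ∧ t (X y + s • c y • chartCross X y) = s
  lipschitzOn : LipschitzOnWith K (fun q : E2 × ℝ => X q.1 + q.2 • c q.1 • chartCross X q.1)
    (Metric.ball y₀ δ ×ˢ Metric.ball (0 : ℝ) δ)
  lipschitzOn_inv : LipschitzOnWith K (fun z => (P z, t z))
    ((fun q : E2 × ℝ => X q.1 + q.2 • c q.1 • chartCross X q.1) ''
      (Metric.ball y₀ δ ×ˢ Metric.ball (0 : ℝ) δ))
  lipschitzOn_fderiv : LipschitzOnWith K (fderiv ℝ X) (Metric.ball y₀ δ)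
  lipschitzOn_N : LipschitzOnWith K (fun y => c y • chartCross X y) (Metric.ball y₀ δ)
  lipschitzOn_c : LipschitzOnWith K c (Metric.ball y₀ δ)
  abs_c_le : ∀ y ∈ Metric.ball y₀ δ, |c y| ≤ K

/-- As `X` is C², its unit normal and the tubular map are C¹. At `(y₀, 0)` the differential is that
of `X` plus the normal direction, which is injective and hence bijective by dimension, so the
inverse function theorem applies. The given normal `n` equals `N` up to sign at each point; the sign
is fixed at `y₀`, and continuity keeps it nearby. -/
theorem exists_tube (hn : IsUnitNormal M S n) (hX : IsC2Chart M V X) {y₀ : E2} (hy₀ : y₀ ∈ V)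
    (hS : X y₀ ∈ closure S) {V' : Set E2} (hV' : V' ∈ 𝓝 y₀) :
    ∃ T : Tube M S n, T.V = V ∧ T.X = X ∧ T.y₀ = y₀ ∧ Metric.ball y₀ T.δ ⊆ V' := by
  have hVn : V ∈ 𝓝 y₀ := hX.isOpen_source.mem_nhds hy₀
  have hcross : ContDiffAt ℝ 1 (chartCross X) y₀ := hX.contDiffOn_chartCross.contDiffAt hVn
  -- the choice of the sign
  obtain ⟨σ, hσ1, hσ⟩ : ∃ σ : ℝ, |σ| = 1 ∧
      n (X y₀) = (σ * ‖chartCross X y₀‖⁻¹) • chartCross X y₀ := by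
    have h1 : ‖‖chartCross X y₀‖⁻¹ • chartCross X y₀‖ = 1 := by
      rw [norm_smul, norm_inv, norm_norm, inv_mul_cancel₀ (norm_ne_zero_iff.2 (hX.chartCross_ne_zero hy₀))]
    rcases eq_or_eq_neg_of_orthogonal (A := fderiv ℝ X y₀) (c := ‖chartCross X y₀‖⁻¹) rfl h1
      (hn.norm_eq_one _ hS) (hn.orthogonal V X hX y₀ hy₀ hS) with h | h
    · exact ⟨1, by simp, by rw [h, one_mul]; rfl⟩
    · exact ⟨-1, by simp, by rw [h, neg_one_mul, neg_smul]; rfl⟩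
  set c : E2 → ℝ := fun y => σ * ‖chartCross X y‖⁻¹ with hc
  set N : E2 → E3 := fun y => c y • chartCross X y with hN
  have hcV : ContDiffOn ℝ 1 c V := contDiffOn_const.mul
    ((hX.contDiffOn_chartCross.norm ℝ fun y hy => hX.chartCross_ne_zero hy).inv
      fun y hy => norm_ne_zero_iff.2 (hX.chartCross_ne_zero hy))
  have hNV : ContDiffOn ℝ 1 N V := hcV.smul hX.contDiffOn_chartCross
  have hN1 : ∀ y ∈ V, ‖N y‖ = 1 := by
    intro y hy
    rw [hN, norm_smul, norm_mul, Real.norm_eq_abs, hσ1, one_mul, norm_inv, norm_norm,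
      inv_mul_cancel₀ (norm_ne_zero_iff.2 (hX.chartCross_ne_zero hy))]
  have hcat := hcV.contDiffAt hVn
  have hNat := hNV.contDiffAt hVn
  have hXat : ContDiffAt ℝ 1 X y₀ := (hX.contDiffOn.contDiffAt hVn).of_le (by norm_num)
  -- `N` agrees with the given normal near the base point
  have hnN : ∀ᶠ y in 𝓝 y₀, X y ∈ closure S → n (X y) = N y := by
    have h1 : ∀ᶠ y in 𝓝[X ⁻¹' closure S] y₀, ‖n (X y) - N y‖ < 1 := by
      have h2 : Tendsto (fun y => n (X y)) (𝓝[X ⁻¹' closure S] y₀) (𝓝 (n (X y₀))) := by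
        refine (hn.continuousOn (X y₀) hS).tendsto.comp ?_
        exact tendsto_nhdsWithin_iff.2 ⟨hXat.continuousAt.tendsto.mono_left nhdsWithin_le_nhds,
          eventually_mem_nhdsWithin⟩
      have h3 := (h2.sub (hNat.continuousAt.tendsto.mono_left nhdsWithin_le_nhds)).norm
      rw [hσ, show (σ * ‖chartCross X y₀‖⁻¹) • chartCross X y₀ = N y₀ from rfl, sub_self,
        norm_zero] at h3
      exact h3.eventually_lt_const one_pos
    rw [eventually_nhdsWithin_iff] at h1
    filter_upwards [h1, hVn] with y hy hyV hyS
    rcases eq_or_eq_neg_of_orthogonal (A := fderiv ℝ X y) (c := c y) rfl (hN1 y hyV)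
      (hn.norm_eq_one _ hyS) (hn.orthogonal V X hX y hyV hyS) with h | h
    · exact h
    · exfalso
      have h4 := hy hyS
      rw [h] at h4
      have h5 : (-c y • crossL (fderiv ℝ X y e₁) (fderiv ℝ X y e₂) - N y) = (-2 : ℝ) • N y := by
        rw [hN]; simp only [chartCross]; module
      have h6 : -(c y • crossL (fderiv ℝ X y e₁) (fderiv ℝ X y e₂)) - N y = (-2 : ℝ) • N y := by
        rw [← h5, neg_smul]
      rw [h6, norm_smul, hN1 y hyV] at h4
      norm_num at h4
  -- the tubular map
  set Φ : E2 × ℝ → E3 := fun q => X q.1 + q.2 • N q.1 with hΦ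
  have hΦat : ContDiffAt ℝ 1 Φ (y₀, 0) :=
    (hXat.comp (y₀, (0:ℝ)) contDiffAt_fst).add
      (contDiffAt_snd.smul (ContDiffAt.comp (y₀, (0:ℝ)) (g := N) hNat contDiffAt_fst))
  let A : E2 × ℝ →L[ℝ] E3 := (fderiv ℝ X y₀).comp (ContinuousLinearMap.fst ℝ E2 ℝ) +
    (ContinuousLinearMap.snd ℝ E2 ℝ).smulRight (N y₀)
  have hΦd : HasFDerivAt Φ A (y₀, 0) := by
    have h1 : HasFDerivAt (fun q : E2 × ℝ => X q.1)
        ((fderiv ℝ X y₀).comp (ContinuousLinearMap.fst ℝ E2 ℝ)) (y₀, 0) :=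
      HasFDerivAt.comp (y₀, (0:ℝ)) (g := X) ((hXat.differentiableAt (by simp)).hasFDerivAt) hasFDerivAt_fst
    have h2 : HasFDerivAt (fun q : E2 × ℝ => N q.1)
        ((fderiv ℝ N y₀).comp (ContinuousLinearMap.fst ℝ E2 ℝ)) (y₀, 0) :=
      HasFDerivAt.comp (y₀, (0:ℝ)) (g := N) ((hNat.differentiableAt (by simp)).hasFDerivAt) hasFDerivAt_fst
    have hsnd : HasFDerivAt (fun q : E2 × ℝ => q.2) (ContinuousLinearMap.snd ℝ E2 ℝ) (y₀, 0) :=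
      hasFDerivAt_snd
    have h3 := h1.add (hsnd.smul h2)
    refine h3.congr_fderiv (ContinuousLinearMap.ext fun v => ?_)
    simp [A]
  have hAinj : Function.Injective A := by
    rw [injective_iff_map_eq_zero]
    rintro ⟨ξ, s⟩ h
    have h0 : fderiv ℝ X y₀ ξ + s • N y₀ = 0 := by simpa [A] using h
    have hs : s = 0 := by
      have h1 := congrArg (fun v => inner ℝ v (N y₀)) h0
      have h2 : inner ℝ (fderiv ℝ X y₀ ξ) (N y₀) = 0 := by
        rw [hN, inner_smul_right]; simp only [chartCross]; rw [inner_map_crossL, mul_zero]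
      simpa [inner_add_left, h2, inner_smul_left, hN1 y₀ hy₀] using h1
    rw [hs, zero_smul, add_zero] at h0
    have := hX.immersion y₀ hy₀ (h0.trans (map_zero _).symm)
    rw [this, hs]; rfl
  let Ae : (E2 × ℝ) ≃L[ℝ] E3 :=
    (LinearEquiv.ofInjectiveOfFinrankEq A.toLinearMap hAinj finrank_E2_prod_real).toContinuousLinearEquiv
  have hAe : (Ae : E2 × ℝ →L[ℝ] E3) = A :=
    ContinuousLinearMap.ext fun v => rfl
  rw [← hAe] at hΦd
  let h := hΦat.toOpenPartialHomeomorph Φ hΦd one_ne_zero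
  have hsrc : (y₀, (0:ℝ)) ∈ h.source := hΦat.mem_toOpenPartialHomeomorph_source hΦd one_ne_zero
  have hh : ∀ q, h q = Φ q := fun q => rfl
  have hΨ : ContDiffAt ℝ 1 h.symm (Φ (y₀, 0)) := hΦat.to_localInverse hΦd one_ne_zero
  obtain ⟨K₁, t₁, ht₁, hK₁⟩ := hΦat.exists_lipschitzOnWith
  obtain ⟨K₂, t₂, ht₂, hK₂⟩ := hΨ.exists_lipschitzOnWith
  obtain ⟨K₃, t₃, ht₃, hK₃⟩ := (hX.contDiffOn_fderiv.contDiffAt hVn).exists_lipschitzOnWith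
  obtain ⟨K₄, t₄, ht₄, hK₄⟩ := hNat.exists_lipschitzOnWith
  obtain ⟨K₅, t₅, ht₅, hK₅⟩ := hcat.exists_lipschitzOnWith
  have ev1 : ∀ᶠ q in 𝓝 (y₀, (0:ℝ)), q ∈ h.source ∧ q ∈ t₁ ∧ Φ q ∈ t₂ ∧ ContDiffAt ℝ 1 h.symm (Φ q) := by
    refine (h.open_source.eventually_mem hsrc).and (Filter.Eventually.and ht₁ (Filter.Eventually.and
      (hΦat.continuousAt.eventually ht₂) (hΦat.continuousAt.eventually (hΨ.eventually (by simp)))))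
  have ev2 : ∀ᶠ y in 𝓝 y₀, y ∈ V ∧ y ∈ V' ∧ y ∈ t₃ ∧ y ∈ t₄ ∧ y ∈ t₅ ∧ |c y| < |c y₀| + 1 ∧
      (X y ∈ closure S → n (X y) = N y) := by
    refine Filter.Eventually.and hVn (Filter.Eventually.and hV' (Filter.Eventually.and ht₃
      (Filter.Eventually.and ht₄ (Filter.Eventually.and ht₅ (Filter.Eventually.and ?_ hnN)))))
    exact hcat.continuousAt.abs.eventually_lt_const (lt_add_one _)
  obtain ⟨δ₁, hδ₁, hb₁⟩ := Metric.eventually_nhds_iff_ball.1 ev1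
  obtain ⟨δ₂, hδ₂, hb₂⟩ := Metric.eventually_nhds_iff_ball.1 ev2
  -- Halving `δ₂` keeps even the closed coordinate ball inside the chart. This compactness gives
  -- square integrability up to the boundary of `S`.
  set δ := min δ₁ (δ₂ / 2) with hδdef
  have hδ : 0 < δ := lt_min hδ₁ (half_pos hδ₂)
  have hδδ₂ : δ < δ₂ := (min_le_right _ _).trans_lt (half_lt_self hδ₂)
  have hbb₁ : Metric.ball y₀ δ ×ˢ Metric.ball (0 : ℝ) δ ⊆ Metric.ball (y₀, (0:ℝ)) δ₁ := by
    rw [ball_prod_same]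
    exact Metric.ball_subset_ball (min_le_left _ _)
  have hbb₂ : Metric.ball y₀ δ ⊆ Metric.ball y₀ δ₂ := Metric.ball_subset_ball hδδ₂.le
  obtain ⟨m, hm⟩ : ∃ m : ℝ≥0, |c y₀| + 1 ≤ m := ⟨⟨|c y₀| + 1, by positivity⟩, le_rfl⟩
  obtain ⟨K, hk1, hk2, hk3, hk4, hk5, hk6⟩ : ∃ K : ℝ≥0, K₁ ≤ K ∧ K₂ ≤ K ∧ K₃ ≤ K ∧ K₄ ≤ K ∧
      K₅ ≤ K ∧ m ≤ K :=
    ⟨max K₁ (max K₂ (max K₃ (max K₄ (max K₅ m)))), by simp, by simp, by simp, by simp, by simp,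
      by simp⟩
  replace hk6 : |c y₀| + 1 ≤ K := hm.trans (by exact_mod_cast hk6)
  have hsymm : ∀ q ∈ Metric.ball y₀ δ ×ˢ Metric.ball (0 : ℝ) δ, h.symm (Φ q) = q := fun q hq =>
    h.left_inv (hb₁ q (hbb₁ hq)).1
  have hopen : ∀ O ⊆ Metric.ball y₀ δ ×ˢ Metric.ball (0 : ℝ) δ, IsOpen O → IsOpen (Φ '' O) :=
    fun O hO hOo => h.isOpen_image_of_subset_source hOo fun q hq => (hb₁ q (hbb₁ (hO hq))).1
  have hW : IsOpen (Φ '' (Metric.ball y₀ δ ×ˢ Metric.ball (0 : ℝ) δ)) :=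
    hopen _ le_rfl (Metric.isOpen_ball.prod Metric.isOpen_ball)
  refine ⟨{
    V := V, X := X, y₀ := y₀, δ := δ, c := c, P := fun z => (h.symm z).1, t := fun z => (h.symm z).2,
    K := K
    chart := hX
    δ_pos := hδ
    closedBall_subset := fun y hy => (hb₂ y (Metric.closedBall_subset_ball hδδ₂ hy)).1
    contDiffOn_c := hcV.mono fun y hy => (hb₂ y (hbb₂ hy)).1
    norm_N := fun y hy => hN1 y (hb₂ y (hbb₂ hy)).1
    n_eq := fun y hy => (hb₂ y (hbb₂ hy)).2.2.2.2.2.2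
    isOpen_image := hopen
    contDiffOn_P := ?_
    contDiffOn_t := ?_
    left_inv := fun y hy s hs => by
      have := hsymm (y, s) ⟨hy, hs⟩
      exact ⟨congrArg Prod.fst this, congrArg Prod.snd this⟩
    lipschitzOn := (hK₁.mono fun q hq => (hb₁ q (hbb₁ hq)).2.1).weaken hk1
    lipschitzOn_inv := (hK₂.mono (by
      rintro _ ⟨q, hq, rfl⟩; exact (hb₁ q (hbb₁ hq)).2.2.1)).weaken hk2
    lipschitzOn_fderiv := (hK₃.mono fun y hy => (hb₂ y (hbb₂ hy)).2.2.1).weaken hk3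
    lipschitzOn_N := (hK₄.mono fun y hy => (hb₂ y (hbb₂ hy)).2.2.2.1).weaken hk4
    lipschitzOn_c := (hK₅.mono fun y hy => (hb₂ y (hbb₂ hy)).2.2.2.2.1).weaken hk5
    abs_c_le := fun y hy => (hb₂ y (hbb₂ hy)).2.2.2.2.2.1.le.trans hk6 }, rfl, rfl, rfl,
    fun y hy => (hb₂ y (hbb₂ hy)).2.1⟩
  · rintro _ ⟨q, hq, rfl⟩
    exact (contDiffAt_fst.comp _ (hb₁ q (hbb₁ hq)).2.2.2).contDiffWithinAt
  · rintro _ ⟨q, hq, rfl⟩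
    exact (contDiffAt_snd.comp _ (hb₁ q (hbb₁ hq)).2.2.2).contDiffWithinAt

namespace Tube

variable (T : Tube M S n)

/-- The coordinate ball. -/
abbrev B : Set E2 := Metric.ball T.y₀ T.δ

/-- The unit normal in coordinates. -/
noncomputable def N (y : E2) : E3 := T.c y • chartCross T.X y

/-- The tubular map. -/
noncomputable def Φ (q : E2 × ℝ) : E3 := T.X q.1 + q.2 • T.N q.1

/-- The region of space covered by the tubular map. -/
def W : Set E3 := T.Φ '' (T.B ×ˢ Metric.ball (0 : ℝ) T.δ)

/-- The part of the coordinate ball that parametrizes `S`. -/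
def D : Set E2 := T.B ∩ T.X ⁻¹' S

variable {T}

theorem B_subset : T.B ⊆ T.V := Metric.ball_subset_closedBall.trans T.closedBall_subset

theorem D_subset : T.D ⊆ T.V ∩ T.X ⁻¹' S := Set.inter_subset_inter_left _ B_subset

theorem contDiffOn_N : ContDiffOn ℝ 1 T.N T.B :=
  T.contDiffOn_c.smul (T.chart.contDiffOn_chartCross.mono B_subset)

theorem contDiffOn_X : ContDiffOn ℝ 1 T.X T.B := (T.chart.contDiffOn.mono B_subset).of_le (by norm_num)

theorem contDiffOn_fderiv : ContDiffOn ℝ 1 (fderiv ℝ T.X) T.B := T.chart.contDiffOn_fderiv.mono B_subset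

theorem isOpen_W : IsOpen T.W := T.isOpen_image _ le_rfl (Metric.isOpen_ball.prod Metric.isOpen_ball)

theorem P_Φ {y : E2} (hy : y ∈ T.B) {s : ℝ} (hs : |s| < T.δ) : T.P (T.Φ (y, s)) = y :=
  (T.left_inv y hy s (by simpa using hs)).1

theorem t_Φ {y : E2} (hy : y ∈ T.B) {s : ℝ} (hs : |s| < T.δ) : T.t (T.Φ (y, s)) = s :=
  (T.left_inv y hy s (by simpa using hs)).2

theorem Φ_mem_W {y : E2} (hy : y ∈ T.B) {s : ℝ} (hs : |s| < T.δ) : T.Φ (y, s) ∈ T.W :=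
  ⟨(y, s), ⟨hy, by simpa using hs⟩, rfl⟩

theorem exists_of_mem_W {z : E3} (hz : z ∈ T.W) : ∃ y ∈ T.B, ∃ s, |s| < T.δ ∧ z = T.Φ (y, s) := by
  obtain ⟨⟨y, s⟩, ⟨hy, hs⟩, rfl⟩ := hz
  exact ⟨y, hy, s, by simpa using hs, rfl⟩

theorem P_mem {z : E3} (hz : z ∈ T.W) : T.P z ∈ T.B := by
  obtain ⟨y, hy, s, hs, rfl⟩ := exists_of_mem_W hz
  rwa [P_Φ hy hs]

theorem Φ_P_t {z : E3} (hz : z ∈ T.W) : T.Φ (T.P z, T.t z) = z := by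
  obtain ⟨y, hy, s, hs, rfl⟩ := exists_of_mem_W hz
  rw [P_Φ hy hs, t_Φ hy hs]

theorem abs_t_lt {z : E3} (hz : z ∈ T.W) : |T.t z| < T.δ := by
  obtain ⟨y, hy, s, hs, rfl⟩ := exists_of_mem_W hz
  rwa [t_Φ hy hs]

theorem contDiffOn_P' : ContDiffOn ℝ 1 T.P T.W := T.contDiffOn_P
theorem contDiffOn_t' : ContDiffOn ℝ 1 T.t T.W := T.contDiffOn_t

theorem norm_N_eq_one {y : E2} (hy : y ∈ T.B) : ‖T.N y‖ = 1 := T.norm_N y hy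

theorem Φ_zero (y : E2) : T.Φ (y, 0) = T.X y := by simp [Φ]

end Tube

end Tubes

/-! ### Differential and volume estimates in tubular coordinates. -/

section TubeCalculus

variable {M S : Set E3} {n : E3 → E3}

namespace Tube

variable {T : Tube M S n}

theorem isOpen_B : IsOpen T.B := Metric.isOpen_ball

theorem hasFDerivAt_X {y : E2} (hy : y ∈ T.B) : HasFDerivAt T.X (fderiv ℝ T.X y) y :=
  ((contDiffOn_X.contDiffAt (isOpen_B.mem_nhds hy)).differentiableAt (by simp)).hasFDerivAt

theorem hasFDerivAt_N {y : E2} (hy : y ∈ T.B) : HasFDerivAt T.N (fderiv ℝ T.N y) y :=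
  ((contDiffOn_N.contDiffAt (isOpen_B.mem_nhds hy)).differentiableAt (by simp)).hasFDerivAt

theorem hasFDerivAt_P {z : E3} (hz : z ∈ T.W) : HasFDerivAt T.P (fderiv ℝ T.P z) z :=
  ((contDiffOn_P'.contDiffAt (isOpen_W.mem_nhds hz)).differentiableAt (by simp)).hasFDerivAt

theorem hasFDerivAt_t {z : E3} (hz : z ∈ T.W) : HasFDerivAt T.t (fderiv ℝ T.t z) z :=
  ((contDiffOn_t'.contDiffAt (isOpen_W.mem_nhds hz)).differentiableAt (by simp)).hasFDerivAt

theorem X_mem_W {y : E2} (hy : y ∈ T.B) : T.X y ∈ T.W := by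
  rw [← T.Φ_zero]; exact Φ_mem_W hy (by simpa using T.δ_pos)

theorem P_X {y : E2} (hy : y ∈ T.B) : T.P (T.X y) = y := by
  rw [← T.Φ_zero]; exact P_Φ hy (by simpa using T.δ_pos)

theorem t_X {y : E2} (hy : y ∈ T.B) : T.t (T.X y) = 0 := by
  rw [← T.Φ_zero]; exact t_Φ hy (by simpa using T.δ_pos)

/-- The derivative of the identity in tubular coordinates. -/
theorem fderiv_decomp {z : E3} (hz : z ∈ T.W) (v : E3) :
    fderiv ℝ T.X (T.P z) (fderiv ℝ T.P z v) + fderiv ℝ T.t z v • T.N (T.P z) +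
      T.t z • fderiv ℝ T.N (T.P z) (fderiv ℝ T.P z v) = v := by
  have hy := P_mem hz
  have h1 : HasFDerivAt (fun z => T.X (T.P z)) _ z := (hasFDerivAt_X hy).comp z (hasFDerivAt_P hz)
  have h2 : HasFDerivAt (fun z => T.N (T.P z)) _ z := (hasFDerivAt_N hy).comp z (hasFDerivAt_P hz)
  have h3 := h1.add ((hasFDerivAt_t hz).smul h2)
  have h4 : HasFDerivAt (fun z : E3 => z) (ContinuousLinearMap.id ℝ E3) z := hasFDerivAt_id z
  have h5 : (fun z => T.X (T.P z) + T.t z • T.N (T.P z)) =ᶠ[𝓝 z] fun z => z := by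
    filter_upwards [isOpen_W.mem_nhds hz] with w hw using Φ_P_t hw
  have h6 := (h4.congr_of_eventuallyEq h5).unique h3
  have h7 := congrArg (fun A : E3 →L[ℝ] E3 => A v) h6
  simp only [ContinuousLinearMap.id_apply] at h7
  refine Eq.trans ?_ h7.symm
  simp
  abel

/-- Differentiation of P(Φ(y, s)) = y along the parallel surface at height `s`. -/
theorem fderiv_P_surj {y : E2} (hy : y ∈ T.B) {s : ℝ} (hs : |s| < T.δ) (ξ : E2) :
    fderiv ℝ T.P (T.Φ (y, s)) (fderiv ℝ T.X y ξ + s • fderiv ℝ T.N y ξ) = ξ := by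
  have h1 : HasFDerivAt (fun y => T.X y + s • T.N y) (fderiv ℝ T.X y + s • fderiv ℝ T.N y) y :=
    (hasFDerivAt_X hy).add ((hasFDerivAt_N hy).const_smul s)
  have h2 : HasFDerivAt (fun y => T.P (T.X y + s • T.N y)) _ y :=
    HasFDerivAt.comp y (g := T.P) (hasFDerivAt_P (Φ_mem_W hy hs)) h1
  have h4 : HasFDerivAt (fun y : E2 => y) (ContinuousLinearMap.id ℝ E2) y := hasFDerivAt_id y
  have h5 : (fun y => T.P (T.X y + s • T.N y)) =ᶠ[𝓝 y] fun y => y := by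
    filter_upwards [isOpen_B.mem_nhds hy] with w hw using P_Φ hw hs
  have h6 := (h4.congr_of_eventuallyEq h5).unique h2
  exact (congrArg (fun A : E2 →L[ℝ] E2 => A ξ) h6).symm

theorem fderiv_P_fderiv_X {y : E2} (hy : y ∈ T.B) (ξ : E2) :
    fderiv ℝ T.P (T.X y) (fderiv ℝ T.X y ξ) = ξ := by
  have := fderiv_P_surj hy (s := 0) (by simpa using T.δ_pos) ξ
  rwa [zero_smul, add_zero, Φ_zero] at this

theorem fderiv_decomp_X {y : E2} (hy : y ∈ T.B) (v : E3) :
    fderiv ℝ T.X y (fderiv ℝ T.P (T.X y) v) + fderiv ℝ T.t (T.X y) v • T.N y = v := by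
  have := fderiv_decomp (X_mem_W hy) v
  rwa [P_X hy, t_X hy, zero_smul, add_zero] at this

theorem lipschitzOn_P : LipschitzOnWith T.K T.P T.W := fun _ hx _ hy =>
  (le_max_left _ _).trans (T.lipschitzOn_inv hx hy)

theorem lipschitzOn_t : LipschitzOnWith T.K T.t T.W := fun _ hx _ hy =>
  (le_max_right _ _).trans (T.lipschitzOn_inv hx hy)

theorem lipschitzOn_Φ : LipschitzOnWith T.K T.Φ (T.B ×ˢ Metric.ball (0 : ℝ) T.δ) := T.lipschitzOn

theorem lipschitzOn_X : LipschitzOnWith T.K T.X T.B := by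
  intro x hx y hy
  have h0 : (0:ℝ) ∈ Metric.ball (0 : ℝ) T.δ := Metric.mem_ball_self T.δ_pos
  have := T.lipschitzOn_Φ (x := (x, 0)) ⟨hx, h0⟩ (y := (y, 0)) ⟨hy, h0⟩
  rw [Φ_zero, Φ_zero] at this
  refine this.trans ?_
  gcongr
  simp [Prod.edist_eq]

theorem norm_fderiv_P_le {z : E3} (hz : z ∈ T.W) : ‖fderiv ℝ T.P z‖ ≤ T.K :=
  norm_fderiv_le_of_lipschitzOn ℝ (isOpen_W.mem_nhds hz) lipschitzOn_P

theorem norm_fderiv_X_le {y : E2} (hy : y ∈ T.B) : ‖fderiv ℝ T.X y‖ ≤ T.K :=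
  norm_fderiv_le_of_lipschitzOn ℝ (isOpen_B.mem_nhds hy) lipschitzOn_X

theorem norm_fderiv_N_le {y : E2} (hy : y ∈ T.B) : ‖fderiv ℝ T.N y‖ ≤ T.K :=
  norm_fderiv_le_of_lipschitzOn ℝ (isOpen_B.mem_nhds hy) T.lipschitzOn_N

theorem norm_fderiv_c_le {y : E2} (hy : y ∈ T.B) : ‖fderiv ℝ T.c y‖ ≤ T.K :=
  norm_fderiv_le_of_lipschitzOn ℝ (isOpen_B.mem_nhds hy) T.lipschitzOn_c

theorem norm_sub_le_norm_X_sub {y y' : E2} (hy : y ∈ T.B) (hy' : y' ∈ T.B) :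
    ‖y - y'‖ ≤ T.K * ‖T.X y - T.X y'‖ := by
  have := lipschitzOn_P.norm_sub_le (X_mem_W hy) (X_mem_W hy')
  rwa [P_X hy, P_X hy'] at this

theorem inner_fderiv_X_N (y : E2) (ξ : E2) : inner ℝ (fderiv ℝ T.X y ξ) (T.N y) = 0 := by
  rw [N, inner_smul_right, chartCross, inner_map_crossL, mul_zero]

theorem norm_X_sub_sub_le {y y' : E2} (hy : y ∈ T.B) (hy' : y' ∈ T.B) :
    ‖T.X y' - T.X y - fderiv ℝ T.X y (y' - y)‖ ≤ T.K * ‖y' - y‖ ^ 2 := by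
  have hseg : segment ℝ y y' ⊆ T.B := (convex_ball _ _).segment_subset hy hy'
  have := (convex_segment y y').norm_image_sub_le_of_norm_hasFDerivWithin_le' (𝕜 := ℝ)
    (f := T.X) (f' := fderiv ℝ T.X) (φ := fderiv ℝ T.X y) (C := T.K * ‖y' - y‖)
    (fun x hx => (hasFDerivAt_X (hseg hx)).hasFDerivWithinAt) (fun x hx => ?_)
    (left_mem_segment ℝ y y') (right_mem_segment ℝ y y')
  · rw [sq, ← mul_assoc]; exact this
  · refine (T.lipschitzOn_fderiv.norm_sub_le (hseg hx) hy).trans ?_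
    gcongr
    obtain ⟨θ, ⟨h0, h1⟩, rfl⟩ := (segment_eq_image' ℝ y y') ▸ hx
    rw [add_sub_cancel_left, norm_smul, Real.norm_of_nonneg h0]
    exact mul_le_of_le_one_left (norm_nonneg _) h1

/-- A surface with Lipschitz tangent planes leaves each tangent plane only quadratically. This is
what makes nearby normal segments disjoint. -/
theorem abs_inner_X_sub_N_le {y y' : E2} (hy : y ∈ T.B) (hy' : y' ∈ T.B) :
    |inner ℝ (T.X y' - T.X y) (T.N y)| ≤ T.K ^ 3 * ‖T.X y' - T.X y‖ ^ 2 := by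
  have e : inner ℝ (T.X y' - T.X y) (T.N y) =
      inner ℝ (T.X y' - T.X y - fderiv ℝ T.X y (y' - y)) (T.N y) := by
    rw [inner_sub_left _ (fderiv ℝ T.X y (y' - y)), inner_fderiv_X_N, sub_zero]
  rw [e]
  calc _ ≤ ‖T.X y' - T.X y - fderiv ℝ T.X y (y' - y)‖ * ‖T.N y‖ := abs_real_inner_le_norm _ _
    _ ≤ T.K * ‖y' - y‖ ^ 2 := by rw [norm_N_eq_one hy, mul_one]; exact norm_X_sub_sub_le hy hy'
    _ ≤ T.K * (T.K * ‖T.X y' - T.X y‖) ^ 2 := by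
        gcongr; exact norm_sub_le_norm_X_sub hy' hy
    _ = _ := by ring

/-- Both the tubular map and its inverse are Lipschitz, so the volume of a product in coordinates is
comparable to that of its image. -/
theorem exists_volume_Φ_le (T : Tube M S n) : ∃ C : ℝ≥0, ∀ (A : Set E2) (J : Set ℝ), A ⊆ T.B →
    J ⊆ Metric.ball 0 T.δ → volume (T.Φ '' (A ×ˢ J)) ≤ C * (volume A * volume J) ∧
      volume A * volume J ≤ C * volume (T.Φ '' (A ×ˢ J)) := by
  have : (volume : Measure (E2 × ℝ)).IsAddHaarMeasure := by
    rw [Measure.volume_eq_prod]; infer_instance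
  obtain ⟨C₁, hC₁⟩ := exists_volume_image_le (E2 × ℝ) E3 finrank_E2_prod_real T.K
  obtain ⟨C₂, hC₂⟩ := exists_volume_image_le E3 (E2 × ℝ) finrank_E2_prod_real.symm T.K
  refine ⟨max C₁ C₂, fun A J hA hJ => ?_⟩
  have hsub := Set.prod_mono hA hJ
  have hv : volume (A ×ˢ J) = volume A * volume J := Measure.prod_prod A J
  constructor
  · rw [← hv]
    refine (hC₁ _ _ (T.lipschitzOn_Φ.mono hsub)).trans ?_
    gcongr
    exact le_max_left _ _
  · have h1 := hC₂ _ _ (T.lipschitzOn_inv.mono (Set.image_mono (f := T.Φ) hsub))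
    have h2 : (fun z => (T.P z, T.t z)) '' (T.Φ '' (A ×ˢ J)) = A ×ˢ J := by
      rw [← Set.image_comp]
      refine (Set.image_congr ?_).trans (Set.image_id _)
      rintro ⟨y, s⟩ h
      have hs : |s| < T.δ := by simpa using hJ h.2
      simp only [Function.comp, id]
      rw [P_Φ (hA h.1) hs, t_Φ (hA h.1) hs]
    rw [h2, hv] at h1
    refine h1.trans ?_
    gcongr
    exact le_max_right _ _

variable (T) in
/-- The part of the shell of thickness `h` over the coordinate ball. -/
def Ω (h : ℝ) : Set E3 := T.Φ '' (T.D ×ˢ Metric.ball (0 : ℝ) h)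

theorem isOpen_D (hS : ∃ U : Set E3, IsOpen U ∧ S = M ∩ U) : IsOpen T.D := by
  obtain ⟨U, hU, rfl⟩ := hS
  have : T.D = T.B ∩ T.X ⁻¹' U := by
    ext y
    exact ⟨fun h => ⟨h.1, h.2.2⟩, fun h => ⟨h.1, T.chart.mapsTo (B_subset h.1), h.2⟩⟩
  rw [this]
  exact contDiffOn_X.continuousOn.isOpen_inter_preimage isOpen_B hU

theorem D_subset_B : T.D ⊆ T.B := Set.inter_subset_left

theorem Ω_subset_W {h : ℝ} (h₁ : h ≤ T.δ) : T.Ω h ⊆ T.W :=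
  Set.image_mono (Set.prod_mono D_subset_B (Metric.ball_subset_ball h₁))

theorem isOpen_Ω (hS : ∃ U : Set E3, IsOpen U ∧ S = M ∩ U) {h : ℝ} (h₁ : h ≤ T.δ) :
    IsOpen (T.Ω h) :=
  T.isOpen_image _ (Set.prod_mono D_subset_B (Metric.ball_subset_ball h₁))
    ((isOpen_D hS).prod Metric.isOpen_ball)

theorem P_mem_D {h : ℝ} (h₁ : h ≤ T.δ) {z : E3} (hz : z ∈ T.Ω h) : T.P z ∈ T.D ∧ |T.t z| < h := by
  obtain ⟨⟨y, s⟩, ⟨hy, hs⟩, rfl⟩ := hz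
  have hs' : |s| < h := by simpa using hs
  rw [P_Φ (D_subset_B hy) (hs'.trans_le h₁), t_Φ (D_subset_B hy) (hs'.trans_le h₁)]
  exact ⟨hy, hs'⟩

theorem Ω_inter_preimage {h : ℝ} (h₁ : h ≤ T.δ) (A : Set E2) :
    T.Ω h ∩ T.P ⁻¹' A = T.Φ '' ((T.D ∩ A) ×ˢ Metric.ball (0 : ℝ) h) := by
  ext z
  constructor
  · rintro ⟨⟨⟨y, s⟩, ⟨hy, hs⟩, rfl⟩, hz⟩
    have hs' : |s| < h := by simpa using hs
    rw [Set.mem_preimage, P_Φ (D_subset_B hy) (hs'.trans_le h₁)] at hz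
    exact ⟨(y, s), ⟨⟨hy, hz⟩, hs⟩, rfl⟩
  · rintro ⟨⟨y, s⟩, ⟨hy, hs⟩, rfl⟩
    have hs' : |s| < h := by simpa using hs
    refine ⟨⟨(y, s), ⟨hy.1, hs⟩, rfl⟩, ?_⟩
    rw [Set.mem_preimage, P_Φ (D_subset_B hy.1) (hs'.trans_le h₁)]
    exact hy.2

theorem aemeasurable_P {h : ℝ} (hS : ∃ U : Set E3, IsOpen U ∧ S = M ∩ U) (h₁ : h ≤ T.δ) :
    AEMeasurable T.P (volume.restrict (T.Ω h)) :=
  (contDiffOn_P'.continuousOn.mono (Ω_subset_W h₁)).aemeasurable (isOpen_Ω hS h₁).measurableSet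

/-- Fibres of the projection have length `2 h`, so the projected volume of the shell is comparable
to `h` times area. The upper bound transports estimates from the surface to the shell, the lower
bound brings them back. -/
theorem exists_map_P_le (T : Tube M S n) (hS : ∃ U : Set E3, IsOpen U ∧ S = M ∩ U) :
    ∃ C : ℝ≥0, ∀ h : ℝ, 0 < h → h ≤ T.δ →
      (volume.restrict (T.Ω h)).map T.P ≤ (C * Real.toNNReal h) • volume.restrict T.D ∧
      Real.toNNReal h • volume.restrict T.D ≤ C • (volume.restrict (T.Ω h)).map T.P := by
  obtain ⟨C, hC⟩ := T.exists_volume_Φ_le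
  refine ⟨2 * C, fun h h0 h₁ => ?_⟩
  have hvol : volume (Metric.ball (0 : ℝ) h) = 2 * Real.toNNReal h := by
    rw [Real.volume_ball, ENNReal.ofReal_mul (by norm_num)]; simp [ENNReal.ofReal]
  have hD := (isOpen_D (T := T) hS).measurableSet
  have e1 : ∀ A : Set E2, MeasurableSet A → (volume.restrict (T.Ω h)).map T.P A =
      volume (T.Φ '' ((T.D ∩ A) ×ˢ Metric.ball (0 : ℝ) h)) := by
    intro A hA
    rw [Measure.map_apply_of_aemeasurable (aemeasurable_P hS h₁) hA,
      Measure.restrict_apply' (isOpen_Ω hS h₁).measurableSet, Set.inter_comm, Ω_inter_preimage h₁]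
  constructor
  · rw [Measure.le_iff]
    intro A hA
    rw [e1 A hA]
    refine (hC _ _ (Set.inter_subset_left.trans D_subset_B) (Metric.ball_subset_ball h₁)).1.trans
      (le_of_eq ?_)
    rw [hvol, Measure.smul_apply, Measure.restrict_apply hA, Set.inter_comm, ENNReal.smul_def]
    simp only [ENNReal.coe_mul, smul_eq_mul, ENNReal.coe_ofNat]
    ring
  · rw [Measure.le_iff]
    intro A hA
    rw [Measure.smul_apply, Measure.smul_apply, e1 A hA, Measure.restrict_apply hA, Set.inter_comm,
      ENNReal.smul_def, ENNReal.smul_def]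
    have := (hC _ _ (Set.inter_subset_left.trans D_subset_B : T.D ∩ A ⊆ T.B)
      (Metric.ball_subset_ball h₁)).2
    rw [hvol] at this
    simp only [ENNReal.coe_mul, smul_eq_mul, ENNReal.coe_ofNat]
    calc (Real.toNNReal h : ℝ≥0∞) * volume (T.D ∩ A)
        ≤ 2 * (volume (T.D ∩ A) * Real.toNNReal h) := by
          rw [mul_comm]; exact le_mul_of_one_le_left zero_le (by norm_num)
      _ = volume (T.D ∩ A) * (2 * Real.toNNReal h) := by ring
      _ ≤ _ := this
      _ ≤ _ := by gcongr; exact le_mul_of_one_le_left zero_le (by norm_num)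

end Tube

end TubeCalculus

/-! ### Finite atlases of tubes and injectivity of the shell coordinates. -/

section Atlases

variable {M S : Set E3} {n : E3 → E3}

/-- A tube is adapted to `S` if its coordinate ball parametrizes a part of `S`, or a part of the
surface in which `S` is the region above a Lipschitz graph. -/
def Tube.IsAdapted (T : Tube M S n) : Prop :=
  (∀ y ∈ T.B, T.X y ∈ S) ∨
    ∃ (K : ℝ≥0) (γ : ℝ → ℝ), LipschitzWith K γ ∧ ∀ z ∈ T.B, (T.X z ∈ S ↔ γ (z 0) < z 1)

theorem IsC2LipschitzDomain.exists_isAdapted (hS : IsC2LipschitzDomain M S)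
    (hn : IsUnitNormal M S n) {p : E3} (hp : p ∈ closure S) :
    ∃ T : Tube M S n, T.IsAdapted ∧ p ∈ T.X '' T.B := by
  by_cases hpS : p ∈ S
  · obtain ⟨V, X, hX, y₀, hy₀, rfl⟩ := hS.surface p (hS.closure_subset hp)
    obtain ⟨U, hU, hSU⟩ := hS.relOpen
    have hcont : ContinuousAt X y₀ :=
      (hX.contDiffOn.contDiffAt (hX.isOpen_source.mem_nhds hy₀)).continuousAt
    have hU' : X y₀ ∈ U := (hSU.subset hpS).2
    obtain ⟨T, hV, rfl, rfl, hb⟩ := exists_tube hn hX hy₀ hp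
      (Filter.inter_mem (hX.isOpen_source.mem_nhds hy₀) (hcont.preimage_mem_nhds (hU.mem_nhds hU')))
    exact ⟨T, Or.inl fun y hy => hSU.superset ⟨hX.mapsTo (hb hy).1, (hb hy).2⟩,
      T.y₀, Metric.mem_ball_self T.δ_pos, rfl⟩
  · obtain ⟨V, X, hX, ⟨y₀, hy₀, rfl⟩, K, γ, hγ, hg⟩ := hS.lipschitz p ⟨hp, hpS⟩
    obtain ⟨T, rfl, rfl, rfl, -⟩ := exists_tube hn hX hy₀ hp univ_mem
    exact ⟨T, Or.inr ⟨K, γ, hγ, fun z hz => hg z (Tube.B_subset hz)⟩,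
      T.y₀, Metric.mem_ball_self T.δ_pos, rfl⟩

/-- A finite family of adapted tubes that covers the closure of `S`, together with a thickness for
which the normal segments of the surface are disjoint. -/
structure TubeAtlas (M S : Set E3) (n : E3 → E3) where
  ι : Type
  finite : Finite ι
  T : ι → Tube M S n
  adapted : ∀ i, (T i).IsAdapted
  covers : ∀ p ∈ closure S, ∃ i, ∃ y ∈ (T i).B, (T i).X y = p
  h₁ : ℝ
  h₁_pos : 0 < h₁
  h₁_le : ∀ i, h₁ ≤ (T i).δ
  norm_sub_le : ∀ p ∈ closure S, ∀ q ∈ closure S, ∀ s s' : ℝ, |s| < h₁ → |s'| < h₁ →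
    ‖p - q‖ ≤ 2 * ‖(p + s • n p) - (q + s' • n q)‖

theorem IsC2LipschitzDomain.isCompact_closure (hS : IsC2LipschitzDomain M S) :
    IsCompact (closure S) := hS.bounded.isCompact_closure

/-- Compactness of the closure gives the finite family. The separation of normal segments rests on
|⟨q - p, n(p)⟩| ≤ C |q - p|²: within the Lebesgue number of the cover this is the quadratic tangency
in one tube, and for distant points it is Cauchy–Schwarz. -/
theorem IsC2LipschitzDomain.nonempty_tubeAtlas (hS : IsC2LipschitzDomain M S)
    (hn : IsUnitNormal M S n) : Nonempty (TubeAtlas M S n) := by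
  choose T hT hpT using fun p : closure S => hS.exists_isAdapted hn p.2
  choose U hU hTU using fun p : closure S =>
    (T p).chart.image_eq_inter (B := (T p).B) Metric.isOpen_ball Tube.B_subset
  obtain ⟨F, hF⟩ := hS.isCompact_closure.elim_finite_subcover U hU fun p hp =>
    Set.mem_iUnion.2 ⟨⟨p, hp⟩, ((hTU ⟨p, hp⟩).subset (hpT ⟨p, hp⟩)).2⟩
  have hF' : closure S ⊆ ⋃ i : F, U i := fun p hp => by
    obtain ⟨i, hi, hpi⟩ := Set.mem_iUnion₂.1 (hF hp)
    exact Set.mem_iUnion.2 ⟨⟨i, hi⟩, hpi⟩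
  obtain ⟨ε, hε, hleb⟩ := lebesgue_number_lemma_of_metric hS.isCompact_closure
    (fun i : F => hU i) hF'
  -- The constant must dominate `K ^ 3` of every tube for near points, and `1 / ε` for points at
  -- distance at least `ε`.
  obtain ⟨C, hC0, hCε, hCK⟩ : ∃ C : ℝ, 0 < C ∧ ε⁻¹ ≤ C ∧ ∀ i : F, ((T i).K : ℝ) ^ 3 ≤ C := by
    refine ⟨ε⁻¹ + ∑ i : F, ((T i).K : ℝ) ^ 3, by positivity,
      le_add_of_nonneg_right (by positivity), fun i => ?_⟩
    have := Finset.single_le_sum (f := fun i : F => ((T i).K : ℝ) ^ 3) (fun i _ => by positivity)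
      (Finset.mem_univ i)
    linarith [inv_pos.2 hε]
  have key : ∀ p ∈ closure S, ∀ q ∈ closure S, |inner ℝ (q - p) (n p)| ≤ C * ‖q - p‖ ^ 2 := by
    intro p hp q hq
    by_cases hd : ‖q - p‖ < ε
    · obtain ⟨i, hi⟩ := hleb p hp
      obtain ⟨y, hy, rfl⟩ := (hTU i).superset
        ⟨hS.closure_subset hp, hi (Metric.mem_ball_self hε)⟩
      obtain ⟨y', hy', rfl⟩ := (hTU i).superset
        ⟨hS.closure_subset hq, hi (mem_ball_iff_norm.2 hd)⟩
      rw [(T i).n_eq y hy hp]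
      refine (Tube.abs_inner_X_sub_N_le hy hy').trans ?_
      gcongr
      exact hCK i
    · rw [not_lt] at hd
      calc |inner ℝ (q - p) (n p)| ≤ ‖q - p‖ * ‖n p‖ := abs_real_inner_le_norm _ _
        _ = ‖q - p‖ := by rw [hn.norm_eq_one p hp, mul_one]
        _ ≤ (ε⁻¹ * ‖q - p‖) * ‖q - p‖ := by
            refine le_mul_of_one_le_left (norm_nonneg _) ?_
            rw [inv_mul_eq_div, one_le_div hε]; exact hd
        _ ≤ (C * ‖q - p‖) * ‖q - p‖ := by gcongr
        _ = _ := by ring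
  obtain ⟨δ, hδ, hδT⟩ : ∃ δ : ℝ, 0 < δ ∧ ∀ i : F, δ ≤ (T i).δ := by
    rcases isEmpty_or_nonempty F with h | h
    · exact ⟨1, one_pos, fun i => h.elim i⟩
    · obtain ⟨i, hi⟩ := Finite.exists_min fun i : F => (T i).δ
      exact ⟨_, (T i).δ_pos, hi⟩
  refine ⟨{ ι := F, finite := inferInstance, T := fun i => T i, adapted := fun i => hT _
            covers := fun p hp => ?_, h₁ := min δ (1 / (4 * C)), h₁_pos := by positivity
            h₁_le := fun i => (min_le_left _ _).trans (hδT i), norm_sub_le := ?_ }⟩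
  · obtain ⟨i, hi⟩ := Set.mem_iUnion.1 (hF' hp)
    obtain ⟨y, hy, hyp⟩ := (hTU i).superset ⟨hS.closure_subset hp, hi⟩
    exact ⟨i, y, hy, hyp⟩
  · intro p hp q hq s s' hs hs'
    have bound : ∀ r : ℝ, |r| < min δ (1 / (4 * C)) → |r| * C ≤ 1 / 4 := by
      intro r hr
      have : |r| ≤ 1 / (4 * C) := (hr.trans_le (min_le_right _ _)).le
      rw [le_div_iff₀ (by positivity)] at this
      linarith
    -- For heights below 1/(4C) each of the last two terms is at most a quarter of |p - q|². So at
    -- least half of |p - q|² remains, which is where the factor 2 comes from.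
    have e : inner ℝ ((p + s • n p) - (q + s' • n q)) (p - q) =
        ‖p - q‖ ^ 2 - s * inner ℝ (q - p) (n p) - s' * inner ℝ (p - q) (n q) := by
      rw [show (p + s • n p) - (q + s' • n q) = (p - q) + s • n p - s' • n q by abel,
        inner_sub_left, inner_add_left, real_inner_self_eq_norm_sq, inner_smul_left,
        inner_smul_left, ← neg_sub q p, inner_neg_right, real_inner_comm (q - p) (n p)]
      simp only [RCLike.conj_to_real, inner_neg_right, inner_neg_left]
      rw [real_inner_comm (n q) (q - p), norm_neg]
      ring
    have i1 : s * inner ℝ (q - p) (n p) ≤ 1 / 4 * ‖p - q‖ ^ 2 := by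
      calc _ ≤ |s * inner ℝ (q - p) (n p)| := le_abs_self _
        _ ≤ |s| * (C * ‖q - p‖ ^ 2) := by
            rw [abs_mul]; gcongr; exact key p hp q hq
        _ = (|s| * C) * ‖p - q‖ ^ 2 := by rw [norm_sub_rev]; ring
        _ ≤ _ := by gcongr; exact bound s hs
    have i2 : s' * inner ℝ (p - q) (n q) ≤ 1 / 4 * ‖p - q‖ ^ 2 := by
      calc _ ≤ |s' * inner ℝ (p - q) (n q)| := le_abs_self _
        _ ≤ |s'| * (C * ‖p - q‖ ^ 2) := by
            rw [abs_mul]; gcongr; exact key q hq p hp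
        _ = (|s'| * C) * ‖p - q‖ ^ 2 := by ring
        _ ≤ _ := by gcongr; exact bound s' hs'
    have i3 := real_inner_le_norm ((p + s • n p) - (q + s' • n q)) (p - q)
    rw [e] at i3
    rcases (norm_nonneg (p - q)).eq_or_lt with h0 | h0
    · rw [← h0]; positivity
    · refine le_of_mul_le_mul_right ?_ h0
      nlinarith

namespace TubeAtlas

variable (A : TubeAtlas M S n)

theorem eq_of_shell_eq {p q : E3} (hp : p ∈ closure S) (hq : q ∈ closure S) {s s' : ℝ}
    (hs : |s| < A.h₁) (hs' : |s'| < A.h₁) (h : p + s • n p = q + s' • n q)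
    (hn : ‖n q‖ = 1) : p = q ∧ s = s' := by
  have h1 := A.norm_sub_le p hp q hq s s' hs hs'
  rw [h, sub_self, norm_zero, mul_zero] at h1
  have hpq : p = q := sub_eq_zero.1 (norm_le_zero_iff.1 h1)
  subst hpq
  refine ⟨rfl, ?_⟩
  have h2 : (s - s') • n p = 0 := by rw [sub_smul, add_left_cancel h, sub_self]
  rcases smul_eq_zero.1 h2 with h3 | h3
  · exact sub_eq_zero.1 h3
  · rw [h3, norm_zero] at hn; exact absurd hn zero_ne_one

variable {A}

theorem Φ_eq {i : A.ι} {y : E2} (hy : y ∈ (A.T i).B) (hS : (A.T i).X y ∈ closure S) (s : ℝ) :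
    (A.T i).Φ (y, s) = (A.T i).X y + s • n ((A.T i).X y) := by
  rw [(A.T i).n_eq y hy hS]; rfl

theorem shell_eq {h : ℝ} (A : TubeAtlas M S n) : shell S n h = ⋃ i, (A.T i).Ω h := by
  ext z
  simp only [Set.mem_iUnion]
  constructor
  · rintro ⟨p, hp, s, hs, rfl⟩
    obtain ⟨i, y, hy, rfl⟩ := A.covers p (subset_closure hp)
    exact ⟨i, (y, s), ⟨⟨hy, hp⟩, by simpa using hs⟩, Φ_eq hy (subset_closure hp) s⟩
  · rintro ⟨i, ⟨y, s⟩, ⟨hy, hs⟩, rfl⟩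
    exact ⟨(A.T i).X y, hy.2, s, by simpa using hs, Φ_eq hy.1 (subset_closure hy.2) s⟩

theorem Ω_subset_shell {h : ℝ} (i : A.ι) : (A.T i).Ω h ⊆ shell S n h := by
  rw [A.shell_eq]; exact Set.subset_iUnion (fun i => (A.T i).Ω h) i

theorem isOpen_shell (A : TubeAtlas M S n) (hS : ∃ U : Set E3, IsOpen U ∧ S = M ∩ U) {h : ℝ}
    (hh : h ≤ A.h₁) : IsOpen (shell S n h) := by
  rw [A.shell_eq]
  exact isOpen_iUnion fun i => Tube.isOpen_Ω hS (hh.trans (A.h₁_le i))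

/-- The tubular coordinates of different charts are compatible. -/
theorem overlap (hn : IsUnitNormal M S n) {h : ℝ} (hh : h ≤ A.h₁) {i j : A.ι} {z : E3}
    (hi : z ∈ (A.T i).Ω h) (hj : z ∈ (A.T j).Ω h) :
    (A.T i).X ((A.T i).P z) = (A.T j).X ((A.T j).P z) ∧ (A.T i).t z = (A.T j).t z ∧
      (A.T i).N ((A.T i).P z) = (A.T j).N ((A.T j).P z) := by
  obtain ⟨hPi, hti⟩ := Tube.P_mem_D (hh.trans (A.h₁_le i)) hi
  obtain ⟨hPj, htj⟩ := Tube.P_mem_D (hh.trans (A.h₁_le j)) hj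
  have ei := Tube.Φ_P_t (Tube.Ω_subset_W (hh.trans (A.h₁_le i)) hi)
  have ej := Tube.Φ_P_t (Tube.Ω_subset_W (hh.trans (A.h₁_le j)) hj)
  rw [Φ_eq hPi.1 (subset_closure hPi.2)] at ei
  rw [Φ_eq hPj.1 (subset_closure hPj.2)] at ej
  obtain ⟨h1, h2⟩ := A.eq_of_shell_eq (subset_closure hPi.2) (subset_closure hPj.2)
    (hti.trans_le hh) (htj.trans_le hh) (ei.trans ej.symm)
    (hn.norm_eq_one _ (subset_closure hPj.2))
  refine ⟨h1, h2, ?_⟩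
  have e1 : n ((A.T i).X ((A.T i).P z)) = (A.T i).N ((A.T i).P z) :=
    (A.T i).n_eq _ hPi.1 (subset_closure hPi.2)
  have e2 : n ((A.T j).X ((A.T j).P z)) = (A.T j).N ((A.T j).P z) :=
    (A.T j).n_eq _ hPj.1 (subset_closure hPj.2)
  rw [← e1, ← e2, h1]

end TubeAtlas

end Atlases

/-! ### The isometry and its image normal in coordinates. -/

section TubeIsometries

variable {M S : Set E3} {n : E3 → E3} {w : E3 → E3}

/-- The unit normal of the image of an isometric immersion with differential `G` in the
coordinates of the tube. -/
noncomputable def Tube.imageNormal (T : Tube M S n) (G : E2 → E2 →L[ℝ] E3) (y : E2) : E3 :=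
  T.c y • crossL (G y e₁) (G y e₂)

/-- An isometric immersion of class `W^{2,2}` in the coordinates of a tube. -/
structure TubeIsometry (T : Tube M S n) (w : E3 → E3) where
  G : E2 → E2 →L[ℝ] E3
  Dν : E2 → E2 →L[ℝ] E3
  weak_G : HasWeakFDerivOn (T.V ∩ T.X ⁻¹' S) (w ∘ T.X) G
  memLp_f : MemLp (w ∘ T.X) 2 (volume.restrict T.D)
  isometric : ∀ᵐ y ∂volume.restrict T.D, ∀ ξ η : E2,
    inner ℝ (G y ξ) (G y η) = inner ℝ (fderiv ℝ T.X y ξ) (fderiv ℝ T.X y η)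
  weak_ν : HasWeakFDerivOn T.D (T.imageNormal G) Dν
  memLp_Dν : MemLp Dν 2 (volume.restrict T.D)

theorem norm_le_of_isometric {A G : E2 →L[ℝ] E3} {K : ℝ}
    (h : ∀ ξ η : E2, inner ℝ (G ξ) (G η) = inner ℝ (A ξ) (A η)) (hA : ‖A‖ ≤ K) : ‖G‖ ≤ K := by
  refine G.opNorm_le_bound ((norm_nonneg _).trans hA) fun ξ => ?_
  have : ‖G ξ‖ = ‖A ξ‖ := by
    have := h ξ ξ
    rw [real_inner_self_eq_norm_sq, real_inner_self_eq_norm_sq] at this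
    exact (sq_eq_sq₀ (norm_nonneg _) (norm_nonneg _)).1 this
  rw [this]
  exact A.le_of_opNorm_le hA ξ

theorem memLp_norm_mono {α E : Type*} [MeasurableSpace α] [NormedAddCommGroup E] {f : α → E}
    {p : ℝ≥0∞} {μ ν : Measure α} (h : MemLp f p ν) (hle : μ ≤ ν) : MemLp (fun x => ‖f x‖) p μ :=
  (h.mono_measure hle).norm

theorem memLp_norm_bilinear_mono {α E F : Type*} [MeasurableSpace α] [NormedAddCommGroup E]
    [NormedSpace ℝ E] [NormedAddCommGroup F] [NormedSpace ℝ F] {f : α → E →L[ℝ] E →L[ℝ] F}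
    {p : ℝ≥0∞} {μ ν : Measure α} (h : MemLp f p ν) (hle : μ ≤ ν) :
    MemLp (fun x => ‖f x‖) p μ := by
  have := @memLp_norm_mono α (E →L[ℝ] E →L[ℝ] F) _ _ f p μ ν h hle
  exact this

theorem norm_e₁ : ‖e₁‖ = 1 := by simp [e₁]
theorem norm_e₂ : ‖e₂‖ = 1 := by simp [e₂]

/-- The image normal is `c` times a cross product of first derivatives. These are bounded because
the map is isometric; this justifies the product rule and gives a bound linear in the second
derivatives, so that their square integrability passes to the normal. -/
theorem Tube.exists_weak_imageNormal (T : Tube M S n) (hDo : IsOpen T.D)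
    {G : E2 → E2 →L[ℝ] E3} {H : E2 → E2 →L[ℝ] E2 →L[ℝ] E3} (hHD : HasWeakFDerivOn T.D G H)
    (hGK : ∀ᵐ y ∂volume.restrict T.D, ‖G y‖ ≤ T.K) :
    ∃ Dν, HasWeakFDerivOn T.D (T.imageNormal G) Dν ∧ ∀ᵐ y ∂volume.restrict T.D,
      ‖Dν y‖ ≤ T.K * (T.K * 2) * ‖H y‖ + T.K * (T.K * T.K) := by
  have hDm := hDo.measurableSet
  have w1 := hHD.clm_comp (ContinuousLinearMap.apply ℝ E3 e₁)
  have w2 := hHD.clm_comp (ContinuousLinearMap.apply ℝ E3 e₂)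
  have b1 : ∀ᵐ y ∂volume.restrict T.D, ‖ContinuousLinearMap.apply ℝ E3 e₁ (G y)‖ ≤ T.K := by
    filter_upwards [hGK] with y hy
    exact ((G y).le_of_opNorm_le hy e₁).trans (by rw [norm_e₁, mul_one])
  have b2 : ∀ᵐ y ∂volume.restrict T.D, ‖ContinuousLinearMap.apply ℝ E3 e₂ (G y)‖ ≤ T.K := by
    filter_upwards [hGK] with y hy
    exact ((G y).le_of_opNorm_le hy e₂).trans (by rw [norm_e₂, mul_one])
  have w3 := w1.bilinear w2 hDo crossL b1 b2
  have w4 := HasWeakFDerivOn.of_contDiffOn (T.contDiffOn_c.mono D_subset_B) hDo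
  have w5 := w4.bilinear w3 hDo (ContinuousLinearMap.lsmul ℝ ℝ) (L := max T.K (T.K * T.K))
    (by
      filter_upwards [ae_restrict_mem hDm] with y hy
      rw [Real.norm_eq_abs]
      exact (T.abs_c_le y (D_subset_B hy)).trans (by exact_mod_cast le_max_left _ _))
    (by
      filter_upwards [b1, b2] with y h1 h2
      refine (norm_crossL_le _ _).trans ((mul_le_mul h1 h2 (norm_nonneg _) T.K.2).trans ?_)
      exact_mod_cast le_max_right _ _)
  refine ⟨_, w5, ?_⟩
  filter_upwards [ae_restrict_mem hDm, hGK] with y hy hGy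
  have hK := T.K.2
  have n1 : ‖G y e₁‖ ≤ T.K := ((G y).le_of_opNorm_le hGy e₁).trans (by rw [norm_e₁, mul_one])
  have n2 : ‖G y e₂‖ ≤ T.K := ((G y).le_of_opNorm_le hGy e₂).trans (by rw [norm_e₂, mul_one])
  refine ContinuousLinearMap.opNorm_le_bound _ (by positivity) fun v => ?_
  have hHv : ‖H y v‖ ≤ ‖H y‖ * ‖v‖ := (H y).le_opNorm v
  have n3 : ‖H y v e₁‖ ≤ ‖H y‖ * ‖v‖ :=
    ((H y v).le_of_opNorm_le hHv e₁).trans (by rw [norm_e₁, mul_one])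
  have n4 : ‖H y v e₂‖ ≤ ‖H y‖ * ‖v‖ :=
    ((H y v).le_of_opNorm_le hHv e₂).trans (by rw [norm_e₂, mul_one])
  change ‖T.c y • (crossL (G y e₁) (H y v e₂) + crossL (H y v e₁) (G y e₂)) +
    (fderiv ℝ T.c y v) • crossL (G y e₁) (G y e₂)‖ ≤ _
  refine (norm_add_le _ _).trans ?_
  rw [norm_smul, norm_smul]
  have c1 : ‖T.c y‖ ≤ T.K := T.abs_c_le y (D_subset_B hy)
  have c2 : ‖fderiv ℝ T.c y v‖ ≤ T.K * ‖v‖ :=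
    (fderiv ℝ T.c y).le_of_opNorm_le (norm_fderiv_c_le (D_subset_B hy)) v
  have k1 : ‖crossL (G y e₁) (H y v e₂)‖ ≤ T.K * (‖H y‖ * ‖v‖) :=
    (norm_crossL_le _ _).trans (by gcongr)
  have k2 : ‖crossL (H y v e₁) (G y e₂)‖ ≤ (‖H y‖ * ‖v‖) * T.K :=
    (norm_crossL_le _ _).trans (by gcongr)
  have k3 : ‖crossL (G y e₁) (G y e₂)‖ ≤ T.K * T.K :=
    (norm_crossL_le _ _).trans (by gcongr)
  calc _ ≤ T.K * (T.K * (‖H y‖ * ‖v‖) + (‖H y‖ * ‖v‖) * T.K) + (T.K * ‖v‖) * (T.K * T.K) := by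
        gcongr
        exact (norm_add_le _ _).trans (add_le_add k1 k2)
    _ = _ := by ring

theorem Tube.exists_tubeIsometry (T : Tube M S n) (hS : ∃ U : Set E3, IsOpen U ∧ S = M ∩ U)
    (hw : IsW22Isometry M S w) : Nonempty (TubeIsometry T w) := by
  obtain ⟨G, H, hG, hH, hmem⟩ := hw.isW22 T.V T.X T.chart
  -- The closed coordinate ball is the compact set in the definition of W^{2,2}, which yields bounds
  -- up to the boundary of `S`.
  obtain ⟨m1, m2, m3⟩ := hmem _ T.closedBall_subset (isCompact_closedBall T.y₀ T.δ)
  have hDK : T.D ⊆ Metric.closedBall T.y₀ T.δ ∩ T.X ⁻¹' S :=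
    Set.inter_subset_inter_left _ Metric.ball_subset_closedBall
  have hle : volume.restrict T.D ≤ volume.restrict (Metric.closedBall T.y₀ T.δ ∩ T.X ⁻¹' S) :=
    Measure.restrict_mono hDK le_rfl
  have hDo : IsOpen T.D := isOpen_D hS
  have hDm := hDo.measurableSet
  have hiso : ∀ᵐ y ∂volume.restrict T.D, ∀ ξ η : E2,
      inner ℝ (G y ξ) (G y η) = inner ℝ (fderiv ℝ T.X y ξ) (fderiv ℝ T.X y η) := by
    filter_upwards [ae_restrict_mem hDm, ae_restrict_of_ae (hw.isometric T.V T.X T.chart G hG)]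
      with y hy h using h (D_subset hy)
  have hGK : ∀ᵐ y ∂volume.restrict T.D, ‖G y‖ ≤ T.K := by
    filter_upwards [ae_restrict_mem hDm, hiso] with y hy h using
      norm_le_of_isometric h (norm_fderiv_X_le (D_subset_B hy))
  obtain ⟨Dν, w5, hDν⟩ := T.exists_weak_imageNormal hDo (hH.mono D_subset) hGK
  refine ⟨⟨G, Dν, hG, m1.mono_measure hle, hiso, w5, ?_⟩⟩
  have hfin : IsFiniteMeasure (volume.restrict T.D) :=
    ⟨by rw [Measure.restrict_apply_univ]; exact (measure_mono D_subset_B).trans_lt measure_ball_lt_top⟩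
  have hbound : MemLp (fun y => (T.K * (T.K * 2) * ‖H y‖ + T.K * (T.K * T.K) : ℝ)) 2
      (volume.restrict T.D) :=
    ((memLp_norm_bilinear_mono m3 hle).const_mul _).add (memLp_const _)
  exact hbound.mono' w5.locallyIntegrableOn_grad.aestronglyMeasurable hDν

end TubeIsometries

/-! ### Extension of the isometry along the normals. -/

section ShellMap

variable {M S : Set E3} {n : E3 → E3} {w : E3 → E3}

/-- The measure on the coordinate domain dominates the image of the volume of the shell. -/
theorem Tube.map_P_absolutelyContinuous (T : Tube M S n) (hS : ∃ U : Set E3, IsOpen U ∧ S = M ∩ U)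
    {h : ℝ} (h0 : 0 < h) (h₁ : h ≤ T.δ) :
    (volume.restrict (T.Ω h)).map T.P ≪ volume.restrict T.D := by
  obtain ⟨C, hC⟩ := T.exists_map_P_le hS
  exact (Measure.absolutelyContinuous_of_le (hC h h0 h₁).1).trans
    (Measure.AbsolutelyContinuous.rfl.smul_left _)

theorem Tube.ae_Ω (T : Tube M S n) (hS : ∃ U : Set E3, IsOpen U ∧ S = M ∩ U)
    {h : ℝ} (h0 : 0 < h) (h₁ : h ≤ T.δ) {p : E2 → Prop} (hp : ∀ᵐ y ∂volume.restrict T.D, p y) :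
    ∀ᵐ z ∂volume.restrict (T.Ω h), p (T.P z) :=
  ae_of_ae_map (aemeasurable_P hS h₁) ((T.map_P_absolutelyContinuous hS h0 h₁).ae_le hp)

theorem Tube.memLp_comp_P {F : Type*} [NormedAddCommGroup F] (T : Tube M S n)
    (hS : ∃ U : Set E3, IsOpen U ∧ S = M ∩ U) {h : ℝ} (h0 : 0 < h) (h₁ : h ≤ T.δ) {g : E2 → F}
    (hg : MemLp g 2 (volume.restrict T.D)) :
    MemLp (fun z => g (T.P z)) 2 (volume.restrict (T.Ω h)) := by
  obtain ⟨C, hC⟩ := T.exists_map_P_le hS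
  have := hg.of_measure_le_smul (c := (C * Real.toNNReal h : ℝ≥0)) ENNReal.coe_ne_top (hC h h0 h₁).1
  exact this.comp_of_map (aemeasurable_P hS h₁)

theorem Tube.isFiniteMeasure_Ω (T : Tube M S n) {h : ℝ} (h₁ : h ≤ T.δ) :
    IsFiniteMeasure (volume.restrict (T.Ω h)) := by
  obtain ⟨C, hC⟩ := T.exists_volume_Φ_le
  refine ⟨?_⟩
  rw [Measure.restrict_apply_univ]
  refine (hC T.D (Metric.ball 0 h) D_subset_B (Metric.ball_subset_ball h₁)).1.trans_lt ?_
  exact ENNReal.mul_lt_top (by simp) (ENNReal.mul_lt_top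
    ((measure_mono D_subset_B).trans_lt measure_ball_lt_top) measure_ball_lt_top)

namespace TubeIsometry

variable {T : Tube M S n} (J : TubeIsometry T w)

/-- The unit normal of the image. -/
noncomputable def ν : E2 → E3 := T.imageNormal J.G

/-- The rotation that carries the tangent frame of the surface to that of its image. -/
noncomputable def R (y : E2) : E3 →L[ℝ] E3 :=
  (J.G y).comp (fderiv ℝ T.P (T.X y)) + (fderiv ℝ T.t (T.X y)).smulRight (J.ν y)

/-- The extension of the isometry to the shell along the normals. -/
noncomputable def u (z : E3) : E3 := w (T.X (T.P z)) + T.t z • J.ν (T.P z)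

/-- The weak gradient of the extension of the isometry to the shell. -/
noncomputable def Γ (z : E3) : E3 →L[ℝ] E3 :=
  (J.G (T.P z)).comp (fderiv ℝ T.P z) + (T.t z • (J.Dν (T.P z)).comp (fderiv ℝ T.P z) +
    (fderiv ℝ T.t z).smulRight (J.ν (T.P z)))

/-- The immersion is differentiable and isometric at the point. -/
def Good (y : E2) : Prop :=
  y ∈ T.D ∧ ∀ ξ η : E2, inner ℝ (J.G y ξ) (J.G y η) = inner ℝ (fderiv ℝ T.X y ξ) (fderiv ℝ T.X y η)

variable {J}

theorem ae_good (hS : ∃ U : Set E3, IsOpen U ∧ S = M ∩ U) : ∀ᵐ y ∂volume.restrict T.D, J.Good y := by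
  filter_upwards [ae_restrict_mem (Tube.isOpen_D hS).measurableSet, J.isometric] with y h1 h2
    using ⟨h1, h2⟩

theorem Good.R_spec {y : E2} (h : J.Good y) :
    J.R y ∈ SO3 ∧ (∀ ξ, J.R y (fderiv ℝ T.X y ξ) = J.G y ξ) ∧ J.R y (T.N y) = J.ν y :=
  rotation_mem_SO3 h.2 rfl (T.norm_N y (Tube.D_subset_B h.1))
    (fun ξ => Tube.fderiv_P_fderiv_X (Tube.D_subset_B h.1) ξ)
    (fun v => Tube.fderiv_decomp_X (Tube.D_subset_B h.1) v)

theorem Good.norm_ν {y : E2} (h : J.Good y) : ‖J.ν y‖ = 1 := by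
  rw [← h.R_spec.2.2, h.R_spec.1.1, Tube.norm_N_eq_one (Tube.D_subset_B h.1)]

/-- With p the image of v under the derivative of `P`, the vector v splits as DX p + (Dt v) N + t DN
p. The rotation sends the first two terms to G p + (Dt v) ν, which is the part of Γ v without the
factor t. What remains is t (Dν p - R DN p). -/
theorem Good.norm_Γ_sub_le {h : ℝ} (h₁ : h ≤ T.δ) {z : E3} (hz : z ∈ T.Ω h)
    (hg : J.Good (T.P z)) :
    ‖J.Γ z - J.R (T.P z)‖ ≤ h * (T.K * ‖J.Dν (T.P z)‖ + T.K * T.K) := by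
  have hzW := Tube.Ω_subset_W h₁ hz
  obtain ⟨hPD, ht⟩ := Tube.P_mem_D h₁ hz
  obtain ⟨hR, hRX, hRN⟩ := hg.R_spec
  have hh : 0 ≤ h := (abs_nonneg _).trans ht.le
  have hK := T.K.2
  have b1 := Tube.norm_fderiv_P_le hzW
  have b2 := Tube.norm_fderiv_N_le (Tube.D_subset_B hPD)
  refine ContinuousLinearMap.opNorm_le_bound _ (by positivity) fun v => ?_
  set p := fderiv ℝ T.P z v with hp
  have hpv : ‖p‖ ≤ T.K * ‖v‖ := (fderiv ℝ T.P z).le_of_opNorm_le b1 v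
  have e : (J.Γ z - J.R (T.P z)) v = T.t z • (J.Dν (T.P z) p - J.R (T.P z) (fderiv ℝ T.N (T.P z) p)) := by
    have e1 : J.Γ z v = J.G (T.P z) p + (T.t z • J.Dν (T.P z) p + fderiv ℝ T.t z v • J.ν (T.P z)) := rfl
    have e2 : J.R (T.P z) v = J.G (T.P z) p + fderiv ℝ T.t z v • J.ν (T.P z) +
        T.t z • J.R (T.P z) (fderiv ℝ T.N (T.P z) p) := by
      conv_lhs => rw [← Tube.fderiv_decomp hzW v]
      rw [map_add, map_add, map_smul, map_smul, hRX, hRN]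
    have e3 : (J.Γ z - J.R (T.P z)) v = J.Γ z v - J.R (T.P z) v := rfl
    rw [e3, e1, e2, smul_sub]
    abel
  rw [e, norm_smul, Real.norm_eq_abs]
  have b3 : ‖J.R (T.P z) (fderiv ℝ T.N (T.P z) p)‖ ≤ T.K * (T.K * ‖v‖) := by
    rw [hR.1]
    exact ((fderiv ℝ T.N (T.P z)).le_of_opNorm_le b2 p).trans (by gcongr)
  have b4 : ‖J.Dν (T.P z) p‖ ≤ ‖J.Dν (T.P z)‖ * (T.K * ‖v‖) :=
    ((J.Dν (T.P z)).le_opNorm p).trans (by gcongr)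
  calc _ ≤ h * (‖J.Dν (T.P z)‖ * (T.K * ‖v‖) + T.K * (T.K * ‖v‖)) := by
        gcongr
        exact (norm_sub_le _ _).trans (add_le_add b4 b3)
    _ = _ := by ring

theorem hasWeakFDerivOn_comp_P {F : Type*} [NormedAddCommGroup F] [NormedSpace ℝ F]
    [CompleteSpace F] {g : E2 → F} {Dg : E2 → E2 →L[ℝ] F}
    (hS : ∃ U : Set E3, IsOpen U ∧ S = M ∩ U) {h : ℝ} (h0 : 0 < h) (h₁ : h ≤ T.δ)
    (hg : HasWeakFDerivOn T.D g Dg) :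
    HasWeakFDerivOn (T.Ω h) (fun z => g (T.P z)) (fun z => (Dg (T.P z)).comp (fderiv ℝ T.P z)) := by
  obtain ⟨C, hC⟩ := T.exists_map_P_le hS
  refine hg.comp (Tube.isOpen_D hS) (Tube.isOpen_Ω hS h₁) (Tube.contDiffOn_P'.mono (Tube.Ω_subset_W h₁))
    (fun z hz => (Tube.P_mem_D h₁ hz).1) (C := C * Real.toNNReal h) ((hC h h0 h₁).1.trans ?_)
  gcongr
  exact Measure.restrict_le_self

/-- Chain rule for the composition with the projection, then product rule for t ν; both factors are
bounded on the shell. -/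
theorem hasWeakFDerivOn_u (hS : ∃ U : Set E3, IsOpen U ∧ S = M ∩ U) {h : ℝ} (h0 : 0 < h)
    (h₁ : h ≤ T.δ) : HasWeakFDerivOn (T.Ω h) J.u J.Γ := by
  have hΩ := Tube.isOpen_Ω (T := T) hS h₁
  have w1 := hasWeakFDerivOn_comp_P hS h0 h₁ (J.weak_G.mono Tube.D_subset)
  have w2 := hasWeakFDerivOn_comp_P hS h0 h₁ J.weak_ν
  have w3 := HasWeakFDerivOn.of_contDiffOn (Tube.contDiffOn_t'.mono (Tube.Ω_subset_W h₁)) hΩ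
  have w4 := w3.bilinear w2 hΩ (ContinuousLinearMap.lsmul ℝ ℝ) (L := max (Real.toNNReal h) 1)
    (by
      filter_upwards [ae_restrict_mem hΩ.measurableSet] with z hz
      rw [Real.norm_eq_abs, NNReal.coe_max]
      exact (Tube.P_mem_D h₁ hz).2.le.trans ((Real.le_coe_toNNReal h).trans (le_max_left _ _)))
    (by
      filter_upwards [T.ae_Ω hS h0 h₁ (J.ae_good hS)] with z hz
      rw [NNReal.coe_max, NNReal.coe_one]
      exact (hz.norm_ν).le.trans (le_max_right _ _))
  exact w1.add w4

theorem memLp_bound (hS : ∃ U : Set E3, IsOpen U ∧ S = M ∩ U) {h : ℝ} (h0 : 0 < h)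
    (h₁ : h ≤ T.δ) : MemLp (fun z => (T.K * ‖J.Dν (T.P z)‖ + T.K * T.K : ℝ)) 2
      (volume.restrict (T.Ω h)) := by
  have := T.isFiniteMeasure_Ω h₁
  have h1 := memLp_norm_mono J.memLp_Dν le_rfl
  exact ((T.memLp_comp_P hS h0 h₁ h1).const_mul _).add (memLp_const _)

theorem memLp_u (hS : ∃ U : Set E3, IsOpen U ∧ S = M ∩ U) {h : ℝ} (h0 : 0 < h)
    (h₁ : h ≤ T.δ) : MemLp J.u 2 (volume.restrict (T.Ω h)) := by
  have := T.isFiniteMeasure_Ω h₁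
  have hΩ := Tube.isOpen_Ω (T := T) hS h₁
  have m1 : MemLp (fun z => (‖(w ∘ T.X) (T.P z)‖ + h : ℝ)) 2 (volume.restrict (T.Ω h)) :=
    (T.memLp_comp_P hS h0 h₁ J.memLp_f).norm.add (memLp_const _)
  refine m1.mono' (J.hasWeakFDerivOn_u hS h0 h₁).locallyIntegrableOn.aestronglyMeasurable ?_
  filter_upwards [ae_restrict_mem hΩ.measurableSet, T.ae_Ω hS h0 h₁ (J.ae_good hS)] with z hz hg
  refine (norm_add_le _ _).trans (add_le_add le_rfl ?_)
  rw [norm_smul, hg.norm_ν, mul_one]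
  exact (Tube.P_mem_D h₁ hz).2.le

theorem memLp_Γ (hS : ∃ U : Set E3, IsOpen U ∧ S = M ∩ U) {h : ℝ} (h0 : 0 < h)
    (h₁ : h ≤ T.δ) : MemLp J.Γ 2 (volume.restrict (T.Ω h)) := by
  have := T.isFiniteMeasure_Ω h₁
  have hΩ := Tube.isOpen_Ω (T := T) hS h₁
  have m1 := ((J.memLp_bound hS h0 h₁).const_mul h).add (memLp_const (1 : ℝ))
  refine m1.mono' (J.hasWeakFDerivOn_u hS h0 h₁).locallyIntegrableOn_grad.aestronglyMeasurable ?_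
  filter_upwards [ae_restrict_mem hΩ.measurableSet, T.ae_Ω hS h0 h₁ (J.ae_good hS)] with z hz hg
  have h1 := hg.norm_Γ_sub_le h₁ hz
  have h2 := norm_le_one_of_mem_SO3 hg.R_spec.1
  calc ‖J.Γ z‖ = ‖(J.Γ z - J.R (T.P z)) + J.R (T.P z)‖ := by rw [sub_add_cancel]
    _ ≤ _ := (norm_add_le _ _).trans (add_le_add h1 h2)

/-- The gradient of the extension is close to the rotations. -/
theorem exists_lintegral_Γ_sub_le (J : TubeIsometry T w)
    (hS : ∃ U : Set E3, IsOpen U ∧ S = M ∩ U) :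
    ∃ C : ℝ≥0, ∀ h : ℝ, 0 < h → h ≤ T.δ →
      ∫⁻ z in T.Ω h, ‖J.Γ z - J.R (T.P z)‖ₑ ^ 2 ≤ C * ENNReal.ofReal h ^ 3 := by
  obtain ⟨C, hC⟩ := T.exists_map_P_le hS
  have hfin : IsFiniteMeasure (volume.restrict T.D) :=
    ⟨by
      rw [Measure.restrict_apply_univ]
      exact (measure_mono Tube.D_subset_B).trans_lt measure_ball_lt_top⟩
  have m : MemLp (fun y => (T.K * ‖J.Dν y‖ + T.K * T.K : ℝ)) 2 (volume.restrict T.D) :=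
    ((memLp_norm_mono J.memLp_Dν le_rfl).const_mul _).add (memLp_const _)
  have hfinite : ∫⁻ y in T.D, ‖(T.K * ‖J.Dν y‖ + T.K * T.K : ℝ)‖ₑ ^ 2 < ∞ := by
    have := (eLpNorm_lt_top_iff_lintegral_rpow_enorm_lt_top (by simp) (by simp)).1 m.2
    simpa using this
  obtain ⟨I, hI⟩ : ∃ I : ℝ≥0, ∫⁻ y in T.D, ‖(T.K * ‖J.Dν y‖ + T.K * T.K : ℝ)‖ₑ ^ 2 = I :=
    ⟨_, (ENNReal.coe_toNNReal hfinite.ne).symm⟩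
  refine ⟨C * I, fun h h0 h₁ => ?_⟩
  have hΩ := Tube.isOpen_Ω (T := T) hS h₁
  -- Two powers of `h` come from the pointwise bound, the third from the thickness of the shell.
  calc ∫⁻ z in T.Ω h, ‖J.Γ z - J.R (T.P z)‖ₑ ^ 2
      ≤ ∫⁻ z in T.Ω h, ENNReal.ofReal h ^ 2 *
          ‖(T.K * ‖J.Dν (T.P z)‖ + T.K * T.K : ℝ)‖ₑ ^ 2 := by
        refine lintegral_mono_ae ?_
        filter_upwards [ae_restrict_mem hΩ.measurableSet, T.ae_Ω hS h0 h₁ (J.ae_good hS)]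
          with z hz hg
        rw [← mul_pow]
        gcongr
        have hK := T.K.2
        rw [← ofReal_norm, Real.enorm_of_nonneg (by positivity), ← ENNReal.ofReal_mul h0.le]
        exact ENNReal.ofReal_le_ofReal (hg.norm_Γ_sub_le h₁ hz)
    _ = ENNReal.ofReal h ^ 2 * ∫⁻ z in T.Ω h,
          ‖(T.K * ‖J.Dν (T.P z)‖ + T.K * T.K : ℝ)‖ₑ ^ 2 :=
        lintegral_const_mul' _ _ (by finiteness)
    _ ≤ ENNReal.ofReal h ^ 2 * (((C * Real.toNNReal h : ℝ≥0) : ℝ≥0∞) * I) := by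
        gcongr
        rw [← hI]
        exact lintegral_comp_le_of_map_le (Tube.aemeasurable_P hS h₁) (hC h h0 h₁).1
          (g := fun y => ‖(T.K * ‖J.Dν y‖ + T.K * T.K : ℝ)‖ₑ ^ 2)
          (m.1.enorm.pow_const 2)
    _ = _ := by
        rw [ENNReal.coe_mul, ENNReal.coe_mul]
        change _ * (C * ENNReal.ofReal h * I) = _
        ring

end TubeIsometry

end ShellMap

/-! ### Gluing the local extensions. -/

section GlobalMap

variable {M S : Set E3} {n : E3 → E3} {w : E3 → E3}

/-- On an overlap the foot point and the height agree. By uniqueness of weak derivatives the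
differentials of `w` agree too, hence so do the rotations on the tangent plane, hence everywhere,
and with them the image normals. Equality of the gradients `Γ` is uniqueness of weak derivatives
once more. -/
theorem TubeAtlas.ae_overlap (A : TubeAtlas M S n) (hS : ∃ U : Set E3, IsOpen U ∧ S = M ∩ U)
    (hn : IsUnitNormal M S n) (J : ∀ i, TubeIsometry (A.T i) w) (i j : A.ι) :
    ∀ᵐ z ∂volume.restrict ((A.T i).Ω A.h₁ ∩ (A.T j).Ω A.h₁),
      (J i).u z = (J j).u z ∧ (J i).Γ z = (J j).Γ z := by
  set O := (A.T i).Ω A.h₁ ∩ (A.T j).Ω A.h₁ with hO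
  have hOi : O ⊆ (A.T i).Ω A.h₁ := Set.inter_subset_left
  have hOj : O ⊆ (A.T j).Ω A.h₁ := Set.inter_subset_right
  have hOo : IsOpen O := (Tube.isOpen_Ω hS (A.h₁_le i)).inter (Tube.isOpen_Ω hS (A.h₁_le j))
  have hov : ∀ z ∈ O, _ := fun z hz => TubeAtlas.overlap hn le_rfl hz.1 hz.2
  have g1 : HasWeakFDerivOn O (fun z => w ((A.T i).X ((A.T i).P z)))
      (fun z => ((J i).G ((A.T i).P z)).comp (fderiv ℝ (A.T i).P z)) :=
    (TubeIsometry.hasWeakFDerivOn_comp_P hS A.h₁_pos (A.h₁_le i)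
      ((J i).weak_G.mono Tube.D_subset)).mono hOi
  have g2 : HasWeakFDerivOn O (fun z => w ((A.T j).X ((A.T j).P z)))
      (fun z => ((J j).G ((A.T j).P z)).comp (fderiv ℝ (A.T j).P z)) :=
    (TubeIsometry.hasWeakFDerivOn_comp_P hS A.h₁_pos (A.h₁_le j)
      ((J j).weak_G.mono Tube.D_subset)).mono hOj
  have g3 := g1.congr_ae (f' := fun z => w ((A.T j).X ((A.T j).P z)))
    ((ae_restrict_mem hOo.measurableSet).mono fun z hz => congrArg w (hov z hz).1) (ae_eq_refl _)
  have hG := g3.ae_eq g2 hOo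
  have good : ∀ k, O ⊆ (A.T k).Ω A.h₁ → ∀ᵐ z ∂volume.restrict O, (J k).Good ((A.T k).P z) :=
    fun k hk => ae_restrict_of_ae_restrict_of_subset hk
      ((A.T k).ae_Ω hS A.h₁_pos (A.h₁_le k) (TubeIsometry.ae_good hS))
  have hu : ∀ᵐ z ∂volume.restrict O, (J i).u z = (J j).u z := by
    filter_upwards [ae_restrict_mem hOo.measurableSet, hG, good i hOi, good j hOj] with z hz hGz gi gj
    obtain ⟨hX, ht, hN⟩ := hov z hz
    have hWi := Tube.Ω_subset_W (A.h₁_le i) hz.1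
    have hWj := Tube.Ω_subset_W (A.h₁_le j) hz.2
    obtain ⟨hPi, hti⟩ := Tube.P_mem_D (A.h₁_le i) hz.1
    obtain ⟨hRi, hRXi, hRNi⟩ := gi.R_spec
    obtain ⟨hRj, hRXj, hRNj⟩ := gj.R_spec
    have hD : (fderiv ℝ (A.T i).X ((A.T i).P z)).comp (fderiv ℝ (A.T i).P z) =
        (fderiv ℝ (A.T j).X ((A.T j).P z)).comp (fderiv ℝ (A.T j).P z) := by
      have d1 : HasFDerivAt (fun z => (A.T i).X ((A.T i).P z)) _ z :=
        (Tube.hasFDerivAt_X (Tube.P_mem hWi)).comp z (Tube.hasFDerivAt_P hWi)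
      have d2 : HasFDerivAt (fun z => (A.T j).X ((A.T j).P z)) _ z :=
        (Tube.hasFDerivAt_X (Tube.P_mem hWj)).comp z (Tube.hasFDerivAt_P hWj)
      refine (d1.congr_of_eventuallyEq ?_).unique d2
      filter_upwards [hOo.mem_nhds hz] with z' hz' using (hov z' hz').1.symm
    -- The derivative of the projection is onto, so every coordinate direction comes from a vector
    -- of the shell, where the two differentials can be compared.
    have key : ∀ ξ, (J i).R ((A.T i).P z) (fderiv ℝ (A.T i).X ((A.T i).P z) ξ) =
        (J j).R ((A.T j).P z) (fderiv ℝ (A.T i).X ((A.T i).P z) ξ) := by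
      intro ξ
      obtain ⟨v, hv⟩ : ∃ v, fderiv ℝ (A.T i).P z v = ξ := by
        have := Tube.fderiv_P_surj hPi.1 (hti.trans_le (A.h₁_le i)) ξ
        rw [Tube.Φ_P_t hWi] at this
        exact ⟨_, this⟩
      have hDv : fderiv ℝ (A.T i).X ((A.T i).P z) (fderiv ℝ (A.T i).P z v) =
        fderiv ℝ (A.T j).X ((A.T j).P z) (fderiv ℝ (A.T j).P z v) :=
        congrArg (fun L : E3 →L[ℝ] E3 => L v) hD
      have hGv : (J i).G ((A.T i).P z) (fderiv ℝ (A.T i).P z v) =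
        (J j).G ((A.T j).P z) (fderiv ℝ (A.T j).P z v) :=
        congrArg (fun L : E3 →L[ℝ] E3 => L v) hGz
      rw [← hv, hRXi, hDv, hRXj, hGv]
    have hRR := eq_of_mem_SO3 hRi hRj
      (crossL_ne_zero_of_injective ((A.T i).chart.immersion _ (Tube.B_subset hPi.1)))
      (key e₁) (key e₂)
    have hν : (J i).ν ((A.T i).P z) = (J j).ν ((A.T j).P z) := by
      rw [← hRNi, ← hRNj, hRR, hN]
    rw [TubeIsometry.u, TubeIsometry.u, hX, ht, hν]
  have hΓ := (((J i).hasWeakFDerivOn_u hS A.h₁_pos (A.h₁_le i)).mono hOi).congr_ae hu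
    (ae_eq_refl _) |>.ae_eq (((J j).hasWeakFDerivOn_u hS A.h₁_pos (A.h₁_le j)).mono hOj) hOo
  filter_upwards [hu, hΓ] with z h1 h2 using ⟨h1, h2⟩

open Classical in
/-- Glue functions given on the parts of the shell. -/
noncomputable def TubeAtlas.glue (A : TubeAtlas M S n) {W : Type*} [Zero W] (F : A.ι → E3 → W)
    (z : E3) : W :=
  if h : ∃ i, z ∈ (A.T i).Ω A.h₁ then F h.choose z else 0

theorem TubeAtlas.glue_ae_eq (A : TubeAtlas M S n) (hS : ∃ U : Set E3, IsOpen U ∧ S = M ∩ U)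
    {W : Type*} [Zero W] {F : A.ι → E3 → W}
    (hF : ∀ i j, ∀ᵐ z ∂volume.restrict ((A.T i).Ω A.h₁ ∩ (A.T j).Ω A.h₁), F i z = F j z) (j : A.ι) :
    A.glue F =ᵐ[volume.restrict ((A.T j).Ω A.h₁)] F j := by
  have := A.finite
  have hm : ∀ i, MeasurableSet ((A.T i).Ω A.h₁) := fun i =>
    (Tube.isOpen_Ω hS (A.h₁_le i)).measurableSet
  have h1 : ∀ᵐ z, ∀ i, z ∈ (A.T i).Ω A.h₁ ∩ (A.T j).Ω A.h₁ → F i z = F j z :=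
    ae_all_iff.2 fun i => (ae_restrict_iff' ((hm i).inter (hm j))).1 (hF i j)
  filter_upwards [ae_restrict_mem (hm j), ae_restrict_of_ae h1] with z hz hz1
  have hex : ∃ i, z ∈ (A.T i).Ω A.h₁ := ⟨j, hz⟩
  rw [TubeAtlas.glue, dif_pos hex]
  exact hz1 _ ⟨hex.choose_spec, hz⟩

theorem memLp_iUnion {α E ι : Type*} [MeasurableSpace α] [NormedAddCommGroup E] [Finite ι]
    {μ : Measure α} {s : ι → Set α} {f : α → E} (h : ∀ i, MemLp f 2 (μ.restrict (s i))) :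
    MemLp f 2 (μ.restrict (⋃ i, s i)) := by
  have := Fintype.ofFinite ι
  refine ⟨aestronglyMeasurable_iUnion_iff.2 fun i => (h i).1, ?_⟩
  have h2 : ∀ i, ∫⁻ x in s i, ‖f x‖ₑ ^ 2 ∂μ < ∞ := fun i => by
    have := (eLpNorm_lt_top_iff_lintegral_rpow_enorm_lt_top (by simp) (by simp)).1 (h i).2
    simpa using this
  rw [eLpNorm_lt_top_iff_lintegral_rpow_enorm_lt_top (by simp) (by simp)]
  simp only [ENNReal.toReal_ofNat, ENNReal.rpow_ofNat]
  refine (lintegral_iUnion_le _ _).trans_lt ?_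
  rw [tsum_fintype]
  exact ENNReal.sum_lt_top.2 fun i _ => h2 i

/-- The extension of an isometric immersion to the shell is a Sobolev map whose gradient is close
to rotations. -/
theorem TubeAtlas.exists_shell_map (A : TubeAtlas M S n)
    (hS : ∃ U : Set E3, IsOpen U ∧ S = M ∩ U) (hn : IsUnitNormal M S n)
    (J : ∀ i, TubeIsometry (A.T i) w) :
    ∃ (u : E3 → E3) (Γ : E3 → E3 →L[ℝ] E3) (C : ℝ≥0),
      (∀ i, u =ᵐ[volume.restrict ((A.T i).Ω A.h₁)] (J i).u) ∧
      (∀ h, 0 < h → h ≤ A.h₁ → IsW12 (shell S n h) u Γ) ∧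
      (∀ h, 0 < h → h ≤ A.h₁ → ∀ i,
        ∫⁻ z in (A.T i).Ω h, ‖Γ z - (J i).R ((A.T i).P z)‖ₑ ^ 2 ≤ C * ENNReal.ofReal h ^ 3) ∧
      ∀ h, 0 < h → h ≤ A.h₁ →
        ∫⁻ z in shell S n h, ENNReal.ofReal (Metric.infDist (Γ z) SO3 ^ 2) ≤
          C * ENNReal.ofReal h ^ 3 := by
  have hfin := A.finite
  have := Fintype.ofFinite A.ι
  have hu := A.glue_ae_eq hS (fun i j => (A.ae_overlap hS hn J i j).mono fun z h => h.1)
  have hΓ := A.glue_ae_eq hS (fun i j => (A.ae_overlap hS hn J i j).mono fun z h => h.2)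
  set u := A.glue fun i => (J i).u
  set Γ := A.glue fun i => (J i).Γ
  choose C hC using fun i => (J i).exists_lintegral_Γ_sub_le hS
  have hsub : ∀ {h}, h ≤ A.h₁ → ∀ i, (A.T i).Ω h ⊆ (A.T i).Ω A.h₁ := fun hh i =>
    Set.image_mono (Set.prod_mono le_rfl (Metric.ball_subset_ball hh))
  have hu' : ∀ {h}, h ≤ A.h₁ → ∀ i, u =ᵐ[volume.restrict ((A.T i).Ω h)] (J i).u := fun hh i =>
    ae_restrict_of_ae_restrict_of_subset (hsub hh i) (hu i)
  have hΓ' : ∀ {h}, h ≤ A.h₁ → ∀ i, Γ =ᵐ[volume.restrict ((A.T i).Ω h)] (J i).Γ := fun hh i =>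
    ae_restrict_of_ae_restrict_of_subset (hsub hh i) (hΓ i)
  have key : ∀ h, 0 < h → h ≤ A.h₁ → ∀ i,
      ∫⁻ z in (A.T i).Ω h, ‖Γ z - (J i).R ((A.T i).P z)‖ₑ ^ 2 ≤ C i * ENNReal.ofReal h ^ 3 := by
    intro h h0 hh i
    refine (le_of_eq (lintegral_congr_ae ?_)).trans (hC i h h0 (hh.trans (A.h₁_le i)))
    filter_upwards [hΓ' hh i] with z hz
    rw [hz]
  refine ⟨u, Γ, ∑ i, C i, hu, fun h h0 hh => ?_, fun h h0 hh i => ?_, fun h h0 hh => ?_⟩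
  · have hh' := fun i => hh.trans (A.h₁_le i)
    refine ⟨?_, ?_, ?_⟩
    · refine hasWeakFDerivOn_of_locally fun z hz => ?_
      rw [A.shell_eq] at hz
      obtain ⟨i, hi⟩ := Set.mem_iUnion.1 hz
      exact ⟨(A.T i).Ω h, Tube.isOpen_Ω hS (hh' i), hi, TubeAtlas.Ω_subset_shell i,
        ((J i).hasWeakFDerivOn_u hS h0 (hh' i)).congr_ae (hu' hh i).symm (hΓ' hh i).symm⟩
    · rw [A.shell_eq]
      exact memLp_iUnion fun i => ((J i).memLp_u hS h0 (hh' i)).ae_eq (hu' hh i).symm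
    · rw [A.shell_eq]
      exact memLp_iUnion fun i => ((J i).memLp_Γ hS h0 (hh' i)).ae_eq (hΓ' hh i).symm
  · refine (key h h0 hh i).trans ?_
    gcongr
    exact Finset.single_le_sum (f := C) (fun i _ => zero_le) (Finset.mem_univ i)
  · rw [A.shell_eq]
    refine (lintegral_iUnion_le _ _).trans ?_
    rw [tsum_fintype, ENNReal.ofNNReal_finsetSum, Finset.sum_mul]
    refine Finset.sum_le_sum fun i _ => (lintegral_mono_ae ?_).trans (key h h0 hh i)
    filter_upwards [(A.T i).ae_Ω hS h0 (hh.trans (A.h₁_le i)) (TubeIsometry.ae_good (J := J i) hS)]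
      with z hz
    rw [← ofReal_norm, ← ENNReal.ofReal_pow (norm_nonneg _), ← dist_eq_norm]
    refine ENNReal.ofReal_le_ofReal ?_
    exact pow_le_pow_left₀ Metric.infDist_nonneg (Metric.infDist_le_dist_of_mem hz.R_spec.1) 2

end GlobalMap

/-! ### Constancy of the rotation field. -/

section ConstantRotation

variable {M S : Set E3} {n : E3 → E3} {w : E3 → E3}

theorem enorm_sub_sq_le {E : Type*} [NormedAddCommGroup E] (a b c : E) :
    ‖a - b‖ₑ ^ 2 ≤ 4 * ‖c - a‖ₑ ^ 2 + 4 * ‖c - b‖ₑ ^ 2 := by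
  have h1 : ‖a - b‖ₑ ≤ ‖c - a‖ₑ + ‖c - b‖ₑ := by
    rw [show a - b = (c - b) - (c - a) by abel, add_comm]
    exact enorm_sub_le
  have h4 : ∀ x : ℝ≥0∞, (2 * x) ^ 2 = 4 * x ^ 2 := fun x => by rw [mul_pow]; norm_num
  rcases le_total ‖c - a‖ₑ ‖c - b‖ₑ with h | h
  · calc ‖a - b‖ₑ ^ 2 ≤ (2 * ‖c - b‖ₑ) ^ 2 := by
          gcongr; rw [two_mul]; exact h1.trans (by gcongr)
      _ ≤ _ := by rw [h4]; exact le_add_self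
  · calc ‖a - b‖ₑ ^ 2 ≤ (2 * ‖c - a‖ₑ) ^ 2 := by
          gcongr; rw [two_mul]; exact h1.trans (by gcongr)
      _ ≤ _ := by rw [h4]; exact le_self_add

theorem eq_of_enorm_sub_eq_zero {E : Type*} [NormedAddCommGroup E] {a b : E}
    (h : ‖a - b‖ₑ = 0) : a = b :=
  sub_eq_zero.1 (enorm_eq_zero.1 h)

theorem Filter.Tendsto.enorm_sub_const {α E : Type*} [NormedAddCommGroup E] {f : α → E}
    {l : Filter α} {b : E} (h : Tendsto f l (𝓝 b)) : Tendsto (fun x => ‖f x - b‖ₑ) l (𝓝 0) := by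
  have := (h.sub (tendsto_const_nhds (x := b))).enorm
  rwa [sub_self, enorm_zero] at this

theorem lintegral_enorm_sub_sq_le {α E : Type*} [MeasurableSpace α] [NormedAddCommGroup E]
    {μ : Measure α} {f g k : α → E} (hk : AEStronglyMeasurable (fun x => k x - f x) μ) :
    ∫⁻ x, ‖f x - g x‖ₑ ^ 2 ∂μ ≤
      4 * ∫⁻ x, ‖k x - f x‖ₑ ^ 2 ∂μ + 4 * ∫⁻ x, ‖k x - g x‖ₑ ^ 2 ∂μ := by
  refine (lintegral_mono fun x => enorm_sub_sq_le (f x) (g x) (k x)).trans ?_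
  rw [lintegral_add_left' ((hk.enorm.pow_const 2).const_mul 4),
    lintegral_const_mul' _ _ (by simp), lintegral_const_mul' _ _ (by simp)]

namespace TubeIsometry

variable {T : Tube M S n} {J : TubeIsometry T w}

theorem aestronglyMeasurable_R (hS : ∃ U : Set E3, IsOpen U ∧ S = M ∩ U) :
    AEStronglyMeasurable J.R (volume.restrict T.D) := by
  have hD := (Tube.isOpen_D (T := T) hS).measurableSet
  have h1 : AEStronglyMeasurable J.G (volume.restrict T.D) :=
    (J.weak_G.mono Tube.D_subset).locallyIntegrableOn_grad.aestronglyMeasurable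
  have h2 : AEStronglyMeasurable J.ν (volume.restrict T.D) :=
    J.weak_ν.locallyIntegrableOn.aestronglyMeasurable
  have hX : ContinuousOn T.X T.D := Tube.contDiffOn_X.continuousOn.mono Tube.D_subset_B
  have hmaps : Set.MapsTo T.X T.D T.W := fun y hy => Tube.X_mem_W (Tube.D_subset_B hy)
  have h3 : AEStronglyMeasurable (fun y => fderiv ℝ T.P (T.X y)) (volume.restrict T.D) :=
    ((Tube.contDiffOn_P'.continuousOn_fderiv_of_isOpen Tube.isOpen_W le_rfl).comp hX
      hmaps).aestronglyMeasurable hD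
  have h4 : AEStronglyMeasurable (fun y => fderiv ℝ T.t (T.X y)) (volume.restrict T.D) :=
    ((Tube.contDiffOn_t'.continuousOn_fderiv_of_isOpen Tube.isOpen_W le_rfl).comp hX
      hmaps).aestronglyMeasurable hD
  have h5 := (ContinuousLinearMap.compL ℝ E3 E2 E3).aestronglyMeasurable_comp₂ h1 h3
  have h6 := (ContinuousLinearMap.smulRightL ℝ E3 E3).aestronglyMeasurable_comp₂ h4 h2
  exact AEStronglyMeasurable.add h5 h6

/-- The integrand is constant along normals, so the lower volume bound gains the factor `h`.
Division by it recovers an estimate on the surface itself. -/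
theorem exists_lintegral_R_sub_le (hS : ∃ U : Set E3, IsOpen U ∧ S = M ∩ U) :
    ∃ C : ℝ≥0, ∀ h : ℝ, 0 < h → h ≤ T.δ → ∀ Q : E3 →L[ℝ] E3,
      ENNReal.ofReal h * ∫⁻ y in T.D, ‖J.R y - Q‖ₑ ^ 2 ≤
        C * ∫⁻ z in T.Ω h, ‖J.R (T.P z) - Q‖ₑ ^ 2 := by
  obtain ⟨C, hC⟩ := T.exists_map_P_le hS
  refine ⟨C, fun h h0 h₁ Q => ?_⟩
  have hm : AEMeasurable (fun y => ‖J.R y - Q‖ₑ ^ 2) (volume.restrict T.D) := by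
    have := (J.aestronglyMeasurable_R hS).sub (aestronglyMeasurable_const (b := Q))
    exact this.enorm.pow_const 2
  have hm' := hm.mono_ac (T.map_P_absolutelyContinuous hS h0 h₁)
  have := lintegral_mono' (hC h h0 h₁).2 (le_refl fun y => ‖J.R y - Q‖ₑ ^ 2)
  rw [lintegral_smul_measure, lintegral_smul_measure,
    lintegral_map' hm' (Tube.aemeasurable_P hS h₁)] at this
  exact this

end TubeIsometry

/-- If the gradient of the extension of the isometry is close to constant matrices in `K`, then
the isometry has constant rotation. -/
theorem TubeAtlas.exists_R_ae_eq (A : TubeAtlas M S n) (hS : ∃ U : Set E3, IsOpen U ∧ S = M ∩ U)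
    {J : ∀ i, TubeIsometry (A.T i) w} {Γ : E3 → E3 →L[ℝ] E3} {C : ℝ≥0}
    (hm : ∀ h, 0 < h → h ≤ A.h₁ → AEStronglyMeasurable Γ (volume.restrict (shell S n h)))
    (hΓ : ∀ h, 0 < h → h ≤ A.h₁ → ∀ i,
      ∫⁻ z in (A.T i).Ω h, ‖Γ z - (J i).R ((A.T i).P z)‖ₑ ^ 2 ≤ C * ENNReal.ofReal h ^ 3)
    {K : Set (E3 →L[ℝ] E3)} (hK : IsCompact K) {h₂ : ℝ} (h₂0 : 0 < h₂) (h₂₁ : h₂ ≤ A.h₁)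
    {a : ℝ → ℝ≥0∞} (ha : Tendsto a (𝓝[>] 0) (𝓝 0))
    (hQ : ∀ h, 0 < h → h < h₂ → ∃ Q ∈ K,
      ∫⁻ z in shell S n h, ‖Γ z - Q‖ₑ ^ 2 ≤ ENNReal.ofReal h * a h) :
    ∃ Q ∈ K, ∀ i, ∀ᵐ y ∂volume.restrict (A.T i).D, (J i).R y = Q := by
  -- The shift by 2 makes every thickness strictly smaller than `h₂`.
  let h : ℕ → ℝ := fun k => h₂ / (k + 2)
  have h0 : ∀ k, 0 < h k := fun k => by positivity
  have hlt : ∀ k, h k < h₂ := fun k => div_lt_self h₂0 (by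
    have : (0:ℝ) ≤ k := k.cast_nonneg
    linarith)
  have hlim : Tendsto h atTop (𝓝[>] 0) := by
    refine tendsto_nhdsWithin_iff.2 ⟨?_, Eventually.of_forall h0⟩
    exact tendsto_const_nhds.div_atTop (tendsto_atTop_add_const_right _ _ tendsto_natCast_atTop_atTop)
  choose Q hQK hQ using fun k => hQ (h k) (h0 k) (hlt k)
  obtain ⟨Q₀, hQ₀, φ, hφ, hlimQ⟩ := hK.tendsto_subseq hQK
  refine ⟨Q₀, hQ₀, fun i => ?_⟩
  have hh₁ : ∀ k, h k ≤ A.h₁ := fun k => (hlt k).le.trans h₂₁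
  obtain ⟨C', hC'⟩ := (J i).exists_lintegral_R_sub_le hS
  -- The gradient in the shell is compared both with the rotation field, with error h³, and with the
  -- constant `Q k`, with error h a(h). One factor h is then cancelled.
  have bound : ∀ k, ∫⁻ y in (A.T i).D, ‖(J i).R y - Q k‖ₑ ^ 2 ≤
      C' * (4 * (C * ENNReal.ofReal (h k) ^ 2) + 4 * a (h k)) := by
    intro k
    have hk0 : ENNReal.ofReal (h k) ≠ 0 := by simpa using h0 k
    rw [← ENNReal.mul_le_mul_iff_right hk0 ENNReal.ofReal_ne_top]
    refine (hC' (h k) (h0 k) ((hh₁ k).trans (A.h₁_le i)) (Q k)).trans ?_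
    have hsub : (A.T i).Ω (h k) ⊆ shell S n (h k) := TubeAtlas.Ω_subset_shell i
    have hm2 : AEStronglyMeasurable (fun z => Γ z - Q k) (volume.restrict ((A.T i).Ω (h k))) := by
      have := ((hm (h k) (h0 k) (hh₁ k)).mono_set hsub).sub
        (aestronglyMeasurable_const (b := Q k))
      exact this
    have h3 : ∫⁻ z in (A.T i).Ω (h k), ‖Γ z - Q k‖ₑ ^ 2 ≤ ENNReal.ofReal (h k) * a (h k) :=
      (lintegral_mono_set hsub).trans (hQ k)
    calc _ ≤ C' * (4 * (C * ENNReal.ofReal (h k) ^ 3) + 4 * (ENNReal.ofReal (h k) * a (h k))) := by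
          gcongr
          have h4 := lintegral_enorm_sub_sq_le (g := fun z => (J i).R ((A.T i).P z)) hm2
          calc ∫⁻ z in (A.T i).Ω (h k), ‖(J i).R ((A.T i).P z) - Q k‖ₑ ^ 2
              = ∫⁻ z in (A.T i).Ω (h k), ‖Q k - (J i).R ((A.T i).P z)‖ₑ ^ 2 :=
                lintegral_congr fun z => by rw [← enorm_neg, neg_sub]
            _ ≤ _ := h4
            _ ≤ 4 * (ENNReal.ofReal (h k) * a (h k)) + 4 * (C * ENNReal.ofReal (h k) ^ 3) := by
                gcongr
                exact hΓ (h k) (h0 k) (hh₁ k) i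
            _ = _ := add_comm _ _
      _ = _ := by ring
  have hmR := (J i).aestronglyMeasurable_R hS
  have hfin : volume (A.T i).D ≠ ∞ :=
    ((measure_mono Tube.D_subset_B).trans_lt measure_ball_lt_top).ne
  have bound2 : ∀ k, ∫⁻ y in (A.T i).D, ‖(J i).R y - Q₀‖ₑ ^ 2 ≤
      4 * (C' * (4 * (C * ENNReal.ofReal (h (φ k)) ^ 2) + 4 * a (h (φ k)))) +
        4 * (‖Q (φ k) - Q₀‖ₑ ^ 2 * volume (A.T i).D) := by
    intro k
    have hm3 : AEStronglyMeasurable (fun y => Q (φ k) - (J i).R y) (volume.restrict (A.T i).D) := by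
      have := (aestronglyMeasurable_const (b := Q (φ k))).sub hmR
      exact this
    refine (lintegral_enorm_sub_sq_le (k := fun _ => Q (φ k)) hm3).trans ?_
    gcongr
    · refine (le_of_eq ?_).trans (bound (φ k))
      exact lintegral_congr fun z => by rw [← enorm_neg, neg_sub]
    · rw [setLIntegral_const]
  have hφlim : Tendsto (fun k => h (φ k)) atTop (𝓝[>] 0) := hlim.comp hφ.tendsto_atTop
  have t1 : Tendsto (fun k => ENNReal.ofReal (h (φ k))) atTop (𝓝 0) := by
    have := ENNReal.tendsto_ofReal (hφlim.mono_right nhdsWithin_le_nhds)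
    simpa using this
  have t2 : Tendsto (fun k => a (h (φ k))) atTop (𝓝 0) := ha.comp hφlim
  have t3 : Tendsto (fun k => ‖Q (φ k) - Q₀‖ₑ) atTop (𝓝 0) := hlimQ.enorm_sub_const
  have t4 : Tendsto (fun k => 4 * (C' * (4 * (C * ENNReal.ofReal (h (φ k)) ^ 2) + 4 * a (h (φ k)))) +
        4 * (‖Q (φ k) - Q₀‖ₑ ^ 2 * volume (A.T i).D)) atTop (𝓝 0) := by
    have s1 : Tendsto (fun k => 4 * (C * ENNReal.ofReal (h (φ k)) ^ 2)) atTop (𝓝 0) := by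
      have := ENNReal.Tendsto.const_mul (a := 4) (ENNReal.Tendsto.const_mul (a := (C : ℝ≥0∞))
        (ENNReal.Tendsto.pow (n := 2) t1) (Or.inr (by simp))) (Or.inr (by simp))
      simpa using this
    have s2 : Tendsto (fun k => 4 * a (h (φ k))) atTop (𝓝 0) := by
      have := ENNReal.Tendsto.const_mul (a := 4) t2 (Or.inr (by simp))
      simpa using this
    have s3 := ENNReal.Tendsto.const_mul (a := 4) (ENNReal.Tendsto.const_mul (a := (C' : ℝ≥0∞))
      (s1.add s2) (Or.inr (by simp))) (Or.inr (by simp))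
    have s4 := ENNReal.Tendsto.const_mul (a := 4) (ENNReal.Tendsto.mul_const
      (b := volume (A.T i).D) (ENNReal.Tendsto.pow (n := 2) t3) (Or.inr hfin)) (Or.inr (by simp))
    simpa using s3.add s4
  have hzero : ∫⁻ y in (A.T i).D, ‖(J i).R y - Q₀‖ₑ ^ 2 = 0 :=
    le_antisymm (ge_of_tendsto' t4 bound2) zero_le
  have hm4 : AEStronglyMeasurable (fun y => (J i).R y - Q₀) (volume.restrict (A.T i).D) := by
    have := hmR.sub (aestronglyMeasurable_const (b := Q₀))
    exact this
  rw [lintegral_eq_zero_iff' (hm4.enorm.pow_const 2)] at hzero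
  filter_upwards [hzero] with y hy
  have : ‖(J i).R y - Q₀‖ₑ = 0 := by simpa using hy
  exact eq_of_enorm_sub_eq_zero this

end ConstantRotation

/-! ### From coordinates to area on the surface; rigid motions. -/

section SurfaceMeasure

variable {M S : Set E3} {n : E3 → E3} {w : E3 → E3}

theorem volume_eq_zero_iff_hausdorffMeasure {s : Set E2} :
    volume s = 0 ↔ (Measure.hausdorffMeasure 2 : Measure E2) s = 0 := by
  have h2 : (Measure.hausdorffMeasure 2 : Measure E2) =
      Measure.hausdorffMeasure (Module.finrank ℝ E2) := by simp
  have e1 : (volume : Measure E2) = Measure.addHaarScalarFactor (volume : Measure E2)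
    (Measure.hausdorffMeasure (Module.finrank ℝ E2)) •
      Measure.hausdorffMeasure (Module.finrank ℝ E2) := Measure.isAddLeftInvariant_eq_smul _ _
  have e2 : (Measure.hausdorffMeasure (Module.finrank ℝ E2) : Measure E2) =
    Measure.addHaarScalarFactor (Measure.hausdorffMeasure (Module.finrank ℝ E2) : Measure E2)
      volume • volume := Measure.isAddLeftInvariant_eq_smul _ _
  rw [h2]
  constructor
  · intro h
    rw [e2, Measure.smul_apply, h, smul_zero]
  · intro h
    rw [e1, Measure.smul_apply, h, smul_zero]

/-- `X` is Lipschitz on the ball and `P` is a Lipschitz inverse, so null sets for area and for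
Lebesgue measure correspond. -/
theorem Tube.hausdorffMeasure_image_X_eq_zero {T : Tube M S n} {s : Set E2} (hs : s ⊆ T.B) :
    (Measure.hausdorffMeasure 2 : Measure E3) (T.X '' s) = 0 ↔ volume s = 0 := by
  constructor
  · intro h
    rw [volume_eq_zero_iff_hausdorffMeasure]
    have h1 : T.P '' (T.X '' s) = s := by
      rw [← Set.image_comp]
      exact (Set.image_congr fun y hy => P_X (hs hy)).trans (Set.image_id _)
    have hsub : T.X '' s ⊆ T.W := by
      rintro _ ⟨y, hy, rfl⟩; exact X_mem_W (hs hy)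
    have := (T.lipschitzOn_P.mono hsub).hausdorffMeasure_image_le (d := 2) (by norm_num)
    rw [h1, h, mul_zero] at this
    exact le_antisymm this zero_le
  · intro h
    rw [volume_eq_zero_iff_hausdorffMeasure] at h
    have := (T.lipschitzOn_X.mono hs).hausdorffMeasure_image_le (d := 2) (by norm_num)
    rw [h, mul_zero] at this
    exact le_antisymm this zero_le

/-- Nonempty relatively open pieces have positive area. So two affine maps that agree with `w`
almost everywhere on overlapping pieces have the same constant, and almost everywhere equality
becomes equality for continuous representatives. -/
theorem TubeAtlas.hausdorffMeasure_inter_pos (A : TubeAtlas M S n)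
    (hS : ∃ U : Set E3, IsOpen U ∧ S = M ∩ U) {p : E3} (hp : p ∈ S) {U : Set E3}
    (hU : IsOpen U) (hpU : p ∈ U) : (Measure.hausdorffMeasure 2 : Measure E3) (S ∩ U) ≠ 0 := by
  obtain ⟨i, y, hy, rfl⟩ := A.covers p (subset_closure hp)
  intro h0
  have hO : IsOpen ((A.T i).D ∩ (A.T i).X ⁻¹' U) :=
    ((Tube.contDiffOn_X.continuousOn.mono Tube.D_subset_B).isOpen_inter_preimage
      (Tube.isOpen_D hS) hU)
  have h1 : volume ((A.T i).D ∩ (A.T i).X ⁻¹' U) = 0 := by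
    rw [← Tube.hausdorffMeasure_image_X_eq_zero (Set.inter_subset_left.trans Tube.D_subset_B)]
    refine measure_mono_null ?_ h0
    rintro _ ⟨y', hy', rfl⟩
    exact ⟨hy'.1.2, hy'.2⟩
  exact (hO.measure_pos volume ⟨y, ⟨hy, hp⟩, hpU⟩).ne' h1

theorem TubeAtlas.eqOnSurface_of_ae (A : TubeAtlas M S n)
    (hS : ∃ U : Set E3, IsOpen U ∧ S = M ∩ U) {g : E3 → E3} (hg : Continuous g)
    (h : ∀ᵐ x ∂(Measure.hausdorffMeasure 2 : Measure E3), x ∈ S → w x = g x) :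
    EqOnSurface S w g := by
  refine ⟨h, fun hw x hx => ?_⟩
  by_contra hne
  have hc : ContinuousOn (fun x => w x - g x) S := hw.sub hg.continuousOn
  obtain ⟨U, hU, hUS⟩ := continuousOn_iff'.1 hc {0}ᶜ isOpen_compl_singleton
  have hxU : x ∈ U := by
    have : x ∈ (fun x => w x - g x) ⁻¹' {0}ᶜ ∩ S := ⟨by simpa [sub_eq_zero] using hne, hx⟩
    rw [hUS] at this
    exact this.1
  refine A.hausdorffMeasure_inter_pos hS hx hU hxU (measure_mono_null ?_ h)
  rintro y ⟨hyS, hyU⟩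
  have : y ∈ (fun x => w x - g x) ⁻¹' {0}ᶜ ∩ S := by rw [hUS]; exact ⟨hyU, hyS⟩
  simp only [Set.mem_compl_iff, Set.mem_ofPred_eq]
  intro h'
  exact this.1 (sub_eq_zero.2 (h' hyS))

/-- An isometry with constant rotation is a rigid motion. -/
theorem TubeAtlas.exists_ae_eq (A : TubeAtlas M S n) (hS : IsC2LipschitzDomain M S)
    {J : ∀ i, TubeIsometry (A.T i) w} {Q : E3 →L[ℝ] E3}
    (hQ : ∀ i, ∀ᵐ y ∂volume.restrict (A.T i).D, (J i).R y = Q) :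
    ∃ a : E3, ∀ᵐ x ∂(Measure.hausdorffMeasure 2 : Measure E3), x ∈ S → w x = Q x + a := by
  have hSo := hS.relOpen
  let good : E3 → Set E3 → Prop := fun a U => IsOpen U ∧
    ∀ᵐ x ∂(Measure.hausdorffMeasure 2 : Measure E3), x ∈ S → x ∈ U → w x = Q x + a
  have hloc : ∀ p ∈ S, ∃ a U, p ∈ U ∧ good a U := by
    intro p hp
    obtain ⟨i, y, hy, rfl⟩ := A.covers p (subset_closure hp)
    set T := A.T i
    have hD : IsOpen T.D := Tube.isOpen_D hSo
    have hyD : y ∈ T.D := ⟨hy, hp⟩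
    -- The difference of `w` and `Q` in coordinates has vanishing weak gradient, hence is constant
    -- on a small ball.
    have w1 := ((J i).weak_G.mono Tube.D_subset).sub (HasWeakFDerivOn.clm_comp
      (HasWeakFDerivOn.of_contDiffOn (Tube.contDiffOn_X.mono Tube.D_subset_B) hD) Q)
    have hz : (fun y => (J i).G y - Q.comp (fderiv ℝ T.X y)) =ᵐ[volume.restrict T.D] 0 := by
      filter_upwards [hQ i, TubeIsometry.ae_good (J := J i) hSo] with y hy hg
      have : (J i).G y = Q.comp (fderiv ℝ T.X y) :=
        ContinuousLinearMap.ext fun ξ => by rw [← hg.R_spec.2.1 ξ, hy]; rfl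
      exact sub_eq_zero.2 this
    obtain ⟨r, hr, hrD, a, ha⟩ := w1.exists_ae_eq_const hD hz hyD
    obtain ⟨U, hU, hUX⟩ := T.chart.image_eq_inter (B := Metric.ball y r) Metric.isOpen_ball
      (hrD.trans (Tube.D_subset_B.trans Tube.B_subset))
    have hpU : T.X y ∈ U := (hUX.subset ⟨y, Metric.mem_ball_self hr, rfl⟩).2
    refine ⟨a, U, hpU, hU, ?_⟩
    rw [ae_restrict_iff' measurableSet_ball] at ha
    have hnull : (Measure.hausdorffMeasure 2 : Measure E3)
        (T.X '' {y' | ¬(y' ∈ Metric.ball y r → (w ∘ T.X) y' - Q (T.X y') = a)}) = 0 := by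
      rw [Tube.hausdorffMeasure_image_X_eq_zero]
      · exact ha
      · intro y' hy'
        simp only [Set.mem_ofPred_eq, not_forall] at hy'
        exact Tube.D_subset_B (hrD hy'.1)
    refine measure_mono_null ?_ hnull
    intro x hx
    simp only [Set.mem_compl_iff, Set.mem_ofPred_eq, not_forall] at hx
    obtain ⟨hxS, hxU, hne⟩ := hx
    obtain ⟨y', hy', rfl⟩ := hUX.superset ⟨hS.closure_subset (subset_closure hxS), hxU⟩
    refine ⟨y', ?_, rfl⟩
    simp only [Set.mem_ofPred_eq, not_forall]
    refine ⟨hy', fun h => hne ?_⟩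
    rw [← h]; simp
  obtain ⟨p₀, hp₀⟩ := hS.connected.nonempty
  obtain ⟨a, U₀, hpU₀, hU₀⟩ := hloc p₀ hp₀
  refine ⟨a, ?_⟩
  -- The open sets with constant `a` and those with another constant cover `S`. They do not meet in
  -- `S`: a common point would give a set of positive area on which both constants hold.
  -- Connectedness excludes the second kind.
  have hconn := isPreconnected_iff_subset_of_disjoint.1 hS.connected.isPreconnected
    (⋃₀ {U | good a U}) (⋃₀ {U | ∃ b, b ≠ a ∧ good b U}) (isOpen_sUnion fun U hU => hU.1)
    (isOpen_sUnion fun U ⟨b, _, hU⟩ => hU.1) (fun p hp => by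
      obtain ⟨b, U, hpU, hU⟩ := hloc p hp
      by_cases hb : b = a
      · subst hb; exact Or.inl ⟨U, hU, hpU⟩
      · exact Or.inr ⟨U, ⟨b, hb, hU⟩, hpU⟩) (by
      rw [Set.eq_empty_iff_forall_notMem]
      rintro p ⟨hpS, ⟨U, hU, hpU⟩, ⟨U', ⟨b, hb, hU'⟩, hpU'⟩⟩
      refine A.hausdorffMeasure_inter_pos hSo hpS (hU.1.inter hU'.1) ⟨hpU, hpU'⟩ ?_
      have : ∀ᵐ x ∂(Measure.hausdorffMeasure 2 : Measure E3), ¬(x ∈ S ∩ (U ∩ U')) := by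
        filter_upwards [hU.2, hU'.2] with x h1 h2 hx
        exact hb (add_left_cancel ((h2 hx.1 hx.2.2).symm.trans (h1 hx.1 hx.2.1)))
      simp only [ae_iff, not_not] at this
      exact this)
  have hsub : S ⊆ ⋃₀ {U | good a U} := by
    rcases hconn with h | h
    · exact h
    · exfalso
      obtain ⟨U', ⟨b, hb, hU'⟩, hpU'⟩ := h hp₀
      refine A.hausdorffMeasure_inter_pos hSo hp₀ (hU₀.1.inter hU'.1) ⟨hpU₀, hpU'⟩ ?_
      have : ∀ᵐ x ∂(Measure.hausdorffMeasure 2 : Measure E3), ¬(x ∈ S ∩ (U₀ ∩ U')) := by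
        filter_upwards [hU₀.2, hU'.2] with x h1 h2 hx
        exact hb (add_left_cancel ((h2 hx.1 hx.2.2).symm.trans (h1 hx.1 hx.2.1)))
      simp only [ae_iff, not_not] at this
      exact this
  change (Measure.hausdorffMeasure 2 : Measure E3) {x | ¬(x ∈ S → w x = Q x + a)} = 0
  -- Uncountably many good open sets may be involved; second countability lets local nullity
  -- suffice.
  refine measure_null_of_locally_null _ fun x hx => ?_
  simp only [Set.mem_ofPred_eq, not_forall] at hx
  obtain ⟨U, hU, hxU⟩ := hsub hx.1
  refine ⟨_, inter_mem_nhdsWithin _ (hU.1.mem_nhds hxU), measure_mono_null ?_ hU.2⟩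
  rintro x' ⟨hx', hx'U⟩
  simp only [Set.mem_ofPred_eq, not_forall] at hx'
  simp only [Set.mem_compl_iff, Set.mem_ofPred_eq, not_forall]
  exact ⟨hx'.1, hx'U, hx'.2⟩

end SurfaceMeasure

/-! ### The first assertion: unconstrained rigidity. -/

section RigidityOfInequality

variable {M S : Set E3} {n : E3 → E3} {w : E3 → E3}

theorem ofReal_integral_norm_sq {α E : Type*} [MeasurableSpace α] [NormedAddCommGroup E]
    {μ : Measure α} {f : α → E} (hf : MemLp f 2 μ) :
    ENNReal.ofReal (∫ x, ‖f x‖ ^ 2 ∂μ) = ∫⁻ x, ‖f x‖ₑ ^ 2 ∂μ := by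
  rw [ofReal_integral_eq_lintegral_ofReal hf.norm.integrable_sq (ae_of_all _ fun x => by positivity)]
  exact lintegral_congr fun x => by rw [ENNReal.ofReal_pow (norm_nonneg _), ofReal_norm]

theorem ofReal_integral_le_lintegral {α : Type*} [MeasurableSpace α] {μ : Measure α} {f : α → ℝ}
    (hf : ∀ x, 0 ≤ f x) : ENNReal.ofReal (∫ x, f x ∂μ) ≤ ∫⁻ x, ENNReal.ofReal (f x) ∂μ := by
  by_cases hi : Integrable f μ
  · exact (ofReal_integral_eq_lintegral_ofReal hi (ae_of_all _ hf)).le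
  -- A nonintegrable function has integral zero by convention, which is harmless for this
  -- inequality.
  · rw [integral_undef hi]; simp

theorem memLp_sub_const {α E : Type*} [MeasurableSpace α] [NormedAddCommGroup E]
    {μ : Measure α} [IsFiniteMeasure μ] {f : α → E} (hf : MemLp f 2 μ) (Q : E) :
    MemLp (fun x => f x - Q) 2 μ := hf.sub (memLp_const Q)

theorem TubeAtlas.isFiniteMeasure_shell (A : TubeAtlas M S n) {h : ℝ} (hh : h ≤ A.h₁) :
    IsFiniteMeasure (volume.restrict (shell S n h)) := by
  have := A.finite
  have := Fintype.ofFinite A.ι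
  refine ⟨?_⟩
  rw [Measure.restrict_apply_univ, A.shell_eq]
  refine (measure_iUnion_le _).trans_lt ?_
  rw [tsum_fintype]
  refine ENNReal.sum_lt_top.2 fun i _ => ?_
  have := (A.T i).isFiniteMeasure_Ω (hh.trans (A.h₁_le i))
  have h1 := measure_lt_top (volume.restrict ((A.T i).Ω h)) Set.univ
  rwa [Measure.restrict_apply_univ] at h1

/-- The exponents combine as h^(-μ) h³ = h h^(2-μ). The factor h is the thickness and the rest tends
to zero when μ < 2. -/
theorem lintegral_le_of_rigidity {h μ C₀ : ℝ} {C : ℝ≥0} {O : Set E3}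
    [IsFiniteMeasure (volume.restrict O)] {Γ : E3 → E3 →L[ℝ] E3} {Q : E3 →L[ℝ] E3}
    (h0 : 0 < h) (hC₀ : 0 < C₀) (hΓ : MemLp Γ 2 (volume.restrict O))
    (hdist : ∫⁻ z in O, ENNReal.ofReal (Metric.infDist (Γ z) SO3 ^ 2) ≤ C * ENNReal.ofReal h ^ 3)
    (hineq : ∫ z in O, ‖Γ z - Q‖ ^ 2 ≤ C₀ / h ^ μ * ∫ z in O, Metric.infDist (Γ z) SO3 ^ 2) :
    ∫⁻ z in O, ‖Γ z - Q‖ₑ ^ 2 ≤ ENNReal.ofReal h * ENNReal.ofReal (C₀ * C * h ^ (2 - μ)) := by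
  have hm := memLp_sub_const hΓ Q
  have e1 := ofReal_integral_norm_sq hm
  refine (le_of_eq e1.symm).trans ?_
  rw [← ENNReal.ofReal_mul h0.le]
  refine ENNReal.ofReal_le_ofReal (hineq.trans ?_)
  have h2 : ∫ z in O, Metric.infDist (Γ z) SO3 ^ 2 ≤ C * h ^ 3 := by
    have h3 := (ofReal_integral_le_lintegral (μ := volume.restrict O)
      (f := fun z => Metric.infDist (Γ z) SO3 ^ 2) fun z => by positivity).trans hdist
    have h4 : (C : ℝ≥0∞) * ENNReal.ofReal h ^ 3 = ENNReal.ofReal (C * h ^ 3) := by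
      rw [ENNReal.ofReal_mul C.coe_nonneg, ENNReal.ofReal_pow h0.le, ENNReal.ofReal_coe_nnreal]
    rw [h4] at h3
    exact (ENNReal.ofReal_le_ofReal_iff (by positivity)).1 h3
  have hp : 0 < h ^ μ := Real.rpow_pos_of_pos h0 μ
  calc _ ≤ C₀ / h ^ μ * (C * h ^ 3) := by gcongr
    _ = _ := by
      rw [Real.rpow_sub h0, Real.rpow_two]
      field_simp

theorem tendsto_ofReal_mul_rpow {c p : ℝ} (hp : 0 < p) :
    Tendsto (fun h : ℝ => ENNReal.ofReal (c * h ^ p)) (𝓝[>] 0) (𝓝 0) := by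
  have h1 : Tendsto (fun h : ℝ => c * h ^ p) (𝓝 0) (𝓝 (c * 0 ^ p)) :=
    ((Real.continuousAt_rpow_const 0 p (Or.inr hp.le)).tendsto).const_mul c
  rw [Real.zero_rpow hp.ne', mul_zero] at h1
  have := ENNReal.tendsto_ofReal (h1.mono_left (nhdsWithin_le_nhds (s := Set.Ioi 0)))
  simpa using this

theorem IsC2LipschitzDomain.rigid_of_rigidityIneq (hS : IsC2LipschitzDomain M S)
    (hn : IsUnitNormal M S n) {μ : ℝ} (hμ : μ < 2) (hR : RigidityIneq S n μ)
    (hw : IsW22Isometry M S w) :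
    ∃ R ∈ SO3, ∃ a : E3, EqOnSurface S w (fun x => R x + a) := by
  obtain ⟨A⟩ := hS.nonempty_tubeAtlas hn
  have J : ∀ i, TubeIsometry (A.T i) w := fun i => ((A.T i).exists_tubeIsometry hS.relOpen hw).some
  obtain ⟨u, Γ, C, -, hW, hΓR, hdist⟩ := A.exists_shell_map hS.relOpen hn J
  obtain ⟨C₀, hC₀, h₀, hh₀, hineq⟩ := hR
  obtain ⟨Q, hQ, hQR⟩ := A.exists_R_ae_eq hS.relOpen (J := J)
    (fun h h0 hh => (hW h h0 hh).memLp_grad.1) hΓR isCompact_SO3 (lt_min hh₀ A.h₁_pos)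
    (min_le_right _ _) (tendsto_ofReal_mul_rpow (c := C₀ * C) (sub_pos.2 hμ)) fun h h0 hh => by
      have hh₁ : h ≤ A.h₁ := (hh.trans_le (min_le_right _ _)).le
      obtain ⟨Q, hQ, hQi⟩ := hineq h h0 (hh.trans_le (min_le_left _ _)) u Γ (hW h h0 hh₁)
      have := A.isFiniteMeasure_shell hh₁
      exact ⟨Q, hQ, lintegral_le_of_rigidity h0 hC₀ (hW h h0 hh₁).memLp_grad (hdist h h0 hh₁) hQi⟩
  obtain ⟨a, ha⟩ := A.exists_ae_eq hS hQR
  exact ⟨Q, hQ, a, A.eqOnSurface_of_ae hS.relOpen (Q.continuous.add continuous_const) ha⟩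

end RigidityOfInequality

/-! ### Smallness in the mean at a point, and traces. -/

section MeanZero

variable {d : ℕ} {D D' : Set (EuclideanSpace ℝ (Fin d))} {g g' : EuclideanSpace ℝ (Fin d) → ℝ≥0∞}
  {y : EuclideanSpace ℝ (Fin d)}

/-- The integral of `g` over `D ∩ B(y, r)` is of smaller order than the volume of the ball. -/
def MeanZero (D : Set (EuclideanSpace ℝ (Fin d))) (g : EuclideanSpace ℝ (Fin d) → ℝ≥0∞)
    (y : EuclideanSpace ℝ (Fin d)) : Prop :=
  ∀ ε : ℝ≥0, 0 < ε → ∀ᶠ r in 𝓝[>] (0 : ℝ),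
    ∫⁻ z in D ∩ Metric.ball y r, g z ≤ ε * ENNReal.ofReal r ^ d

theorem volume_ball_eq {d : ℕ} (y : EuclideanSpace ℝ (Fin d)) {r : ℝ} (hr : 0 < r) :
    volume (Metric.ball y r) =
      ENNReal.ofReal r ^ d * volume (Metric.ball (0 : EuclideanSpace ℝ (Fin d)) 1) := by
  rw [Measure.addHaar_ball_of_pos volume y hr, ENNReal.ofReal_pow hr.le, finrank_euclideanSpace_fin]

/-- The volume of the unit ball. -/
noncomputable def unitBallVolume (d : ℕ) : ℝ≥0 :=
  (volume (Metric.ball (0 : EuclideanSpace ℝ (Fin d)) 1)).toNNReal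

theorem coe_unitBallVolume (d : ℕ) :
    (unitBallVolume d : ℝ≥0∞) = volume (Metric.ball (0 : EuclideanSpace ℝ (Fin d)) 1) :=
  ENNReal.coe_toNNReal measure_ball_lt_top.ne

theorem unitBallVolume_pos (d : ℕ) : 0 < unitBallVolume d := by
  rw [← ENNReal.coe_pos, coe_unitBallVolume]
  exact Metric.measure_ball_pos volume _ one_pos

theorem volume_ball_eq_mul (y : EuclideanSpace ℝ (Fin d)) {r : ℝ} (hr : 0 < r) :
    volume (Metric.ball y r) = unitBallVolume d * ENNReal.ofReal r ^ d := by
  rw [volume_ball_eq y hr, coe_unitBallVolume, mul_comm]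

namespace MeanZero

theorem mono (h : MeanZero D g' y) {C : ℝ≥0} (hg : ∀ᵐ z ∂volume.restrict D, g z ≤ C * g' z) :
    MeanZero D g y := by
  intro ε hε
  have hC : 0 < ε / (C + 1) := by positivity
  filter_upwards [h _ hC] with r hr
  calc ∫⁻ z in D ∩ Metric.ball y r, g z ≤ ∫⁻ z in D ∩ Metric.ball y r, C * g' z :=
        lintegral_mono_ae (ae_restrict_of_ae_restrict_of_subset Set.inter_subset_left hg)
    _ = C * ∫⁻ z in D ∩ Metric.ball y r, g' z := lintegral_const_mul' _ _ ENNReal.coe_ne_top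
    _ ≤ C * (((ε / (C + 1) : ℝ≥0) : ℝ≥0∞) * ENNReal.ofReal r ^ d) := by gcongr
    _ ≤ ε * ENNReal.ofReal r ^ d := by
        rw [← mul_assoc]
        gcongr
        rw [← ENNReal.coe_mul, ENNReal.coe_le_coe, ← mul_div_assoc]
        refine div_le_of_le_mul₀ zero_le zero_le ?_
        rw [mul_comm]
        gcongr
        exact le_self_add

theorem congr_set (h : MeanZero D g y) {ρ : ℝ} (hρ : 0 < ρ)
    (hD : D' ∩ Metric.ball y ρ ⊆ D) : MeanZero D' g y := by
  intro ε hε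
  filter_upwards [h ε hε, Ioo_mem_nhdsGT hρ] with r hr hrρ
  refine (lintegral_mono_set ?_).trans hr
  exact fun z hz => ⟨hD ⟨hz.1, Metric.ball_subset_ball hrρ.2.le hz.2⟩, hz.2⟩

theorem add (h : MeanZero D g y) (h' : MeanZero D g' y) (hg : AEMeasurable g (volume.restrict D)) :
    MeanZero D (fun z => g z + g' z) y := by
  intro ε hε
  filter_upwards [h _ (half_pos hε), h' _ (half_pos hε)] with r hr hr'
  rw [lintegral_add_left' (hg.mono_measure (Measure.restrict_mono Set.inter_subset_left le_rfl))]
  refine (add_le_add hr hr').trans (le_of_eq ?_)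
  rw [← add_mul, ← ENNReal.coe_add, add_halves]

theorem of_eventually_le (h : ∀ ε : ℝ≥0, 0 < ε → ∀ᶠ z in 𝓝[D] y, g z ≤ ε) (hD : MeasurableSet D) :
    MeanZero D g y := by
  intro ε hε
  have hV := unitBallVolume_pos d
  have h1 := h (ε / unitBallVolume d) (by positivity)
  rw [eventually_nhdsWithin_iff, Metric.eventually_nhds_iff_ball] at h1
  obtain ⟨ρ, hρ, hb⟩ := h1
  filter_upwards [Ioo_mem_nhdsGT hρ] with r hr
  calc ∫⁻ z in D ∩ Metric.ball y r, g z
      ≤ ∫⁻ z in D ∩ Metric.ball y r, ((ε / unitBallVolume d : ℝ≥0) : ℝ≥0∞) :=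
        setLIntegral_mono' (hD.inter measurableSet_ball)
          fun z hz => hb z (Metric.ball_subset_ball hr.2.le hz.2) hz.1
    _ = ((ε / unitBallVolume d : ℝ≥0) : ℝ≥0∞) * volume (D ∩ Metric.ball y r) := setLIntegral_const _ _
    _ ≤ ((ε / unitBallVolume d : ℝ≥0) : ℝ≥0∞) * (unitBallVolume d * ENNReal.ofReal r ^ d) := by
        rw [← volume_ball_eq_mul y hr.1]
        gcongr
        exact Set.inter_subset_right
    _ = ε * ENNReal.ofReal r ^ d := by
        rw [← mul_assoc, ← ENNReal.coe_mul, div_mul_cancel₀ _ hV.ne']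

theorem scale (h : MeanZero D g y) {m : ℝ≥0} (hm : 0 < m) {ε : ℝ≥0} (hε : 0 < ε) :
    ∀ᶠ r in 𝓝[>] (0 : ℝ), ∫⁻ z in D ∩ Metric.ball y (m * r), g z ≤ ε * ENNReal.ofReal r ^ d := by
  have h1 : Tendsto (fun r : ℝ => m * r) (𝓝[>] 0) (𝓝[>] 0) := by
    refine tendsto_nhdsWithin_iff.2 ⟨?_, ?_⟩
    · have : Tendsto (fun r : ℝ => m * r) (𝓝 0) (𝓝 (m * 0)) := tendsto_id.const_mul _
      rw [mul_zero] at this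
      exact this.mono_left nhdsWithin_le_nhds
    · filter_upwards [self_mem_nhdsWithin] with r hr
      have : (0 : ℝ) < r := hr
      have hm' : (0 : ℝ) < m := hm
      exact mul_pos hm' this
  filter_upwards [h1.eventually (h (ε / m ^ d) (by positivity)), self_mem_nhdsWithin] with r hr hr0
  refine hr.trans (le_of_eq ?_)
  rw [ENNReal.ofReal_mul m.coe_nonneg, mul_pow, ENNReal.ofReal_coe_nnreal, ← mul_assoc,
    ← ENNReal.coe_pow, ← ENNReal.coe_mul, div_mul_cancel₀ _ (by positivity)]

/-- A Cauchy–Schwarz argument in the form x ≤ δ + x²/δ. -/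
theorem of_sq (h : MeanZero D (fun z => g z ^ 2) y) : MeanZero D g y := by
  intro ε hε
  have hV := unitBallVolume_pos d
  -- With this choice the constant term contributes at most half of `ε` on the ball; the quadratic
  -- term is then allowed the other half.
  set δ : ℝ≥0 := ε / (2 * unitBallVolume d) with hδ
  have hδ0 : 0 < δ := by positivity
  filter_upwards [h (ε / 2 * δ) (by positivity), self_mem_nhdsWithin] with r hr hr0
  have hpt : ∀ x : ℝ≥0∞, x ≤ δ + (δ⁻¹ : ℝ≥0) * x ^ 2 := by
    intro x
    rcases le_total x δ with hx | hx
    · exact hx.trans le_self_add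
    · refine le_trans ?_ le_add_self
      have h1 : (1 : ℝ≥0∞) ≤ (δ⁻¹ : ℝ≥0) * x := by
        calc (1 : ℝ≥0∞) = (δ⁻¹ : ℝ≥0) * δ := by
              rw [← ENNReal.coe_mul, inv_mul_cancel₀ hδ0.ne', ENNReal.coe_one]
          _ ≤ _ := by gcongr
      calc x = 1 * x := (one_mul x).symm
        _ ≤ ((δ⁻¹ : ℝ≥0) * x) * x := by gcongr
        _ = _ := by ring
  calc ∫⁻ z in D ∩ Metric.ball y r, g z
      ≤ ∫⁻ z in D ∩ Metric.ball y r, ((δ : ℝ≥0∞) + (δ⁻¹ : ℝ≥0) * g z ^ 2) :=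
        lintegral_mono fun z => hpt (g z)
    _ = δ * volume (D ∩ Metric.ball y r) + (δ⁻¹ : ℝ≥0) * ∫⁻ z in D ∩ Metric.ball y r, g z ^ 2 := by
        rw [lintegral_add_left measurable_const, setLIntegral_const,
          lintegral_const_mul' _ _ ENNReal.coe_ne_top]
    _ ≤ δ * (unitBallVolume d * ENNReal.ofReal r ^ d) +
        (δ⁻¹ : ℝ≥0) * (((ε / 2 * δ : ℝ≥0) : ℝ≥0∞) * ENNReal.ofReal r ^ d) := by
        gcongr
        rw [← volume_ball_eq_mul y hr0]
        exact measure_mono Set.inter_subset_right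
    _ = ε * ENNReal.ofReal r ^ d := by
        rw [← mul_assoc, ← mul_assoc, ← add_mul, ← ENNReal.coe_mul, ← ENNReal.coe_mul,
          ← ENNReal.coe_add]
        congr 2
        rw [hδ]
        field_simp
        norm_num

end MeanZero

theorem HasTraceAt.meanZero {F : Type*} [NormedAddCommGroup F]
    {f : EuclideanSpace ℝ (Fin d) → F} {v : F} (h : HasTraceAt D f y v) :
    MeanZero D (fun z => ‖f z - v‖ₑ) y := by
  intro ε hε
  have hV := unitBallVolume_pos d
  have h1 : (0 : ℝ≥0∞) < ((ε / unitBallVolume d : ℝ≥0) : ℝ≥0∞) := by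
    rw [ENNReal.coe_pos]; positivity
  filter_upwards [Filter.Tendsto.eventually_lt_const h1 h, self_mem_nhdsWithin] with r hr hr0
  have hfin : volume (D ∩ Metric.ball y r) ≠ ∞ :=
    ((measure_mono Set.inter_subset_right).trans_lt measure_ball_lt_top).ne
  have hfin' : IsFiniteMeasure (volume.restrict (D ∩ Metric.ball y r)) :=
    ⟨by rw [Measure.restrict_apply_univ]; exact hfin.lt_top⟩
  rw [← measure_mul_laverage, Measure.restrict_apply_univ]
  calc _ ≤ (unitBallVolume d * ENNReal.ofReal r ^ d) * ((ε / unitBallVolume d : ℝ≥0) : ℝ≥0∞) := by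
        rw [← volume_ball_eq_mul y hr0]
        gcongr
        exact Set.inter_subset_right
    _ = _ := by
        rw [mul_right_comm, ← ENNReal.coe_mul, mul_div_cancel₀ _ hV.ne']

/-- Traces average over the part of the ball inside the domain, whereas `MeanZero` normalizes by the
full power of the radius. The lower density bound makes the two equivalent. -/
theorem MeanZero.hasTraceAt {F : Type*} [NormedAddCommGroup F]
    {f : EuclideanSpace ℝ (Fin d) → F} {v : F} (h : MeanZero D (fun z => ‖f z - v‖ₑ) y)
    {c : ℝ≥0} (hc : 0 < c)
    (hD : ∀ᶠ r in 𝓝[>] (0 : ℝ), c * ENNReal.ofReal r ^ d ≤ volume (D ∩ Metric.ball y r)) :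
    HasTraceAt D f y v := by
  rw [HasTraceAt, ENNReal.tendsto_nhds_zero]
  intro ε hε
  obtain ⟨ε', hε'0, hε'⟩ := ENNReal.lt_iff_exists_nnreal_btwn.1 hε
  have hε'0 : 0 < ε' := by exact_mod_cast hε'0
  filter_upwards [h (ε' * c) (by positivity), hD, self_mem_nhdsWithin] with r hr hr' hr0
  have hr0' : ENNReal.ofReal r ≠ 0 := by simpa using hr0
  rw [setLAverage_eq]
  refine ENNReal.div_le_of_le_mul ?_
  refine hr.trans ?_
  rw [ENNReal.coe_mul, mul_assoc]
  gcongr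

end MeanZero

/-! ### Cones above boundary points. -/

section Cone

/-- The open upward cone of slope `κ` at `y`. -/
def upCone (κ : ℝ≥0) (y : E2) : Set E2 := {z | κ * |z 0 - y 0| < z 1 - y 1}

theorem isOpen_upCone (κ : ℝ≥0) (y : E2) : IsOpen (upCone κ y) :=
  isOpen_lt (by fun_prop) (by fun_prop)

theorem convex_upCone (κ : ℝ≥0) (y : E2) : Convex ℝ (upCone κ y) := by
  intro u hu v hv a b ha hb hab
  simp only [upCone, Set.mem_ofPred_eq] at hu hv ⊢
  have e : ∀ j, (a • u + b • v) j - y j = a * (u j - y j) + b * (v j - y j) := by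
    intro j
    simp only [PiLp.add_apply, PiLp.smul_apply, smul_eq_mul]
    linear_combination (y j) * hab
  rw [e, e]
  have h1 : |a * (u 0 - y 0) + b * (v 0 - y 0)| ≤ a * |u 0 - y 0| + b * |v 0 - y 0| := by
    refine (abs_add_le _ _).trans ?_
    rw [abs_mul, abs_mul, abs_of_nonneg ha, abs_of_nonneg hb]
  have h2 := mul_le_mul_of_nonneg_left h1 κ.coe_nonneg
  rcases ha.eq_or_lt with rfl | ha'
  · have : b = 1 := by linarith
    subst this; nlinarith
  · nlinarith [mul_lt_mul_of_pos_left hu ha', mul_le_mul_of_nonneg_left hv.le hb]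

theorem abs_apply_le_norm (v : E2) (j : Fin 2) : |v j| ≤ ‖v‖ := PiLp.norm_apply_le v j

theorem ball_subset_upCone (κ : ℝ≥0) (y : E2) {r : ℝ} (hr : 0 < r) :
    Metric.ball (y + (r / 2) • e₂) (r / (4 * (1 + κ))) ⊆ upCone κ y ∩ Metric.ball y r := by
  intro z hz
  have hκ := κ.coe_nonneg
  rw [mem_ball_iff_norm] at hz
  set v := z - (y + (r / 2) • e₂) with hv
  have hzv : z = y + (r / 2) • e₂ + v := by rw [hv]; abel
  have hr4 : r / (4 * (1 + κ)) ≤ r / 4 := by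
    gcongr; linarith
  -- The ball is centred at height `r / 2`; a perturbation of this size cannot lower the point below
  -- the cone.
  have hc : (1 + κ) * ‖v‖ < r / 4 := by
    rw [lt_div_iff₀ (by positivity)] at hz
    linarith
  constructor
  · have h0 : z 0 - y 0 = v 0 := by rw [hzv]; simp [e₂]
    have h1 : z 1 - y 1 = r / 2 + v 1 := by rw [hzv]; simp [e₂]; ring
    rw [upCone, Set.mem_ofPred_eq, h0, h1]
    have a0 := abs_apply_le_norm v 0
    have a1 := (abs_le.1 (abs_apply_le_norm v 1)).1
    nlinarith
  · rw [mem_ball_iff_norm, hzv, show y + (r / 2) • e₂ + v - y = (r / 2) • e₂ + v by abel]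
    refine (norm_add_le _ _).trans_lt ?_
    rw [norm_smul, norm_e₂, Real.norm_of_nonneg (by positivity)]
    linarith

theorem exists_volume_upCone_ge (κ : ℝ≥0) (y : E2) : ∃ c : ℝ≥0, 0 < c ∧ ∀ r : ℝ, 0 < r →
    c * ENNReal.ofReal r ^ 2 ≤ volume (upCone κ y ∩ Metric.ball y r) := by
  have hV := unitBallVolume_pos 2
  refine ⟨(4 * (1 + κ))⁻¹ ^ 2 * unitBallVolume 2, by positivity, fun r hr => ?_⟩
  refine le_trans (le_of_eq ?_) (measure_mono (ball_subset_upCone κ y hr))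
  have hκ := κ.coe_nonneg
  rw [volume_ball_eq_mul _ (by positivity)]
  have : ENNReal.ofReal (r / (4 * (1 + κ))) = ((4 * (1 + κ))⁻¹ : ℝ≥0) * ENNReal.ofReal r := by
    rw [div_eq_inv_mul, ENNReal.ofReal_mul (by positivity)]
    congr 1
    rw [← ENNReal.ofReal_coe_nnreal]
    congr 1
  rw [this, ENNReal.coe_mul, ENNReal.coe_pow]
  ring

end Cone

/-! ### Tubes in which the domain lies above a Lipschitz graph. -/

section GraphTube

variable {M S : Set E3} {n : E3 → E3} {T : Tube M S n} {κ : ℝ≥0} {γ : ℝ → ℝ}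

/-- In the coordinates of the tube, `S` is the region above the graph of `γ`. -/
structure Tube.IsGraph (T : Tube M S n) (κ : ℝ≥0) (γ : ℝ → ℝ) : Prop where
  lipschitz : LipschitzWith κ γ
  mem_iff : ∀ z ∈ T.B, (T.X z ∈ S ↔ γ (z 0) < z 1)

/-- The point of the graph of `γ` over `s`. -/
noncomputable def graphPoint (γ : ℝ → ℝ) (s : ℝ) : E2 := !₂[s, γ s]

@[simp] theorem graphPoint_zero (γ : ℝ → ℝ) (s : ℝ) : graphPoint γ s 0 = s := rfl
@[simp] theorem graphPoint_one (γ : ℝ → ℝ) (s : ℝ) : graphPoint γ s 1 = γ s := rfl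

theorem graphPoint_eq {y : E2} (hy : y 1 = γ (y 0)) : graphPoint γ (y 0) = y := by
  ext j; fin_cases j
  · rfl
  · exact hy.symm

theorem norm_E2_le (v : E2) : ‖v‖ ≤ |v 0| + |v 1| := by
  rw [EuclideanSpace.norm_eq, Fin.sum_univ_two]
  refine Real.sqrt_le_iff.2 ⟨by positivity, ?_⟩
  simp only [Real.norm_eq_abs]
  nlinarith [abs_nonneg (v 0), abs_nonneg (v 1)]

theorem lipschitzWith_graphPoint (h : LipschitzWith κ γ) : LipschitzWith (1 + κ) (graphPoint γ) := by
  refine LipschitzWith.of_dist_le_mul fun s s' => ?_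
  rw [dist_eq_norm]
  refine (norm_E2_le _).trans ?_
  have h1 := h.dist_le_mul s s'
  rw [Real.dist_eq, Real.dist_eq] at h1
  simp only [PiLp.sub_apply, graphPoint_zero, graphPoint_one, NNReal.coe_add, NNReal.coe_one,
    Real.dist_eq]
  linarith

namespace Tube.IsGraph

theorem mem_D (h : T.IsGraph κ γ) {z : E2} : z ∈ T.D ↔ z ∈ T.B ∧ γ (z 0) < z 1 :=
  ⟨fun hz => ⟨hz.1, (h.mem_iff z hz.1).1 hz.2⟩, fun hz => ⟨hz.1, (h.mem_iff z hz.1).2 hz.2⟩⟩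

theorem upCone_subset (h : T.IsGraph κ γ) {y : E2} (hy : y 1 = γ (y 0)) :
    upCone κ y ∩ T.B ⊆ T.D := by
  rintro z ⟨hz, hzB⟩
  refine h.mem_D.2 ⟨hzB, ?_⟩
  have h1 := h.lipschitz.dist_le_mul (z 0) (y 0)
  rw [Real.dist_eq, Real.dist_eq] at h1
  have h2 := (abs_le.1 h1).2
  rw [upCone, Set.mem_ofPred_eq, hy] at hz
  linarith

theorem eventually_ball_subset {y : E2} (hyB : y ∈ T.B) :
    ∀ᶠ r in 𝓝[>] (0 : ℝ), Metric.ball y r ⊆ T.B := by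
  obtain ⟨ρ, hρ, hb⟩ := Metric.isOpen_iff.1 (Tube.isOpen_B (T := T)) y hyB
  filter_upwards [Ioo_mem_nhdsGT hρ] with r hr
  exact (Metric.ball_subset_ball hr.2.le).trans hb

theorem exists_volume_ge (h : T.IsGraph κ γ) {y : E2} (hyB : y ∈ T.B) (hy : y 1 = γ (y 0)) :
    ∃ c : ℝ≥0, 0 < c ∧ ∀ᶠ r in 𝓝[>] (0 : ℝ),
      c * ENNReal.ofReal r ^ 2 ≤ volume (T.D ∩ Metric.ball y r) := by
  obtain ⟨c, hc, hcr⟩ := exists_volume_upCone_ge κ y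
  refine ⟨c, hc, ?_⟩
  filter_upwards [eventually_ball_subset hyB, self_mem_nhdsWithin] with r hr hr0
  refine (hcr r hr0).trans (measure_mono ?_)
  exact fun z hz => ⟨h.upCone_subset hy ⟨hz.1, hr hz.2⟩, hz.2⟩

theorem mem_closure (h : T.IsGraph κ γ) {y : E2} (hyB : y ∈ T.B) (hy : y 1 = γ (y 0)) :
    T.X y ∈ closure S := by
  have h1 : y ∈ closure T.D := by
    obtain ⟨c, hc, hcr⟩ := h.exists_volume_ge hyB hy
    rw [Metric.mem_closure_iff]
    intro ε hε
    obtain ⟨r, hr1, hr2⟩ := (hcr.and (Ioo_mem_nhdsGT hε)).exists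
    have : volume (T.D ∩ Metric.ball y r) ≠ 0 := by
      refine (lt_of_lt_of_le ?_ hr1).ne'
      have := hr2.1
      refine ENNReal.mul_pos (by simpa using hc.ne') ?_
      simpa using this
    obtain ⟨z, hz1, hz2⟩ := nonempty_of_measure_ne_zero this
    exact ⟨z, hz1, (Metric.mem_ball'.1 hz2).trans hr2.2⟩
  exact (Tube.hasFDerivAt_X hyB).continuousAt.continuousWithinAt.mem_closure h1 fun z hz => hz.2

theorem mem_surfBoundary (h : T.IsGraph κ γ) {y : E2} (hyB : y ∈ T.B) (hy : y 1 = γ (y 0)) :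
    T.X y ∈ surfBoundary S :=
  ⟨h.mem_closure hyB hy, fun hS => ((h.mem_iff y hyB).1 hS).ne' hy⟩

theorem eq_of_mem_surfBoundary (h : T.IsGraph κ γ) (hSM : S ⊆ M) {y : E2} (hyB : y ∈ T.B)
    (hy : T.X y ∈ surfBoundary S) : y 1 = γ (y 0) := by
  refine le_antisymm (not_lt.1 fun h' => hy.2 ((h.mem_iff y hyB).2 h')) (not_lt.1 fun h' => ?_)
  have hO : IsOpen {z | z ∈ T.B ∧ z 1 < γ (z 0)} :=
    Tube.isOpen_B.inter (isOpen_lt (by fun_prop) (h.lipschitz.continuous.comp (by fun_prop)))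
  obtain ⟨U, hU, hUX⟩ := T.chart.image_eq_inter hO fun z hz => Tube.B_subset hz.1
  obtain ⟨x, hxU, hxS⟩ := mem_closure_iff.1 hy.1 U hU (hUX.subset ⟨y, ⟨hyB, h'⟩, rfl⟩).2
  obtain ⟨z, hz, rfl⟩ := hUX.superset ⟨hSM hxS, hxU⟩
  exact lt_asymm hz.2 ((h.mem_iff z hz.1).1 hxS)

/-- The first coordinate of the projection is Lipschitz, so it maps null sets for length to null
sets of the line. Boundary conditions that hold almost everywhere along ∂S thus hold for almost
every graph parameter. -/
theorem volume_graph_preimage (T : Tube M S n) (γ : ℝ → ℝ) {A : Set E3}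
    (hA : (Measure.hausdorffMeasure 1 : Measure E3) A = 0) :
    volume {s | graphPoint γ s ∈ T.B ∧ T.X (graphPoint γ s) ∈ A} = 0 := by
  have hl : LipschitzOnWith T.K (fun z => T.P z 0) (A ∩ T.W) := by
    intro x hx x' hx'
    refine le_trans ?_ (Tube.lipschitzOn_P hx.2 hx'.2)
    rw [edist_dist, edist_dist]
    refine ENNReal.ofReal_le_ofReal ?_
    rw [Real.dist_eq, dist_eq_norm]
    exact abs_apply_le_norm (T.P x - T.P x') 0
  have h1 := hl.hausdorffMeasure_image_le (d := 1) (by norm_num)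
  rw [measure_mono_null Set.inter_subset_left hA, mul_zero, hausdorffMeasure_real] at h1
  refine measure_mono_null ?_ (le_antisymm h1 zero_le)
  rintro s ⟨hsB, hsA⟩
  exact ⟨_, ⟨hsA, Tube.X_mem_W hsB⟩, by simp [Tube.P_X hsB]⟩

/-- Conversely, a null set of parameters times an interval is null in the plane, and it sweeps out a
null part of the lateral boundary under a Lipschitz map. -/
theorem hausdorffMeasure_Φ_graph (h : T.IsGraph κ γ) {E : Set ℝ} (hE : volume E = 0)
    (hEB : ∀ s ∈ E, graphPoint γ s ∈ T.B) :
    (Measure.hausdorffMeasure 2 : Measure E3)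
      ((fun q : ℝ × ℝ => T.Φ (graphPoint γ q.1, q.2)) '' (E ×ˢ Metric.ball 0 T.δ)) = 0 := by
  have h1 : LipschitzOnWith (T.K * (1 + κ)) (fun q : ℝ × ℝ => T.Φ (graphPoint γ q.1, q.2))
      (E ×ˢ Metric.ball 0 T.δ) := by
    have hl : LipschitzWith (1 + κ) (fun q : ℝ × ℝ => (graphPoint γ q.1, q.2)) := by
      have h2 : LipschitzWith ((1 + κ) * 1) (fun q : ℝ × ℝ => graphPoint γ q.1) :=
        (lipschitzWith_graphPoint h.lipschitz).comp LipschitzWith.prod_fst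
      have h3 : LipschitzWith 1 (fun q : ℝ × ℝ => q.2) := LipschitzWith.prod_snd
      refine (h2.prodMk h3).weaken ?_
      simp
    exact T.lipschitzOn_Φ.comp (hl.lipschitzOnWith) fun q hq => ⟨hEB q.1 hq.1, hq.2⟩
  have h2 := h1.hausdorffMeasure_image_le (d := 2) (by norm_num)
  rw [hausdorffMeasure_prod_real, Measure.volume_eq_prod, Measure.prod_prod, hE, zero_mul,
    mul_zero] at h2
  exact le_antisymm h2 zero_le

/-- A function with bounded weak gradient and mean zero at the vertex of a cone grows at most
linearly. -/
theorem ae_norm_le_of_meanZero {F : Type*} [NormedAddCommGroup F] [NormedSpace ℝ F]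
    [CompleteSpace F] {φ : E2 → F} {Dφ : E2 → E2 →L[ℝ] F} {L : ℝ≥0}
    (hw : HasWeakFDerivOn T.D φ Dφ) (hφ : IntegrableOn φ T.D) (hDφ : IntegrableOn Dφ T.D)
    (hL : ∀ᵐ z ∂volume.restrict T.D, ‖Dφ z‖ ≤ L) (h : T.IsGraph κ γ) {y : E2} (hyB : y ∈ T.B)
    (hy : y 1 = γ (y 0)) (h0 : MeanZero T.D (fun z => ‖φ z‖ₑ) y) :
    ∀ᵐ z ∂volume, z ∈ upCone κ y ∩ T.B → ‖φ z‖ ≤ L * ‖z - y‖ := by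
  have hsub := h.upCone_subset hy
  have hCo : IsOpen (upCone κ y ∩ T.B) := (isOpen_upCone κ y).inter Tube.isOpen_B
  obtain ⟨Z, hZ, hZ0, hZL⟩ := (hw.mono hsub).exists_ae_lipschitz hCo
    ((convex_upCone κ y).inter (convex_ball _ _)) (hφ.mono_set hsub)
    (by exact MeasureTheory.IntegrableOn.mono_set hDφ hsub)
    (ae_restrict_of_ae_restrict_of_subset hsub hL)
  refine measure_mono_null (t := (upCone κ y ∩ T.B) \ Z) (fun z hz => ?_) hZ0
  simp only [Set.mem_compl_iff, Set.mem_ofPred_eq, not_forall] at hz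
  refine ⟨hz.1, fun hzZ => hz.2 ?_⟩
  by_contra hlt
  rw [not_le] at hlt
  obtain ⟨c, hc, hcr⟩ := exists_volume_upCone_ge κ y
  -- If ‖φ z‖ exceeded the bound by 2δ, the Lipschitz estimate would keep ‖φ‖ ≥ δ almost everywhere
  -- on the cone close to `y`. There the cone fills a fixed fraction of each small ball, against the
  -- vanishing mean.
  obtain ⟨δ, hδ⟩ : ∃ δ : ℝ≥0, (δ : ℝ) = (‖φ z‖ - L * ‖z - y‖) / 2 :=
    ⟨⟨_, by linarith⟩, rfl⟩
  have hδ0 : 0 < δ := by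
    have : (0 : ℝ) < δ := by rw [hδ]; linarith
    exact_mod_cast this
  have hLr : ∀ᶠ r in 𝓝[>] (0 : ℝ), (L : ℝ) * r ≤ δ := by
    have : Tendsto (fun r : ℝ => L * r) (𝓝 0) (𝓝 (L * 0)) := tendsto_id.const_mul _
    rw [mul_zero] at this
    exact (this.mono_left nhdsWithin_le_nhds).eventually_le_const (by exact_mod_cast hδ0)
  obtain ⟨r, ⟨⟨hr1, hr2⟩, hr3⟩, hr0⟩ :=
    (((h0 (δ * c / 2) (by positivity)).and hLr).and (eventually_ball_subset hyB)).and
      self_mem_nhdsWithin |>.exists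
  have hr0 : 0 < r := hr0
  have hsub2 : upCone κ y ∩ Metric.ball y r ⊆ upCone κ y ∩ T.B := fun x hx => ⟨hx.1, hr3 hx.2⟩
  have hmZ : ∀ᵐ x ∂volume.restrict (upCone κ y ∩ Metric.ball y r), x ∈ Z := by
    have : ∀ᵐ x ∂volume.restrict (upCone κ y ∩ T.B), x ∈ Z := by
      rw [ae_restrict_iff' hCo.measurableSet]
      refine measure_mono_null (fun x hx => ?_) hZ0
      simp only [Set.mem_compl_iff, Set.mem_ofPred_eq, not_forall] at hx
      exact ⟨hx.1, hx.2⟩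
    exact ae_restrict_of_ae_restrict_of_subset hsub2 this
  have hlow : (δ : ℝ≥0∞) * (c * ENNReal.ofReal r ^ 2) ≤
      ∫⁻ x in T.D ∩ Metric.ball y r, ‖φ x‖ₑ := by
    calc (δ : ℝ≥0∞) * (c * ENNReal.ofReal r ^ 2)
        ≤ δ * volume (upCone κ y ∩ Metric.ball y r) := by gcongr; exact hcr r hr0
      _ = ∫⁻ x in upCone κ y ∩ Metric.ball y r, (δ : ℝ≥0∞) := (setLIntegral_const _ _).symm
      _ ≤ ∫⁻ x in upCone κ y ∩ Metric.ball y r, ‖φ x‖ₑ := by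
          refine lintegral_mono_ae ?_
          filter_upwards [hmZ, ae_restrict_mem ((isOpen_upCone κ y).inter
            Metric.isOpen_ball).measurableSet] with x hxZ hx
          rw [← ofReal_norm, ← ENNReal.ofReal_coe_nnreal]
          refine ENNReal.ofReal_le_ofReal ?_
          have h1 := hZL z hzZ x hxZ
          have h2 : ‖z - x‖ ≤ ‖z - y‖ + r := by
            have := mem_ball_iff_norm.1 hx.2
            calc ‖z - x‖ = ‖(z - y) - (x - y)‖ := by rw [sub_sub_sub_cancel_right]
              _ ≤ ‖z - y‖ + ‖x - y‖ := norm_sub_le _ _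
              _ ≤ _ := by gcongr
          have h3 : ‖φ z‖ ≤ ‖φ z - φ x‖ + ‖φ x‖ := by
            simpa using norm_add_le (φ z - φ x) (φ x)
          have h4 : L * ‖z - x‖ ≤ L * (‖z - y‖ + r) := by gcongr
          rw [mul_add] at h4
          linarith
      _ ≤ _ := lintegral_mono_set fun x hx => Set.mem_inter (hsub ⟨hx.1, hr3 hx.2⟩) hx.2
  have hcontr := hlow.trans hr1
  rw [← mul_assoc, ← ENNReal.coe_mul] at hcontr
  have hrr : ENNReal.ofReal r ^ 2 ≠ 0 := by simpa using hr0
  rw [ENNReal.mul_le_mul_iff_left hrr (by finiteness), ENNReal.coe_le_coe] at hcontr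
  exact absurd hcontr (not_le.2 (half_lt_self (by positivity)))

/-- A function with bounded weak gradient and vanishing trace is bounded by the distance to the
graph. -/
theorem ae_norm_le {F : Type*} [NormedAddCommGroup F] [NormedSpace ℝ F]
    [CompleteSpace F] {φ : E2 → F} {Dφ : E2 → E2 →L[ℝ] F} {L : ℝ≥0}
    (hw : HasWeakFDerivOn T.D φ Dφ) (hφ : IntegrableOn φ T.D) (hDφ : IntegrableOn Dφ T.D)
    (hL : ∀ᵐ z ∂volume.restrict T.D, ‖Dφ z‖ ≤ L) (h : T.IsGraph κ γ)
    (h0 : ∀ᵐ s : ℝ, graphPoint γ s ∈ T.B → MeanZero T.D (fun z => ‖φ z‖ₑ) (graphPoint γ s)) :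
    ∀ᵐ z ∂volume, z ∈ T.D → graphPoint γ (z 0) ∈ T.B → ‖φ z‖ ≤ L * (z 1 - γ (z 0)) := by
  set O := {s : ℝ | graphPoint γ s ∈ T.B}
  have hcont := (lipschitzWith_graphPoint h.lipschitz).continuous
  have hO : IsOpen O := Tube.isOpen_B.preimage hcont
  set E := {s ∈ O | MeanZero T.D (fun z => ‖φ z‖ₑ) (graphPoint γ s)}
  -- The cone estimate has an exceptional null set for each vertex, so only countably many vertices
  -- may be used. A countable set dense among the good parameters suffices: the point of the graph
  -- below z is approximated by these vertices, whose open cones still contain z.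
  obtain ⟨Q, hQE, hQc, hEQ⟩ :=
    (TopologicalSpace.IsSeparable.of_separableSpace E).exists_countable_dense_subset
  have hOE : O ⊆ closure E := by
    intro s hs
    rw [mem_closure_iff]
    intro U hU hsU
    by_contra hemp
    rw [Set.not_nonempty_iff_eq_empty] at hemp
    refine ((hU.inter hO).measure_pos volume (Set.nonempty_of_mem (Set.mem_inter hsU hs))).ne' (measure_mono_null ?_ h0)
    rintro x ⟨hxU, hxO⟩
    simp only [Set.mem_compl_iff, Set.mem_ofPred_eq, not_forall]
    exact ⟨hxO, fun hm => Set.eq_empty_iff_forall_notMem.1 hemp x (Set.mem_inter hxU ⟨hxO, hm⟩)⟩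
  have hOQ : O ⊆ closure Q := fun s hs => closure_minimal hEQ isClosed_closure (hOE hs)
  have hall : ∀ᵐ z ∂volume, ∀ s ∈ Q, z ∈ upCone κ (graphPoint γ s) ∩ T.B →
      ‖φ z‖ ≤ L * ‖z - graphPoint γ s‖ :=
    (ae_ball_iff hQc).2 fun s hs =>
      ae_norm_le_of_meanZero hw hφ hDφ hL h (hQE hs).1 rfl (hQE hs).2
  filter_upwards [hall] with z hz hzD hzB
  have hzlt := (h.mem_D.1 hzD).2
  by_contra hlt
  rw [not_le] at hlt
  have e0 : ‖z - graphPoint γ (z 0)‖ = z 1 - γ (z 0) := by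
    rw [EuclideanSpace.norm_eq, Fin.sum_univ_two]
    simp only [PiLp.sub_apply, graphPoint_zero, graphPoint_one, sub_self, norm_zero]
    rw [zero_pow two_ne_zero, zero_add, Real.sqrt_sq (norm_nonneg _), Real.norm_of_nonneg]
    linarith
  have ev1 : ∀ᶠ s in 𝓝 (z 0), L * ‖z - graphPoint γ s‖ < ‖φ z‖ := by
    refine ContinuousAt.eventually_lt ?_ continuousAt_const ?_
    · exact (continuous_const.mul (continuous_const.sub hcont).norm).continuousAt
    · rw [e0]; exact hlt
  have ev2 : ∀ᶠ s in 𝓝 (z 0), z ∈ upCone κ (graphPoint γ s) := by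
    simp only [upCone, Set.mem_ofPred_eq, graphPoint_zero, graphPoint_one]
    refine ContinuousAt.eventually_lt ?_ ?_ ?_
    · fun_prop
    · exact (continuous_const.sub h.lipschitz.continuous).continuousAt
    · simpa using hzlt
  obtain ⟨s, hsQ, h1, h2⟩ := ((mem_closure_iff_frequently.1 (hOQ hzB)).and_eventually
    (ev1.and ev2)).exists
  exact absurd (hz s hsQ ⟨h2, hzD.1⟩) (not_le.2 h1)

end Tube.IsGraph

end GraphTube

/-! ### Oblique coordinates at a boundary point, product test functions and cut-offs. -/

section BoxCoordinates

/-- The height above the line of slope `g`. -/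
noncomputable def ell (g : ℝ) : E2 →L[ℝ] ℝ :=
  EuclideanSpace.proj (1 : Fin 2) - g • EuclideanSpace.proj (0 : Fin 2)

/-- The coordinate along the line of slope `g` for which `lam g t (e₂ - t (1, g)) = 0`. -/
noncomputable def lam (g t : ℝ) : E2 →L[ℝ] ℝ :=
  EuclideanSpace.proj (0 : Fin 2) + t • ell g

/-- The tangent vector of the graph. -/
noncomputable def tangentVec (g : ℝ) : E2 := !₂[1, g]

/-- An inward vector of the domain above the graph. -/
noncomputable def inwardVec (g t : ℝ) : E2 := e₂ - t • tangentVec g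

variable (g t : ℝ)

theorem ell_apply (v : E2) : ell g v = v 1 - g * v 0 := rfl
theorem lam_apply (v : E2) : lam g t v = v 0 + t * ell g v := rfl
@[simp] theorem ell_tangentVec : ell g (tangentVec g) = 0 := by simp [ell_apply, tangentVec]
@[simp] theorem lam_tangentVec : lam g t (tangentVec g) = 1 := by
  rw [lam_apply, ell_tangentVec]; simp [tangentVec]
@[simp] theorem ell_inwardVec : ell g (inwardVec g t) = 1 := by
  rw [inwardVec, map_sub, map_smul, ell_tangentVec]; simp [ell_apply, e₂]
@[simp] theorem lam_inwardVec : lam g t (inwardVec g t) = 0 := by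
  rw [lam_apply, ell_inwardVec]; simp [inwardVec, tangentVec, e₂]

/-- The coordinates are dual to the tangent and inward vectors. Hence a derivative along either
vector falls on only one factor of a product test function. -/
theorem eq_lam_add_ell (v : E2) : v = lam g t v • tangentVec g + ell g v • inwardVec g t := by
  ext j
  fin_cases j
  · simp [lam_apply, ell_apply, tangentVec, inwardVec, e₂]; ring
  · simp [lam_apply, ell_apply, tangentVec, inwardVec, e₂]; ring

theorem exists_norm_bounds : ∃ c : ℝ≥0, 1 ≤ c ∧ (∀ v, |lam g t v| ≤ c * ‖v‖) ∧
    (∀ v, |ell g v| ≤ c * ‖v‖) ∧ ∀ v, ‖v‖ ≤ c * (|lam g t v| + |ell g v|) := by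
  refine ⟨1 + ‖lam g t‖₊ + ‖ell g‖₊ + ‖tangentVec g‖₊ + ‖inwardVec g t‖₊, ?_, fun v => ?_, fun v => ?_,
    fun v => ?_⟩
  · rw [add_assoc, add_assoc, add_assoc]; exact le_self_add
  · refine ((lam g t).le_opNorm v).trans ?_
    gcongr
    push_cast [coe_nnnorm]
    linarith [norm_nonneg (lam g t), norm_nonneg (ell g), norm_nonneg (tangentVec g),
      norm_nonneg (inwardVec g t)]
  · refine ((ell g).le_opNorm v).trans ?_
    gcongr
    push_cast [coe_nnnorm]
    linarith [norm_nonneg (lam g t), norm_nonneg (ell g), norm_nonneg (tangentVec g),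
      norm_nonneg (inwardVec g t)]
  · conv_lhs => rw [eq_lam_add_ell g t v]
    refine (norm_add_le _ _).trans ?_
    rw [norm_smul, norm_smul, mul_add, Real.norm_eq_abs, Real.norm_eq_abs, mul_comm, mul_comm |ell g v|]
    push_cast [coe_nnnorm]
    gcongr <;>
    linarith [norm_nonneg (lam g t), norm_nonneg (ell g), norm_nonneg (tangentVec g),
      norm_nonneg (inwardVec g t)]

/-- The strip along the line of slope `g` through `y`. -/
def strip (y : E2) (m ε r : ℝ) : Set E2 :=
  {z | |lam g t (z - y)| ≤ m * r ∧ -(ε * r) ≤ ell g (z - y) ∧ ell g (z - y) ≤ 2 * (ε * r)}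

theorem isClosed_strip (y : E2) (m ε r : ℝ) : IsClosed (strip g t y m ε r) := by
  have h1 : Continuous fun z : E2 => lam g t (z - y) := by fun_prop
  have h2 : Continuous fun z : E2 => ell g (z - y) := by fun_prop
  exact (isClosed_le h1.abs continuous_const).inter
    ((isClosed_le continuous_const h2).inter (isClosed_le h2 continuous_const))

/-- The strip lies in an affine image of a box with sides `2 m r` and `3 ε r`. Its area is a small
multiple of `r ^ 2`, which absorbs what happens near the boundary line. -/
theorem exists_volume_strip_le (y : E2) (m : ℝ≥0) : ∃ C : ℝ≥0, ∀ (ε : ℝ≥0) (r : ℝ), 0 < r →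
    volume (strip g t y m ε r) ≤ C * ε * ENNReal.ofReal r ^ 2 := by
  have : (volume : Measure (ℝ × ℝ)).IsAddHaarMeasure := by
    rw [Measure.volume_eq_prod]; infer_instance
  let Ψ : ℝ × ℝ → E2 := fun q => y + (q.1 • tangentVec g + q.2 • inwardVec g t)
  obtain ⟨K, hK⟩ : ∃ K, LipschitzWith K Ψ := by
    let L : ℝ × ℝ →L[ℝ] E2 := (ContinuousLinearMap.fst ℝ ℝ ℝ).smulRight (tangentVec g) +
      (ContinuousLinearMap.snd ℝ ℝ ℝ).smulRight (inwardVec g t)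
    refine ⟨‖L‖₊, LipschitzWith.of_dist_le_mul fun q q' => ?_⟩
    have := L.lipschitz.dist_le_mul q q'
    rwa [← dist_add_left y] at this
  obtain ⟨C, hC⟩ := exists_volume_image_le (ℝ × ℝ) E2 (by simp) K
  refine ⟨C * (2 * m * 3), fun ε r hr => ?_⟩
  have hsub : strip g t y m ε r ⊆
      Ψ '' (Set.Icc (-(m * r)) (m * r) ×ˢ Set.Icc (-(ε * r)) (2 * (ε * r))) := by
    intro z hz
    refine ⟨(lam g t (z - y), ell g (z - y)), ⟨abs_le.1 hz.1, hz.2⟩, ?_⟩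
    simp only [Ψ]
    rw [← eq_lam_add_ell, add_sub_cancel]
  refine (measure_mono hsub).trans ((hC Ψ _ hK.lipschitzOnWith).trans (le_of_eq ?_))
  rw [Measure.volume_eq_prod, Measure.prod_prod, Real.volume_Icc, Real.volume_Icc,
    show (m : ℝ) * r - -(m * r) = (2 * m : ℝ≥0) * r by push_cast; ring,
    show 2 * ((ε : ℝ) * r) - -(ε * r) = (3 * ε : ℝ≥0) * r by push_cast; ring,
    ENNReal.ofReal_mul (NNReal.coe_nonneg _), ENNReal.ofReal_mul (NNReal.coe_nonneg _),
    ENNReal.ofReal_coe_nnreal, ENNReal.ofReal_coe_nnreal]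
  push_cast
  ring

variable {g t}

/-- A product test function in the coordinates `lam`, `ell`, scaled by `r` around `y`. -/
noncomputable def boxTest (g t : ℝ) (y : E2) (r : ℝ) (F H : ℝ → ℝ) (z : E2) : ℝ :=
  F (lam g t (z - y) / r) * H (ell g (z - y) / r)

theorem contDiff_boxTest {y : E2} {r : ℝ} {F H : ℝ → ℝ} {k : WithTop ℕ∞} (hF : ContDiff ℝ k F) (hH : ContDiff ℝ k H) :
    ContDiff ℝ k (boxTest g t y r F H) := by
  have h1 : ContDiff ℝ k fun z : E2 => lam g t (z - y) / r := by fun_prop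
  have h2 : ContDiff ℝ k fun z : E2 => ell g (z - y) / r := by fun_prop
  exact (hF.comp h1).mul (hH.comp h2)

theorem fderiv_boxTest {y : E2} {r : ℝ} {F H : ℝ → ℝ} (hF : Differentiable ℝ F)
    (hH : Differentiable ℝ H) (z v : E2) : fderiv ℝ (boxTest g t y r F H) z v =
      r⁻¹ * (lam g t v * boxTest g t y r (deriv F) H z + ell g v * boxTest g t y r F (deriv H) z) := by
  have h1 : HasFDerivAt (fun z : E2 => lam g t (z - y) / r) (r⁻¹ • lam g t) z := by
    have : HasFDerivAt (fun z : E2 => r⁻¹ * lam g t (z - y)) (r⁻¹ • lam g t) z :=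
      (((lam g t).hasFDerivAt).comp z ((hasFDerivAt_id z).sub_const y)).const_mul r⁻¹
    simpa only [div_eq_inv_mul] using this
  have h2 : HasFDerivAt (fun z : E2 => ell g (z - y) / r) (r⁻¹ • ell g) z := by
    have : HasFDerivAt (fun z : E2 => r⁻¹ * ell g (z - y)) (r⁻¹ • ell g) z :=
      (((ell g).hasFDerivAt).comp z ((hasFDerivAt_id z).sub_const y)).const_mul r⁻¹
    simpa only [div_eq_inv_mul] using this
  have h3 := ((hF _).hasDerivAt.comp_hasFDerivAt z h1).mul ((hH _).hasDerivAt.comp_hasFDerivAt z h2)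
  have h4 : HasFDerivAt (boxTest g t y r F H) _ z := h3
  rw [h4.fderiv]
  simp only [boxTest, add_apply, smul_apply, smul_eq_mul,
    Function.comp_apply]
  ring

theorem support_boxTest_subset {y : E2} {r : ℝ} (hr : 0 < r) {F H : ℝ → ℝ} {m ε : ℝ}
    (hF : ∀ a, m < |a| → F a = 0) (hH : ∀ b, b < ε ∨ m < b → H b = 0) {z : E2}
    (hz : boxTest g t y r F H z ≠ 0) : |lam g t (z - y)| ≤ m * r ∧ ε * r ≤ ell g (z - y) ∧
      ell g (z - y) ≤ m * r := by
  have h1 : F (lam g t (z - y) / r) ≠ 0 := fun h => hz (by rw [boxTest, h, zero_mul])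
  have h2 : H (ell g (z - y) / r) ≠ 0 := fun h => hz (by rw [boxTest, h, mul_zero])
  refine ⟨?_, ?_, ?_⟩
  · by_contra h
    refine h1 (hF _ ?_)
    rwa [abs_div, abs_of_pos hr, lt_div_iff₀ hr, ← not_le]
  · by_contra h
    refine h2 (hH _ (Or.inl ?_))
    rwa [div_lt_iff₀ hr, ← not_le]
  · by_contra h
    refine h2 (hH _ (Or.inr ?_))
    rwa [lt_div_iff₀ hr, ← not_le]

/-- The support stays at height at least `ε r` above the line, inside the domain, so the product is
an admissible test function although the boundary is near. -/
theorem HasWeakFDerivOn.integral_boxTest {W : Type*} [NormedAddCommGroup W] [NormedSpace ℝ W]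
    {D : Set E2} {φ : E2 → W} {Dφ : E2 → E2 →L[ℝ] W} (h : HasWeakFDerivOn D φ Dφ) {y : E2} {r : ℝ}
    (hr : 0 < r) {F H : ℝ → ℝ} (hFs : ContDiff ℝ (⊤ : ℕ∞) F) (hHs : ContDiff ℝ (⊤ : ℕ∞) H) {m ε : ℝ}
    (hF : ∀ a, m < |a| → F a = 0) (hH : ∀ b, b < ε ∨ m < b → H b = 0)
    (hD : ∀ z, |lam g t (z - y)| ≤ m * r → ε * r ≤ ell g (z - y) → ell g (z - y) ≤ m * r → z ∈ D)
    (v : E2) :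
    ∫ z in D, boxTest g t y r F H z • Dφ z v = -∫ z in D,
      (r⁻¹ * (lam g t v * boxTest g t y r (deriv F) H z +
        ell g v * boxTest g t y r F (deriv H) z)) • φ z := by
  set A : Set E2 := {z | |lam g t (z - y)| ≤ m * r ∧ ε * r ≤ ell g (z - y) ∧
    ell g (z - y) ≤ m * r} with hA
  have hAc : IsClosed A := by
    have h1 : Continuous fun z : E2 => lam g t (z - y) := by fun_prop
    have h2 : Continuous fun z : E2 => ell g (z - y) := by fun_prop
    exact (isClosed_le h1.abs continuous_const).inter
      ((isClosed_le continuous_const h2).inter (isClosed_le h2 continuous_const))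
  have hsupp : tsupport (boxTest g t y r F H) ⊆ A :=
    closure_minimal (fun z hz => support_boxTest_subset hr hF hH hz) hAc
  have hAb : Bornology.IsBounded A := by
    obtain ⟨c, -, -, -, hc⟩ := exists_norm_bounds g t
    refine (Metric.isBounded_closedBall (x := y) (r := c * (m * r + (|ε| * r + m * r)))).subset ?_
    intro z hz
    rw [mem_closedBall_iff_norm]
    refine (hc _).trans ?_
    gcongr
    · exact hz.1
    · have hm : 0 ≤ m * r := (abs_nonneg _).trans hz.1
      rw [abs_le]
      have := neg_abs_le ε
      constructor
      · nlinarith [hz.2.1]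
      · have := mul_nonneg (abs_nonneg ε) hr.le
        linarith [hz.2.2]
  have hcomp : HasCompactSupport (boxTest g t y r F H) :=
    (Metric.isCompact_of_isClosed_isBounded hAc hAb).of_isClosed_subset (isClosed_tsupport _) hsupp
  rw [h.integral_eq _ (contDiff_boxTest hFs hHs) hcomp
    (hsupp.trans fun z hz => hD z hz.1 hz.2.1 hz.2.2) v]
  congr 1
  refine integral_congr_ae (ae_of_all _ fun z => ?_)
  simp only
  rw [fderiv_boxTest (hFs.differentiable (by simp)) (hHs.differentiable (by simp))]

end BoxCoordinates

/-- The function `k` is a primitive of `-α` that vanishes beyond the plateau. It serves to write a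
cut-off in the inward variable as an inward derivative. -/
theorem exists_plateau (c : ℝ≥0) : ∃ (α k : ℝ → ℝ) (C : ℝ≥0), ContDiff ℝ (⊤ : ℕ∞) α ∧
    ContDiff ℝ (⊤ : ℕ∞) k ∧ (∀ a, 0 ≤ α a ∧ α a ≤ 1) ∧ (∀ a : ℝ, |a| ≤ c → α a = 1) ∧
    (∀ a : ℝ, ((c + 1 : ℝ≥0) : ℝ) < |a| → α a = 0) ∧ (∀ a : ℝ, ((c + 1 : ℝ≥0) : ℝ) < |a| → deriv α a = 0) ∧
    (∀ a, |deriv α a| ≤ C) ∧ (∀ b, HasDerivAt k (-α b) b) ∧ (∀ b, ((c + 1 : ℝ≥0) : ℝ) < b → k b = 0) ∧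
    ∀ b, 0 ≤ b → |k b| ≤ ((c + 1 : ℝ≥0) : ℝ) := by
  let α : ContDiffBump (0 : ℝ) := ⟨c + 1 / 2, c + 1, by positivity, by linarith⟩
  have hα : ContDiff ℝ (⊤ : ℕ∞) α := α.contDiff
  have hα0 : ∀ a : ℝ, ((c + 1 : ℝ≥0) : ℝ) ≤ |a| → α a = 0 := fun a ha => α.zero_of_le_dist (by
    rw [Real.dist_eq, sub_zero]; simpa [α] using ha)
  have hd0 : ∀ a : ℝ, ((c + 1 : ℝ≥0) : ℝ) < |a| → deriv α a = 0 := by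
    intro a ha
    have : (α : ℝ → ℝ) =ᶠ[𝓝 a] fun _ => 0 := by
      filter_upwards [(isOpen_lt continuous_const continuous_abs).mem_nhds ha] with b hb
      exact hα0 b hb.le
    rw [this.deriv_eq, deriv_const]
  have hdc : Continuous (deriv α) := hα.continuous_deriv (by simp)
  obtain ⟨C, hC⟩ : ∃ C, ∀ a, ‖deriv α a‖ ≤ C := by
    have hs : HasCompactSupport (deriv α) := HasCompactSupport.deriv α.hasCompactSupport
    exact hs.exists_bound_of_continuous hdc
  have hαc : Continuous α := α.continuous
  have hkd : ∀ b, HasDerivAt (fun b => (∫ s in (0 : ℝ)..(c + 1), α s) - ∫ s in (0 : ℝ)..b, α s)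
      (-α b) b := by
    intro b
    exact (intervalIntegral.integral_hasDerivAt_right (hαc.intervalIntegrable _ _)
      hαc.stronglyMeasurable.stronglyMeasurableAtFilter hαc.continuousAt).const_sub _
  have hke : ∀ b, (∫ s in (0 : ℝ)..(c + 1), α s) - ∫ s in (0 : ℝ)..b, α s =
      ∫ s in b..(c + 1), α s := fun b => by
    rw [intervalIntegral.integral_interval_sub_left (hαc.intervalIntegrable _ _)
      (hαc.intervalIntegrable _ _)]
  refine ⟨α, _, C.toNNReal, hα, ?_, fun a => ⟨α.nonneg, α.le_one⟩, fun a ha => ?_,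
    fun a ha => hα0 a ha.le, hd0, fun a => ?_, hkd, fun b hb => ?_, fun b hb => ?_⟩
  · refine contDiff_infty_iff_deriv.2 ⟨fun b => (hkd b).differentiableAt, ?_⟩
    rw [show deriv _ = fun b => -α b from funext fun b => (hkd b).deriv]
    exact hα.neg
  · refine α.one_of_mem_closedBall ?_
    rw [Metric.mem_closedBall, Real.dist_eq, sub_zero]
    refine ha.trans ?_
    simp only [α]; linarith
  · exact (hC a).trans (Real.le_coe_toNNReal C)
  · rw [hke, intervalIntegral.integral_symm, intervalIntegral.integral_congr (g := fun _ => 0)]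
    · simp
    · intro s hs
      push_cast at hb
      rw [Set.uIcc_of_le hb.le] at hs
      refine hα0 s ?_
      push_cast
      exact hs.1.trans (le_abs_self s)
  · have h1 : ∀ b b' : ℝ, b ≤ b' → |∫ s in b..b', α s| ≤ b' - b := by
      intro b b' h
      have := intervalIntegral.norm_integral_le_of_norm_le_const (a := b) (b := b') (f := α) (C := 1)
        (fun s _ => by rw [Real.norm_eq_abs, abs_of_nonneg α.nonneg]; exact α.le_one)
      rwa [one_mul, abs_of_nonneg (sub_nonneg.2 h)] at this
    simp only [hke]
    push_cast
    rcases le_total b (c + 1) with h | h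
    · exact (h1 _ _ h).trans (by linarith)
    · rw [intervalIntegral.integral_symm, intervalIntegral.integral_congr (g := fun _ => 0)]
      · simp; positivity
      · intro s hs
        rw [Set.uIcc_of_le h] at hs
        refine hα0 s ?_
        push_cast
        exact hs.1.trans (le_abs_self s)

/-- The step keeps test functions away from the boundary. Its slope is of order `1 / ε` on an
interval of length `ε`, with a constant independent of `ε`. -/
theorem exists_smooth_step : ∃ C : ℝ≥0, ∀ ε : ℝ≥0, 0 < ε → ∃ χ : ℝ → ℝ,
    ContDiff ℝ (⊤ : ℕ∞) χ ∧ (∀ b, 0 ≤ χ b ∧ χ b ≤ 1) ∧ (∀ b : ℝ, b ≤ ε → χ b = 0) ∧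
    (∀ b : ℝ, 2 * ε ≤ b → χ b = 1) ∧ (∀ b, |deriv χ b| ≤ C / ε) ∧
    ∀ b : ℝ, b < ε ∨ 2 * ε < b → deriv χ b = 0 := by
  have hs : ContDiff ℝ (⊤ : ℕ∞) Real.smoothTransition := Real.smoothTransition.contDiff
  have hd0 : ∀ b, b < 0 ∨ 1 < b → deriv Real.smoothTransition b = 0 := by
    rintro b (hb | hb)
    · have : Real.smoothTransition =ᶠ[𝓝 b] fun _ => 0 := by
        filter_upwards [Iio_mem_nhds hb] with a ha
        exact Real.smoothTransition.zero_of_nonpos (le_of_lt ha)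
      rw [this.deriv_eq, deriv_const]
    · have : Real.smoothTransition =ᶠ[𝓝 b] fun _ => 1 := by
        filter_upwards [Ioi_mem_nhds hb] with a ha
        exact Real.smoothTransition.one_of_one_le (le_of_lt ha)
      rw [this.deriv_eq, deriv_const]
  have hdc : Continuous (deriv Real.smoothTransition) := hs.continuous_deriv (by simp)
  obtain ⟨C, hC⟩ : ∃ C, ∀ a, ‖deriv Real.smoothTransition a‖ ≤ C := by
    refine HasCompactSupport.exists_bound_of_continuous
      (HasCompactSupport.of_support_subset_isCompact (isCompact_Icc (a := (0 : ℝ)) (b := 1)) ?_) hdc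
    intro b hb
    by_contra h
    rw [Set.mem_Icc, not_and_or, not_le, not_le] at h
    exact hb (hd0 b h)
  refine ⟨C.toNNReal, fun ε hε => ?_⟩
  have hε' : (0 : ℝ) < ε := hε
  have hder : ∀ b, deriv (fun b : ℝ => Real.smoothTransition (b / ε - 1)) b =
      deriv Real.smoothTransition (b / ε - 1) / ε := by
    intro b
    have h1 : HasDerivAt (fun b : ℝ => b / ε - 1) (1 / ε) b :=
      ((hasDerivAt_id b).div_const _).sub_const 1
    have h2 := ((hs.differentiable (by simp) (b / ε - 1)).hasDerivAt).comp b h1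
    rw [div_eq_mul_one_div]
    exact h2.deriv
  refine ⟨fun b => Real.smoothTransition (b / ε - 1), hs.comp (by fun_prop),
    fun b => ⟨Real.smoothTransition.nonneg _, Real.smoothTransition.le_one _⟩, fun b hb => ?_,
    fun b hb => ?_, fun b => ?_, fun b hb => ?_⟩
  · refine Real.smoothTransition.zero_of_nonpos ?_
    rw [sub_nonpos, div_le_one hε']; exact hb
  · refine Real.smoothTransition.one_of_one_le ?_
    rw [le_sub_iff_add_le, le_div_iff₀ hε']; linarith
  · rw [hder, abs_div, abs_of_pos hε']
    gcongr
    exact (hC _).trans (Real.le_coe_toNNReal C)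
  · rw [hder, hd0, zero_div]
    rcases hb with hb | hb
    · left; rw [sub_neg, div_lt_one hε']; exact hb
    · right; rw [lt_sub_iff_add_lt, lt_div_iff₀ hε']; linarith

/-! ### Weighted averages of the tangential derivative at the boundary. -/

section TangentialAverage

variable {W : Type*} [NormedAddCommGroup W] [NormedSpace ℝ W] {D : Set E2} {g t : ℝ} {y : E2}

/-- Near `y`, the set `D` is the region above the line of slope `g`, up to errors of higher
order. -/
def IsEpigraphAt (D : Set E2) (g : ℝ) (y : E2) : Prop :=
  ∀ m ε : ℝ≥0, 0 < ε → ∀ᶠ r in 𝓝[>] (0 : ℝ), ∀ z ∈ Metric.ball y (m * r),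
    (z ∈ D → -(ε * r) ≤ ell g (z - y)) ∧ (ε * r ≤ ell g (z - y) → z ∈ D)

theorem MeasureTheory.IntegrableOn.smul_of_bound {φ : E2 → W} (hφ : IntegrableOn φ D) {p : E2 → ℝ}
    (hp : Continuous p) {C : ℝ} (hC : ∀ z, |p z| ≤ C) : IntegrableOn (fun z => p z • φ z) D :=
  Integrable.bdd_smul hφ C hp.aestronglyMeasurable (ae_of_all _ fun z => by
    rw [Real.norm_eq_abs]; exact hC z)

theorem continuous_boxTest {r : ℝ} {F H : ℝ → ℝ} (hF : Continuous F) (hH : Continuous H) :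
    Continuous (boxTest g t y r F H) := by
  have h1 : Continuous fun z : E2 => lam g t (z - y) / r := by fun_prop
  have h2 : Continuous fun z : E2 => ell g (z - y) / r := by fun_prop
  exact (hF.comp h1).mul (hH.comp h2)

theorem abs_boxTest_le {r : ℝ} {F H : ℝ → ℝ} {C C' : ℝ} {z : E2} (hF : ∀ a, |F a| ≤ C)
    (hH : |H (ell g (z - y) / r)| ≤ C') : |boxTest g t y r F H z| ≤ C * C' := by
  rw [boxTest, abs_mul]
  exact mul_le_mul (hF _) hH (abs_nonneg _) ((abs_nonneg _).trans (hF 0))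

/-- One integration by parts along the tangent costs a factor 1/r, while φ is only of order r, so
the result has order r² and is not small. A second integration by parts is needed: by χα = χ'k -
(χk)' the remaining term becomes an integral of the inward derivative, which is small in mean, and a
term with χ'. The latter lives in a strip of width comparable to εr, where φ is of order εr. -/
theorem HasWeakFDerivOn.exists_weight {φ : E2 → W} {Dφ : E2 → E2 →L[ℝ] W} {L : ℝ≥0}
    (h : HasWeakFDerivOn D φ Dφ) (hφ : IntegrableOn φ D) (hD : IsEpigraphAt D g y)
    (hL : ∀ m ε : ℝ≥0, 0 < ε → ∀ᶠ r in 𝓝[>] (0 : ℝ), ∀ᵐ z ∂volume.restrict D,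
      z ∈ Metric.ball y (m * r) → ‖φ z‖ ≤ L * (ell g (z - y) + ε * r))
    (hξ : MeanZero D (fun z => ‖Dφ z (inwardVec g t)‖ₑ) y) :
    ∃ m C : ℝ≥0, 0 < m ∧ ∀ ε : ℝ≥0, 0 < ε → ∀ᶠ r in 𝓝[>] (0 : ℝ), ∃ ω : E2 → ℝ, Continuous ω ∧
      (∀ z, 0 ≤ ω z ∧ ω z ≤ 1) ∧ (∀ z, ω z ≠ 0 → z ∈ Metric.ball y (m * r)) ∧
      (∀ z ∈ D ∩ Metric.ball y r, ω z = 1 ∨ z ∈ strip g t y m ε r) ∧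
      ‖∫ z in D, ω z • Dφ z (tangentVec g)‖ₑ ≤ C * ε * ENNReal.ofReal r ^ 2 := by
  obtain ⟨c, hc1, hlam, hell, hnorm⟩ := exists_norm_bounds g t
  obtain ⟨α, k, C₁, hα, hk, hα01, hα1, hα0, hα'0, hC₁, hkd, hk0, hkm⟩ := exists_plateau c
  obtain ⟨C₂, hstep⟩ := exists_smooth_step
  -- The plateau functions vanish beyond `m₁`. As the norm is at most `c` times the sum of the
  -- coordinates, a box of size `m₁ r` fits in a ball of radius `m r`.
  set m₁ : ℝ≥0 := c + 1 with hm₁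
  set m : ℝ≥0 := 2 * c * m₁ + m₁ with hm
  have hm₁m : m₁ ≤ m := le_add_self
  have hm₁0 : 0 < m₁ := by positivity
  obtain ⟨C₃, hC₃⟩ := exists_volume_strip_le g t y m
  refine ⟨m, C₁ * C₂ * m₁ * (3 * L) * C₃ + C₁ * m₁, lt_of_lt_of_le hm₁0 hm₁m, fun ε hε => ?_⟩
  obtain ⟨χ, hχ, hχ01, hχ0, hχ1, hχ'C, hχ'0⟩ := hstep ε hε
  filter_upwards [hD m ε hε, hL m ε hε, hξ.scale (lt_of_lt_of_le hm₁0 hm₁m) hε,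
    self_mem_nhdsWithin] with r hDr hLr hξr hr0
  have hr : 0 < r := hr0
  have hball : ∀ z, |lam g t (z - y)| ≤ m₁ * r → 0 ≤ ell g (z - y) → ell g (z - y) ≤ m₁ * r →
      z ∈ Metric.ball y (m * r) := by
    intro z h1 h2 h3
    rw [mem_ball_iff_norm]
    calc ‖z - y‖ ≤ c * (|lam g t (z - y)| + |ell g (z - y)|) := hnorm _
      _ ≤ c * (m₁ * r + m₁ * r) := by
        gcongr
        rwa [abs_of_nonneg h2]
      _ < m * r := by
        have : (0 : ℝ) < m₁ * r := by positivity
        rw [hm]; push_cast; nlinarith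
  have hε' : (0 : ℝ) < ε := hε
  have hDbox : ∀ z, |lam g t (z - y)| ≤ m₁ * r → ε * r ≤ ell g (z - y) → ell g (z - y) ≤ m₁ * r →
      z ∈ D := fun z h1 h2 h3 =>
    (hDr z (hball z h1 (le_trans (by positivity) h2) h3)).2 h2
  have hχα0 : ∀ b : ℝ, b < ε ∨ m₁ < b → χ b * α b = 0 := by
    rintro b (hb | hb)
    · rw [hχ0 b hb.le, zero_mul]
    · rw [hα0 b (hb.trans_le (le_abs_self b)), mul_zero]
  have hχk0 : ∀ b : ℝ, b < ε ∨ m₁ < b → χ b * k b = 0 := by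
    rintro b (hb | hb)
    · rw [hχ0 b hb.le, zero_mul]
    · rw [hk0 b hb, mul_zero]
  have hα' : ContDiff ℝ (⊤ : ℕ∞) (deriv α) := (contDiff_infty_iff_deriv.1 hα).2
  have hχ' : ContDiff ℝ (⊤ : ℕ∞) (deriv χ) := (contDiff_infty_iff_deriv.1 hχ).2
  have hαb : ∀ a, |α a| ≤ 1 := fun a => by rw [abs_of_nonneg (hα01 a).1]; exact (hα01 a).2
  have hχb : ∀ a, |χ a| ≤ 1 := fun a => by rw [abs_of_nonneg (hχ01 a).1]; exact (hχ01 a).2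
  have hχαb : ∀ b, |χ b * α b| ≤ 1 := fun b => by
    rw [abs_mul]; exact mul_le_one₀ (hχb b) (abs_nonneg _) (hαb b)
  have hχkb : ∀ b, |χ b * k b| ≤ m₁ := fun b => by
    rcases lt_or_ge b 0 with hb | hb
    · rw [hχ0 b (hb.le.trans hε'.le), zero_mul, abs_zero]; positivity
    · rw [abs_mul]
      calc |χ b| * |k b| ≤ 1 * m₁ := by gcongr; exacts [hχb b, hkm b hb]
        _ = m₁ := one_mul _
  have hχ'kb : ∀ b, |deriv χ b * k b| ≤ C₂ / ε * m₁ := fun b => by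
    rcases lt_or_ge b 0 with hb | hb
    · rw [hχ'0 b (Or.inl (hb.trans hε')), zero_mul, abs_zero]; positivity
    · rw [abs_mul]
      gcongr
      exacts [hχ'C b, hkm b hb]
  have hder : deriv (fun b => χ b * k b) = fun b => deriv χ b * k b - χ b * α b := by
    funext b
    have : HasDerivAt (fun b => χ b * k b) _ b :=
      (hχ.differentiable (by simp) b).hasDerivAt.mul (hkd b)
    rw [this.deriv]
    ring
  refine ⟨boxTest g t y r α fun b => χ b * α b,
    continuous_boxTest hα.continuous (hχ.continuous.mul hα.continuous), fun z => ⟨?_, ?_⟩,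
    fun z hz => ?_, fun z hz => ?_, ?_⟩
  · exact mul_nonneg (hα01 _).1 (mul_nonneg (hχ01 _).1 (hα01 _).1)
  · refine (le_abs_self _).trans ((abs_boxTest_le hαb (hχαb _)).trans_eq (one_mul 1))
  · obtain ⟨h1, h2, h3⟩ := support_boxTest_subset hr hα0 hχα0 hz
    exact hball z h1 (le_trans (by positivity) h2) h3
  · have hzr : ‖z - y‖ ≤ r := (mem_ball_iff_norm.1 hz.2).le
    have h1 : |lam g t (z - y)| ≤ c * r := (hlam _).trans (by gcongr)
    have h2 : |ell g (z - y)| ≤ c * r := (hell _).trans (by gcongr)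
    rcases le_or_gt (ell g (z - y)) (2 * (ε * r)) with h3 | h3
    · refine Or.inr ⟨h1.trans ?_, (hDr z ?_).1 hz.1, h3⟩
      · gcongr
        exact le_trans le_self_add hm₁m
      · refine Metric.ball_subset_ball ?_ hz.2
        have h1c : (1 : ℝ) ≤ m := by
          exact_mod_cast hc1.trans (le_trans le_self_add hm₁m)
        nlinarith
    · left
      have e1 : |lam g t (z - y) / r| ≤ c := by rwa [abs_div, abs_of_pos hr, div_le_iff₀ hr]
      have e2 : |ell g (z - y) / r| ≤ c := by rwa [abs_div, abs_of_pos hr, div_le_iff₀ hr]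
      have e3 : 2 * ε ≤ ell g (z - y) / r := by rw [le_div_iff₀ hr]; linarith
      rw [boxTest, hα1 _ e1, hα1 _ e2, hχ1 _ e3]
      norm_num
  have I1 := h.integral_boxTest (t := t) hr hα (hχ.mul hα) hα0 hχα0 hDbox (tangentVec g)
  have I2 := h.integral_boxTest (t := t) hr hα' (hχ.mul hk) hα'0 hχk0 hDbox (inwardVec g t)
  simp only [ell_tangentVec, lam_tangentVec, ell_inwardVec, lam_inwardVec, one_mul, zero_mul,
    add_zero, zero_add, hder] at I1 I2
  have i1 : IntegrableOn (fun z => (r⁻¹ * boxTest g t y r (deriv α) (fun b => χ b * α b) z) • φ z)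
      D := by
    simp_rw [mul_smul]
    exact (hφ.smul_of_bound (continuous_boxTest hα'.continuous (hχ.continuous.mul hα.continuous))
      fun z => abs_boxTest_le hC₁ (hχαb _)).smul r⁻¹
  have i2 : IntegrableOn (fun z => (r⁻¹ * boxTest g t y r (deriv α) (fun b => deriv χ b * k b) z) •
      φ z) D := by
    simp_rw [mul_smul]
    exact (hφ.smul_of_bound (continuous_boxTest hα'.continuous (hχ'.continuous.mul hk.continuous))
      fun z => abs_boxTest_le hC₁ (hχ'kb _)).smul r⁻¹
  -- Elimination of the common term with χα between the tangential and the inward integration by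
  -- parts.
  have key : ∫ z in D, boxTest g t y r α (fun b => χ b * α b) z • Dφ z (tangentVec g) =
      -(∫ z in D, (r⁻¹ * boxTest g t y r (deriv α) (fun b => deriv χ b * k b) z) • φ z) -
        ∫ z in D, boxTest g t y r (deriv α) (fun b => χ b * k b) z • Dφ z (inwardVec g t) := by
    rw [I1, I2, ← sub_eq_zero]
    have : ∀ z, (r⁻¹ * boxTest g t y r (deriv α) (fun b => deriv χ b * k b - χ b * α b) z) • φ z =
        (r⁻¹ * boxTest g t y r (deriv α) (fun b => deriv χ b * k b) z) • φ z -
        (r⁻¹ * boxTest g t y r (deriv α) (fun b => χ b * α b) z) • φ z := by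
      intro z
      rw [← sub_smul]
      simp only [boxTest]
      congr 1; ring
    simp_rw [this]
    rw [integral_sub i2 i1]
    abel
  -- The sizes are 1/r from scaling, 1/ε from χ', εr from φ and εr² from the area of the strip;
  -- their product is εr².
  have b1 : ‖∫ z in D, (r⁻¹ * boxTest g t y r (deriv α) (fun b => deriv χ b * k b) z) • φ z‖ₑ ≤
      C₁ * C₂ * m₁ * (3 * L) * C₃ * ε * ENNReal.ofReal r ^ 2 := by
    refine (enorm_integral_le_lintegral_enorm _).trans ?_
    calc _ ≤ ∫⁻ z in D, (strip g t y m ε r).indicator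
          (fun _ => ((C₁ * C₂ * m₁ * (3 * L) : ℝ≥0) : ℝ≥0∞)) z := by
          refine lintegral_mono_ae ?_
          filter_upwards [hLr] with z hz
          by_cases hb : boxTest g t y r (deriv α) (fun b => deriv χ b * k b) z = 0
          · rw [hb, mul_zero, zero_smul, enorm_zero]; exact zero_le
          have hs : |lam g t (z - y)| ≤ m₁ * r ∧ ε * r ≤ ell g (z - y) ∧ ell g (z - y) ≤ m₁ * r :=
            support_boxTest_subset hr hα'0 (fun b hb => by
              rcases hb with hb | hb
              · rw [hχ'0 b (Or.inl hb), zero_mul]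
              · rw [hk0 b hb, mul_zero]) hb
          have hs2 : ell g (z - y) ≤ 2 * (ε * r) := by
            by_contra hcon
            refine hb ?_
            rw [boxTest, hχ'0 (ell g (z - y) / r) (Or.inr _), zero_mul, mul_zero]
            rw [lt_div_iff₀ hr]; linarith
          have h0 : 0 ≤ ell g (z - y) := le_trans (by positivity) hs.2.1
          have hzs : z ∈ strip g t y m ε r :=
            ⟨hs.1.trans (by gcongr), le_trans (by linarith [mul_pos hε' hr]) hs.2.1, hs2⟩
          rw [Set.indicator_of_mem hzs, ← ofReal_norm, ← ENNReal.ofReal_coe_nnreal]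
          refine ENNReal.ofReal_le_ofReal ?_
          rw [norm_smul, norm_mul, norm_inv, Real.norm_of_nonneg hr.le, Real.norm_eq_abs]
          calc r⁻¹ * |boxTest g t y r (deriv α) (fun b => deriv χ b * k b) z| * ‖φ z‖
              ≤ r⁻¹ * (C₁ * (C₂ / ε * m₁)) * (L * (2 * (ε * r) + ε * r)) := by
                gcongr
                · exact abs_boxTest_le hC₁ (hχ'kb _)
                · refine (hz (hball z hs.1 h0 hs.2.2)).trans ?_
                  gcongr
            _ = _ := by push_cast; field_simp; ring
      _ ≤ ∫⁻ z, (strip g t y m ε r).indicator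
          (fun _ => ((C₁ * C₂ * m₁ * (3 * L) : ℝ≥0) : ℝ≥0∞)) z := setLIntegral_le_lintegral _ _
      _ = (C₁ * C₂ * m₁ * (3 * L) : ℝ≥0) * volume (strip g t y m ε r) := by
          rw [lintegral_indicator_const (isClosed_strip g t y m ε r).measurableSet]
      _ ≤ (C₁ * C₂ * m₁ * (3 * L) : ℝ≥0) * (C₃ * ε * ENNReal.ofReal r ^ 2) := by
          gcongr; exact hC₃ ε r hr
      _ = _ := by push_cast; ring
  have b2 : ‖∫ z in D, boxTest g t y r (deriv α) (fun b => χ b * k b) z • Dφ z (inwardVec g t)‖ₑ ≤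
      C₁ * m₁ * ε * ENNReal.ofReal r ^ 2 := by
    refine (enorm_integral_le_lintegral_enorm _).trans ?_
    calc _ ≤ ∫⁻ z in D, (Metric.ball y (m * r)).indicator
          (fun z => ((C₁ * m₁ : ℝ≥0) : ℝ≥0∞) * ‖Dφ z (inwardVec g t)‖ₑ) z := by
          refine lintegral_mono fun z => ?_
          by_cases hb : boxTest g t y r (deriv α) (fun b => χ b * k b) z = 0
          · simp only [hb, zero_smul, enorm_zero]; exact zero_le
          have hs : |lam g t (z - y)| ≤ m₁ * r ∧ ε * r ≤ ell g (z - y) ∧ ell g (z - y) ≤ m₁ * r :=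
            support_boxTest_subset hr hα'0 hχk0 hb
          rw [Set.indicator_of_mem (hball z hs.1 (le_trans (by positivity) hs.2.1) hs.2.2), enorm_smul]
          gcongr
          rw [← ofReal_norm, ← ENNReal.ofReal_coe_nnreal]
          refine ENNReal.ofReal_le_ofReal ?_
          push_cast
          exact abs_boxTest_le hC₁ (hχkb _)
      _ = (C₁ * m₁ : ℝ≥0) * ∫⁻ z in D ∩ Metric.ball y (m * r), ‖Dφ z (inwardVec g t)‖ₑ := by
          rw [setLIntegral_indicator Metric.isOpen_ball.measurableSet, Set.inter_comm,
            lintegral_const_mul' _ _ ENNReal.coe_ne_top]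
      _ ≤ (C₁ * m₁ : ℝ≥0) * (ε * ENNReal.ofReal r ^ 2) := by gcongr
      _ = _ := by push_cast; ring
  rw [key]
  refine (enorm_sub_le).trans ?_
  rw [enorm_neg]
  refine (add_le_add b1 b2).trans (le_of_eq ?_)
  push_cast; ring

end TangentialAverage

theorem MeanZero.of_le_mul {d : ℕ} {D : Set (EuclideanSpace ℝ (Fin d))}
    {g : EuclideanSpace ℝ (Fin d) → ℝ≥0∞} {y : EuclideanSpace ℝ (Fin d)} (C : ℝ≥0)
    (h : ∀ ε : ℝ≥0, 0 < ε → ∀ᶠ r in 𝓝[>] (0 : ℝ),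
      ∫⁻ z in D ∩ Metric.ball y r, g z ≤ C * ε * ENNReal.ofReal r ^ d) : MeanZero D g y := by
  intro ε hε
  filter_upwards [h (ε / (C + 1)) (by positivity)] with r hr
  refine hr.trans ?_
  gcongr
  rw [← ENNReal.coe_mul, ENNReal.coe_le_coe, mul_div_assoc', div_le_iff₀ (by positivity), mul_comm]
  gcongr
  exact le_self_add

/-- Smallness of averages of a signed quantity says nothing about its absolute value, but `Q` is
nonnegative and affine in the tangential derivative. So its weighted integral is small, the weight
is 1 on the ball outside a strip, and on the strip the boundedness of `Q` suffices. -/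
theorem HasWeakFDerivOn.meanZero_tangential {W : Type*} [NormedAddCommGroup W]
    [InnerProductSpace ℝ W] [CompleteSpace W] {D : Set E2} {g t : ℝ} {y : E2}
    {φ : E2 → W} {Dφ : E2 → E2 →L[ℝ] W} {L : ℝ≥0} (hDm : MeasurableSet D)
    (h : HasWeakFDerivOn D φ Dφ) (hφ : IntegrableOn φ D) (hDφ : IntegrableOn Dφ D)
    (hD : IsEpigraphAt D g y)
    (hL : ∀ m ε : ℝ≥0, 0 < ε → ∀ᶠ r in 𝓝[>] (0 : ℝ), ∀ᵐ z ∂volume.restrict D,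
      z ∈ Metric.ball y (m * r) → ‖φ z‖ ≤ L * (ell g (z - y) + ε * r))
    (hξ : MeanZero D (fun z => ‖Dφ z (inwardVec g t)‖ₑ) y)
    {Q q₀ : E2 → ℝ} {p : W} {C : ℝ≥0} (hQi : IntegrableOn Q D)
    (hQ0 : ∀ᵐ z ∂volume.restrict D, 0 ≤ Q z ∧ Q z ≤ C)
    (hQ : ∀ᵐ z ∂volume.restrict D, Q z = q₀ z - 2 * inner ℝ p (Dφ z (tangentVec g)))
    (hq₀ : MeanZero D (fun z => ‖q₀ z‖ₑ) y) : MeanZero D (fun z => ENNReal.ofReal (Q z)) y := by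
  obtain ⟨m, C₁, hm, hω⟩ := h.exists_weight hφ hD hL hξ
  obtain ⟨C₂, hC₂⟩ := exists_volume_strip_le g t y m
  have hDφe : IntegrableOn (fun z => Dφ z (tangentVec g)) D :=
    (ContinuousLinearMap.apply ℝ W (tangentVec g)).integrable_comp hDφ
  refine MeanZero.of_le_mul (1 + 2 * ‖p‖₊ * C₁ + C * C₂) fun ε hε => ?_
  filter_upwards [hω ε hε, hq₀.scale hm hε, self_mem_nhdsWithin] with r hωr hqr hr0
  have hr : 0 < r := hr0
  obtain ⟨ω, hωc, hω01, hωs, hω1, hωint⟩ := hωr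
  have hωb : ∀ z, |ω z| ≤ 1 := fun z => by rw [abs_of_nonneg (hω01 z).1]; exact (hω01 z).2
  have i1 : IntegrableOn (fun z => ω z • Q z) D := hQi.smul_of_bound hωc hωb
  have i2 : IntegrableOn (fun z => ω z • Dφ z (tangentVec g)) D := hDφe.smul_of_bound hωc hωb
  have i3 : IntegrableOn (fun z => inner ℝ p (ω z • Dφ z (tangentVec g))) D := i2.const_inner p
  have hsplit : ∫ z in D, ω z • Q z =
      (∫ z in D, ω z • q₀ z) - 2 * inner ℝ p (∫ z in D, ω z • Dφ z (tangentVec g)) := by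
    rw [← integral_inner i2 p, ← integral_const_mul, eq_sub_iff_add_eq,
      ← integral_add i1 (i3.const_mul 2)]
    refine integral_congr_ae ?_
    filter_upwards [hQ] with z hz
    rw [hz, inner_smul_right, smul_eq_mul, smul_eq_mul]
    ring
  have hq : ‖∫ z in D, ω z • q₀ z‖ₑ ≤ ε * ENNReal.ofReal r ^ 2 := by
    refine (enorm_integral_le_lintegral_enorm _).trans (le_trans ?_ hqr)
    rw [Set.inter_comm, ← setLIntegral_indicator Metric.isOpen_ball.measurableSet]
    refine lintegral_mono fun z => ?_
    by_cases hz : ω z = 0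
    · simp only [hz, zero_smul, enorm_zero]; exact zero_le
    · rw [Set.indicator_of_mem (hωs z hz), enorm_smul]
      refine mul_le_of_le_one_left zero_le ?_
      rw [← ofReal_norm, Real.norm_eq_abs]
      exact ENNReal.ofReal_le_one.2 (hωb z)
  have hωQ : ∫⁻ z in D, ENNReal.ofReal (ω z • Q z) ≤
      (1 + 2 * ‖p‖₊ * C₁ : ℝ≥0) * ε * ENNReal.ofReal r ^ 2 := by
    rw [← ofReal_integral_eq_lintegral_ofReal i1 (by
      filter_upwards [hQ0] with z hz using mul_nonneg (hω01 z).1 hz.1), hsplit]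
    refine (Real.ofReal_le_enorm _).trans (enorm_sub_le.trans ?_)
    have : ‖2 * inner ℝ p (∫ z in D, ω z • Dφ z (tangentVec g))‖ₑ ≤
        (2 * ‖p‖₊ : ℝ≥0) * ‖∫ z in D, ω z • Dφ z (tangentVec g)‖ₑ := by
      rw [← ofReal_norm, ← ofReal_norm, ← ENNReal.ofReal_coe_nnreal,
        ← ENNReal.ofReal_mul (NNReal.coe_nonneg _)]
      refine ENNReal.ofReal_le_ofReal ?_
      rw [norm_mul, Real.norm_ofNat]
      push_cast
      rw [mul_assoc]
      gcongr
      exact norm_inner_le_norm _ _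
    refine (add_le_add hq (this.trans (mul_le_mul_right hωint _))).trans (le_of_eq ?_)
    push_cast; ring
  calc ∫⁻ z in D ∩ Metric.ball y r, ENNReal.ofReal (Q z)
      ≤ ∫⁻ z in D ∩ Metric.ball y r, ENNReal.ofReal (ω z • Q z) +
          (strip g t y m ε r).indicator (fun _ => (C : ℝ≥0∞)) z := by
        refine lintegral_mono_ae ?_
        filter_upwards [ae_restrict_of_ae_restrict_of_subset Set.inter_subset_left hQ0,
          ae_restrict_mem (hDm.inter Metric.isOpen_ball.measurableSet)] with z hz hzm
        rcases hω1 z hzm with h1 | h1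
        · rw [h1, one_smul]; exact le_self_add
        · rw [Set.indicator_of_mem h1]
          refine le_trans ?_ le_add_self
          rw [← ENNReal.ofReal_coe_nnreal]
          exact ENNReal.ofReal_le_ofReal hz.2
    _ ≤ (∫⁻ z in D, ENNReal.ofReal (ω z • Q z)) +
          ∫⁻ z, (strip g t y m ε r).indicator (fun _ => (C : ℝ≥0∞)) z := by
        rw [lintegral_add_right _ (measurable_const.indicator (isClosed_strip g t y m ε r).measurableSet)]
        gcongr
        · exact Set.inter_subset_left
        · exact Measure.restrict_le_self
    _ ≤ (1 + 2 * ‖p‖₊ * C₁ : ℝ≥0) * ε * ENNReal.ofReal r ^ 2 +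
          C * (C₂ * ε * ENNReal.ofReal r ^ 2) := by
        rw [lintegral_indicator_const (isClosed_strip g t y m ε r).measurableSet]
        gcongr
        exact hC₂ ε r hr
    _ = _ := by push_cast; ring

/-! ### Differentiability points of the graph and the outer conormal. -/

section GraphGeometry

variable {M S : Set E3} {n : E3 → E3} {T : Tube M S n} {κ : ℝ≥0} {γ : ℝ → ℝ} {g s : ℝ}

theorem eventually_abs_ell_sub_le (hg : HasDerivAt γ g s) {η : ℝ} (hη : 0 < η) :
    ∀ᶠ z : E2 in 𝓝 (graphPoint γ s),
      |ell g (z - graphPoint γ s) - (z 1 - γ (z 0))| ≤ η * ‖z - graphPoint γ s‖ := by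
  have h1 : Tendsto (fun z : E2 => z 0) (𝓝 (graphPoint γ s)) (𝓝 s) := by
    have : Continuous fun z : E2 => z 0 := by fun_prop
    exact this.tendsto' _ _ rfl
  filter_upwards [h1.eventually (hg.isLittleO.bound hη)] with z hz
  have e : ell g (z - graphPoint γ s) - (z 1 - γ (z 0)) = γ (z 0) - γ s - (z 0 - s) • g := by
    simp only [ell_apply, PiLp.sub_apply, graphPoint_zero, graphPoint_one, smul_eq_mul]
    ring
  rw [e, ← Real.norm_eq_abs]
  refine hz.trans ?_
  gcongr
  exact abs_apply_le_norm (z - graphPoint γ s) 0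

theorem eventually_ball_of_eventually {p : E2 → Prop} {y : E2} (hp : ∀ᶠ z in 𝓝 y, p z) (m : ℝ≥0) :
    ∀ᶠ r in 𝓝[>] (0 : ℝ), ∀ z ∈ Metric.ball y (m * r), p z := by
  obtain ⟨ρ, hρ, hb⟩ := Metric.eventually_nhds_iff_ball.1 hp
  filter_upwards [Ioo_mem_nhdsGT (show 0 < ρ / (m + 1) by positivity)] with r hr z hz
  refine hb z (Metric.ball_subset_ball ?_ hz)
  have := (lt_div_iff₀ (by positivity)).1 hr.2
  linarith [hr.1]

namespace Tube.IsGraph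

theorem eventually_mem (h : T.IsGraph κ γ) (hs : graphPoint γ s ∈ T.B) :
    ∀ᶠ z : E2 in 𝓝 (graphPoint γ s), z ∈ T.B ∧ graphPoint γ (z 0) ∈ T.B := by
  have h1 : Continuous fun z : E2 => graphPoint γ (z 0) :=
    (lipschitzWith_graphPoint h.lipschitz).continuous.comp (by fun_prop)
  have h2 : ∀ᶠ z in 𝓝 (graphPoint γ s), z ∈ T.B := Tube.isOpen_B.mem_nhds hs
  exact h2.and (h1.continuousAt (Tube.isOpen_B.mem_nhds hs))

theorem eventually_ell (h : T.IsGraph κ γ) (hs : graphPoint γ s ∈ T.B) (hg : HasDerivAt γ g s)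
    (m : ℝ≥0) {ε : ℝ≥0} (hε : 0 < ε) : ∀ᶠ r in 𝓝[>] (0 : ℝ),
      ∀ z ∈ Metric.ball (graphPoint γ s) (m * r), (z ∈ T.B ∧ graphPoint γ (z 0) ∈ T.B) ∧
        |ell g (z - graphPoint γ s) - (z 1 - γ (z 0))| < ε * r := by
  have hη : (0 : ℝ) < ε / (m + 1) := by positivity
  filter_upwards [eventually_ball_of_eventually ((h.eventually_mem hs).and
    (eventually_abs_ell_sub_le hg hη)) m, self_mem_nhdsWithin] with r hr hr0 z hz
  refine ⟨(hr z hz).1, (hr z hz).2.trans_lt ?_⟩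
  have hr0 : 0 < r := hr0
  rw [mem_ball_iff_norm] at hz
  calc (ε : ℝ) / (m + 1) * ‖z - graphPoint γ s‖ < ε / (m + 1) * ((m + 1) * r) := by
        gcongr; linarith
    _ = ε * r := by field_simp

theorem isEpigraphAt (h : T.IsGraph κ γ) (hs : graphPoint γ s ∈ T.B) (hg : HasDerivAt γ g s) :
    IsEpigraphAt T.D g (graphPoint γ s) := by
  intro m ε hε
  filter_upwards [h.eventually_ell hs hg m hε] with r hr z hz
  obtain ⟨⟨hzB, -⟩, h1⟩ := hr z hz
  rw [abs_lt] at h1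
  exact ⟨fun hD => by linarith [(h.mem_D.1 hD).2, h1.1],
    fun hl => h.mem_D.2 ⟨hzB, by linarith [h1.2]⟩⟩

/-- The slope of the inward vector that is normal to the graph in the induced metric. -/
noncomputable def _root_.normalSlope (A : E2 →L[ℝ] E3) (g : ℝ) : ℝ :=
  inner ℝ (A e₂) (A (tangentVec g)) / ‖A (tangentVec g)‖ ^ 2

theorem _root_.inner_inwardVec {A : E2 →L[ℝ] E3} (hA : Function.Injective A) (g : ℝ) :
    inner ℝ (A (inwardVec g (normalSlope A g))) (A (tangentVec g)) = 0 := by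
  have h0 : A (tangentVec g) ≠ 0 := by
    intro h
    have : tangentVec g = 0 := hA (h.trans (map_zero A).symm)
    have := congrArg (lam g 0) this
    simp at this
  have h1 : ‖A (tangentVec g)‖ ≠ 0 := norm_ne_zero_iff.2 h0
  rw [inwardVec, map_sub, map_smul, inner_sub_left, real_inner_smul_left,
    real_inner_self_eq_norm_sq, normalSlope]
  field_simp
  ring

theorem _root_.map_inwardVec_ne_zero {A : E2 →L[ℝ] E3} (hA : Function.Injective A) (g t : ℝ) :
    A (inwardVec g t) ≠ 0 := by
  intro h
  have : inwardVec g t = 0 := hA (h.trans (map_zero A).symm)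
  have := congrArg (ell g) this
  simp at this

/-- Along the surface the inner product of X(z) - X(y) with the conormal is -‖Aξ‖ times the height
of z above the tangent line, up to a quadratic error. By differentiability this height differs from
the height above the graph by o(|z - y|), so outside a thin cone the sign decides on which side z
lies. -/
theorem isOuterConormal (h : T.IsGraph κ γ) (hs : graphPoint γ s ∈ T.B) (hg : HasDerivAt γ g s)
    {A : E2 →L[ℝ] E3} (hA : fderiv ℝ T.X (graphPoint γ s) = A) :
    IsOuterConormal M S n (T.X (graphPoint γ s))
      (A (-‖A (inwardVec g (normalSlope A g))‖⁻¹ • inwardVec g (normalSlope A g))) := by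
  set y := graphPoint γ s with hy
  set ξ := inwardVec g (normalSlope A g) with hξ
  have hAi : Function.Injective A := hA ▸ T.chart.immersion y (Tube.B_subset hs)
  have hξ0 : 0 < ‖A ξ‖ := norm_pos_iff.2 (map_inwardVec_ne_zero hAi _ _)
  have hcl : T.X y ∈ closure S := h.mem_closure hs rfl
  have hNy : n (T.X y) = T.N y := T.n_eq y hs hcl
  rw [map_smul]
  refine ⟨?_, ?_, fun ε hε => ?_⟩
  · rw [norm_smul, norm_neg, norm_inv, norm_norm, inv_mul_cancel₀ hξ0.ne']
  · rw [hNy, real_inner_smul_left, ← hA, Tube.inner_fderiv_X_N, mul_zero]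
  -- the expansion of `X` in the direction of the conormal
  have hexp : ∀ z ∈ T.B, |inner ℝ (T.X z - T.X y) (-‖A ξ‖⁻¹ • A ξ) + ‖A ξ‖ * ell g (z - y)| ≤
      T.K * ‖z - y‖ ^ 2 := by
    intro z hz
    have h1 := Tube.norm_X_sub_sub_le hs hz
    rw [hA] at h1
    have h2 : inner ℝ (A (z - y)) (-‖A ξ‖⁻¹ • A ξ) = -(‖A ξ‖ * ell g (z - y)) := by
      have horth := inner_inwardVec hAi g
      rw [real_inner_comm, ← hξ] at horth
      conv_lhs => rw [eq_lam_add_ell g (normalSlope A g) (z - y)]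
      rw [map_add, map_smul, map_smul, inner_add_left, real_inner_smul_left, real_inner_smul_left,
        inner_smul_right, inner_smul_right, horth, real_inner_self_eq_norm_sq]
      field_simp
      ring
    have h3 : inner ℝ (T.X z - T.X y) (-‖A ξ‖⁻¹ • A ξ) + ‖A ξ‖ * ell g (z - y) =
        inner ℝ (T.X z - T.X y - A (z - y)) (-‖A ξ‖⁻¹ • A ξ) := by
      rw [inner_sub_left _ (A (z - y)), h2]; ring
    rw [h3]
    refine (abs_real_inner_le_norm _ _).trans ?_
    rw [norm_smul, norm_neg, norm_inv, norm_norm, inv_mul_cancel₀ hξ0.ne', mul_one]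
    exact h1
  set K' : ℝ := T.K + 1 with hK'
  have hK0 : 0 < K' := by positivity
  -- The constants make the quadratic error and the differentiability error at most ε/(2K') ‖z - y‖
  -- each; together they stay below ε ‖X z - X y‖. Adding 1 to the Lipschitz constant keeps `K'`
  -- positive.
  set η : ℝ := ε / (2 * K' * ‖A ξ‖) with hη
  have hη0 : 0 < η := by positivity
  obtain ⟨ρ, hρ, hb⟩ := Metric.eventually_nhds_iff_ball.1
    ((h.eventually_mem hs).and (eventually_abs_ell_sub_le hg hη0))
  set ρ' := min ρ (ε / (2 * K' * K'))
  have hρ' : 0 < ρ' := lt_min hρ (by positivity)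
  have hbB : Metric.ball y ρ' ⊆ T.B := fun z hz =>
    (hb z (Metric.ball_subset_ball (min_le_left _ _) hz)).1.1
  obtain ⟨U, hU, hUX⟩ := T.chart.image_eq_inter (Metric.isOpen_ball (x := y) (ε := ρ'))
    (hbB.trans Tube.B_subset)
  obtain ⟨r, hr, hrU⟩ := Metric.isOpen_iff.1 hU (T.X y)
    (hUX.subset ⟨y, Metric.mem_ball_self hρ', rfl⟩).2
  refine ⟨r, hr, fun q hq hqr => ?_⟩
  obtain ⟨z, hz, rfl⟩ := hUX.superset ⟨hq, hrU hqr⟩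
  have hzB := hbB hz
  have hl := abs_le.1 (hb z (Metric.ball_subset_ball (min_le_left _ _) hz)).2
  have he := abs_le.1 (hexp z hzB)
  have hnorm : ‖z - y‖ ≤ K' * ‖T.X z - T.X y‖ := by
    refine (Tube.norm_sub_le_norm_X_sub hzB hs).trans ?_
    gcongr
    linarith
  have hzρ : ‖z - y‖ ≤ ε / (2 * K' * K') :=
    ((mem_ball_iff_norm.1 hz).trans_le (min_le_right _ _)).le
  have hq1 : T.K * ‖z - y‖ ^ 2 ≤ ε / (2 * K') * ‖z - y‖ := by
    have : T.K * ‖z - y‖ ≤ K' * (ε / (2 * K' * K')) := by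
      gcongr
      linarith
    have e : K' * (ε / (2 * K' * K')) = ε / (2 * K') := by field_simp
    rw [e] at this
    rw [sq, ← mul_assoc]
    gcongr
  have hq2 : ‖A ξ‖ * (η * ‖z - y‖) = ε / (2 * K') * ‖z - y‖ := by
    rw [hη]; field_simp
  have hq3 : 2 * (ε / (2 * K') * ‖z - y‖) ≤ ε * ‖T.X z - T.X y‖ := by
    have : 2 * (ε / (2 * K') * ‖z - y‖) = ε * (‖z - y‖ / K') := by field_simp
    rw [this]
    gcongr
    rw [div_le_iff₀ hK0, mul_comm]; exact hnorm
  refine ⟨fun h1 h2 => ?_, fun h1 => ?_⟩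
  · have h3 := (h.mem_iff z hzB).1 h2
    have h4 : -(η * ‖z - y‖) ≤ ell g (z - y) := by linarith [hl.1]
    have h5 := mul_le_mul_of_nonneg_left h4 hξ0.le
    linarith [he.2]
  · refine (h.mem_iff z hzB).2 ?_
    by_contra h3
    have h4 : ell g (z - y) ≤ η * ‖z - y‖ := by linarith [hl.2]
    have h5 := mul_le_mul_of_nonneg_left h4 hξ0.le
    linarith [he.1]

end Tube.IsGraph

end GraphGeometry

namespace MeanZero

variable {d : ℕ} {D : Set (EuclideanSpace ℝ (Fin d))} {y : EuclideanSpace ℝ (Fin d)}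
  {g g₁ g₂ : EuclideanSpace ℝ (Fin d) → ℝ≥0∞}

theorem of_continuousAt {F : Type*} [NormedAddCommGroup F] {f : EuclideanSpace ℝ (Fin d) → F}
    (hf : ContinuousAt f y) (hD : MeasurableSet D) : MeanZero D (fun z => ‖f z - f y‖ₑ) y := by
  refine of_eventually_le (fun ε hε => mem_nhdsWithin_of_mem_nhds ?_) hD
  filter_upwards [hf (Metric.ball_mem_nhds (f y) (NNReal.coe_pos.2 hε))] with z hz
  have hz : dist (f z) (f y) < ε := hz
  rw [dist_eq_norm] at hz
  rw [← ofReal_norm, ← ENNReal.ofReal_coe_nnreal]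
  exact ENNReal.ofReal_le_ofReal hz.le

theorem of_le_add (h₁ : MeanZero D g₁ y) (h₂ : MeanZero D g₂ y)
    (hg₁ : AEMeasurable g₁ (volume.restrict D)) {C : ℝ≥0}
    (hg : ∀ᵐ z ∂volume.restrict D, g z ≤ C * (g₁ z + g₂ z)) : MeanZero D g y :=
  (h₁.add h₂ hg₁).mono hg

end MeanZero

/-! ### Boundary values of the gradient and of the image normal. -/

section BoundaryPoints

/-- `w(p) = p` in the sense of traces. -/
def FixesBoundaryAt (M S : Set E3) (w : E3 → E3) (p : E3) : Prop :=
  ∀ (V : Set E2) (X : E2 → E3), IsC2Chart M V X → ∀ y ∈ V, X y = p →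
    HasTraceAt (V ∩ X ⁻¹' S) (w ∘ X) y p

/-- `∇_τ w(p) = τ` in the sense of traces. -/
def FixesConormalAt (M S : Set E3) (n w : E3 → E3) (p : E3) : Prop :=
  ∀ τ : E3, IsOuterConormal M S n p τ →
    ∀ (V : Set E2) (X : E2 → E3), IsC2Chart M V X → ∀ y ∈ V, X y = p →
      ∀ ξ : E2, fderiv ℝ X y ξ = τ →
        ∀ G : E2 → E2 →L[ℝ] E3, HasWeakFDerivOn (V ∩ X ⁻¹' S) (w ∘ X) G →
          HasTraceAt (V ∩ X ⁻¹' S) (fun z => G z ξ) y τ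

variable {M S : Set E3} {n w : E3 → E3} {T : Tube M S n} {κ : ℝ≥0} {γ : ℝ → ℝ} {g s : ℝ}

theorem Tube.IsGraph.ae_fixesAt (h : T.IsGraph κ γ) (hb : FixesBoundary M S w)
    (hc : FixesConormal M S n w) : ∀ᵐ s : ℝ, graphPoint γ s ∈ T.B →
      DifferentiableAt ℝ γ s ∧ FixesBoundaryAt M S w (T.X (graphPoint γ s)) ∧
      FixesConormalAt M S n w (T.X (graphPoint γ s)) := by
  have h1 : ∀ᵐ p ∂(Measure.hausdorffMeasure 1 : Measure E3), p ∈ surfBoundary S →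
      FixesBoundaryAt M S w p ∧ FixesConormalAt M S n w p := by
    filter_upwards [hb, hc] with p h1 h2 hp using ⟨h1 hp, h2 hp⟩
  have h2 := volume_graph_preimage T γ (ae_iff.1 h1)
  filter_upwards [h.lipschitz.ae_differentiableAt, measure_eq_zero_iff_ae_notMem.1 h2] with s hs hs2 hsB
  refine ⟨hs, ?_⟩
  by_contra hcon
  exact hs2 ⟨hsB, fun hp => hcon (hp (h.mem_surfBoundary hsB rfl))⟩

namespace TubeIsometry

variable (J : TubeIsometry T w)

theorem weak_G_D : HasWeakFDerivOn T.D (w ∘ T.X) J.G := J.weak_G.mono Tube.D_subset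

theorem aestronglyMeasurable_G_apply (v : E2) :
    AEStronglyMeasurable (fun z => J.G z v) (volume.restrict T.D) :=
  (ContinuousLinearMap.apply ℝ E3 v).continuous.comp_aestronglyMeasurable
    J.weak_G_D.locallyIntegrableOn_grad.aestronglyMeasurable

theorem ae_norm_G_le : ∀ᵐ z ∂volume.restrict T.D, z ∈ T.D → ‖J.G z‖ ≤ T.K := by
  filter_upwards [J.isometric] with z hz hD
  exact norm_le_of_isometric hz (Tube.norm_fderiv_X_le (Tube.D_subset_B hD))

theorem meanZero_sub_X (J : TubeIsometry T w) (hS : ∃ U : Set E3, IsOpen U ∧ S = M ∩ U) {y : E2} (hy : y ∈ T.B)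
    (hb : FixesBoundaryAt M S w (T.X y)) : MeanZero T.D (fun z => ‖w (T.X z) - T.X z‖ₑ) y := by
  have hD := (Tube.isOpen_D (T := T) hS).measurableSet
  have h1 := (hb T.V T.X T.chart y (Tube.B_subset hy) rfl).meanZero.congr_set one_pos
    (D' := T.D) (Set.inter_subset_left.trans Tube.D_subset)
  have h2 := MeanZero.of_continuousAt (Tube.hasFDerivAt_X hy).continuousAt hD
  refine h1.of_le_add h2 (J.memLp_f.aestronglyMeasurable.sub aestronglyMeasurable_const).enorm
    (C := 1) (ae_of_all _ fun z => ?_)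
  rw [ENNReal.coe_one, one_mul]
  refine le_trans (le_of_eq ?_) enorm_sub_le
  congr 1
  simp only [Function.comp_apply]
  abel

theorem meanZero_conormal (hS : ∃ U : Set E3, IsOpen U ∧ S = M ∩ U) (h : T.IsGraph κ γ)
    (hs : graphPoint γ s ∈ T.B) (hg : HasDerivAt γ g s) {A : E2 →L[ℝ] E3}
    (hA : fderiv ℝ T.X (graphPoint γ s) = A)
    (hc : FixesConormalAt M S n w (T.X (graphPoint γ s))) :
    MeanZero T.D (fun z => ‖(J.G z - fderiv ℝ T.X z) (inwardVec g (normalSlope A g))‖ₑ)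
      (graphPoint γ s) := by
  have hD := (Tube.isOpen_D (T := T) hS).measurableSet
  set y := graphPoint γ s
  set ξ := inwardVec g (normalSlope A g) with hξ
  have hAi : Function.Injective A := hA ▸ T.chart.immersion y (Tube.B_subset hs)
  have hξ0 : ‖A ξ‖ ≠ 0 := norm_ne_zero_iff.2 (map_inwardVec_ne_zero hAi _ _)
  set ζ := -‖A ξ‖⁻¹ • ξ with hζ
  have hξζ : ξ = (-‖A ξ‖) • ζ := by
    rw [hζ, smul_smul, neg_mul_neg, mul_inv_cancel₀ hξ0, one_smul]
  have h1 := (hc _ (h.isOuterConormal hs hg hA) T.V T.X T.chart y (Tube.B_subset hs) rfl ζ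
    (by rw [hA]) J.G J.weak_G).meanZero.congr_set one_pos
      (D' := T.D) (Set.inter_subset_left.trans Tube.D_subset)
  have hcont : ContinuousAt (fun z => fderiv ℝ T.X z ζ) y :=
    ((Tube.contDiffOn_fderiv.continuousOn.continuousAt (Tube.isOpen_B.mem_nhds hs))).clm_apply
      continuousAt_const
  have h2 := MeanZero.of_continuousAt hcont hD
  refine h1.of_le_add h2 ((J.aestronglyMeasurable_G_apply ζ).sub aestronglyMeasurable_const).enorm
    (C := ‖A ξ‖₊) (ae_of_all _ fun z => ?_)
  have e : (J.G z - fderiv ℝ T.X z) ξ =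
      (-‖A ξ‖) • ((J.G z ζ - A ζ) - (fderiv ℝ T.X z ζ - fderiv ℝ T.X y ζ)) := by
    conv_lhs => rw [hξζ]
    rw [map_smul, sub_apply, hA]
    congr 1; abel
  rw [e, enorm_smul, enorm_neg, enorm_norm]
  exact mul_le_mul_right enorm_sub_le _

/-- With e tangent to the graph, |G e| = |DX e| gives |G e - A e|² = |DX e - A e|² - 2 ⟨A e, (G -
DX) e⟩. The first term vanishes by continuity and the second is linear, so the averages obtained by
integration by parts give convergence in mean square. -/
theorem meanZero_tangent (hS : ∃ U : Set E3, IsOpen U ∧ S = M ∩ U) (h : T.IsGraph κ γ)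
    (hs : graphPoint γ s ∈ T.B) (hg : HasDerivAt γ g s) {A : E2 →L[ℝ] E3}
    (hA : fderiv ℝ T.X (graphPoint γ s) = A)
    (hb : ∀ᵐ s : ℝ, graphPoint γ s ∈ T.B → FixesBoundaryAt M S w (T.X (graphPoint γ s)))
    (hc : FixesConormalAt M S n w (T.X (graphPoint γ s))) :
    MeanZero T.D (fun z => ‖(J.G z - fderiv ℝ T.X z) (tangentVec g)‖ₑ) (graphPoint γ s) := by
  have hDo := Tube.isOpen_D (T := T) hS
  have hD := hDo.measurableSet
  have hfin : IsFiniteMeasure (volume.restrict T.D) :=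
    ⟨by rw [Measure.restrict_apply_univ]
        exact (measure_mono Tube.D_subset_B).trans_lt measure_ball_lt_top⟩
  set y := graphPoint γ s with hy
  set e := tangentVec g with he
  have hX1 : ContDiffOn ℝ 1 T.X T.D := Tube.contDiffOn_X.mono Tube.D_subset_B
  have hweak : HasWeakFDerivOn T.D (fun z => (w ∘ T.X) z - T.X z)
      (fun z => J.G z - fderiv ℝ T.X z) := J.weak_G_D.sub (HasWeakFDerivOn.of_contDiffOn hX1 hDo)
  have hDφL : ∀ᵐ z ∂volume.restrict T.D, ‖J.G z - fderiv ℝ T.X z‖ ≤ (2 * T.K : ℝ≥0) := by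
    filter_upwards [J.ae_norm_G_le, ae_restrict_mem hD] with z h1 hz
    refine (norm_sub_le _ _).trans ?_
    have := Tube.norm_fderiv_X_le (Tube.D_subset_B hz)
    push_cast
    linarith [h1 hz]
  have hDφi : IntegrableOn (fun z => J.G z - fderiv ℝ T.X z) T.D :=
    Integrable.of_bound hweak.locallyIntegrableOn_grad.aestronglyMeasurable _ hDφL
  have hXb : ∃ C, ∀ z ∈ T.B, ‖T.X z‖ ≤ C := by
    refine ⟨T.K * T.δ + ‖T.X T.y₀‖, fun z hz => ?_⟩
    have h0 : T.y₀ ∈ T.B := Metric.mem_ball_self T.δ_pos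
    have h1 := Tube.lipschitzOn_X.norm_sub_le hz h0
    have h2 : ‖z - T.y₀‖ < T.δ := mem_ball_iff_norm.1 hz
    have h3 := norm_le_norm_sub_add (T.X z) (T.X T.y₀)
    have : T.K * ‖z - T.y₀‖ ≤ T.K * T.δ := by gcongr
    linarith
  obtain ⟨CX, hCX⟩ := hXb
  have hXm : MemLp T.X 2 (volume.restrict T.D) :=
    MemLp.of_bound (hX1.continuousOn.aestronglyMeasurable hD) CX (by
      filter_upwards [ae_restrict_mem hD] with z hz using hCX z (Tube.D_subset_B hz))
  have hφi : IntegrableOn (fun z => (w ∘ T.X) z - T.X z) T.D :=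
    (J.memLp_f.sub hXm).integrable (by norm_num)
  -- The boundary condition at almost all parameters, not only at `s`, bounds w - x by the height
  -- above the graph.
  have hφ := Tube.IsGraph.ae_norm_le hweak hφi hDφi hDφL h (by
    filter_upwards [hb] with s' hs' hsB using J.meanZero_sub_X hS hsB (hs' hsB))
  have hφ' : ∀ m ε : ℝ≥0, 0 < ε → ∀ᶠ r in 𝓝[>] (0 : ℝ), ∀ᵐ z ∂volume.restrict T.D,
      z ∈ Metric.ball y (m * r) →
        ‖(w ∘ T.X) z - T.X z‖ ≤ (2 * T.K : ℝ≥0) * (ell g (z - y) + ε * r) := by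
    intro m ε hε
    filter_upwards [h.eventually_ell hs hg m hε] with r hr
    filter_upwards [ae_restrict_of_ae hφ, ae_restrict_mem hD] with z hz hzD hzb
    obtain ⟨⟨-, h1⟩, h2⟩ := hr z hzb
    refine (hz hzD h1).trans ?_
    gcongr
    linarith [(abs_lt.1 h2).1]
  have hcont : ContinuousAt (fun z => fderiv ℝ T.X z e) y :=
    ((Tube.contDiffOn_fderiv.continuousOn.continuousAt (Tube.isOpen_B.mem_nhds hs))).clm_apply
      continuousAt_const
  have hGe : AEStronglyMeasurable (fun z => J.G z e) (volume.restrict T.D) :=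
    J.aestronglyMeasurable_G_apply e
  have hQb : ∀ᵐ z ∂volume.restrict T.D, 0 ≤ ‖J.G z e - A e‖ ^ 2 ∧
      ‖J.G z e - A e‖ ^ 2 ≤ ((2 * T.K * ‖e‖₊) ^ 2 : ℝ≥0) := by
    filter_upwards [J.ae_norm_G_le, ae_restrict_mem hD] with z h1 hz
    refine ⟨sq_nonneg _, ?_⟩
    push_cast
    gcongr
    refine (norm_sub_le _ _).trans ?_
    have h2 := (J.G z).le_of_opNorm_le (h1 hz) e
    have h3 := A.le_of_opNorm_le (hA ▸ Tube.norm_fderiv_X_le hs) e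
    linarith
  have hQi : IntegrableOn (fun z => ‖J.G z e - A e‖ ^ 2) T.D :=
    Integrable.of_bound ((hGe.sub aestronglyMeasurable_const).norm.pow 2) _ (by
      filter_upwards [hQb] with z hz
      rw [Real.norm_of_nonneg hz.1]
      exact hz.2)
  have hq : MeanZero T.D (fun z => ‖‖fderiv ℝ T.X z e - A e‖ ^ 2‖ₑ) y := by
    have hc2 : ContinuousAt (fun z => ‖fderiv ℝ T.X z e - A e‖ ^ 2) y :=
      ((hcont.sub continuousAt_const).norm).pow 2
    have := MeanZero.of_continuousAt hc2 hD
    simpa [hA] using this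
  have key := hweak.meanZero_tangential hD hφi hDφi (h.isEpigraphAt hs hg) hφ'
    (J.meanZero_conormal hS h hs hg hA hc) (p := A e) hQi hQb (by
      filter_upwards [J.isometric] with z hz
      have h1 := hz e e
      rw [real_inner_self_eq_norm_sq, real_inner_self_eq_norm_sq] at h1
      rw [norm_sub_sq_real, norm_sub_sq_real, h1, sub_apply, inner_sub_right,
        real_inner_comm (A e) (J.G z e), real_inner_comm (A e) (fderiv ℝ T.X z e)]
      ring) hq
  have key2 : MeanZero T.D (fun z => ‖J.G z e - A e‖ₑ) y := by
    refine MeanZero.of_sq ?_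
    refine key.mono (C := 1) (ae_of_all _ fun z => ?_)
    rw [ENNReal.coe_one, one_mul, ENNReal.ofReal_pow (norm_nonneg _), ofReal_norm]
  refine key2.of_le_add (MeanZero.of_continuousAt hcont hD)
    (hGe.sub aestronglyMeasurable_const).enorm (C := 1) (ae_of_all _ fun z => ?_)
  rw [ENNReal.coe_one, one_mul, sub_apply, hA]
  refine le_trans (le_of_eq ?_) enorm_sub_le
  congr 1; abel

/-- Tangent and inward vectors form a basis of the parameter plane, so the tangential and the
conormal estimate give every direction. -/
theorem meanZero_gradient (hS : ∃ U : Set E3, IsOpen U ∧ S = M ∩ U) (h : T.IsGraph κ γ)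
    (hs : graphPoint γ s ∈ T.B) (hg : HasDerivAt γ g s)
    (hb : ∀ᵐ s : ℝ, graphPoint γ s ∈ T.B → FixesBoundaryAt M S w (T.X (graphPoint γ s)))
    (hc : FixesConormalAt M S n w (T.X (graphPoint γ s))) (v : E2) :
    MeanZero T.D (fun z => ‖(J.G z - fderiv ℝ T.X z) v‖ₑ) (graphPoint γ s) := by
  have hDo := Tube.isOpen_D (T := T) hS
  have h1 := J.meanZero_tangent hS h hs hg rfl hb hc
  have h2 := J.meanZero_conormal hS h hs hg rfl hc
  set t := normalSlope (fderiv ℝ T.X (graphPoint γ s)) g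
  have hcont : ContinuousOn (fun z => fderiv ℝ T.X z (tangentVec g)) T.D :=
    (Tube.contDiffOn_fderiv.continuousOn.mono Tube.D_subset_B).clm_apply continuousOn_const
  refine h1.of_le_add h2 ((J.aestronglyMeasurable_G_apply _).sub
    (hcont.aestronglyMeasurable hDo.measurableSet)).enorm
    (C := ‖lam g t v‖₊ + ‖ell g v‖₊) (ae_of_all _ fun z => ?_)
  conv_lhs => rw [eq_lam_add_ell g t v, map_add, map_smul, map_smul]
  refine (enorm_add_le _ _).trans ?_
  rw [enorm_smul, enorm_smul, mul_add]
  push_cast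
  gcongr
  · exact le_self_add
  · exact le_add_self

theorem meanZero_normal (hS : ∃ U : Set E3, IsOpen U ∧ S = M ∩ U) (h : T.IsGraph κ γ)
    (hs : graphPoint γ s ∈ T.B) (hg : HasDerivAt γ g s)
    (hb : ∀ᵐ s : ℝ, graphPoint γ s ∈ T.B → FixesBoundaryAt M S w (T.X (graphPoint γ s)))
    (hc : FixesConormalAt M S n w (T.X (graphPoint γ s))) :
    MeanZero T.D (fun z => ‖J.ν z - T.N z‖ₑ) (graphPoint γ s) := by
  have hDo := Tube.isOpen_D (T := T) hS
  have h1 := J.meanZero_gradient hS h hs hg hb hc e₁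
  have h2 := J.meanZero_gradient hS h hs hg hb hc e₂
  have hcont : ContinuousOn (fun z => fderiv ℝ T.X z e₁) T.D :=
    (Tube.contDiffOn_fderiv.continuousOn.mono Tube.D_subset_B).clm_apply continuousOn_const
  refine h1.of_le_add h2 ((J.aestronglyMeasurable_G_apply _).sub
    (hcont.aestronglyMeasurable hDo.measurableSet)).enorm (C := T.K * T.K) ?_
  filter_upwards [J.ae_norm_G_le, ae_restrict_mem hDo.measurableSet] with z hG hz
  have hzB := Tube.D_subset_B hz
  have e : J.ν z - T.N z = T.c z • (crossL ((J.G z - fderiv ℝ T.X z) e₁) (J.G z e₂) +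
      crossL (fderiv ℝ T.X z e₁) ((J.G z - fderiv ℝ T.X z) e₂)) := by
    rw [ν, Tube.imageNormal, Tube.N, chartCross, ← smul_sub]
    congr 1
    simp only [sub_apply, map_sub]
    abel
  rw [← ofReal_norm, ← ofReal_norm, ← ofReal_norm, ← ENNReal.ofReal_add (norm_nonneg _) (norm_nonneg _),
    ← ENNReal.ofReal_coe_nnreal, ← ENNReal.ofReal_mul (NNReal.coe_nonneg _)]
  refine ENNReal.ofReal_le_ofReal ?_
  have k1 := (norm_crossL_le ((J.G z - fderiv ℝ T.X z) e₁) (J.G z e₂))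
  have k2 := (norm_crossL_le (fderiv ℝ T.X z e₁) ((J.G z - fderiv ℝ T.X z) e₂))
  have k3 : ‖J.G z e₂‖ ≤ T.K := by
    have := (J.G z).le_of_opNorm_le (hG hz) e₂
    rwa [norm_e₂, mul_one] at this
  have k4 : ‖fderiv ℝ T.X z e₁‖ ≤ T.K := by
    have := (fderiv ℝ T.X z).le_of_opNorm_le (Tube.norm_fderiv_X_le hzB) e₁
    rwa [norm_e₁, mul_one] at this
  rw [e, norm_smul, Real.norm_eq_abs]
  push_cast
  rw [mul_assoc]
  gcongr
  · exact T.abs_c_le z hzB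
  · refine (norm_add_le _ _).trans ?_
    rw [mul_add]
    refine add_le_add (k1.trans ?_) (k2.trans ?_)
    · rw [mul_comm]; exact mul_le_mul_of_nonneg_right k3 (norm_nonneg _)
    · exact mul_le_mul_of_nonneg_right k4 (norm_nonneg _)

end TubeIsometry

end BoundaryPoints

/-! ### Traces on the lateral boundary of the shell. -/

section ShellTraces

variable {M S : Set E3} {n w : E3 → E3}

namespace Tube

variable {T : Tube M S n} {κ : ℝ≥0} {γ : ℝ → ℝ}

/-- A ball of radius r in the shell projects into a planar ball of comparable radius, with fibres of
length at most a multiple of r. The extra factor r turns the planar normalization into the spatial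
one. -/
theorem meanZero_comp_P (hS : ∃ U : Set E3, IsOpen U ∧ S = M ∩ U) {f : E2 → ℝ≥0∞}
    (hf : AEMeasurable f (volume.restrict T.D)) {y : E2} (hy : y ∈ T.B) (hf0 : MeanZero T.D f y)
    {h σ : ℝ} (h₁ : h ≤ T.δ) (hσ : |σ| < h) :
    MeanZero (T.Ω h) (fun z => f (T.P z)) (T.Φ (y, σ)) := by
  obtain ⟨C, hC⟩ := T.exists_volume_Φ_le
  set K' : ℝ≥0 := T.K + 1 with hK'
  have hK0 : 0 < K' := by positivity
  refine MeanZero.of_le_mul (C * (2 * K')) fun ε hε => ?_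
  filter_upwards [hf0.scale hK0 hε, self_mem_nhdsWithin] with r hr hr0
  have hr0 : 0 < r := hr0
  set A := T.Ω h ∩ Metric.ball (T.Φ (y, σ)) r
  have hAm : MeasurableSet A :=
    (isOpen_Ω hS h₁).measurableSet.inter Metric.isOpen_ball.measurableSet
  have hPm : AEMeasurable T.P (volume.restrict A) :=
    (aemeasurable_P hS h₁).mono_measure (Measure.restrict_mono Set.inter_subset_left le_rfl)
  have hσ' : |σ| < T.δ := hσ.trans_le h₁
  set E := T.D ∩ Metric.ball y (K' * r)
  set c : ℝ≥0 := C * (2 * K') * r.toNNReal with hc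
  have hle : (volume.restrict A).map T.P ≤ c • volume.restrict E := by
    rw [Measure.le_iff]
    intro B hB
    rw [Measure.map_apply_of_aemeasurable hPm hB, Measure.restrict_apply' hAm, Measure.smul_apply,
      Measure.restrict_apply hB]
    have hsub : T.P ⁻¹' B ∩ A ⊆
        T.Φ '' ((B ∩ E) ×ˢ (Metric.ball σ (K' * r) ∩ Metric.ball 0 T.δ)) := by
      rintro z ⟨hzB, hzΩ, hzr⟩
      have hzW := Ω_subset_W h₁ hzΩ
      obtain ⟨hD, -⟩ := P_mem_D h₁ hzΩ
      have hz : ‖z - T.Φ (y, σ)‖ < r := mem_ball_iff_norm.1 hzr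
      have h1 := lipschitzOn_P.norm_sub_le hzW (Φ_mem_W hy hσ')
      have h2 := lipschitzOn_t.norm_sub_le hzW (Φ_mem_W hy hσ')
      rw [P_Φ hy hσ'] at h1
      rw [t_Φ hy hσ'] at h2
      have h3 : T.K * ‖z - T.Φ (y, σ)‖ < K' * r := by
        rw [hK']; push_cast
        nlinarith [T.K.coe_nonneg, norm_nonneg (z - T.Φ (y, σ))]
      refine ⟨(T.P z, T.t z), ⟨⟨hzB, hD, ?_⟩, ?_, ?_⟩, Φ_P_t hzW⟩
      · exact mem_ball_iff_norm.2 (h1.trans_lt h3)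
      · exact mem_ball_iff_norm.2 (h2.trans_lt h3)
      · simpa using abs_t_lt hzW
    refine (measure_mono hsub).trans ((hC _ _ (Set.inter_subset_right.trans
      (Set.inter_subset_left.trans D_subset_B)) Set.inter_subset_right).1.trans ?_)
    have h4 : volume (Metric.ball σ (K' * r) ∩ Metric.ball 0 T.δ) ≤ 2 * K' * r.toNNReal := by
      refine (measure_mono Set.inter_subset_left).trans (le_of_eq ?_)
      rw [Real.volume_ball, ENNReal.ofReal_mul (by norm_num), ENNReal.ofReal_mul K'.coe_nonneg,
        ENNReal.ofReal_coe_nnreal, ENNReal.ofReal_ofNat, ← mul_assoc]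
      rfl
    calc (C : ℝ≥0∞) * (volume (B ∩ E) * volume (Metric.ball σ (K' * r) ∩ Metric.ball 0 T.δ))
        ≤ C * (volume (B ∩ E) * (2 * K' * r.toNNReal)) := by gcongr
      _ = c • volume (B ∩ E) := by
        rw [ENNReal.smul_def, hc]
        push_cast
        rw [smul_eq_mul]; ring
  have hac : (volume.restrict A).map T.P ≪ volume.restrict T.D :=
    (Measure.absolutelyContinuous_of_le hle).trans
      ((Measure.AbsolutelyContinuous.rfl.smul_left _).trans
        (Measure.absolutelyContinuous_of_le (Measure.restrict_mono Set.inter_subset_left le_rfl)))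
  rw [← lintegral_map' (hf.mono_ac hac) hPm]
  refine (lintegral_mono' hle le_rfl).trans ?_
  rw [lintegral_smul_measure, ENNReal.smul_def, hc, smul_eq_mul]
  calc ((C * (2 * K') * r.toNNReal : ℝ≥0) : ℝ≥0∞) * ∫⁻ z in E, f z
      ≤ (C * (2 * K') * r.toNNReal : ℝ≥0) * (ε * ENNReal.ofReal r ^ 2) := by gcongr
    _ = _ := by
      rw [ENNReal.ofReal]; push_cast; ring

/-- Scaled by `1 / (K + 1)`, the product of a planar piece and an interval is mapped into the ball
of radius `r`, and its volume is of order `r ^ 3`. -/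
theorem exists_volume_Ω_ge {y : E2} (hy : y ∈ T.B) {c : ℝ≥0} (hc : 0 < c)
    (hD : ∀ᶠ r in 𝓝[>] (0 : ℝ), c * ENNReal.ofReal r ^ 2 ≤ volume (T.D ∩ Metric.ball y r))
    {h σ : ℝ} (h₁ : h ≤ T.δ) (hσ : |σ| < h) : ∃ c' : ℝ≥0, 0 < c' ∧ ∀ᶠ r in 𝓝[>] (0 : ℝ),
      c' * ENNReal.ofReal r ^ 3 ≤ volume (T.Ω h ∩ Metric.ball (T.Φ (y, σ)) r) := by
  obtain ⟨C, hC⟩ := T.exists_volume_Φ_le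
  set m : ℝ≥0 := (T.K + 1)⁻¹ with hm
  have hm0 : 0 < m := by positivity
  have htend : Tendsto (fun r : ℝ => m * r) (𝓝[>] 0) (𝓝[>] 0) := by
    refine tendsto_nhdsWithin_iff.2 ⟨?_, ?_⟩
    · have : Tendsto (fun r : ℝ => m * r) (𝓝 0) (𝓝 (m * 0)) := tendsto_id.const_mul _
      rw [mul_zero] at this
      exact this.mono_left nhdsWithin_le_nhds
    · filter_upwards [self_mem_nhdsWithin] with r hr
      exact mul_pos (NNReal.coe_pos.2 hm0) hr
  refine ⟨(C + 1)⁻¹ * (c * m ^ 2 * (2 * m)), by positivity, ?_⟩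
  filter_upwards [htend.eventually hD, htend.eventually (Ioo_mem_nhdsGT (sub_pos.2 hσ)),
    self_mem_nhdsWithin] with r hr hrσ hr0
  have hr0 : 0 < r := hr0
  have hJ : Metric.ball σ (m * r) ⊆ Metric.ball 0 h := by
    intro s hs
    rw [Metric.mem_ball, Real.dist_eq] at hs
    rw [mem_ball_zero_iff, Real.norm_eq_abs]
    have h1 := abs_sub_abs_le_abs_sub s σ
    linarith [hrσ.2]
  have hsub : T.Φ '' ((T.D ∩ Metric.ball y (m * r)) ×ˢ Metric.ball σ (m * r)) ⊆
      T.Ω h ∩ Metric.ball (T.Φ (y, σ)) r := by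
    rintro _ ⟨⟨z, s⟩, ⟨⟨hzD, hzr⟩, hs⟩, rfl⟩
    refine ⟨⟨(z, s), ⟨hzD, hJ hs⟩, rfl⟩, ?_⟩
    have hin1 : (z, s) ∈ T.B ×ˢ Metric.ball (0 : ℝ) T.δ :=
      ⟨D_subset_B hzD, Metric.ball_subset_ball h₁ (hJ hs)⟩
    have hin2 : (y, σ) ∈ T.B ×ˢ Metric.ball (0 : ℝ) T.δ := ⟨hy, by simpa using hσ.trans_le h₁⟩
    have h1 := lipschitzOn_Φ.dist_le_mul _ hin1 _ hin2
    have h2 : dist (z, s) (y, σ) ≤ m * r := by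
      rw [Prod.dist_eq]
      exact max_le (le_of_lt hzr) (le_of_lt hs)
    rw [Metric.mem_ball]
    calc dist (T.Φ (z, s)) (T.Φ (y, σ)) ≤ T.K * (m * r) := h1.trans (by gcongr)
      _ < (T.K + 1) * (m * r) := by
        have : (0 : ℝ) < m * r := mul_pos (NNReal.coe_pos.2 hm0) hr0
        linarith
      _ = r := by
        rw [hm]; push_cast; field_simp
  have h1 := (hC _ _ (Set.inter_subset_left.trans D_subset_B : T.D ∩ Metric.ball y (m * r) ⊆ T.B)
    (hJ.trans (Metric.ball_subset_ball h₁))).2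
  have h2 : (c * m ^ 2 * (2 * m) : ℝ≥0) * ENNReal.ofReal r ^ 3 ≤
      (C + 1 : ℝ≥0) * volume (T.Ω h ∩ Metric.ball (T.Φ (y, σ)) r) := by
    calc ((c * m ^ 2 * (2 * m) : ℝ≥0) : ℝ≥0∞) * ENNReal.ofReal r ^ 3 =
          (c * ENNReal.ofReal (m * r) ^ 2) * ENNReal.ofReal (2 * (m * r)) := by
          rw [ENNReal.ofReal_mul (by norm_num : (0 : ℝ) ≤ 2), ENNReal.ofReal_mul m.coe_nonneg,
            ENNReal.ofReal_coe_nnreal, ENNReal.ofReal_ofNat]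
          push_cast; ring
      _ ≤ volume (T.D ∩ Metric.ball y (m * r)) * volume (Metric.ball σ (m * r)) := by
          rw [Real.volume_ball]; gcongr
      _ ≤ C * volume (T.Φ '' ((T.D ∩ Metric.ball y (m * r)) ×ˢ Metric.ball σ (m * r))) := h1
      _ ≤ _ := by
          gcongr
          exact_mod_cast le_self_add
  rw [ENNReal.coe_mul, mul_assoc]
  have h3 : ((C + 1 : ℝ≥0) : ℝ≥0∞) ≠ 0 := by simp
  rw [ENNReal.coe_inv (by positivity), mul_comm, ← div_eq_mul_inv]
  exact ENNReal.div_le_of_le_mul' h2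

end Tube

/-- Shell points close to each other have foot points close to each other, so near a boundary point
no part of the shell outside the tube can interfere with the trace. -/
theorem TubeAtlas.exists_shell_inter_ball_subset (A : TubeAtlas M S n) (hSM : S ⊆ M) {i : A.ι}
    {y : E2} (hy : y ∈ (A.T i).B) (hyS : (A.T i).X y ∈ closure S) {h σ : ℝ} (hh : h ≤ A.h₁)
    (hσ : |σ| < h) :
    ∃ ρ > 0, shell S n h ∩ Metric.ball ((A.T i).Φ (y, σ)) ρ ⊆ (A.T i).Ω h := by
  obtain ⟨U, hU, hUX⟩ := (A.T i).chart.image_eq_inter Tube.isOpen_B Tube.B_subset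
  obtain ⟨r, hr, hrU⟩ := Metric.isOpen_iff.1 hU _ (hUX.subset ⟨y, hy, rfl⟩).2
  refine ⟨r / 2, by positivity, ?_⟩
  rintro _ ⟨⟨p, hp, s, hs, rfl⟩, hz⟩
  rw [mem_ball_iff_norm, TubeAtlas.Φ_eq hy hyS] at hz
  have h1 := A.norm_sub_le p (subset_closure hp) _ hyS s σ (hs.trans_le hh) (hσ.trans_le hh)
  have h2 : p ∈ Metric.ball ((A.T i).X y) r := by
    rw [mem_ball_iff_norm]; linarith
  obtain ⟨y', hy', rfl⟩ := hUX.superset ⟨hSM hp, hrU h2⟩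
  exact ⟨(y', s), ⟨⟨hy', hp⟩, by simpa using hs⟩, TubeAtlas.Φ_eq hy' (subset_closure hp) s⟩

theorem TubeAtlas.hasTraceAt_shell (A : TubeAtlas M S n) (hS : ∃ U : Set E3, IsOpen U ∧ S = M ∩ U)
    {i : A.ι} (J : TubeIsometry (A.T i) w) {u : E3 → E3}
    (hu : u =ᵐ[volume.restrict ((A.T i).Ω A.h₁)] J.u) {y : E2} (hy : y ∈ (A.T i).B)
    (hyS : (A.T i).X y ∈ closure S) {c : ℝ≥0} (hc : 0 < c)
    (hD : ∀ᶠ r in 𝓝[>] (0 : ℝ), c * ENNReal.ofReal r ^ 2 ≤ volume ((A.T i).D ∩ Metric.ball y r))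
    (h1 : MeanZero (A.T i).D (fun z => ‖w ((A.T i).X z) - (A.T i).X z‖ₑ) y)
    (h2 : MeanZero (A.T i).D (fun z => ‖J.ν z - (A.T i).N z‖ₑ) y) {h σ : ℝ} (hh : h ≤ A.h₁)
    (hσ : |σ| < h) :
    HasTraceAt (shell S n h) (fun z => u z - z) ((A.T i).Φ (y, σ)) 0 := by
  let T := A.T i
  have hSM : S ⊆ M := by obtain ⟨U, -, rfl⟩ := hS; exact Set.inter_subset_left
  have hδ : h ≤ T.δ := hh.trans (A.h₁_le i)
  have h0 : 0 < h := (abs_nonneg σ).trans_lt hσ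
  have hDm := (Tube.isOpen_D (T := T) hS).measurableSet
  have hΩm := (Tube.isOpen_Ω (T := T) hS hδ).measurableSet
  have m1 : AEMeasurable (fun z => ‖w (T.X z) - T.X z‖ₑ) (volume.restrict T.D) :=
    (J.memLp_f.aestronglyMeasurable.sub ((Tube.contDiffOn_X.continuousOn.mono
      Tube.D_subset_B).aestronglyMeasurable hDm)).enorm
  have m2 : AEMeasurable (fun z => ‖J.ν z - T.N z‖ₑ) (volume.restrict T.D) :=
    (J.weak_ν.locallyIntegrableOn.aestronglyMeasurable.sub
      ((Tube.contDiffOn_N.continuousOn.mono Tube.D_subset_B).aestronglyMeasurable hDm)).enorm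
  have k1 := Tube.meanZero_comp_P hS m1 hy h1 hδ hσ
  have k2 := Tube.meanZero_comp_P hS m2 hy h2 hδ hσ
  have m3 : AEMeasurable (fun z => ‖w (T.X (T.P z)) - T.X (T.P z)‖ₑ) (volume.restrict (T.Ω h)) :=
    (m1.mono_ac (T.map_P_absolutelyContinuous hS h0 hδ)).comp_aemeasurable
      (Tube.aemeasurable_P hS hδ)
  have key : MeanZero (T.Ω h) (fun z => ‖u z - z - 0‖ₑ) (T.Φ (y, σ)) := by
    refine k1.of_le_add k2 m3 (C := 1 + T.δ.toNNReal) ?_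
    have hu' := ae_restrict_of_ae_restrict_of_subset (s := T.Ω h) (t := T.Ω A.h₁)
      (Set.image_mono (Set.prod_mono le_rfl (Metric.ball_subset_ball hh))) hu
    filter_upwards [hu', ae_restrict_mem hΩm] with z hz hzΩ
    have hzW := Tube.Ω_subset_W hδ hzΩ
    -- In tubular coordinates u - id is w - x plus the height times ν - n, both taken at the foot
    -- point; the height is bounded.
    have e : u z - z - 0 = (w (T.X (T.P z)) - T.X (T.P z)) + T.t z • (J.ν (T.P z) - T.N (T.P z)) := by
      conv_lhs => rw [hz, sub_zero]; enter [2]; rw [← Tube.Φ_P_t hzW]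
      rw [TubeIsometry.u, Tube.Φ]
      simp only [smul_sub]
      abel
    rw [e]
    refine (enorm_add_le _ _).trans ?_
    rw [mul_add, enorm_smul]
    gcongr
    · refine le_mul_of_one_le_left zero_le ?_
      exact_mod_cast le_self_add
    · have : ‖T.t z‖ₑ ≤ T.δ.toNNReal := by
        rw [← ofReal_norm]
        exact ENNReal.ofReal_le_ofReal (Tube.abs_t_lt hzW).le
      refine this.trans ?_
      exact_mod_cast le_add_self
  obtain ⟨ρ, hρ, hsub⟩ := A.exists_shell_inter_ball_subset hSM hy hyS hh hσ
  obtain ⟨c', hc', hvol⟩ := Tube.exists_volume_Ω_ge hy hc hD hδ hσ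
  refine (key.congr_set hρ hsub).hasTraceAt hc' ?_
  filter_upwards [hvol] with r hr
  exact hr.trans (measure_mono (Set.inter_subset_inter_left _ (TubeAtlas.Ω_subset_shell i)))

theorem TubeAtlas.ae_hasTraceAt_shell (A : TubeAtlas M S n)
    (hS : ∃ U : Set E3, IsOpen U ∧ S = M ∩ U) (J : ∀ i, TubeIsometry (A.T i) w) {u : E3 → E3}
    (hu : ∀ i, u =ᵐ[volume.restrict ((A.T i).Ω A.h₁)] (J i).u) (hb : FixesBoundary M S w)
    (hc : FixesConormal M S n w) {h : ℝ} (hh : h ≤ A.h₁) :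
    ∀ᵐ z ∂(Measure.hausdorffMeasure 2 : Measure E3),
      z ∈ shell (surfBoundary S) n h → HasTraceAt (shell S n h) (fun z => u z - z) z 0 := by
  have hSM : S ⊆ M := by obtain ⟨U, -, rfl⟩ := hS; exact Set.inter_subset_left
  have := A.finite
  have key : ∀ i, ∀ᵐ z ∂(Measure.hausdorffMeasure 2 : Measure E3), ∀ y ∈ (A.T i).B,
      (A.T i).X y ∈ surfBoundary S → ∀ σ : ℝ, |σ| < h → z = (A.T i).Φ (y, σ) →
        HasTraceAt (shell S n h) (fun z => u z - z) z 0 := by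
    intro i
    set T := A.T i
    rcases A.adapted i with hi | ⟨κ, γ, hγ, hγS⟩
    · exact ae_of_all _ fun z y hy hyS => absurd (hi y hy) hyS.2
    have hG : T.IsGraph κ γ := ⟨hγ, hγS⟩
    have hgood := hG.ae_fixesAt hb hc
    have hgood' : ∀ᵐ s : ℝ, graphPoint γ s ∈ T.B →
        FixesBoundaryAt M S w (T.X (graphPoint γ s)) := by
      filter_upwards [hgood] with s hs hsB using (hs hsB).2.1
    -- Parameters at which the graph is not differentiable or a boundary condition fails form a null
    -- set, and the normal segments over them form a null set for area.
    set E := {s : ℝ | ¬(graphPoint γ s ∈ T.B → DifferentiableAt ℝ γ s ∧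
      FixesBoundaryAt M S w (T.X (graphPoint γ s)) ∧
      FixesConormalAt M S n w (T.X (graphPoint γ s)))} with hE
    have hE0 : volume E = 0 := ae_iff.1 hgood
    have hnull := hG.hausdorffMeasure_Φ_graph hE0 fun s hs => (Classical.not_imp.1 hs).1
    filter_upwards [measure_eq_zero_iff_ae_notMem.1 hnull] with z hz y hy hyS σ hσ hzy
    have hyγ := hG.eq_of_mem_surfBoundary hSM hy hyS
    have hyg : graphPoint γ (y 0) = y := graphPoint_eq hyγ
    have hyE : y 0 ∉ E := fun hmem => hz ⟨(y 0, σ), ⟨hmem, by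
      simpa using hσ.trans_le (hh.trans (A.h₁_le i))⟩, by simp only [hyg]; exact hzy.symm⟩
    rw [hE, Set.mem_ofPred_eq, not_not] at hyE
    obtain ⟨hd, hfb, hfc⟩ := hyE (by rw [hyg]; exact hy)
    have hn1 := (J i).meanZero_normal hS hG (by rw [hyg]; exact hy) hd.hasDerivAt hgood' hfc
    rw [hyg] at hn1 hfb
    obtain ⟨c, hc0, hD⟩ := hG.exists_volume_ge hy hyγ
    rw [hzy]
    exact A.hasTraceAt_shell hS (J i) (hu i) hy hyS.1 hc0 hD ((J i).meanZero_sub_X hS hy hfb) hn1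
      hh hσ
  filter_upwards [ae_all_iff.2 key] with z hz
  rintro ⟨p, hp, σ, hσ, hzp⟩
  obtain ⟨i, y, hy, rfl⟩ := A.covers p hp.1
  exact hz i y hy hp σ hσ (hzp.trans (TubeAtlas.Φ_eq hy hp.1 σ).symm)

end ShellTraces

/-! ### The second assertion: rigidity with boundary conditions. -/

section ZeroBoundaryRigidity

variable {M S : Set E3} {n w : E3 → E3}

/-- The half turn about a coordinate axis: reflection in a line has determinant (-1)² in dimension
three. -/
theorem exists_mem_SO3_ne_id : ∃ R ∈ SO3, R ≠ ContinuousLinearMap.id ℝ E3 := by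
  let v : E3 := EuclideanSpace.single 0 1
  let v' : E3 := EuclideanSpace.single 1 1
  let K : Submodule ℝ E3 := Submodule.span ℝ {v}
  have hv : v ≠ 0 := by simp [v]
  refine ⟨K.reflection.toContinuousLinearEquiv.toContinuousLinearMap, ⟨fun x => ?_, ?_⟩, fun h => ?_⟩
  · exact K.reflection.norm_map x
  · have h1 := K.det_reflection
    have : Fact (Module.finrank ℝ E3 = 2 + 1) := ⟨by simp⟩
    rw [Submodule.finrank_orthogonal_span_singleton (n := 2) hv] at h1
    refine Eq.trans ?_ (h1.trans (by norm_num))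
    rfl
  · have h1 : v' ∈ Kᗮ := by
      rw [Submodule.mem_orthogonal_singleton_iff_inner_right]
      simp [v, v', inner_E3]
    have h2 : K.reflection v' = -v' := Submodule.reflection_mem_subspace_orthogonalComplement_eq_neg h1
    have h3 : K.reflection v' = v' := DFunLike.congr_fun h v'
    rw [h2] at h3
    have h4 := congrArg (fun x : E3 => x 1) h3
    simp [v'] at h4
    norm_num at h4

theorem IsC2LipschitzDomain.isBounded_shell (hS : IsC2LipschitzDomain M S)
    (hn : IsUnitNormal M S n) (h : ℝ) : ∃ C, ∀ z ∈ shell S n h, ‖z‖ ≤ C := by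
  obtain ⟨C, hC⟩ := hS.bounded.exists_norm_le
  refine ⟨C + h, ?_⟩
  rintro _ ⟨p, hp, t, ht, rfl⟩
  refine (norm_add_le _ _).trans (add_le_add (hC p hp) ?_)
  rw [norm_smul, hn.norm_eq_one p (subset_closure hp), mul_one]
  exact ht.le

theorem IsC2LipschitzDomain.isW12_clm (hS : IsC2LipschitzDomain M S) (hn : IsUnitNormal M S n)
    (A : TubeAtlas M S n) {h : ℝ} (hh : h ≤ A.h₁) (L : E3 →L[ℝ] E3) :
    IsW12 (shell S n h) L fun _ => L := by
  have hO := A.isOpen_shell hS.relOpen hh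
  have := A.isFiniteMeasure_shell hh
  obtain ⟨C, hC⟩ := hS.isBounded_shell hn h
  refine ⟨?_, ?_, memLp_const L⟩
  · have h1 := HasWeakFDerivOn.of_contDiffOn (L.contDiff.contDiffOn (n := 1) (s := shell S n h)) hO
    have h2 : fderiv ℝ L = fun _ => L := funext fun z => L.fderiv
    rwa [h2] at h1
  · refine MemLp.of_bound L.continuous.aestronglyMeasurable (‖L‖ * C) ?_
    filter_upwards [ae_restrict_mem hO.measurableSet] with z hz
    exact L.le_opNorm_of_le (hC z hz)

theorem IsW12.sub {O : Set E3} {u v : E3 → E3} {Γ Λ : E3 → E3 →L[ℝ] E3} (hu : IsW12 O u Γ)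
    (hv : IsW12 O v Λ) : IsW12 O (fun z => u z - v z) fun z => Γ z - Λ z :=
  ⟨hu.hasWeakFDerivOn.sub hv.hasWeakFDerivOn, hu.memLp.sub hv.memLp, hu.memLp_grad.sub hv.memLp_grad⟩

/-- Without boundary the trace condition is void, and the displacement (R - I)z for a rotation R
other than the identity has zero right-hand side but positive energy. -/
theorem IsC2LipschitzDomain.surfBoundary_nonempty (hS : IsC2LipschitzDomain M S)
    (hn : IsUnitNormal M S n) {μ : ℝ} (hR : ZeroBoundaryRigidityIneq S n μ) :
    (surfBoundary S).Nonempty := by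
  by_contra hne
  rw [Set.not_nonempty_iff_eq_empty] at hne
  obtain ⟨A⟩ := hS.nonempty_tubeAtlas hn
  obtain ⟨C₀, hC₀, h₀, hh₀, hineq⟩ := hR
  obtain ⟨R, hR, hne1⟩ := exists_mem_SO3_ne_id
  obtain ⟨h, h0, hlt⟩ := exists_between (lt_min hh₀ A.h₁_pos)
  have hh : h ≤ A.h₁ := (hlt.trans_le (min_le_right _ _)).le
  have := A.isFiniteMeasure_shell hh
  have hW := hS.isW12_clm hn A hh (R - ContinuousLinearMap.id ℝ E3)
  have key := hineq h h0 (hlt.trans_le (min_le_left _ _)) _ _ ⟨hW, ae_of_all _ fun z hz => by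
    obtain ⟨p, hp, -⟩ := hz
    rw [hne] at hp
    exact hp.elim⟩
  have hpos : 0 < volume.real (shell S n h) := by
    refine ENNReal.toReal_pos ?_ ?_
    · obtain ⟨p, hp⟩ := hS.connected.nonempty
      exact ((A.isOpen_shell hS.relOpen hh).measure_pos volume
        ⟨p, p, hp, 0, by simpa using h0, by simp⟩).ne'
    · have := measure_lt_top (volume.restrict (shell S n h)) Set.univ
      rw [Measure.restrict_apply_univ] at this
      exact this.ne
  simp only [sub_add_cancel, Metric.infDist_zero_of_mem hR, ne_eq, OfNat.ofNat_ne_zero,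
    not_false_eq_true, zero_pow, integral_zero, mul_zero, setIntegral_const, smul_eq_mul] at key
  have h1 : 0 < ‖R - ContinuousLinearMap.id ℝ E3‖ := norm_pos_iff.2 (sub_ne_zero.2 hne1)
  have h2 : 0 < volume.real (shell S n h) * ‖R - ContinuousLinearMap.id ℝ E3‖ ^ 2 := by positivity
  exact absurd key (not_le.2 h2)

theorem MeanZero.eq_zero_of_const {d : ℕ} {D : Set (EuclideanSpace ℝ (Fin d))} {a : ℝ≥0∞}
    {y : EuclideanSpace ℝ (Fin d)} (h : MeanZero D (fun _ => a) y) {c : ℝ≥0} (hc : 0 < c)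
    (hD : ∀ᶠ r in 𝓝[>] (0 : ℝ), c * ENNReal.ofReal r ^ d ≤ volume (D ∩ Metric.ball y r)) :
    a = 0 := by
  by_contra ha
  have h1 : 0 < a * c := ENNReal.mul_pos ha (by exact_mod_cast hc.ne')
  obtain ⟨ε, hε0, hε⟩ := ENNReal.lt_iff_exists_nnreal_btwn.1 h1
  have hε0' : 0 < ε := by exact_mod_cast hε0
  obtain ⟨r, ⟨hr1, hr2⟩, hr0⟩ := ((h ε hε0').and hD |>.and self_mem_nhdsWithin).exists
  rw [setLIntegral_const] at hr1
  have hr0 : 0 < ENNReal.ofReal r ^ d := ENNReal.pow_pos (ENNReal.ofReal_pos.2 hr0) d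
  have hrt : ENNReal.ofReal r ^ d ≠ ∞ := ENNReal.pow_ne_top ENNReal.ofReal_ne_top
  have h2 : a * c * ENNReal.ofReal r ^ d ≤ ε * ENNReal.ofReal r ^ d := by
    refine le_trans ?_ hr1
    rw [mul_assoc]
    gcongr
  exact absurd ((ENNReal.mul_le_mul_iff_left hr0.ne' hrt).1 h2) (not_le.2 hε)

/-- At a boundary point where w = x in the sense of traces, the constant w - x = a has vanishing
mean on a set of positive density. -/
theorem IsC2LipschitzDomain.eq_zero_of_fixesBoundary (hS : IsC2LipschitzDomain M S)
    (A : TubeAtlas M S n) (J : ∀ i, TubeIsometry (A.T i) w) (hne : (surfBoundary S).Nonempty)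
    (hb : FixesBoundary M S w) (hc : FixesConormal M S n w) {a : E3}
    (ha : ∀ᵐ x ∂(Measure.hausdorffMeasure 2 : Measure E3), x ∈ S → w x = x + a) : a = 0 := by
  have hSM : S ⊆ M := subset_closure.trans hS.closure_subset
  obtain ⟨p, hp⟩ := hne
  obtain ⟨i, y, hy, rfl⟩ := A.covers p hp.1
  rcases A.adapted i with hi | ⟨κ, γ, hγ, hγS⟩
  · exact absurd (hi y hy) hp.2
  have hG : (A.T i).IsGraph κ γ := ⟨hγ, hγS⟩
  have hO : IsOpen {s : ℝ | graphPoint γ s ∈ (A.T i).B} :=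
    Tube.isOpen_B.preimage (lipschitzWith_graphPoint hγ).continuous
  have hyg := graphPoint_eq (hG.eq_of_mem_surfBoundary hSM hy hp)
  have hpos := hO.measure_pos volume ⟨y 0, by rw [Set.mem_ofPred_eq, hyg]; exact hy⟩
  obtain ⟨s, hsB, hs⟩ : ∃ s, graphPoint γ s ∈ (A.T i).B ∧
      FixesBoundaryAt M S w ((A.T i).X (graphPoint γ s)) := by
    by_contra hcon
    refine hpos.ne' (measure_mono_null (fun s hs => ?_) (ae_iff.1 (hG.ae_fixesAt hb hc)))
    exact fun himp => hcon ⟨s, hs, (himp hs).2.1⟩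
  obtain ⟨c, hc0, hD⟩ := hG.exists_volume_ge hsB rfl
  have hm := (J i).meanZero_sub_X hS.relOpen hsB hs
  have hDm := (Tube.isOpen_D (T := A.T i) hS.relOpen).measurableSet
  have hae : ∀ᵐ z ∂volume.restrict (A.T i).D, w ((A.T i).X z) = (A.T i).X z + a := by
    rw [ae_restrict_iff' hDm]
    refine ae_iff.2 ?_
    have hsub : {z | ¬(z ∈ (A.T i).D → w ((A.T i).X z) = (A.T i).X z + a)} ⊆ (A.T i).B :=
      fun z hz => Tube.D_subset_B (Classical.not_imp.1 hz).1
    rw [← Tube.hausdorffMeasure_image_X_eq_zero hsub]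
    refine measure_mono_null ?_ (ae_iff.1 ha)
    rintro _ ⟨z, hz, rfl⟩ himp
    obtain ⟨hzD, hzw⟩ := Classical.not_imp.1 hz
    exact hzw (himp hzD.2)
  have hm' : MeanZero (A.T i).D (fun _ => ‖a‖ₑ) (graphPoint γ s) := by
    refine hm.mono (C := 1) ?_
    filter_upwards [hae] with z hz
    rw [hz, add_sub_cancel_left, ENNReal.coe_one, one_mul]
  exact enorm_eq_zero.1 (hm'.eq_zero_of_const hc0 hD)

theorem IsC2LipschitzDomain.eq_id_of_zeroBoundaryRigidityIneq (hS : IsC2LipschitzDomain M S)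
    (hn : IsUnitNormal M S n) {μ : ℝ} (hμ : μ < 2) (hR : ZeroBoundaryRigidityIneq S n μ)
    (hw : IsW22Isometry M S w) (hb : FixesBoundary M S w) (hc : FixesConormal M S n w) :
    EqOnSurface S w fun x => x := by
  have hne := hS.surfBoundary_nonempty hn hR
  obtain ⟨A⟩ := hS.nonempty_tubeAtlas hn
  have J : ∀ i, TubeIsometry (A.T i) w := fun i => ((A.T i).exists_tubeIsometry hS.relOpen hw).some
  obtain ⟨u, Γ, C, hu, hW, hΓR, hdist⟩ := A.exists_shell_map hS.relOpen hn J
  obtain ⟨C₀, hC₀, h₀, hh₀, hineq⟩ := hR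
  obtain ⟨Q, hQ, hQR⟩ := A.exists_R_ae_eq hS.relOpen (J := J)
    (fun h h0 hh => (hW h h0 hh).memLp_grad.1) hΓR
    (isCompact_singleton (x := ContinuousLinearMap.id ℝ E3)) (lt_min hh₀ A.h₁_pos)
    (min_le_right _ _) (tendsto_ofReal_mul_rpow (c := C₀ * C) (sub_pos.2 hμ)) fun h h0 hh => by
      have hh₁ : h ≤ A.h₁ := (hh.trans_le (min_le_right _ _)).le
      have := A.isFiniteMeasure_shell hh₁
      -- For the displacement u - id the left side is the distance of ∇u to the identity and the
      -- right side is that of ∇u to SO(3). Thus the comparison matrix is the identity for every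
      -- `h`, and the compact set is a single point.
      have hi := hineq h h0 (hh.trans_le (min_le_left _ _)) _ _
        ⟨(hW h h0 hh₁).sub (hS.isW12_clm hn A hh₁ (ContinuousLinearMap.id ℝ E3)),
          A.ae_hasTraceAt_shell hS.relOpen J hu hb hc hh₁⟩
      simp only [sub_add_cancel] at hi
      exact ⟨_, rfl, lintegral_le_of_rigidity h0 hC₀ (hW h h0 hh₁).memLp_grad (hdist h h0 hh₁) hi⟩
  rw [Set.mem_singleton_iff.1 hQ] at hQR
  obtain ⟨a, ha⟩ := A.exists_ae_eq hS hQR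
  have ha0 : a = 0 := hS.eq_zero_of_fixesBoundary A J hne hb hc ha
  refine A.eqOnSurface_of_ae hS.relOpen continuous_id ?_
  filter_upwards [ha] with x hx hxS
  rw [hx hxS, ha0, add_zero]
  rfl

end ZeroBoundaryRigidity

theorem theorem1p3 (M S : Set E3) (n : E3 → E3) (hS : IsC2LipschitzDomain M S)
    (hn : IsUnitNormal M S n) :
    ((∃ μ : ℝ, 0 < μ ∧ μ < 2 ∧ RigidityIneq S n μ) →
      ∀ w : E3 → E3, IsW22Isometry M S w →
        ∃ R ∈ SO3, ∃ a : E3, EqOnSurface S w (fun x => R x + a)) ∧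
    ((∃ μ : ℝ, 0 < μ ∧ μ < 2 ∧ ZeroBoundaryRigidityIneq S n μ) →
      ∀ w : E3 → E3, IsW22Isometry M S w → FixesBoundary M S w → FixesConormal M S n w →
        EqOnSurface S w (fun x => x)) := by
  exact ⟨fun ⟨_, _, hμ, hR⟩ _ hw => hS.rigid_of_rigidityIneq hn hμ hR hw,
    fun ⟨_, _, hμ, hR⟩ _ hw hb hc => hS.eq_id_of_zeroBoundaryRigidityIneq hn hμ hR hw hb hc⟩
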